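/- Let $q(x)=\lambda x^{-2}+q_0(x)$ on $(0,\infty)$, where $\lambda=0$ or $\lambda\ge 3/4$, and $q_0\in C^1(0,\infty)$ satisfies $q_0>0$, $q_0'<0$, $q_0(x)\to 0$ as $x\to+\infty$, and, for some $\kappa\in(0,2)$, $q_0(x)\lesssim x^{-\kappa}$ and $|q_0'(x)|\lesssim x^{-\kappa-1}$ for all $x$ near $0$. Let $\mathbf A=-\frac{d^2}{dx^2}+q(x)$ be the corresponding self-adjoint operator on $L^2(0,\infty)$ with zero boundary condition at $0$, with energy space $\dot{\mathcal H}^1_{\mathbf A}=\{v: v(x)=\int_0^x v'(y)\,dy,\ \int_0^\infty(|v'|^2+q|v|^2)\,dx<\infty\}$. Let $w$ be a (complex-valued) finite-energy solution of $w_{tt}+\mathbf A w=0$ on $(0,\infty)\times\mathbb R$, that is, $(w,w_t)\in C(\mathbb R;\dot{\mathcal H}^1_{\mathbf A}\times L^2)$ and the equation holds in the weak sense. Put $$e=|w_x|^2+|w_t|^2+q|w|^2,\qquad e_\pm=\tfrac12|w_x\mp w_t|^2+\tfrac q2|w|^2,\qquad M=-\tfrac{q'}{2}|w|^2,$$ and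 let $E=\int_0^\infty e(x,t)\,dx$ be the (conserved) energy and $E_\pm(t)=\int_0^\infty e_\pm(x,t)\,dx$ the outward ($+$) and inward ($-$) energies. Let $w_x(0,\cdot)\in L^2(\mathbb R)$ be the boundary derivative, defined by continuous extension in the energy norm from the strong solutions $(w,w_t)\in C(\mathbb R;D(\mathbf A)\times D(\mathbf A^{1/2}))$. Then: 1. The energy $E$ does not depend on $t$, $E_-(t)$ is a decreasing (i.e. non-increasing) and $E_+(t)$ an increasing (i.e. non-decreasing) function of $t$, and $$\lim_{t\to\pm\infty}E_\pm(t)=E,\qquad \lim_{t\to\mp\infty}E_\pm(t)=0,\qquad \lim_{t\to\pm\infty}\int_0^\infty q(x)|w(x,t)|^2\,dx=0 .$$ 2. The boundary derivative $w_x(0,\cdot)$ is well defined in $L^2(\mathbb R)$, $M$ is integrable, and the Morawetz identity holds: $$\frac12\int_{-\infty}^\infty|w_x(0,t)|^2\,dt+\int_{-\infty}^\infty\int_0^\infty M(x,t)\,dx\,dt=E .$$ 3. For every $c\in(0,1)$, $$\lim_{t\to\pm\infty}\int_0^{c|t|}e(x,t)\,dx=0 .$$ 4. The quantities $\int_0^\infty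 |w(x,t)|^2x^{-2}\,dx$ and $\sup_{x>0}|w(x,t)|^2/x$ are finite for every $t$, and $$\lim_{t\to\pm\infty}\int_0^\infty\frac{|w(x,t)|^2}{x^2}\,dx=0,\qquad \lim_{t\to\pm\infty}\ \sup_{x>0}\frac{|w(x,t)|^2}{x}=0 .$$ -/

import Mathlib

open MeasureTheory Filter Set
open scoped Topology ENNReal ContDiff

namespace HalfLineWave

noncomputable section

/-- Lebesgue measure on the half line `(0, ∞)`. -/
def halfLine : Measure ℝ := volume.restrict (Ioi 0)

/-- Repulsive potentials: `C¹` on `(0, ∞)`, positive, with negative derivative, vanishing at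
infinity. -/
structure IsRepulsive (q₀ : ℝ → ℝ) : Prop where
  contDiffOn : ContDiffOn ℝ 1 q₀ (Ioi 0)
  pos : ∀ x, 0 < x → 0 < q₀ x
  deriv_neg : ∀ x, 0 < x → deriv q₀ x < 0
  tendsto_zero : Tendsto q₀ atTop (𝓝 0)

/-- The growth condition at zero, with an exponent `κ ∈ (0, 2)`. -/
def GrowthAtZero (q₀ : ℝ → ℝ) : Prop :=
  ∃ κ : ℝ, 0 < κ ∧ κ < 2 ∧ ∃ C δ : ℝ, 0 < δ ∧ ∀ x, 0 < x → x < δ →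
    |q₀ x| ≤ C * x ^ (-κ) ∧ |deriv q₀ x| ≤ C * x ^ (-κ - 1)

/-- The full potential `q(x) = lam / x² + q₀(x)`. -/
def potential (lam : ℝ) (q₀ : ℝ → ℝ) (x : ℝ) : ℝ := lam / x ^ 2 + q₀ x

/-- A time dependent function that is a continuous curve in `L²(0, ∞)`. A curve is written
`f t x`, with the time first. -/
def ContinuousInL2 (f : ℝ → ℝ → ℂ) : Prop :=
  (∀ t, MemLp (f t) 2 halfLine) ∧
    ∀ t, Tendsto (fun s => eLpNorm (fun x => f s x - f t x) 2 halfLine) (𝓝 t) (𝓝 0)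

/-- Multiplication by the square root of the potential; `∫ |√q v|² = ∫ q |v|²`. -/
def sqrtMul (q : ℝ → ℝ) (v : ℝ → ℂ) (x : ℝ) : ℂ := (Real.sqrt (q x) : ℂ) * v x

/-- `v` belongs to the homogeneous energy space of `A = -d²/dx² + q` with zero boundary
condition, and `v'` is its derivative: `v` is the primitive, vanishing at `0`, of the square
integrable `v'`, and `∫ q |v|² < ∞`. -/
structure IsEnergyClass (q : ℝ → ℝ) (v v' : ℝ → ℂ) : Prop where
  memLp_deriv : MemLp v' 2 halfLine
  eq_integral : ∀ x, 0 ≤ x → v x = ∫ y in (0 : ℝ)..x, v' y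
  memLp_potential : MemLp (sqrtMul q v) 2 halfLine

/-- Finite-energy solutions of `w_tt - w_xx + q w = 0` on `(0, ∞) × ℝ` with zero boundary
condition. Here `wx t` and `wt t` are (representatives of) the derivatives `w_x(·, t)` and
`w_t(·, t)`. The pair `(w, w_t)` is a continuous curve in the energy space, `w_t` is the time
derivative of `w` in `L²`, and the equation holds against all test functions. -/
structure IsFiniteEnergySolution (q : ℝ → ℝ) (w wx wt : ℝ → ℝ → ℂ) : Prop where
  energyClass : ∀ t, IsEnergyClass q (w t) (wx t)
  continuous_wx : ContinuousInL2 wx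
  continuous_potential : ContinuousInL2 (fun t => sqrtMul q (w t))
  continuous_wt : ContinuousInL2 wt
  time_deriv : ∀ t, Tendsto
    (fun s => eLpNorm (fun x => ((s - t : ℝ) : ℂ)⁻¹ * (w s x - w t x) - wt t x) 2 halfLine)
    (𝓝[≠] t) (𝓝 0)
  weak_eq : ∀ φ : ℝ → ℂ, ContDiff ℝ ∞ φ → HasCompactSupport φ → tsupport φ ⊆ Ioi 0 →
    ∀ t, HasDerivAt (fun s => ∫ x in Ioi (0 : ℝ), wt s x * φ x)
      (-∫ x in Ioi (0 : ℝ), (wx t x * deriv φ x + (q x : ℂ) * w t x * φ x)) t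

/-- `v` lies in the domain of the self-adjoint operator `A = -d²/dx² + lam / x² + q₀` with zero
boundary condition, with first and second derivatives `v'` and `v''`: `v` and `v'` are absolutely
continuous on the compact subintervals of `(0, ∞)`. -/
structure IsInDomain (lam : ℝ) (q₀ : ℝ → ℝ) (v v' v'' : ℝ → ℂ) : Prop where
  locallyIntegrable : LocallyIntegrableOn v'' (Ioi 0)
  sub_eq : ∀ a b, 0 < a → a ≤ b → v b - v a = ∫ y in a..b, v' y
  deriv_sub_eq : ∀ a b, 0 < a → a ≤ b → v' b - v' a = ∫ y in a..b, v'' y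
  near_zero : lam = 0 → IntegrableOn v'' (Ioo 0 1)
  near_zero' : lam ≠ 0 → ∀ p : ℝ≥0∞, 1 ≤ p → p < 2 → MemLp v'' p (volume.restrict (Ioo 0 1))
  near_infinity : MemLp v'' 2 (volume.restrict (Ioi 1))
  memLp : MemLp v 2 halfLine
  boundary : v 0 = 0 ∧ Tendsto v (𝓝[>] 0) (𝓝 0)
  boundary' : lam ≠ 0 → Tendsto v' (𝓝[>] 0) (𝓝 0)
  memLp_op : MemLp (fun x => -v'' x + (potential lam q₀ x : ℂ) * v x) 2 halfLine

/-- Strong solutions: `(w, w_t)` is a continuous curve in `D(A) × D(A^(1/2))` (graph norms). -/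
def IsStrongSolution (lam : ℝ) (q₀ : ℝ → ℝ) (w wx wt : ℝ → ℝ → ℂ) : Prop :=
  IsFiniteEnergySolution (potential lam q₀) w wx wt ∧
  (∃ w' w'' : ℝ → ℝ → ℂ, (∀ t, IsInDomain lam q₀ (w t) (w' t) (w'' t)) ∧
    ContinuousInL2 w ∧
    ContinuousInL2 (fun t x => -w'' t x + (potential lam q₀ x : ℂ) * w t x)) ∧
  (∃ v v' : ℝ → ℝ → ℂ, (∀ t, v t =ᵐ[halfLine] wt t) ∧
    (∀ t, IsEnergyClass (potential lam q₀) (v t) (v' t)) ∧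
    ContinuousInL2 v' ∧ ContinuousInL2 (fun t => sqrtMul (potential lam q₀) (v t)))

/-- A sequence of strong solutions, with boundary derivatives `h k t = ∂ₓ (w k) (0, t)`, whose
initial data converge in the energy norm to those of `w`. -/
structure StrongApproximation (lam : ℝ) (q₀ : ℝ → ℝ) (w wx wt : ℝ → ℝ → ℂ)
    (u ux ut : ℕ → ℝ → ℝ → ℂ) (h : ℕ → ℝ → ℂ) : Prop where
  strong : ∀ k, IsStrongSolution lam q₀ (u k) (ux k) (ut k)
  slope : ∀ k t, HasDerivWithinAt (u k t) (h k t) (Ici 0) 0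
  tendsto_x : Tendsto (fun k => eLpNorm (fun x => ux k 0 x - wx 0 x) 2 halfLine) atTop (𝓝 0)
  tendsto_t : Tendsto (fun k => eLpNorm (fun x => ut k 0 x - wt 0 x) 2 halfLine) atTop (𝓝 0)
  tendsto_potential : Tendsto (fun k => eLpNorm
    (sqrtMul (potential lam q₀) (fun x => u k 0 x - w 0 x)) 2 halfLine) atTop (𝓝 0)

/-- `g` is the boundary derivative `w_x(0, ·) ∈ L²(ℝ)` of a finite-energy solution, defined by
continuous extension from strong solutions: approximating sequences exist, and along each of them
the classical boundary derivatives converge to `g` in `L²(ℝ)`. -/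
def IsBoundaryDerivative (lam : ℝ) (q₀ : ℝ → ℝ) (w wx wt : ℝ → ℝ → ℂ) (g : ℝ → ℂ) : Prop :=
  MemLp g 2 volume ∧
  (∃ u ux ut h, StrongApproximation lam q₀ w wx wt u ux ut h) ∧
  ∀ u ux ut h, StrongApproximation lam q₀ w wx wt u ux ut h →
    Tendsto (fun k => eLpNorm (fun t => h k t - g t) 2 volume) atTop (𝓝 0)

/-- The energy density `e(x, t)`. -/
def energyDensity (q : ℝ → ℝ) (w wx wt : ℝ → ℝ → ℂ) (t x : ℝ) : ℝ :=
  ‖wx t x‖ ^ 2 + ‖wt t x‖ ^ 2 + q x * ‖w t x‖ ^ 2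

/-- The total energy at time `t`. -/
def energy (q : ℝ → ℝ) (w wx wt : ℝ → ℝ → ℂ) (t : ℝ) : ℝ :=
  ∫ x in Ioi (0 : ℝ), energyDensity q w wx wt t x

/-- The outward energy `E₊(t)`. -/
def outwardEnergy (q : ℝ → ℝ) (w wx wt : ℝ → ℝ → ℂ) (t : ℝ) : ℝ :=
  ∫ x in Ioi (0 : ℝ), (1 / 2 * ‖wx t x - wt t x‖ ^ 2 + q x / 2 * ‖w t x‖ ^ 2)

/-- The inward energy `E₋(t)`. -/
def inwardEnergy (q : ℝ → ℝ) (w wx wt : ℝ → ℝ → ℂ) (t : ℝ) : ℝ :=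
  ∫ x in Ioi (0 : ℝ), (1 / 2 * ‖wx t x + wt t x‖ ^ 2 + q x / 2 * ‖w t x‖ ^ 2)

/-- The Morawetz density `M(x, t) = -q'(x) |w(x, t)|² / 2`. -/
def morawetzDensity (q : ℝ → ℝ) (w : ℝ → ℝ → ℂ) (t x : ℝ) : ℝ :=
  -(deriv q x) / 2 * ‖w t x‖ ^ 2

end

end HalfLineWave

/-! Write p = Re (w_t conj w_x) and f = (|w_x|² + |w_t|² - q|w|²)/2. The equation gives two local
laws, e_t = (2p)_x and p_t = f_x - M, and M ≥ 0 because q decreases. At the boundary w_t and q|w|²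
vanish, so 2p tends to 0 and f tends to |w_x(0,t)|²/2. Hence E is conserved, and the momentum P(t) =
∫ p decreases, its total loss being the left side of the Morawetz identity. Since E₋ = E/2 + P and
E₊ = E/2 - P, this is the monotonicity of E₋ and E₊; since |P| ≤ E/2, the loss is at most E.

The heart is E₋ → 0 (`IsRegularSolution.exists_inwardEnergy_le`). The bound on M and the flux
through each point make the energy of a bounded region integrable in time
(`exists_integral_energy_le`), so bounded regions empty along a sequence of times. Inward energy in
(0, y] can disappear only through the loss of P, which is small after a late time s, or at the price
of half the time integral of q(y)|w(y,t)|² (`inward_local_le`). If E₋ stayed above 4η, then ∫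
q(y)|w(y,t)|² dt ≥ 2η for every y in a long interval [Y, R]. As M = (-q'/q)(q|w|²)/2, integration in
y gives ∬ M ≥ η log(q(Y)/q(R)), which exceeds E for large R because q → 0: a contradiction. Then P
tends to -E/2 at +∞ and, by time reversal, to E/2 at -∞, so the total loss is exactly E.

For a weight g(x - t) with g' ≥ 0, the weighted energy ∫ g(x - t) e changes at the rate -2 ∫ g'(x -
t) e₋ (`weighted_energy`). A fixed g gives finite speed of propagation. A transition stretched over
a length comparable to t loses at most a multiple of sup E₋ and gives the decay in x ≤ c|t|. Both
together concentrate w_x on an interval around x = t of length small compared with t, and Hardy's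
inequality turns this into the decay of ∫ |w|²/x² and sup |w|²/x (`weighted_bounds`).

These computations need regularity. Mollification in time keeps the class of solutions and gives
smoothness in t; the weak equation then determines w_xx (`exists_spatial`). A maximum principle with
the supersolutions 2x - x² or x^α, where λ ≥ 3/4 enters, bounds w near 0 so that w_xx is integrable
there, and the trace w_x(0,t) exists (`exists_trace`). Since the difference of two solutions is a
solution, conservation of energy makes the approximation uniform in time.

For the boundary derivative, ∫ |w_x(0,t)|² dt ≤ 20 E is proved from difference quotients
(`slope_bound`), so traces extend by continuity. Strong solutions must lie in L², while w need not;
averages of widely separated time translates of w have small energy and differ from w by an L²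
function, which gives the density (`exists_memLp_approximation`). -/

namespace HalfLineWave

/-! ### Square integrable functions and curves on the half line. -/

noncomputable section

/-- The complex Hilbert space `L²(0, ∞)`. -/
abbrev L2 : Type := Lp ℂ 2 halfLine

instance : IsLocallyFiniteMeasure halfLine := by unfold halfLine; infer_instance

instance : SigmaFinite halfLine := by unfold halfLine; infer_instance

lemma MemLp.norm_toLp_sq {f : ℝ → ℂ} (hf : MemLp f 2 halfLine) :
    ‖hf.toLp f‖ ^ 2 = ∫ x in Ioi (0 : ℝ), ‖f x‖ ^ 2 := by
  rw [← @inner_self_eq_norm_sq ℂ, L2.inner_def]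
  have h : ∀ᵐ x ∂halfLine, inner ℂ (hf.toLp f x) (hf.toLp f x) = ((‖f x‖ ^ 2 : ℝ) : ℂ) := by
    filter_upwards [hf.coeFn_toLp] with x hx
    rw [hx, inner_self_eq_norm_sq_to_K]; simp
  rw [integral_congr_ae h, integral_complex_ofReal]
  simp [halfLine]

lemma MemLp.integrableOn_sq {f : ℝ → ℂ} (hf : MemLp f 2 halfLine) :
    IntegrableOn (fun x => ‖f x‖ ^ 2) (Ioi 0) :=
  hf.integrable_norm_pow (by norm_num)

lemma halfLine_restrict {s : Set ℝ} (hs : MeasurableSet s) (h : s ⊆ Ioi 0) :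
    halfLine.restrict s = volume.restrict s := by
  rw [halfLine, Measure.restrict_restrict hs, inter_eq_self_of_subset_left h]

lemma Ioc_subset_Ioi_zero {a b : ℝ} (ha : 0 ≤ a) : Ioc a b ⊆ Ioi 0 :=
  fun _ hx => lt_of_le_of_lt ha hx.1

lemma MemLp.integrableOn_Ioc {f : ℝ → ℂ} (hf : MemLp f 2 halfLine) {a b : ℝ} (ha : 0 ≤ a) :
    IntegrableOn f (Ioc a b) := by
  have h := hf.restrict (Ioc a b)
  rw [halfLine_restrict measurableSet_Ioc (Ioc_subset_Ioi_zero ha)] at h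
  exact h.integrable (by norm_num)

lemma MemLp.intervalIntegrable' {f : ℝ → ℂ} (hf : MemLp f 2 halfLine) {a b : ℝ} (ha : 0 ≤ a)
    (hb : 0 ≤ b) : IntervalIntegrable f volume a b :=
  ⟨MemLp.integrableOn_Ioc hf ha, MemLp.integrableOn_Ioc hf hb⟩

/-- Cauchy–Schwarz against the constant function, read off from the nonnegative variance of `‖f‖`
over the interval. It makes primitives of `L²` functions Hölder continuous of exponent 1/2. -/
lemma norm_integral_sq_le {f : ℝ → ℂ} (hf : MemLp f 2 halfLine) {a b : ℝ} (ha : 0 ≤ a)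
    (hab : a ≤ b) :
    ‖∫ y in a..b, f y‖ ^ 2 ≤ (b - a) * ∫ y in Ioc a b, ‖f y‖ ^ 2 := by
  have hf1 := MemLp.integrableOn_Ioc (b := b) hf ha
  have hf2 : IntegrableOn (fun x => ‖f x‖ ^ 2) (Ioc a b) :=
    (MemLp.integrableOn_sq hf).mono_set (Ioc_subset_Ioi_zero ha)
  have h1 : ‖∫ y in a..b, f y‖ ≤ ∫ y in Ioc a b, ‖f y‖ := by
    rw [intervalIntegral.integral_of_le hab]
    exact norm_integral_le_integral_norm _
  set m := ∫ y in Ioc a b, ‖f y‖ with hm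
  have hm0 : 0 ≤ m := integral_nonneg fun _ => norm_nonneg _
  have h2 : m ^ 2 ≤ (b - a) * ∫ y in Ioc a b, ‖f y‖ ^ 2 := by
    rcases hab.eq_or_lt with rfl | hlt
    · simp [hm]
    have hb : 0 < b - a := sub_pos.2 hlt
    have h3 : 0 ≤ ∫ y in Ioc a b, (‖f y‖ - m / (b - a)) ^ 2 := integral_nonneg fun _ => sq_nonneg _
    have h4 : ∫ y in Ioc a b, (‖f y‖ - m / (b - a)) ^ 2 =
        (∫ y in Ioc a b, ‖f y‖ ^ 2) - 2 * (m / (b - a)) * m + (m / (b - a)) ^ 2 * (b - a) := by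
      have : ∀ y, (‖f y‖ - m / (b - a)) ^ 2 =
          ‖f y‖ ^ 2 - 2 * (m / (b - a)) * ‖f y‖ + (m / (b - a)) ^ 2 := fun y => by ring
      simp_rw [this]
      rw [integral_add, integral_sub, integral_const_mul, integral_const, ← hm]
      · simp [hab, mul_comm]
      · exact hf2
      · exact hf1.norm.const_mul _
      · exact hf2.sub (hf1.norm.const_mul _)
      · exact integrable_const _
    rw [h4] at h3
    have h5 : (∫ y in Ioc a b, ‖f y‖ ^ 2) - 2 * (m / (b - a)) * m + (m / (b - a)) ^ 2 * (b - a)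
      = (∫ y in Ioc a b, ‖f y‖ ^ 2) - m ^ 2 / (b - a) := by field_simp; ring
    rw [h5, sub_nonneg, div_le_iff₀ hb] at h3
    linarith
  calc _ ≤ m ^ 2 := by gcongr
    _ ≤ _ := h2

lemma setIntegral_sq_le_norm_sq {f : ℝ → ℂ} (hf : MemLp f 2 halfLine) {s : Set ℝ}
    (hs : s ⊆ Ioi 0) : ∫ y in s, ‖f y‖ ^ 2 ≤ ‖hf.toLp f‖ ^ 2 := by
  rw [MemLp.norm_toLp_sq]
  exact setIntegral_mono_set (MemLp.integrableOn_sq hf)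
    (Eventually.of_forall fun _ => sq_nonneg _) (LE.le.eventuallyLE hs)

lemma norm_integral_le_sqrt_mul {f : ℝ → ℂ} (hf : MemLp f 2 halfLine) {a b : ℝ} (ha : 0 ≤ a)
    (hab : a ≤ b) : ‖∫ y in a..b, f y‖ ≤ √(b - a) * ‖hf.toLp f‖ := by
  refine abs_le_of_sq_le_sq' ?_ (by positivity) |>.2
  rw [mul_pow, Real.sq_sqrt (sub_nonneg.2 hab)]
  exact (norm_integral_sq_le hf ha hab).trans (mul_le_mul_of_nonneg_left
    (setIntegral_sq_le_norm_sq hf (Ioc_subset_Ioi_zero ha)) (sub_nonneg.2 hab))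

/-- A continuous curve in `L²`, as a map into the Hilbert space. -/
def ContinuousInL2.curve {f : ℝ → ℝ → ℂ} (hf : ContinuousInL2 f) (t : ℝ) : L2 :=
  (hf.1 t).toLp (f t)

lemma ContinuousInL2.coeFn_curve {f : ℝ → ℝ → ℂ} (hf : ContinuousInL2 f) (t : ℝ) :
    hf.curve t =ᵐ[halfLine] f t := MemLp.coeFn_toLp _

lemma ContinuousInL2.continuous_curve {f : ℝ → ℝ → ℂ} (hf : ContinuousInL2 f) :
    Continuous hf.curve :=
  continuous_iff_continuousAt.2 fun t =>
    (Lp.tendsto_Lp_iff_tendsto_eLpNorm'' _ hf.1 _ (hf.1 t)).2 (hf.2 t)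

lemma ContinuousInL2.norm_curve_sq {f : ℝ → ℝ → ℂ} (hf : ContinuousInL2 f) (t : ℝ) :
    ‖hf.curve t‖ ^ 2 = ∫ x in Ioi (0 : ℝ), ‖f t x‖ ^ 2 := MemLp.norm_toLp_sq _

/-- The way back from the Hilbert space: curves are built and differentiated in `L2`, and concrete
representatives inherit their continuity. -/
lemma continuousInL2_of_ae_eq {f : ℝ → ℝ → ℂ} {F : ℝ → L2} (hF : Continuous F)
    (h : ∀ t, F t =ᵐ[halfLine] f t) : ContinuousInL2 f := by
  have hm : ∀ t, MemLp (f t) 2 halfLine := fun t => (memLp_congr_ae (h t)).1 (Lp.memLp _)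
  have he : ∀ t, (hm t).toLp (f t) = F t := fun t => by
    apply Lp.ext
    exact (MemLp.coeFn_toLp _).trans (h t).symm
  refine ⟨hm, fun t => ?_⟩
  refine (Lp.tendsto_Lp_iff_tendsto_eLpNorm'' _ hm _ (hm t)).1 ?_
  simp_rw [he]
  exact hF.tendsto t

lemma ContinuousInL2.curve_eq_of_ae_eq {f : ℝ → ℝ → ℂ} (hf : ContinuousInL2 f) {F : ℝ → L2}
    (h : ∀ t, F t =ᵐ[halfLine] f t) : hf.curve = F := by
  funext t
  exact Lp.ext ((hf.coeFn_curve t).trans (h t).symm)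

/-- Integration over `(a, b]`, as a continuous functional on `L²`. -/
def integralCLM (a b : ℝ) : L2 →L[ℂ] ℂ :=
  if h : 0 ≤ a then
    innerSL ℂ (indicatorConstLp 2 (measurableSet_Ioc (a := a) (b := b)) (by
      rw [← Measure.restrict_apply_univ, halfLine_restrict measurableSet_Ioc (Ioc_subset_Ioi_zero h)]
      simp) (1 : ℂ))
  else 0

/-- A value of the primitive is a bounded functional of the derivative, and therefore commutes with
the Bochner integrals in time used for mollification. -/
lemma integralCLM_apply {a b : ℝ} (ha : 0 ≤ a) (hab : a ≤ b) (F : L2) :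
    integralCLM a b F = ∫ x in a..b, F x := by
  rw [integralCLM, dif_pos ha, innerSL_apply_apply, L2.inner_indicatorConstLp_one,
    halfLine_restrict measurableSet_Ioc (Ioc_subset_Ioi_zero ha),
    intervalIntegral.integral_of_le hab]

lemma intervalIntegral_congr_ae_halfLine {f g : ℝ → ℂ} (h : f =ᵐ[halfLine] g) {a b : ℝ}
    (ha : 0 ≤ a) (hab : a ≤ b) : ∫ x in a..b, f x = ∫ x in a..b, g x := by
  rw [intervalIntegral.integral_of_le hab, intervalIntegral.integral_of_le hab]
  exact integral_congr_ae (ae_restrict_of_ae_restrict_of_subset (Ioc_subset_Ioi_zero ha) h)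

/-- Two functions that are integrable on the compact subintervals of `(0, ∞)` and have the same
integrals over them agree almost everywhere. -/
lemma ae_eq_of_forall_intervalIntegral_eq {f g : ℝ → ℂ} (hf : LocallyIntegrableOn f (Ioi 0))
    (hg : LocallyIntegrableOn g (Ioi 0))
    (h : ∀ a b, 0 < a → a ≤ b → ∫ x in a..b, f x = ∫ x in a..b, g x) : f =ᵐ[halfLine] g := by
  have hd : LocallyIntegrableOn (fun x => f x - g x) (Ioi 0) := hf.sub hg
  -- Exhaustion by intervals with positive left endpoint, on each of which the difference is
  -- integrable.
  have key : ∀ n : ℕ, ∀ᵐ x ∂(volume.restrict (Ioc (1 / (n + 1 : ℝ)) (n + 2))), f x - g x = 0 := by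
    intro n
    set a : ℝ := 1 / (n + 1 : ℝ) with ha
    have ha0 : 0 < a := by positivity
    have hab : a ≤ n + 2 := by
      have : a ≤ 1 := by rw [ha, div_le_one (by positivity)]; linarith [n.cast_nonneg (α := ℝ)]
      linarith [n.cast_nonneg (α := ℝ)]
    have hint : ∀ c d, a ≤ c → IntegrableOn (fun x => f x - g x) (Icc c d) := fun c d hc =>
      hd.integrableOn_compact_subset (fun x hx => lt_of_lt_of_le (ha0.trans_le hc) hx.1)
        isCompact_Icc
    have hI : Integrable (fun x => f x - g x) (volume.restrict (Ioc a (n + 2))) :=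
      (hint a (n + 2) le_rfl).mono_set Ioc_subset_Icc_self
    refine Integrable.ae_eq_zero_of_forall_setIntegral_eq_zero hI ?_
    intro s hs _
    -- Half-open intervals form a π-system generating the Borel sets; complements are handled by the
    -- vanishing of the integral over the whole of `(a, n + 2]`.
    have hgen : ∀ s, MeasurableSet s → ∫ x in s, (f x - g x) ∂(volume.restrict (Ioc a (n + 2))) = 0 := by
      intro s hs
      induction s, hs using MeasurableSpace.induction_on_inter
        (BorelSpace.measurable_eq.trans (borel_eq_generateFrom_Ioc ℝ))
        (by simpa using isPiSystem_Ioc_mem (univ : Set ℝ) univ) with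
      | empty => simp
      | basic s hs =>
        obtain ⟨l, u, _, rfl⟩ := hs
        rw [Measure.restrict_restrict measurableSet_Ioc, Ioc_inter_Ioc]
        rcases le_total (max l a) (min u (n + 2)) with hle | hle
        · rw [← intervalIntegral.integral_of_le hle, intervalIntegral.integral_sub, h, sub_self]
          · exact lt_of_lt_of_le ha0 (le_max_right _ _)
          · exact hle
          · exact (intervalIntegrable_iff_integrableOn_Icc_of_le hle).2
              (hf.integrableOn_compact_subset (fun x hx => lt_of_lt_of_le
                (ha0.trans_le (le_max_right _ _)) hx.1) isCompact_Icc)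
          · exact (intervalIntegrable_iff_integrableOn_Icc_of_le hle).2
              (hg.integrableOn_compact_subset (fun x hx => lt_of_lt_of_le
                (ha0.trans_le (le_max_right _ _)) hx.1) isCompact_Icc)
        · rw [Ioc_eq_empty (not_lt.2 hle)]; simp
      | compl s hs ih =>
        have h1 := integral_add_compl hs hI
        rw [ih, zero_add] at h1
        rw [h1, ← intervalIntegral.integral_of_le hab, intervalIntegral.integral_sub, h _ _ ha0 hab, sub_self]
        · exact (intervalIntegrable_iff_integrableOn_Icc_of_le hab).2
              (hf.integrableOn_compact_subset (fun x hx => lt_of_lt_of_le ha0 hx.1) isCompact_Icc)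
        · exact (intervalIntegrable_iff_integrableOn_Icc_of_le hab).2
              (hg.integrableOn_compact_subset (fun x hx => lt_of_lt_of_le ha0 hx.1) isCompact_Icc)
      | iUnion s hd hs ih =>
        rw [integral_iUnion hs hd hI.integrableOn]
        simp [ih]
    exact hgen s hs
  rw [halfLine, EventuallyEq, ae_restrict_iff' measurableSet_Ioi]
  have key' : ∀ᵐ x, ∀ n : ℕ, x ∈ Ioc (1 / (n + 1 : ℝ)) (n + 2) → f x - g x = 0 :=
    ae_all_iff.2 fun n => (ae_restrict_iff' measurableSet_Ioc).1 (key n)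
  filter_upwards [key'] with x hx h0
  obtain ⟨n, hn⟩ := exists_nat_gt (max x (1 / x))
  have hx0 : 0 < x := h0
  have h1 : 1 / x < n := (le_max_right _ _).trans_lt hn
  have h2 : x < n := (le_max_left _ _).trans_lt hn
  have h3 : 1 / (n + 1 : ℝ) < x := by
    rw [div_lt_iff₀ (by positivity)]
    rw [div_lt_iff₀ hx0] at h1
    nlinarith
  exact sub_eq_zero.1 (hx n ⟨h3, by linarith⟩)

end

end HalfLineWave

/-! ### Mollification in time and joint continuity of primitives. -/

namespace HalfLineWave

noncomputable section

/-- Smooth compactly supported kernels. -/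
structure IsKernel (k : ℝ → ℝ) : Prop where
  smooth : ContDiff ℝ ∞ k
  compact : HasCompactSupport k

lemma IsKernel.derivative {k : ℝ → ℝ} (hk : IsKernel k) : IsKernel (deriv k) :=
  ⟨((contDiff_infty_iff_deriv (𝕜 := ℝ)).1 hk.smooth).2, hk.compact.deriv⟩

lemma IsKernel.exists_support {k : ℝ → ℝ} (hk : IsKernel k) :
    ∃ R, 0 ≤ R ∧ ∀ s, s ∉ Ioc (-R) R → k s = 0 := by
  obtain ⟨R, hR⟩ := hk.compact.isBounded.subset_closedBall 0
  refine ⟨|R| + 1, by positivity, fun s hs => ?_⟩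
  by_contra h
  have := hR (subset_tsupport k h)
  rw [Metric.mem_closedBall, dist_zero_right, Real.norm_eq_abs, abs_le] at this
  exact hs ⟨by linarith [le_abs_self R], by linarith [le_abs_self R]⟩

section Mollifier

variable {E : Type*} [NormedAddCommGroup E]

/-- Joint continuity on the open half plane. -/
def JointContinuous (f : ℝ → ℝ → E) : Prop :=
  ContinuousOn (Function.uncurry f) (univ ×ˢ Ioi 0)

lemma JointContinuous.continuousOn_of_subset {f : ℝ → ℝ → E} (hf : JointContinuous f)
    {s t : Set ℝ} (ht : t ⊆ Ioi 0) : ContinuousOn (Function.uncurry f) (s ×ˢ t) :=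
  hf.mono (prod_mono (subset_univ _) ht)

lemma JointContinuous.time {f : ℝ → ℝ → E} (hf : JointContinuous f) {x : ℝ} (hx : 0 < x) :
    Continuous fun t => f t x :=
  ContinuousOn.comp_continuous (f := fun t => (t, x)) hf (by fun_prop) fun t => ⟨trivial, hx⟩

lemma JointContinuous.space {f : ℝ → ℝ → E} (hf : JointContinuous f) (t : ℝ) :
    ContinuousOn (f t) (Ioi 0) :=
  ContinuousOn.comp (f := fun x => (t, x)) hf (by fun_prop) fun x hx => ⟨trivial, hx⟩

/-- Clamping the space variable at `a > 0` turns continuity on the open half plane into global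
continuity, the form required by theorems on parametric integrals. `jointContinuous_of_max` is the
converse. -/
lemma JointContinuous.max_const {f : ℝ → ℝ → E} (hf : JointContinuous f) {a : ℝ} (ha : 0 < a) :
    Continuous fun p : ℝ × ℝ => f p.1 (max p.2 a) :=
  ContinuousOn.comp_continuous (f := fun p : ℝ × ℝ => (p.1, max p.2 a)) hf (by fun_prop)
    fun p => ⟨trivial, lt_max_of_lt_right ha⟩

lemma jointContinuous_of_max {f : ℝ → ℝ → E}
    (h : ∀ a, 0 < a → Continuous fun p : ℝ × ℝ => f p.1 (max p.2 a)) : JointContinuous f := by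
  rintro ⟨t, x⟩ ⟨-, hx⟩
  have hx : 0 < x := hx
  have h1 := (h (x / 2) (by positivity)).continuousAt (x := (t, x))
  refine (h1.congr ?_).continuousWithinAt
  have : ∀ᶠ p : ℝ × ℝ in 𝓝 (t, x), x / 2 < p.2 :=
    continuous_snd.continuousAt.eventually (lt_mem_nhds (by simp [hx]))
  filter_upwards [this] with p hp
  simp [Function.uncurry, max_eq_left hp.le]

lemma JointContinuous.locallyIntegrableOn {f : ℝ → ℝ → E} (hf : JointContinuous f) (t : ℝ) :
    LocallyIntegrableOn (f t) (Ioi 0) :=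
  (hf.space t).locallyIntegrableOn measurableSet_Ioi

variable [NormedSpace ℝ E]

/-- Mollification by a kernel. -/
def moll (k : ℝ → ℝ) (f : ℝ → E) (t : ℝ) : E := ∫ s, k s • f (t - s)

lemma moll_eq_intervalIntegral {k : ℝ → ℝ} {R : ℝ} (hR : 0 ≤ R)
    (h : ∀ s, s ∉ Ioc (-R) R → k s = 0) (f : ℝ → E) (t : ℝ) :
    moll k f t = ∫ s in (-R)..R, k s • f (t - s) := by
  rw [moll, intervalIntegral.integral_of_le (by linarith)]
  exact (setIntegral_eq_integral_of_forall_compl_eq_zero fun s hs => by rw [h s hs, zero_smul]).symm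

lemma IsKernel.integrable_smul {k : ℝ → ℝ} (hk : IsKernel k) {f : ℝ → E} (hf : Continuous f)
    (t : ℝ) : Integrable fun s => k s • f (t - s) :=
  Continuous.integrable_of_hasCompactSupport
    (hk.smooth.continuous.smul (hf.comp (continuous_const.sub continuous_id)))
    hk.compact.smul_right

lemma hasDerivAt_moll [CompleteSpace E] {k : ℝ → ℝ} (hk : IsKernel k) {f : ℝ → E}
    (hf : Continuous f) (t : ℝ) : HasDerivAt (moll k f) (moll (deriv k) f t) t :=
  hk.compact.hasDerivAt_convolution_left (ContinuousLinearMap.lsmul ℝ ℝ)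
    (hk.smooth.of_le (by exact_mod_cast le_top)) hf.locallyIntegrable t

lemma continuous_moll [CompleteSpace E] {k : ℝ → ℝ} (hk : IsKernel k) {f : ℝ → E}
    (hf : Continuous f) : Continuous (moll k f) :=
  continuous_iff_continuousAt.2 fun t => (hasDerivAt_moll hk hf t).continuousAt

/-- Integration by parts: the derivative of the compactly supported `s ↦ k s • f (t - s)` has
integral zero. Derivatives in time can thus be moved onto the kernel. -/
lemma moll_deriv [CompleteSpace E] {k : ℝ → ℝ} (hk : IsKernel k) {f f' : ℝ → E}
    (hf : ∀ t, HasDerivAt f (f' t) t) (hf' : Continuous f') (t : ℝ) :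
    moll (deriv k) f t = moll k f' t := by
  have hfc : Continuous f := continuous_iff_continuousAt.2 fun t => (hf t).continuousAt
  have h1 : ∀ s, HasDerivAt (fun s => k s • f (t - s)) (k s • (-f' (t - s)) + deriv k s • f (t - s)) s := by
    intro s
    have h2 : HasDerivAt (fun s => f (t - s)) (-f' (t - s)) s := by
      simpa [Function.comp_def] using (hf (t - s)).scomp s ((hasDerivAt_id s).const_sub t)
    exact ((hk.smooth.differentiable (by simp)) s).hasDerivAt.smul h2
  have i1 := hk.integrable_smul hf' t
  have i2 := hk.derivative.integrable_smul hfc t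
  have i3 := hk.integrable_smul hfc t
  have h4 : ∀ s, k s • (-f' (t - s)) + deriv k s • f (t - s) =
      deriv k s • f (t - s) - k s • f' (t - s) := fun s => by rw [smul_neg]; abel
  simp only [h4] at h1
  have h3 := integral_eq_zero_of_hasDerivAt_of_integrable h1 (i2.sub i1) i3
  rw [integral_sub i2 i1, sub_eq_zero] at h3
  exact h3

lemma ContinuousLinearMap.map_moll {F : Type*} [NormedAddCommGroup F] [NormedSpace ℝ F]
    [CompleteSpace E] [CompleteSpace F] (T : E →L[ℝ] F) {k : ℝ → ℝ} (hk : IsKernel k) {f : ℝ → E}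
    (hf : Continuous f) (t : ℝ) : T (moll k f t) = moll k (fun s => T (f s)) t := by
  rw [moll, ← T.integral_comp_comm (hk.integrable_smul hf t)]
  simp [moll]

lemma moll_const_deriv {k : ℝ → ℝ} (hk : IsKernel k) (c : ℝ → ℂ) (hc : ∀ s t, c s = c t) (t : ℝ) :
    moll (deriv k) c t = 0 := by
  have : c = fun _ => c 0 := funext fun s => hc _ _
  rw [this, moll_deriv hk (f' := fun _ => 0) (fun t => hasDerivAt_const _ _) continuous_const]
  simp [moll]

lemma intervalIntegral_swap_of_continuousOn [CompleteSpace E] {f : ℝ → ℝ → E} {a b c d : ℝ}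
    (hf : ContinuousOn (Function.uncurry f) (uIcc a b ×ˢ uIcc c d)) :
    ∫ x in a..b, ∫ y in c..d, f x y = ∫ y in c..d, ∫ x in a..b, f x y :=
  intervalIntegral_intervalIntegral_swap
    ((hf.integrableOn_compact (isCompact_uIcc.prod isCompact_uIcc)).mono_set
      (prod_mono uIoc_subset_uIcc uIoc_subset_uIcc))

/-- The integral runs over the compact set `tsupport k`, the same for all parameters, so no
domination argument is needed. -/
lemma continuous_moll_param {k : ℝ → ℝ} (hk : IsKernel k) {f : ℝ → ℝ → E}
    (hf : Continuous (Function.uncurry f)) :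
    Continuous fun p : ℝ × ℝ => moll k (fun s => f s p.2) p.1 := by
  have h : ∀ p : ℝ × ℝ, moll k (fun s => f s p.2) p.1 =
      ∫ s in tsupport k, k s • f (p.1 - s) p.2 := fun p =>
    (setIntegral_eq_integral_of_forall_compl_eq_zero fun s hs => by
      rw [image_eq_zero_of_notMem_tsupport hs, zero_smul]).symm
  simp_rw [h]
  refine continuous_parametric_integral_of_continuous
    (f := fun (p : ℝ × ℝ) s => k s • f (p.1 - s) p.2) ?_ hk.compact
  have hk' := hk.smooth.continuous
  have : Continuous fun q : (ℝ × ℝ) × ℝ => f (q.1.1 - q.2) q.1.2 :=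
    hf.comp (by fun_prop : Continuous fun q : (ℝ × ℝ) × ℝ => (q.1.1 - q.2, q.1.2))
  exact (hk'.comp continuous_snd).smul this

lemma JointContinuous.mollify {k : ℝ → ℝ} (hk : IsKernel k) {f : ℝ → ℝ → E}
    (hf : JointContinuous f) : JointContinuous fun t x => moll k (fun s => f s x) t :=
  jointContinuous_of_max fun a ha =>
    continuous_moll_param hk (f := fun s x => f s (max x a)) (hf.max_const ha)

lemma intervalIntegral_moll [CompleteSpace E] {k : ℝ → ℝ} (hk : IsKernel k) {f : ℝ → ℝ → E}
    (hf : JointContinuous f) {a b : ℝ} (ha : 0 < a) (hab : a ≤ b) (t : ℝ) :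
    ∫ x in a..b, moll k (fun s => f s x) t = moll k (fun s => ∫ x in a..b, f s x) t := by
  obtain ⟨R, hR, hk0⟩ := hk.exists_support
  simp_rw [moll_eq_intervalIntegral hR hk0]
  rw [intervalIntegral_swap_of_continuousOn]
  · refine intervalIntegral.integral_congr fun s _ => ?_
    simp
  · rw [uIcc_of_le hab]
    have h1 : ContinuousOn (fun p : ℝ × ℝ => f (t - p.2) p.1) (Icc a b ×ˢ uIcc (-R) R) :=
      ContinuousOn.comp (f := fun p : ℝ × ℝ => (t - p.2, p.1)) hf (by fun_prop)
        fun p hp => ⟨trivial, ha.trans_le hp.1.1⟩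
    exact (hk.smooth.continuous.comp continuous_snd).continuousOn.smul h1

end Mollifier

/-- Mollification in `L²` agrees with pointwise mollification. -/
lemma moll_ae_eq {k : ℝ → ℝ} (hk : IsKernel k) {F : ℝ → L2} (hF : Continuous F)
    {f : ℝ → ℝ → ℂ} (hf : JointContinuous f) (h : ∀ t, F t =ᵐ[halfLine] f t) (t : ℝ) :
    (moll k F t : L2) =ᵐ[halfLine] fun x => moll k (fun s => f s x) t := by
  refine ae_eq_of_forall_intervalIntegral_eq ?_ ((hf.mollify hk).locallyIntegrableOn t) ?_
  · have h1 : LocallyIntegrable (moll k F t : L2) (volume.restrict (Ioi 0)) :=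
      (Lp.memLp (moll k F t)).locallyIntegrable (by norm_num)
    exact locallyIntegrableOn_of_locallyIntegrable_restrict h1
  -- The integrals over `[a, b]` agree: on the left the functional `integralCLM` passes inside the
  -- Bochner integral, on the right Fubini exchanges the two integrations.
  · intro a b ha hab
    rw [intervalIntegral_moll hk hf ha hab, ← integralCLM_apply ha.le hab]
    have h2 := ContinuousLinearMap.map_moll ((integralCLM a b).restrictScalars ℝ) hk hF t
    simp only [ContinuousLinearMap.coe_restrictScalars'] at h2
    rw [h2]
    congr 1
    funext s
    rw [integralCLM_apply ha.le hab]
    exact intervalIntegral_congr_ae_halfLine (h s) ha.le hab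

/-- `f t` is the primitive of `F t` that vanishes at zero. -/
def IsPrimitive (F : ℝ → L2) (f : ℝ → ℝ → ℂ) : Prop :=
  ∀ t x, 0 ≤ x → f t x = ∫ y in (0 : ℝ)..x, F t y

lemma norm_integral_L2_le (F : L2) {a b : ℝ} (ha : 0 ≤ a) (hab : a ≤ b) :
    ‖∫ y in a..b, F y‖ ≤ √(b - a) * ‖F‖ := by
  simpa using norm_integral_le_sqrt_mul (Lp.memLp F) ha hab

lemma L2.intervalIntegrable (F : L2) {a b : ℝ} (ha : 0 ≤ a) (hb : 0 ≤ b) :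
    IntervalIntegrable F volume a b := MemLp.intervalIntegrable' (Lp.memLp F) ha hb

lemma IsPrimitive.norm_le {F : ℝ → L2} {f : ℝ → ℝ → ℂ} (h : IsPrimitive F f) (t : ℝ) {x : ℝ}
    (hx : 0 ≤ x) : ‖f t x‖ ≤ √x * ‖F t‖ := by
  rw [h t x hx]; simpa using norm_integral_L2_le (F t) le_rfl hx

lemma IsPrimitive.sub_eq {F : ℝ → L2} {f : ℝ → ℝ → ℂ} (h : IsPrimitive F f) (t : ℝ) {x y : ℝ}
    (hx : 0 ≤ x) (hxy : x ≤ y) : f t y - f t x = ∫ z in x..y, F t z := by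
  rw [h t x hx, h t y (hx.trans hxy)]
  exact intervalIntegral.integral_interval_sub_left
    (L2.intervalIntegrable _ le_rfl (hx.trans hxy)) (L2.intervalIntegrable _ le_rfl hx)

lemma IsPrimitive.norm_sub_le {F : ℝ → L2} {f : ℝ → ℝ → ℂ} (h : IsPrimitive F f) (t : ℝ) {x y : ℝ}
    (hx : 0 ≤ x) (hy : 0 ≤ y) : ‖f t y - f t x‖ ≤ √|y - x| * ‖F t‖ := by
  rcases le_total x y with hxy | hxy
  · rw [h.sub_eq t hx hxy, abs_of_nonneg (sub_nonneg.2 hxy)]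
    exact norm_integral_L2_le _ hx hxy
  · rw [norm_sub_rev, h.sub_eq t hy hxy, abs_sub_comm, abs_of_nonneg (sub_nonneg.2 hxy)]
    exact norm_integral_L2_le _ hy hxy

lemma IsPrimitive.norm_sub_time_le {F : ℝ → L2} {f : ℝ → ℝ → ℂ} (h : IsPrimitive F f) (s t : ℝ)
    {x : ℝ} (hx : 0 ≤ x) : ‖f s x - f t x‖ ≤ √x * ‖F s - F t‖ := by
  rw [h s x hx, h t x hx, ← integralCLM_apply le_rfl hx, ← integralCLM_apply le_rfl hx, ← map_sub,
    integralCLM_apply le_rfl hx]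
  simpa using norm_integral_L2_le (F s - F t) le_rfl hx

/-- The increment splits into a time part, at most `√x ‖F s - F t‖`, and a space part that is Hölder
of exponent 1/2. The clamp at `0` is there because nothing is known about `f` at negative `x`. -/
lemma IsPrimitive.continuous_max {F : ℝ → L2} {f : ℝ → ℝ → ℂ} (h : IsPrimitive F f)
    (hF : Continuous F) : Continuous fun p : ℝ × ℝ => f p.1 (max p.2 0) := by
  rw [continuous_iff_continuousAt]
  rintro ⟨t, x⟩
  rw [ContinuousAt, tendsto_iff_norm_sub_tendsto_zero]
  have hb : ∀ p : ℝ × ℝ, ‖f p.1 (max p.2 0) - f t (max x 0)‖ ≤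
      √(max p.2 0) * ‖F p.1 - F t‖ + √|max p.2 0 - max x 0| * ‖F t‖ := fun p => by
    have h1 := h.norm_sub_time_le p.1 t (le_max_right p.2 0)
    have h2 := h.norm_sub_le t (le_max_right x 0) (le_max_right p.2 0)
    have h3 := norm_add_le (f p.1 (max p.2 0) - f t (max p.2 0)) (f t (max p.2 0) - f t (max x 0))
    rw [sub_add_sub_cancel] at h3
    linarith
  refine squeeze_zero (fun _ => norm_nonneg _) hb ?_
  have hc : Continuous fun p : ℝ × ℝ =>
      √(max p.2 0) * ‖F p.1 - F t‖ + √|max p.2 0 - max x 0| * ‖F t‖ := by fun_prop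
  have := hc.tendsto (t, x)
  simpa using this

lemma IsPrimitive.jointContinuous {F : ℝ → L2} {f : ℝ → ℝ → ℂ} (h : IsPrimitive F f)
    (hF : Continuous F) : JointContinuous f :=
  jointContinuous_of_max fun a ha => by
    have := (h.continuous_max hF).comp
      (by fun_prop : Continuous fun p : ℝ × ℝ => (p.1, max p.2 a))
    have h0 : ∀ x : ℝ, max (max x a) 0 = max x a := fun x => max_eq_left (le_max_of_le_right ha.le)
    simpa [Function.comp_def, h0] using this

lemma IsPrimitive.continuous_time {F : ℝ → L2} {f : ℝ → ℝ → ℂ} (h : IsPrimitive F f)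
    (hF : Continuous F) {x : ℝ} (hx : 0 ≤ x) : Continuous fun t => f t x := by
  have := (h.continuous_max hF).comp (by fun_prop : Continuous fun t : ℝ => (t, x))
  simpa [Function.comp_def, max_eq_left hx] using this

lemma IsPrimitive.mollify {k : ℝ → ℝ} (hk : IsKernel k) {F : ℝ → L2} (hF : Continuous F)
    {f : ℝ → ℝ → ℂ} (h : IsPrimitive F f) :
    IsPrimitive (moll k F) fun t x => moll k (fun s => f s x) t := by
  intro t x hx
  have h2 := ContinuousLinearMap.map_moll ((integralCLM 0 x).restrictScalars ℝ) hk hF t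
  simp only [ContinuousLinearMap.coe_restrictScalars'] at h2
  rw [← integralCLM_apply le_rfl hx, h2]
  simp only []
  congr 1
  funext s
  rw [integralCLM_apply le_rfl hx, h s x hx]

end

end HalfLineWave

/-! ### Test functions and weak derivatives on the half line. -/

namespace HalfLineWave

noncomputable section

/-- Real test functions on the open half line. -/
structure IsTest (φ : ℝ → ℝ) : Prop where
  smooth : ContDiff ℝ ∞ φ
  compact : HasCompactSupport φ
  subset : tsupport φ ⊆ Ioi 0

lemma IsTest.derivative {φ : ℝ → ℝ} (h : IsTest φ) : IsTest (deriv φ) :=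
  ⟨((contDiff_infty_iff_deriv (𝕜 := ℝ)).1 h.smooth).2, h.compact.deriv,
    (tsupport_deriv_subset ..).trans h.subset⟩

lemma IsTest.hasDerivAt {φ : ℝ → ℝ} (h : IsTest φ) (x : ℝ) : HasDerivAt φ (deriv φ x) x :=
  (h.smooth.differentiable (by simp) x).hasDerivAt

lemma IsTest.eq_zero {φ : ℝ → ℝ} (h : IsTest φ) {x : ℝ} (hx : x ∉ Ioi (0 : ℝ)) : φ x = 0 :=
  image_eq_zero_of_notMem_tsupport fun h' => hx (h.subset h')

lemma IsTest.continuous_smul {φ : ℝ → ℝ} (h : IsTest φ) {f : ℝ → ℂ}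
    (hf : ContinuousOn f (Ioi 0)) : Continuous fun x => φ x • f x :=
  ContinuousOn.continuous_of_tsupport_subset (h.smooth.continuous.continuousOn.smul hf) isOpen_Ioi
    ((tsupport_smul_subset_left φ f).trans h.subset)

lemma IsTest.integrable_smul_of_continuousOn {φ : ℝ → ℝ} (h : IsTest φ) {f : ℝ → ℂ}
    (hf : ContinuousOn f (Ioi 0)) : Integrable fun x => φ x • f x :=
  (h.continuous_smul hf).integrable_of_hasCompactSupport h.compact.smul_right

lemma IsTest.integrable_smul {φ : ℝ → ℝ} (h : IsTest φ) {f : ℝ → ℂ}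
    (hf : LocallyIntegrableOn f (Ioi 0)) : Integrable fun x => φ x • f x := by
  have h1 : IntegrableOn f (tsupport φ) := hf.integrableOn_compact_subset h.subset h.compact
  have h2 : IntegrableOn (fun x => φ x • f x) (tsupport φ) :=
    h1.continuousOn_smul h.smooth.continuous.continuousOn h.compact
  exact (integrableOn_iff_integrable_of_support_subset
    ((Function.support_smul_subset_left φ f).trans (subset_tsupport φ))).1 h2

/-- The product `φ F` is differentiable on all of `ℝ`, although `F` is so only on the half line,
because it vanishes near every point outside `tsupport φ`. Its derivative integrates to zero. -/
lemma IsTest.integral_deriv_smul {φ : ℝ → ℝ} (h : IsTest φ) {F r : ℝ → ℂ}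
    (hF : ∀ x, 0 < x → HasDerivAt F (r x) x) (hr : ContinuousOn r (Ioi 0)) :
    ∫ x, deriv φ x • F x = -∫ x, φ x • r x := by
  have hFc : ContinuousOn F (Ioi 0) := fun x hx => (hF x hx).continuousAt.continuousWithinAt
  have hd : ∀ x, HasDerivAt (fun x => φ x • F x) (φ x • r x + deriv φ x • F x) x := by
    intro x
    by_cases hx : 0 < x
    · exact (h.hasDerivAt x).smul (hF x hx)
    · have hx' : x ∉ tsupport φ := fun h' => hx (h.subset h')
      have h0 : φ =ᶠ[𝓝 x] 0 := notMem_tsupport_iff_eventuallyEq.1 hx'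
      rw [h.eq_zero hx, h.derivative.eq_zero hx, zero_smul, zero_smul, add_zero]
      refine (hasDerivAt_const x (0 : ℂ)).congr_of_eventuallyEq ?_
      filter_upwards [h0] with y hy
      simp [hy]
  have i1 := h.integrable_smul_of_continuousOn hr
  have i2 := h.derivative.integrable_smul_of_continuousOn hFc
  have h3 := integral_eq_zero_of_hasDerivAt_of_integrable hd (i1.add i2)
    (h.integrable_smul_of_continuousOn hFc)
  rw [integral_add i1 i2, add_comm] at h3
  exact eq_neg_of_add_eq_zero_left h3

lemma hasDerivAt_primitive {r : ℝ → ℂ} (hr : ContinuousOn r (Ioi 0)) {a x : ℝ} (ha : 0 < a)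
    (hx : 0 < x) : HasDerivAt (fun x => ∫ y in a..x, r y) (r x) x := by
  refine intervalIntegral.integral_hasDerivAt_right ?_
    (hr.stronglyMeasurableAtFilter isOpen_Ioi x hx) (hr.continuousAt (Ioi_mem_nhds hx))
  exact (hr.mono fun y hy => lt_of_lt_of_le (lt_min ha hx) hy.1).intervalIntegrable

/-- A test function with integral zero is the derivative of a test function. -/
lemma IsTest.exists_primitive {ψ : ℝ → ℝ} (h : IsTest ψ) (h0 : ∫ x, ψ x = 0) :
    ∃ φ, IsTest φ ∧ deriv φ = ψ := by
  have hc := h.smooth.continuous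
  have hK : ∃ a b, 0 < a ∧ tsupport ψ ⊆ Icc a b := by
    rcases (tsupport ψ).eq_empty_or_nonempty with he | hne
    · exact ⟨1, 1, one_pos, by simp [he]⟩
    · obtain ⟨a, ha, hae⟩ := h.compact.exists_isLeast hne
      obtain ⟨b, hb, hbe⟩ := h.compact.exists_isGreatest hne
      exact ⟨a, b, h.subset ha, fun x hx => ⟨hae hx, hbe hx⟩⟩
  obtain ⟨a, b, ha, hab⟩ := hK
  have hz : ∀ x, x ∉ Icc a b → ψ x = 0 := fun x hx =>
    image_eq_zero_of_notMem_tsupport fun h' => hx (hab h')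
  set φ : ℝ → ℝ := fun x => ∫ y in a..x, ψ y with hφ
  have hd : ∀ x, HasDerivAt φ (ψ x) x := fun x => hc.integral_hasStrictDerivAt a x |>.hasDerivAt
  have hder : deriv φ = ψ := funext fun x => (hd x).deriv
  -- To the left of `a` only zeros of `ψ` are integrated; to the right of `b` the value is the full
  -- integral of `ψ`, which is zero.
  have hz' : ∀ x, x ∉ Icc a b → φ x = 0 := by
    intro x hx
    rcases lt_or_ge x a with hxa | hxa
    · simp only [hφ]
      rw [intervalIntegral.integral_symm, intervalIntegral.integral_of_le hxa.le, neg_eq_zero,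
        integral_Ioc_eq_integral_Ioo]
      exact setIntegral_eq_zero_of_forall_eq_zero fun y hy => hz y fun h' => by
        linarith [h'.1, hy.2]
    · have hxb : b < x := by by_contra hcon; exact hx ⟨hxa, not_lt.1 hcon⟩
      simp only [hφ]
      rw [intervalIntegral.integral_of_le hxa, ← integral_Icc_eq_integral_Ioc, ← h0]
      exact setIntegral_eq_integral_of_forall_compl_eq_zero fun y hy => hz y fun h' =>
        hy ⟨h'.1, h'.2.trans hxb.le⟩
  have hts : tsupport φ ⊆ Icc a b :=
    closure_minimal (fun x hx => by by_contra hcon; exact hx (hz' x hcon)) isClosed_Icc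
  refine ⟨φ, ⟨?_, ?_, hts.trans fun x hx => ha.trans_le hx.1⟩, hder⟩
  · rw [contDiff_infty_iff_deriv, hder]
    exact ⟨fun x => (hd x).differentiableAt, h.smooth⟩
  · exact isCompact_Icc.of_isClosed_subset (isClosed_tsupport _) hts

lemma exists_isTest_integral_one : ∃ η, IsTest η ∧ ∫ x, η x = 1 := by
  let b : ContDiffBump (2 : ℝ) := ⟨1 / 2, 1, by norm_num, by norm_num⟩
  refine ⟨b.normed volume, ⟨b.contDiff_normed, b.hasCompactSupport_normed, ?_⟩, b.integral_normed⟩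
  rw [b.tsupport_normed_eq]
  intro x hx
  have : |x - 2| ≤ 1 := by simpa [b, Real.dist_eq] using hx
  have := (abs_le.1 this).1
  exact lt_of_lt_of_le (by norm_num : (0 : ℝ) < 1) (by linarith)

lemma IsTest.add_smul {φ ψ : ℝ → ℝ} (h : IsTest φ) (h' : IsTest ψ) (c : ℝ) :
    IsTest fun x => φ x - c * ψ x := by
  refine ⟨h.smooth.sub (contDiff_const.mul h'.smooth), h.compact.sub h'.compact.mul_left, ?_⟩
  refine (tsupport_sub φ (fun x => c * ψ x)).trans (union_subset h.subset ?_)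
  exact (tsupport_mul_subset_right (f := fun _ => c) (g := ψ)).trans h'.subset

/-- A locally integrable function whose distributional derivative vanishes is constant. -/
lemma ae_eq_const_of_forall_integral_deriv {g : ℝ → ℂ} (hg : LocallyIntegrableOn g (Ioi 0))
    (h : ∀ φ, IsTest φ → ∫ x, deriv φ x • g x = 0) : ∃ C : ℂ, g =ᵐ[halfLine] fun _ => C := by
  obtain ⟨η, hη, hη1⟩ := exists_isTest_integral_one
  refine ⟨∫ x, η x • g x, ?_⟩
  set C := ∫ x, η x • g x with hC
  rw [halfLine, EventuallyEq, ae_restrict_iff' measurableSet_Ioi]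
  have hgC : LocallyIntegrableOn (fun x => g x - C) (Ioi 0) :=
    hg.sub (continuousOn_const.locallyIntegrableOn measurableSet_Ioi)
  have := isOpen_Ioi.ae_eq_zero_of_integral_contDiff_smul_eq_zero hgC ?_
  · filter_upwards [this] with x hx hx0
    exact sub_eq_zero.1 (hx hx0)
  intro ψ h1 h2 h3
  have hψ : IsTest ψ := ⟨h1, h2, h3⟩
  have hcont : Continuous ψ := hψ.smooth.continuous
  have iψ : Integrable ψ := hcont.integrable_of_hasCompactSupport h2
  have iη : Integrable η := hη.smooth.continuous.integrable_of_hasCompactSupport hη.compact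
  set m := ∫ x, ψ x with hm
  -- Subtracting `m η`, with `η` of integral one, leaves a test function of mean zero, hence a
  -- derivative of a test function, against which `g` vanishes.
  obtain ⟨φ, hφ, hφd⟩ := (hψ.add_smul hη m).exists_primitive (by
    rw [integral_sub iψ (iη.const_mul m), integral_const_mul, hη1]; simp [hm])
  have h4 := h φ hφ
  rw [hφd] at h4
  simp only [sub_smul, mul_smul] at h4
  have i2 : Integrable fun x => m • η x • g x := (hη.integrable_smul hg).smul m
  rw [integral_sub (hψ.integrable_smul hg) i2, integral_smul, ← hC,
    sub_eq_zero] at h4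
  simp only [smul_sub]
  rw [integral_sub (hψ.integrable_smul hg) (iψ.smul_const C), h4, integral_smul_const, sub_self]

/-- A locally integrable function with continuous distributional derivative `r` is a primitive
of `r`. -/
lemma ae_eq_primitive_of_forall_integral_deriv {f r : ℝ → ℂ} (hf : LocallyIntegrableOn f (Ioi 0))
    (hr : ContinuousOn r (Ioi 0))
    (h : ∀ φ, IsTest φ → ∫ x, deriv φ x • f x = -∫ x, φ x • r x) :
    ∃ C : ℂ, f =ᵐ[halfLine] fun x => C + ∫ y in (1 : ℝ)..x, r y := by
  have hR : ∀ x : ℝ, 0 < x → HasDerivAt (fun x => ∫ y in (1 : ℝ)..x, r y) (r x) x := fun x hx =>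
    hasDerivAt_primitive hr one_pos hx
  have hRc : ContinuousOn (fun x => ∫ y in (1 : ℝ)..x, r y) (Ioi 0) := fun x hx =>
    (hR x hx).continuousAt.continuousWithinAt
  have hRl := hRc.locallyIntegrableOn (μ := volume) measurableSet_Ioi
  obtain ⟨C, hC⟩ := ae_eq_const_of_forall_integral_deriv (hf.sub hRl) (by
    intro φ hφ
    simp only [Pi.sub_apply, smul_sub]
    rw [integral_sub (hφ.derivative.integrable_smul hf) (hφ.derivative.integrable_smul hRl), h φ hφ,
      hφ.integral_deriv_smul hR hr, sub_self])
  refine ⟨C, ?_⟩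
  filter_upwards [hC] with x hx
  rw [← hx]; simp

end

end HalfLineWave

/-! ### The equation for time averages of a finite-energy solution. -/

namespace HalfLineWave

noncomputable section

/-- The bilinear pairing with a fixed `L²` function. -/
def pairCLM (φ : ℝ → ℂ) (hφ : MemLp φ 2 halfLine) : L2 →L[ℂ] ℂ := innerSL ℂ (hφ.star.toLp (star φ))

lemma pairCLM_apply (φ : ℝ → ℂ) (hφ : MemLp φ 2 halfLine) (F : L2) :
    pairCLM φ hφ F = ∫ x in Ioi (0 : ℝ), φ x * F x := by
  rw [pairCLM, innerSL_apply_apply, L2.inner_def]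
  refine integral_congr_ae ?_
  filter_upwards [hφ.star.coeFn_toLp] with x hx
  rw [hx]
  simp [mul_comm]

variable {q : ℝ → ℝ} {w wx wt : ℝ → ℝ → ℂ}

namespace IsFiniteEnergySolution

variable (hw : IsFiniteEnergySolution q w wx wt)
include hw

lemma isPrimitive : IsPrimitive hw.continuous_wx.curve w := fun t x hx => by
  rw [(hw.energyClass t).eq_integral x hx]
  exact (intervalIntegral_congr_ae_halfLine (hw.continuous_wx.coeFn_curve t) le_rfl hx).symm

lemma jointContinuous : JointContinuous w :=
  hw.isPrimitive.jointContinuous hw.continuous_wx.continuous_curve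

lemma aestronglyMeasurable (t : ℝ) : AEStronglyMeasurable (w t) halfLine :=
  (hw.jointContinuous.space t).aestronglyMeasurable measurableSet_Ioi

/-- A finite-energy solution need not be square integrable in space, but its increments in time are.
The existence of `w_t` in `L²` gives this for `s` near `t`, since the norm in `time_deriv` is
eventually below one; connectedness of `ℝ` chains the local statements together. -/
lemma memLp_sub (s t : ℝ) : MemLp (fun x => w s x - w t x) 2 halfLine := by
  have hneg : ∀ a b, MemLp (fun x => w a x - w b x) 2 halfLine →
      MemLp (fun x => w b x - w a x) 2 halfLine := fun a b hab => by
    convert hab.neg using 1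
    funext x; simp
  refine PreconnectedSpace.induction₂' (fun s t => MemLp (fun x => w s x - w t x) 2 halfLine)
    (fun t => ?_) ⟨fun a b c hab hbc => ?_⟩ s t
  · have h1 := (hw.time_deriv t).eventually (gt_mem_nhds (by norm_num : (0 : ℝ≥0∞) < 1))
    rw [eventually_nhdsWithin_iff] at h1
    filter_upwards [h1] with s hs
    rcases eq_or_ne s t with rfl | hst
    · simp
    have h2 := hs hst
    have hm : MemLp (fun x => ((s - t : ℝ) : ℂ)⁻¹ * (w s x - w t x) - wt t x) 2 halfLine :=
      ⟨((((hw.aestronglyMeasurable s).sub (hw.aestronglyMeasurable t)).const_mul _).sub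
        (hw.continuous_wt.1 t).1), h2.trans ENNReal.one_lt_top⟩
    have hne : ((s - t : ℝ) : ℂ) ≠ 0 := by exact_mod_cast sub_ne_zero.2 hst
    have h3 : MemLp (fun x => w s x - w t x) 2 halfLine := by
      convert (hm.add (hw.continuous_wt.1 t)).const_mul ((s - t : ℝ) : ℂ) using 1
      funext x
      simp only [Pi.add_apply, sub_add_cancel]
      rw [mul_inv_cancel_left₀ hne]
    exact ⟨hneg _ _ h3, h3⟩
  · convert hab.add hbc using 1
    funext x; simp

/-- The curve `w(t) - w(0)` in `L²`. -/
def incr (t : ℝ) : L2 := (hw.memLp_sub t 0).toLp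

lemma coeFn_incr (t : ℝ) : hw.incr t =ᵐ[halfLine] fun x => w t x - w 0 x := MemLp.coeFn_toLp _

lemma hasDerivAt_incr (t : ℝ) : HasDerivAt hw.incr (hw.continuous_wt.curve t) t := by
  rw [hasDerivAt_iff_tendsto_slope]
  have hm : ∀ s, MemLp (fun x => ((s - t : ℝ) : ℂ)⁻¹ * (w s x - w t x)) 2 halfLine := fun s =>
    (hw.memLp_sub s t).const_mul _
  have h1 := (Lp.tendsto_Lp_iff_tendsto_eLpNorm'' (fi := 𝓝[≠] t) _ hm _
    (hw.continuous_wt.1 t)).2 (hw.time_deriv t)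
  refine h1.congr fun s => ?_
  apply Lp.ext
  have h2 : slope hw.incr t s = (s - t)⁻¹ • (hw.incr s - hw.incr t) := by
    rw [slope_def_module]
  rw [h2]
  filter_upwards [(hm s).coeFn_toLp, Lp.coeFn_smul (s - t)⁻¹ (hw.incr s - hw.incr t),
    Lp.coeFn_sub (hw.incr s) (hw.incr t), hw.coeFn_incr s, hw.coeFn_incr t] with x a1 a2 a3 a4 a5
  rw [a1, a2, Pi.smul_apply, a3, Pi.sub_apply, a4, a5]
  simp

lemma continuous_incr : Continuous hw.incr :=
  continuous_iff_continuousAt.2 fun t => (hw.hasDerivAt_incr t).continuousAt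

end IsFiniteEnergySolution

/-- Mollification in time, pointwise in space. -/
def timeMoll (k : ℝ → ℝ) (f : ℝ → ℝ → ℂ) (t x : ℝ) : ℂ := moll k (fun s => f s x) t

lemma IsTest.ofReal {φ : ℝ → ℝ} (h : IsTest φ) : ContDiff ℝ ∞ (fun x => (φ x : ℂ)) ∧
    HasCompactSupport (fun x => (φ x : ℂ)) ∧ tsupport (fun x => (φ x : ℂ)) ⊆ Ioi 0 :=
  ⟨Complex.ofRealCLM.contDiff.comp h.smooth, h.compact.comp_left (g := Complex.ofReal) rfl,
    (closure_mono (Function.support_comp_subset (g := Complex.ofReal) rfl φ)).trans h.subset⟩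

lemma IsTest.memLp_mul {φ : ℝ → ℝ} (h : IsTest φ) {f : ℝ → ℂ} (hf : ContinuousOn f (Ioi 0)) :
    MemLp (fun x => φ x • f x) 2 halfLine :=
  ((h.continuous_smul hf).memLp_of_hasCompactSupport h.compact.smul_right).restrict _

lemma IsTest.memLp {φ : ℝ → ℝ} (h : IsTest φ) : MemLp (fun x => (φ x : ℂ)) 2 halfLine := by
  have := h.memLp_mul (f := fun _ => 1) continuousOn_const
  simpa using this

lemma IsTest.integral_eq {φ : ℝ → ℝ} (h : IsTest φ) (f : ℝ → ℂ) :
    ∫ x in Ioi (0 : ℝ), (φ x : ℂ) * f x = ∫ x, φ x • f x := by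
  simp_rw [Complex.real_smul]
  exact setIntegral_eq_integral_of_forall_compl_eq_zero fun x hx => by simp [h.eq_zero hx]

lemma sqrtMul_jointContinuous (hqc : ContinuousOn q (Ioi 0)) {f : ℝ → ℝ → ℂ}
    (hf : JointContinuous f) : JointContinuous fun t => sqrtMul q (f t) := by
  have h1 : ContinuousOn (fun p : ℝ × ℝ => (Real.sqrt (q p.2) : ℂ)) (univ ×ˢ Ioi 0) :=
    Complex.continuous_ofReal.comp_continuousOn
      (hqc.comp continuousOn_snd fun p hp => hp.2).sqrt
  exact h1.mul hf

namespace IsFiniteEnergySolution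

variable (hw : IsFiniteEnergySolution q w wx wt)
include hw

lemma isPrimitive_timeMoll {k : ℝ → ℝ} (hk : IsKernel k) :
    IsPrimitive (moll k hw.continuous_wx.curve) (timeMoll k w) :=
  hw.isPrimitive.mollify hk hw.continuous_wx.continuous_curve

lemma jointContinuous_timeMoll {k : ℝ → ℝ} (hk : IsKernel k) : JointContinuous (timeMoll k w) :=
  hw.jointContinuous.mollify hk

lemma hasDerivAt_timeMoll {k : ℝ → ℝ} (hk : IsKernel k) (t : ℝ) {x : ℝ} (hx : 0 ≤ x) :
    HasDerivAt (fun t => timeMoll k w t x) (timeMoll (deriv k) w t x) t :=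
  hasDerivAt_moll hk (hw.isPrimitive.continuous_time hw.continuous_wx.continuous_curve hx) t

/-- A derived kernel has integral zero, so it does not see the subtracted `w 0`. Thus `incr`, which
lives in `L2`, can stand in for `w`. -/
lemma moll_incr_ae_eq {k : ℝ → ℝ} (hk : IsKernel k) (t : ℝ) :
    (moll (deriv k) hw.incr t : L2) =ᵐ[halfLine] timeMoll (deriv k) w t := by
  have hc : JointContinuous fun t x => w t x - w 0 x := by
    refine ContinuousOn.sub hw.jointContinuous ?_
    exact (hw.jointContinuous.space 0).comp continuousOn_snd fun p hp => hp.2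
  have h1 := moll_ae_eq hk.derivative hw.continuous_incr hc hw.coeFn_incr t
  refine h1.trans ?_
  filter_upwards [self_mem_ae_restrict measurableSet_Ioi] with x hx
  have hcx := hw.jointContinuous.time hx
  simp only [timeMoll]
  have h2 : moll (deriv k) (fun s => w s x - w 0 x) t =
      moll (deriv k) (fun s => w s x) t - moll (deriv k) (fun _ => w 0 x) t := by
    simp only [moll, smul_sub]
    exact integral_sub (hk.derivative.integrable_smul hcx t)
      (hk.derivative.integrable_smul continuous_const t)
  rw [h2, moll_const_deriv hk (fun _ => w 0 x) (fun _ _ => rfl), sub_zero]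

lemma moll_wt_ae_eq {k : ℝ → ℝ} (hk : IsKernel k) (t : ℝ) :
    (moll k hw.continuous_wt.curve t : L2) =ᵐ[halfLine] timeMoll (deriv k) w t := by
  rw [← moll_deriv hk hw.hasDerivAt_incr hw.continuous_wt.continuous_curve]
  exact hw.moll_incr_ae_eq hk t

lemma moll_potential_ae_eq (hqc : ContinuousOn q (Ioi 0)) {k : ℝ → ℝ} (hk : IsKernel k) (t : ℝ) :
    (moll k hw.continuous_potential.curve t : L2) =ᵐ[halfLine] sqrtMul q (timeMoll k w t) := by
  refine (moll_ae_eq hk hw.continuous_potential.continuous_curve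
    (sqrtMul_jointContinuous hqc hw.jointContinuous) hw.continuous_potential.coeFn_curve t).trans ?_
  refine Eventually.of_forall fun x => ?_
  simp only [sqrtMul, timeMoll, moll]
  rw [← integral_const_mul]
  congr 1; funext s
  simp only [Complex.real_smul]; ring

/-- The source term `w_tt + q w` of the mollified solution. -/
lemma weak_timeMoll (hqc : ContinuousOn q (Ioi 0)) (hq0 : ∀ x, 0 < x → 0 ≤ q x) {k : ℝ → ℝ}
    (hk : IsKernel k) (t : ℝ) (φ : ℝ → ℝ) (hφ : IsTest φ) :
    ∫ x, deriv φ x • moll k hw.continuous_wx.curve t x =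
      -∫ x, φ x • (timeMoll (deriv (deriv k)) w t x + (q x : ℂ) * timeMoll k w t x) := by
  have hsq : ContinuousOn (fun x => (Real.sqrt (q x) : ℂ)) (Ioi 0) :=
    Complex.continuous_ofReal.comp_continuousOn hqc.sqrt
  have hφq := hφ.memLp_mul hsq
  set T1 := pairCLM _ hφ.memLp
  set T2 := pairCLM _ hφ.derivative.memLp
  -- One factor `√q` sits in the test function and the other in the curve `√q w`, so that `T3`
  -- produces the potential term of the weak equation.
  set T3 := pairCLM _ hφq
  set X := hw.continuous_wx.curve
  set Y := hw.continuous_potential.curve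
  set Z := hw.continuous_wt.curve
  have hXc := hw.continuous_wx.continuous_curve
  have hYc := hw.continuous_potential.continuous_curve
  have hZc := hw.continuous_wt.continuous_curve
  have d0 : ∀ t, HasDerivAt (fun s => T1 (hw.incr s)) (T1 (Z t)) t := fun t =>
    (T1.restrictScalars ℝ).hasFDerivAt.comp_hasDerivAt t (hw.hasDerivAt_incr t)
  have hsqrt : ∀ x, 0 < x → (Real.sqrt (q x) : ℂ) * (Real.sqrt (q x) : ℂ) = q x := fun x hx => by
    rw [← Complex.ofReal_mul, Real.mul_self_sqrt (hq0 x hx)]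
  have d1 : ∀ t, HasDerivAt (fun s => T1 (Z s)) (-(T2 (X t) + T3 (Y t))) t := by
    intro t
    obtain ⟨h1, h2, h3⟩ := hφ.ofReal
    have h4 := hw.weak_eq _ h1 h2 h3 t
    have e1 : (fun s => ∫ x in Ioi (0 : ℝ), wt s x * (φ x : ℂ)) = fun s => T1 (Z s) := by
      funext s
      rw [pairCLM_apply]
      refine integral_congr_ae ?_
      filter_upwards [hw.continuous_wt.coeFn_curve s] with x hx
      rw [hx, mul_comm]
    have e2 : ∀ x, deriv (fun x => (φ x : ℂ)) x = ((deriv φ x : ℝ) : ℂ) := fun x =>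
      (hφ.hasDerivAt x).ofReal_comp.deriv
    have e3 : ∫ x in Ioi (0 : ℝ), (wx t x * deriv (fun x => (φ x : ℂ)) x +
        (q x : ℂ) * w t x * (φ x : ℂ)) = T2 (X t) + T3 (Y t) := by
      rw [pairCLM_apply, pairCLM_apply, ← integral_add]
      · refine integral_congr_ae ?_
        filter_upwards [hw.continuous_wx.coeFn_curve t, hw.continuous_potential.coeFn_curve t,
          self_mem_ae_restrict measurableSet_Ioi] with x hx hy h0
        rw [hx, hy, e2, sqrtMul, Complex.real_smul, ← hsqrt x h0]
        ring
      · exact hφ.derivative.memLp.integrable_mul (Lp.memLp _)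
      · exact hφq.integrable_mul (Lp.memLp _)
    rw [e1, e3] at h4
    exact h4
  have hcont : Continuous fun t => -(T2 (X t) + T3 (Y t)) :=
    ((T2.continuous.comp hXc).add (T3.continuous.comp hYc)).neg
  -- Tested against `φ`, the increment is twice differentiable in time; both derivatives are moved
  -- onto the kernel, and the weak equation supplies the second one.
  have m1 : T1 (moll (deriv (deriv k)) hw.incr t) = -(T2 (moll k X t) + T3 (moll k Y t)) := by
    have a1 := ContinuousLinearMap.map_moll (T1.restrictScalars ℝ) hk.derivative.derivative
      hw.continuous_incr t
    have a2 := ContinuousLinearMap.map_moll (T2.restrictScalars ℝ) hk hXc t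
    have a3 := ContinuousLinearMap.map_moll (T3.restrictScalars ℝ) hk hYc t
    simp only [ContinuousLinearMap.coe_restrictScalars'] at a1 a2 a3
    rw [a1, moll_deriv hk.derivative d0 (T1.continuous.comp hZc),
      moll_deriv hk d1 hcont, a2, a3]
    simp only [moll]
    rw [← integral_add, ← integral_neg]
    · congr 1; funext s; simp only [smul_neg, smul_add, X, Y]
    · exact hk.integrable_smul (T2.continuous.comp hXc) t
    · exact hk.integrable_smul (T3.continuous.comp hYc) t
  rw [pairCLM_apply, pairCLM_apply, pairCLM_apply] at m1
  have i1 := hφ.integrable_smul_of_continuousOn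
    ((hw.jointContinuous_timeMoll hk.derivative.derivative).space t)
  have i2 : Integrable fun x => φ x • ((q x : ℂ) * timeMoll k w t x) :=
    hφ.integrable_smul_of_continuousOn
      ((Complex.continuous_ofReal.comp_continuousOn hqc).mul
      ((hw.jointContinuous_timeMoll hk).space t))
  have b1 : ∫ x in Ioi (0 : ℝ), (φ x : ℂ) * moll (deriv (deriv k)) hw.incr t x =
      ∫ x, φ x • timeMoll (deriv (deriv k)) w t x := by
    rw [← hφ.integral_eq]
    refine integral_congr_ae ?_
    filter_upwards [hw.moll_incr_ae_eq hk.derivative t] with x hx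
    rw [hx]
  have b2 : ∫ x in Ioi (0 : ℝ), φ x • (Real.sqrt (q x) : ℂ) * moll k Y t x =
      ∫ x, φ x • ((q x : ℂ) * timeMoll k w t x) := by
    rw [← hφ.integral_eq]
    refine integral_congr_ae ?_
    filter_upwards [hw.moll_potential_ae_eq hqc hk t, self_mem_ae_restrict measurableSet_Ioi]
      with x hx h0
    rw [hx, sqrtMul, Complex.real_smul, ← hsqrt x h0]
    ring
  rw [b1, b2, hφ.derivative.integral_eq] at m1
  simp only [smul_add]
  rw [integral_add i1 i2, m1]
  ring

/-- The mollified `w_x` has the continuous function `r = w_tt + q w` as its weak derivative, hence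
has a `C¹` representative `v`. The mollified `w` is a primitive of `v`, which makes it a classical
solution in space. -/
lemma exists_spatial (hqc : ContinuousOn q (Ioi 0)) (hq0 : ∀ x, 0 < x → 0 ≤ q x) {k : ℝ → ℝ}
    (hk : IsKernel k) (t : ℝ) : ∃ v : ℝ → ℂ,
      (∀ x, 0 < x → HasDerivAt (timeMoll k w t) (v x) x) ∧
      (∀ x, 0 < x → HasDerivAt v (timeMoll (deriv (deriv k)) w t x +
        (q x : ℂ) * timeMoll k w t x) x) ∧
      (moll k hw.continuous_wx.curve t : L2) =ᵐ[halfLine] v := by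
  set r : ℝ → ℂ := fun x => timeMoll (deriv (deriv k)) w t x + (q x : ℂ) * timeMoll k w t x
  have hr : ContinuousOn r (Ioi 0) :=
    ((hw.jointContinuous_timeMoll hk.derivative.derivative).space t).add
      ((Complex.continuous_ofReal.comp_continuousOn hqc).mul
      ((hw.jointContinuous_timeMoll hk).space t))
  have hl : LocallyIntegrableOn (moll k hw.continuous_wx.curve t : L2) (Ioi 0) := by
    have h1 : LocallyIntegrable (moll k hw.continuous_wx.curve t : L2) (volume.restrict (Ioi 0)) :=
      (Lp.memLp (moll k hw.continuous_wx.curve t)).locallyIntegrable (by norm_num)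
    exact locallyIntegrableOn_of_locallyIntegrable_restrict h1
  obtain ⟨C, hC⟩ := ae_eq_primitive_of_forall_integral_deriv hl hr
    (hw.weak_timeMoll hqc hq0 hk t)
  have hv : ∀ x : ℝ, 0 < x → HasDerivAt (fun x => C + ∫ y in (1 : ℝ)..x, r y) (r x) x :=
    fun x hx => (hasDerivAt_primitive hr one_pos hx).const_add C
  refine ⟨_, fun x hx => ?_, hv, hC⟩
  have hvc : ContinuousOn (fun x => C + ∫ y in (1 : ℝ)..x, r y) (Ioi 0) := fun x hx =>
    (hv x hx).continuousAt.continuousWithinAt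
  set a := x / 2
  have ha : 0 < a := by positivity
  have hax : a < x := by simp only [a]; linarith
  have h1 := (hasDerivAt_primitive hvc ha hx).const_add (timeMoll k w t a)
  refine h1.congr_of_eventuallyEq ?_
  filter_upwards [lt_mem_nhds hax] with y hy
  have h2 := (hw.isPrimitive_timeMoll hk).sub_eq t ha.le hy.le
  rw [intervalIntegral_congr_ae_halfLine hC ha.le hy.le] at h2
  rw [← h2]; ring

end IsFiniteEnergySolution

end

end HalfLineWave

/-! ### Mollified solutions are regular solutions. -/

namespace HalfLineWave

noncomputable section

/-- The derivative in the space variable. -/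
def spaceDeriv (f : ℝ → ℝ → ℂ) (t x : ℝ) : ℂ := deriv (f t) x

/-- Finite-energy solutions that are twice differentiable on the open half plane, whose time
derivative has finite energy and whose second time derivative is a continuous curve in `L²`. -/
structure IsRegularSolution (q : ℝ → ℝ) (u ux ut utt uxt : ℝ → ℝ → ℂ) : Prop where
  sol : IsFiniteEnergySolution q u ux ut
  hasDerivAt_t : ∀ t x, 0 < x → HasDerivAt (fun t => u t x) (ut t x) t
  hasDerivAt_tt : ∀ t x, 0 < x → HasDerivAt (fun t => ut t x) (utt t x) t
  hasDerivAt_x : ∀ t x, 0 < x → HasDerivAt (u t) (ux t x) x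
  hasDerivAt_xx : ∀ t x, 0 < x → HasDerivAt (ux t) (utt t x + (q x : ℂ) * u t x) x
  hasDerivAt_tx : ∀ t x, 0 < x → HasDerivAt (ut t) (uxt t x) x
  hasDerivAt_xt : ∀ t x, 0 < x → HasDerivAt (fun t => ux t x) (uxt t x) t
  cont_u : JointContinuous u
  cont_ux : JointContinuous ux
  cont_ut : JointContinuous ut
  cont_utt : JointContinuous utt
  cont_uxt : JointContinuous uxt
  energyClass_t : ∀ t, IsEnergyClass q (ut t) (uxt t)
  continuous_uxt : ContinuousInL2 uxt
  continuous_potential_t : ContinuousInL2 fun t => sqrtMul q (ut t)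
  continuous_utt : ContinuousInL2 utt
  bound : ∀ T, ∃ K, 0 ≤ K ∧ ∀ t, |t| ≤ T → ∀ x, 0 < x →
    ‖u t x‖ ≤ K * √x ∧ ‖ut t x‖ ≤ K * √x ∧ ‖utt t x‖ ≤ K * √x

lemma integral_deriv_mul_of_tsupport {φ : ℝ → ℂ} (h1 : ContDiff ℝ ∞ φ) (h2 : HasCompactSupport φ)
    (h3 : tsupport φ ⊆ Ioi 0) {F r : ℝ → ℂ} (hF : ∀ x, 0 < x → HasDerivAt F (r x) x)
    (hr : ContinuousOn r (Ioi 0)) : ∫ x, deriv φ x * F x = -∫ x, φ x * r x := by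
  have hFc : ContinuousOn F (Ioi 0) := fun x hx => (hF x hx).continuousAt.continuousWithinAt
  have hd1 : ContDiff ℝ ∞ (deriv φ) := ((contDiff_infty_iff_deriv (𝕜 := ℝ)).1 h1).2
  have hint : ∀ ψ f : ℝ → ℂ, Continuous ψ → HasCompactSupport ψ → tsupport ψ ⊆ Ioi 0 →
      ContinuousOn f (Ioi 0) → Integrable fun x => ψ x * f x := fun ψ f a b c d =>
    (ContinuousOn.continuous_of_tsupport_subset (a.continuousOn.mul d) isOpen_Ioi
      ((tsupport_mul_subset_left (f := ψ) (g := f)).trans c)).integrable_of_hasCompactSupport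
      b.mul_right
  have hd : ∀ x, HasDerivAt (fun x => φ x * F x) (deriv φ x * F x + φ x * r x) x := by
    intro x
    by_cases hx : 0 < x
    · exact (h1.differentiable (by simp) x).hasDerivAt.mul (hF x hx)
    · have hx' : x ∉ tsupport φ := fun h' => hx (h3 h')
      have h0 : φ =ᶠ[𝓝 x] 0 := notMem_tsupport_iff_eventuallyEq.1 hx'
      rw [h0.deriv_eq, h0.eq_of_nhds]
      have : deriv (0 : ℝ → ℂ) x = 0 := deriv_const x 0
      rw [this, Pi.zero_apply, zero_mul, zero_mul, add_zero]
      refine (hasDerivAt_const x (0 : ℂ)).congr_of_eventuallyEq ?_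
      filter_upwards [h0] with y hy
      simp [hy]
  have i1 := hint φ r h1.continuous h2 h3 hr
  have i2 := hint _ F hd1.continuous h2.deriv ((tsupport_deriv_subset ..).trans h3) hFc
  have h4 := integral_eq_zero_of_hasDerivAt_of_integrable hd (i2.add i1)
    (hint φ F h1.continuous h2 h3 hFc)
  rw [integral_add i2 i1] at h4
  exact eq_neg_of_add_eq_zero_left h4

lemma tendsto_of_hasDerivAt_L2 {G : ℝ → L2} {H : L2} {u : ℝ → ℝ → ℂ} {v : ℝ → ℂ} {t : ℝ}
    (hG : HasDerivAt G H t) (h1 : ∀ s, (G s - G t : L2) =ᵐ[halfLine] fun x => u s x - u t x)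
    (h2 : H =ᵐ[halfLine] v) :
    Tendsto (fun s => eLpNorm (fun x => ((s - t : ℝ) : ℂ)⁻¹ * (u s x - u t x) - v x) 2 halfLine)
    (𝓝[≠] t) (𝓝 0) := by
  rw [hasDerivAt_iff_tendsto_slope] at hG
  have h3 := (Lp.tendsto_Lp_iff_tendsto_eLpNorm' _ _).1 hG
  refine h3.congr fun s => eLpNorm_congr_ae ?_
  have e : slope G t s = (s - t)⁻¹ • (G s - G t) := by rw [slope_def_module]
  rw [e]
  filter_upwards [h1 s, h2, Lp.coeFn_smul (s - t)⁻¹ (G s - G t)] with x a1 a2 a3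
  rw [Pi.sub_apply, a3, Pi.smul_apply, a1, a2]
  simp

variable {q : ℝ → ℝ} {w wx wt : ℝ → ℝ → ℂ}

namespace IsFiniteEnergySolution

section Regularity

variable (hw : IsFiniteEnergySolution q w wx wt) (hqc : ContinuousOn q (Ioi 0))
  (hq0 : ∀ x, 0 < x → 0 ≤ q x) {k : ℝ → ℝ} (hk : IsKernel k)
include hw hqc hq0 hk

lemma hasDerivAt_timeMoll_space (t : ℝ) {x : ℝ} (hx : 0 < x) :
    HasDerivAt (timeMoll k w t) (spaceDeriv (timeMoll k w) t x) x := by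
  obtain ⟨v, h1, -, -⟩ := hw.exists_spatial hqc hq0 hk t
  have := h1 x hx
  rwa [spaceDeriv, this.deriv]

lemma hasDerivAt_spaceDeriv (t : ℝ) {x : ℝ} (hx : 0 < x) :
    HasDerivAt (spaceDeriv (timeMoll k w) t)
      (timeMoll (deriv (deriv k)) w t x + (q x : ℂ) * timeMoll k w t x) x := by
  obtain ⟨v, h1, h2, -⟩ := hw.exists_spatial hqc hq0 hk t
  refine (h2 x hx).congr_of_eventuallyEq ?_
  filter_upwards [Ioi_mem_nhds hx] with y hy
  exact (h1 y hy).deriv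

lemma moll_wx_ae_eq (t : ℝ) :
    (moll k hw.continuous_wx.curve t : L2) =ᵐ[halfLine] spaceDeriv (timeMoll k w) t := by
  obtain ⟨v, h1, -, h3⟩ := hw.exists_spatial hqc hq0 hk t
  filter_upwards [h3, self_mem_ae_restrict measurableSet_Ioi] with x hx h0
  rw [hx]
  exact (h1 x h0).deriv.symm

omit hq0 in
lemma jointContinuous_source :
    JointContinuous fun t x => timeMoll (deriv (deriv k)) w t x + (q x : ℂ) * timeMoll k w t x := by
  refine ContinuousOn.add (hw.jointContinuous_timeMoll hk.derivative.derivative)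
    (ContinuousOn.mul ?_ (hw.jointContinuous_timeMoll hk))
  exact Complex.continuous_ofReal.comp_continuousOn (hqc.comp continuousOn_snd fun p hp => hp.2)

/-- Taylor's formula on `[a, a + 1]` with integral remainder. It expresses the space derivative
through `u` and `u_xx`, which are already known to be jointly continuous and smooth in time, so
these properties pass to `u_x`. -/
lemma spaceDeriv_eq (t : ℝ) {a : ℝ} (ha : 0 < a) :
    spaceDeriv (timeMoll k w) t a = timeMoll k w t (a + 1) - timeMoll k w t a -
      ∫ z in (0 : ℝ)..1, (1 - z) • (timeMoll (deriv (deriv k)) w t (a + z) +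
        (q (a + z) : ℂ) * timeMoll k w t (a + z)) := by
  have hpos : ∀ z ∈ uIcc (0 : ℝ) 1, 0 < a + z := fun z hz => by
    rw [uIcc_of_le zero_le_one] at hz; linarith [hz.1]
  have hd : ∀ z ∈ uIcc (0 : ℝ) 1, HasDerivAt (fun z => (1 - z) • spaceDeriv (timeMoll k w) t (a + z)
      + timeMoll k w t (a + z)) ((1 - z) • (timeMoll (deriv (deriv k)) w t (a + z) +
        (q (a + z) : ℂ) * timeMoll k w t (a + z))) z := by
    intro z hz
    have d1 : HasDerivAt (fun z : ℝ => 1 - z) (-1) z := by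
      simpa using (hasDerivAt_id z).const_sub 1
    have d2 := (hw.hasDerivAt_spaceDeriv hqc hq0 hk t (hpos z hz)).comp_const_add a z
    have d3 := (hw.hasDerivAt_timeMoll_space hqc hq0 hk t (hpos z hz)).comp_const_add a z
    refine ((d1.smul d2).add d3).congr_deriv ?_
    simp
  have hc : ContinuousOn (fun z => (1 - z) • (timeMoll (deriv (deriv k)) w t (a + z) +
        (q (a + z) : ℂ) * timeMoll k w t (a + z))) (uIcc 0 1) :=
    (by fun_prop : ContinuousOn (fun z : ℝ => 1 - z) (uIcc 0 1)).smul
      (((hw.jointContinuous_source hqc hk).space t).comp (by fun_prop) hpos)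
  rw [intervalIntegral.integral_eq_sub_of_hasDerivAt hd hc.intervalIntegrable]
  simp

lemma jointContinuous_spaceDeriv : JointContinuous (spaceDeriv (timeMoll k w)) := by
  refine jointContinuous_of_max fun a ha => ?_
  have hm : ∀ x, 0 < max x a := fun x => lt_max_of_lt_right ha
  have h1 := hw.jointContinuous_timeMoll hk
  have h2 := (hw.jointContinuous_source hqc hk).max_const ha
  simp_rw [fun p : ℝ × ℝ => hw.spaceDeriv_eq hqc hq0 hk p.1 (hm p.2)]
  refine Continuous.sub (Continuous.sub ?_ (h1.max_const ha)) ?_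
  · exact ContinuousOn.comp_continuous (f := fun p : ℝ × ℝ => (p.1, max p.2 a + 1)) h1
      (by fun_prop) fun p => ⟨trivial, by simp only [mem_Ioi]; linarith [hm p.2]⟩
  -- A second clamp at `a` changes nothing for `z ≥ 0` and makes the integrand continuous for all
  -- real `z`.
  · have h3 : ∀ p : ℝ × ℝ, ∫ z in (0 : ℝ)..1, (1 - z) •
        (timeMoll (deriv (deriv k)) w p.1 (max p.2 a + z) +
        (q (max p.2 a + z) : ℂ) * timeMoll k w p.1 (max p.2 a + z)) =
        ∫ z in (0 : ℝ)..1, (1 - z) • (timeMoll (deriv (deriv k)) w p.1 (max (max p.2 a + z) a) +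
        (q (max (max p.2 a + z) a) : ℂ) * timeMoll k w p.1 (max (max p.2 a + z) a)) := by
      intro p
      refine intervalIntegral.integral_congr fun z hz => ?_
      rw [uIcc_of_le zero_le_one] at hz
      have : max (max p.2 a + z) a = max p.2 a + z :=
        max_eq_left (by linarith [le_max_right p.2 a, hz.1])
      simp only [this]
    simp_rw [h3]
    refine intervalIntegral.continuous_parametric_intervalIntegral_of_continuous' ?_ 0 1
    have h4 : Continuous fun y : (ℝ × ℝ) × ℝ => (y.1.1, max y.1.2 a + y.2) := by fun_prop
    have h5 : Continuous fun y : (ℝ × ℝ) × ℝ => (1 - y.2 : ℝ) := by fun_prop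
    exact h5.smul (h2.comp h4)

/-- Integrating the Taylor formula for the kernel `deriv k` over a time interval and exchanging
integrals reproduces the difference of the Taylor formulas for `k` at the end times. So `u_x` is a
primitive in time of the continuous mixed derivative. -/
lemma hasDerivAt_spaceDeriv_time (t : ℝ) {a : ℝ} (ha : 0 < a) :
    HasDerivAt (fun t => spaceDeriv (timeMoll k w) t a)
      (spaceDeriv (timeMoll (deriv k) w) t a) t := by
  have hk' := hk.derivative
  have hVc := (hw.jointContinuous_spaceDeriv hqc hq0 hk').time ha
  have key : ∀ t, spaceDeriv (timeMoll k w) t a = spaceDeriv (timeMoll k w) 0 a +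
      ∫ s in (0 : ℝ)..t, spaceDeriv (timeMoll (deriv k) w) s a := by
    intro t
    have ftc : ∀ (m : ℝ → ℝ), IsKernel m → ∀ x, 0 < x →
        ∫ s in (0 : ℝ)..t, timeMoll (deriv m) w s x = timeMoll m w t x - timeMoll m w 0 x :=
      fun m hm x hx => intervalIntegral.integral_eq_sub_of_hasDerivAt
        (fun s _ => hw.hasDerivAt_timeMoll hm s hx.le)
        (((hw.jointContinuous_timeMoll hm.derivative).time hx).intervalIntegrable _ _)
    have hU : ∀ (m : ℝ → ℝ), IsKernel m → ∀ x, 0 < x →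
        IntervalIntegrable (fun s => timeMoll m w s x) volume 0 t := fun m hm x hx =>
      ((hw.jointContinuous_timeMoll hm).time hx).intervalIntegrable _ _
    have hpos : ∀ z ∈ uIcc (0 : ℝ) 1, 0 < a + z := fun z hz => by
      rw [uIcc_of_le zero_le_one] at hz; linarith [hz.1]
    have hjc : ContinuousOn (Function.uncurry fun s z : ℝ =>
        (1 - z) • (timeMoll (deriv (deriv (deriv k))) w s (a + z) +
        (q (a + z) : ℂ) * timeMoll (deriv k) w s (a + z))) (uIcc 0 t ×ˢ uIcc 0 1) := by
      refine ContinuousOn.smul (f := fun p : ℝ × ℝ => 1 - p.2) (by fun_prop) ?_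
      exact ContinuousOn.comp (f := fun p : ℝ × ℝ => (p.1, a + p.2))
        (hw.jointContinuous_source hqc hk') (by fun_prop) fun p hp => ⟨trivial, hpos _ hp.2⟩
    have swap := intervalIntegral_swap_of_continuousOn hjc
    have hII : IntervalIntegrable (fun s => ∫ z in (0 : ℝ)..1, (1 - z) •
        (timeMoll (deriv (deriv (deriv k))) w s (a + z) +
        (q (a + z) : ℂ) * timeMoll (deriv k) w s (a + z))) volume 0 t := by
      have e : ∀ s, ∫ z in (0 : ℝ)..1, (1 - z) •
        (timeMoll (deriv (deriv (deriv k))) w s (a + z) +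
        (q (a + z) : ℂ) * timeMoll (deriv k) w s (a + z)) = timeMoll (deriv k) w s (a + 1) -
          timeMoll (deriv k) w s a - spaceDeriv (timeMoll (deriv k) w) s a := fun s => by
        rw [hw.spaceDeriv_eq hqc hq0 hk' s ha]; ring
      simp_rw [e]
      exact ((hU _ hk' _ (by linarith)).sub (hU _ hk' _ ha)).sub (hVc.intervalIntegrable _ _)
    simp_rw [fun s => hw.spaceDeriv_eq hqc hq0 hk' s ha]
    rw [intervalIntegral.integral_sub ((hU _ hk' _ (by linarith)).sub (hU _ hk' _ ha)) hII,
      intervalIntegral.integral_sub (hU _ hk' _ (by linarith)) (hU _ hk' _ ha), swap,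
      ftc k hk _ (by linarith), ftc k hk _ ha, hw.spaceDeriv_eq hqc hq0 hk t ha,
      hw.spaceDeriv_eq hqc hq0 hk 0 ha]
    have e2 : ∫ z in (0 : ℝ)..1, ∫ s in (0 : ℝ)..t, (1 - z) •
        (timeMoll (deriv (deriv (deriv k))) w s (a + z) +
        (q (a + z) : ℂ) * timeMoll (deriv k) w s (a + z)) =
        (∫ z in (0 : ℝ)..1, (1 - z) • (timeMoll (deriv (deriv k)) w t (a + z) +
          (q (a + z) : ℂ) * timeMoll k w t (a + z))) -
        ∫ z in (0 : ℝ)..1, (1 - z) • (timeMoll (deriv (deriv k)) w 0 (a + z) +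
          (q (a + z) : ℂ) * timeMoll k w 0 (a + z)) := by
      have hc : ∀ t, IntervalIntegrable (fun z => (1 - z) •
          (timeMoll (deriv (deriv k)) w t (a + z) +
          (q (a + z) : ℂ) * timeMoll k w t (a + z))) volume 0 1 := fun t =>
        ((by fun_prop : ContinuousOn (fun z : ℝ => 1 - z) (uIcc 0 1)).smul
          (((hw.jointContinuous_source hqc hk).space t).comp (by fun_prop)
            hpos)).intervalIntegrable
      rw [← intervalIntegral.integral_sub (hc t) (hc 0)]
      refine intervalIntegral.integral_congr fun z hz => ?_
      have hz' := hpos z hz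
      rw [intervalIntegral.integral_smul,
        intervalIntegral.integral_add (hU _ hk'.derivative.derivative _ hz')
          ((hU _ hk' _ hz').const_mul _), intervalIntegral.integral_const_mul,
        ftc _ hk.derivative.derivative _ hz', ftc _ hk _ hz', ← smul_sub]
      congr 1
      ring
    rw [e2]
    ring
  rw [show (fun t => spaceDeriv (timeMoll k w) t a) = fun t => spaceDeriv (timeMoll k w) 0 a +
      ∫ s in (0 : ℝ)..t, spaceDeriv (timeMoll (deriv k) w) s a from funext key]
  exact ((hVc.integral_hasStrictDerivAt 0 t).hasDerivAt).const_add _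

lemma continuousInL2_spaceDeriv : ContinuousInL2 (spaceDeriv (timeMoll k w)) :=
  continuousInL2_of_ae_eq (continuous_moll hk hw.continuous_wx.continuous_curve)
    (hw.moll_wx_ae_eq hqc hq0 hk)

omit hq0 in
lemma continuousInL2_sqrtMul_timeMoll : ContinuousInL2 fun t => sqrtMul q (timeMoll k w t) :=
  continuousInL2_of_ae_eq (continuous_moll hk hw.continuous_potential.continuous_curve)
    (hw.moll_potential_ae_eq hqc hk)

omit hqc hq0 in
lemma continuousInL2_timeMoll_deriv : ContinuousInL2 (timeMoll (deriv k) w) :=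
  continuousInL2_of_ae_eq (continuous_moll hk hw.continuous_wt.continuous_curve)
    (hw.moll_wt_ae_eq hk)

lemma energyClass_timeMoll (t : ℝ) :
    IsEnergyClass q (timeMoll k w t) (spaceDeriv (timeMoll k w) t) where
  memLp_deriv := (hw.continuousInL2_spaceDeriv hqc hq0 hk).1 t
  eq_integral x hx := by
    rw [hw.isPrimitive_timeMoll hk t x hx]
    exact intervalIntegral_congr_ae_halfLine (hw.moll_wx_ae_eq hqc hq0 hk t) le_rfl hx
  memLp_potential := (hw.continuousInL2_sqrtMul_timeMoll hqc hk).1 t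

omit hqc hq0 in
lemma bound_timeMoll (T : ℝ) : ∃ K, 0 ≤ K ∧ ∀ t, |t| ≤ T → ∀ x, 0 < x →
    ‖timeMoll k w t x‖ ≤ K * √x := by
  have hc := (continuous_moll hk hw.continuous_wx.continuous_curve).norm
  obtain ⟨K, hK⟩ := (isCompact_Icc (a := -T) (b := T)).bddAbove_image hc.continuousOn
  refine ⟨max K 0, le_max_right _ _, fun t ht x hx => ?_⟩
  have h1 := (hw.isPrimitive_timeMoll hk).norm_le t hx.le
  have h2 : ‖moll k hw.continuous_wx.curve t‖ ≤ max K 0 :=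
    (hK (mem_image_of_mem _ (abs_le.1 ht))).trans (le_max_left _ _)
  calc _ ≤ _ := h1
    _ ≤ √x * max K 0 := by gcongr
    _ = _ := mul_comm _ _

lemma isFiniteEnergySolution_timeMoll :
    IsFiniteEnergySolution q (timeMoll k w) (spaceDeriv (timeMoll k w))
      (timeMoll (deriv k) w) where
  energyClass := hw.energyClass_timeMoll hqc hq0 hk
  continuous_wx := hw.continuousInL2_spaceDeriv hqc hq0 hk
  continuous_potential := hw.continuousInL2_sqrtMul_timeMoll hqc hk
  continuous_wt := hw.continuousInL2_timeMoll_deriv hk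
  time_deriv t := by
    refine tendsto_of_hasDerivAt_L2 (hasDerivAt_moll hk hw.continuous_incr t) (fun s => ?_)
      (hw.moll_incr_ae_eq hk t)
    have hc : JointContinuous fun t x => w t x - w 0 x :=
      ContinuousOn.sub hw.jointContinuous
        ((hw.jointContinuous.space 0).comp continuousOn_snd fun p hp => hp.2)
    filter_upwards [moll_ae_eq hk hw.continuous_incr hc hw.coeFn_incr s,
      moll_ae_eq hk hw.continuous_incr hc hw.coeFn_incr t,
      Lp.coeFn_sub (moll k hw.incr s) (moll k hw.incr t),
      self_mem_ae_restrict measurableSet_Ioi] with x h1 h2 h3 h0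
    have hcx := hw.jointContinuous.time h0
    have h4 : ∀ t, moll k (fun s => w s x - w 0 x) t =
        moll k (fun s => w s x) t - moll k (fun _ => w 0 x) t := fun t => by
      simp only [moll, smul_sub]
      exact integral_sub (hk.integrable_smul hcx t) (hk.integrable_smul continuous_const t)
    rw [h3, Pi.sub_apply, h1, h2, h4, h4]
    simp only [timeMoll]
    have h5 : moll k (fun _ : ℝ => (w 0 x : ℂ)) s = moll k (fun _ : ℝ => (w 0 x : ℂ)) t := by
      simp only [moll]
    rw [h5]; ring
  weak_eq φ h1 h2 h3 t := by
    have hφ : MemLp φ 2 halfLine :=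
      (h1.continuous.memLp_of_hasCompactSupport h2).restrict _
    have hz : ∀ x, x ∉ Ioi (0 : ℝ) → φ x = 0 := fun x hx =>
      image_eq_zero_of_notMem_tsupport fun h' => hx (h3 h')
    have hz' : ∀ x, x ∉ Ioi (0 : ℝ) → deriv φ x = 0 := fun x hx =>
      image_eq_zero_of_notMem_tsupport fun h' => hx (h3 (tsupport_deriv_subset (𝕜 := ℝ) h'))
    have e1 : (fun s => ∫ x in Ioi (0 : ℝ), timeMoll (deriv k) w s x * φ x) =
        fun s => pairCLM φ hφ (moll k hw.continuous_wt.curve s) := by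
      funext s
      rw [pairCLM_apply]
      refine integral_congr_ae ?_
      filter_upwards [hw.moll_wt_ae_eq hk s] with x hx
      rw [hx, mul_comm]
    rw [e1]
    have h4 : HasDerivAt (fun s => pairCLM φ hφ (moll k hw.continuous_wt.curve s))
        (pairCLM φ hφ (moll (deriv k) hw.continuous_wt.curve t)) t :=
      ((pairCLM φ hφ).restrictScalars ℝ).hasFDerivAt.comp_hasDerivAt t
        (hasDerivAt_moll hk hw.continuous_wt.continuous_curve t)
    refine h4.congr_deriv ?_
    have hVd := fun x hx => hw.hasDerivAt_spaceDeriv hqc hq0 hk t (x := x) hx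
    have hVc : ContinuousOn (spaceDeriv (timeMoll k w) t) (Ioi 0) := fun x hx =>
      (hVd x hx).continuousAt.continuousWithinAt
    have ibp := integral_deriv_mul_of_tsupport h1 h2 h3 hVd
      ((hw.jointContinuous_source hqc hk).space t)
    have hc1 : ContDiff ℝ ∞ (deriv φ) := ((contDiff_infty_iff_deriv (𝕜 := ℝ)).1 h1).2
    have hint : ∀ ψ f : ℝ → ℂ, Continuous ψ → HasCompactSupport ψ → tsupport ψ ⊆ Ioi 0 →
        ContinuousOn f (Ioi 0) → Integrable fun x => ψ x * f x := fun ψ f a b c d =>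
      (ContinuousOn.continuous_of_tsupport_subset (a.continuousOn.mul d) isOpen_Ioi
        ((tsupport_mul_subset_left (f := ψ) (g := f)).trans c)).integrable_of_hasCompactSupport
        b.mul_right
    have hqU : ContinuousOn (fun x => (q x : ℂ) * timeMoll k w t x) (Ioi 0) :=
      (Complex.continuous_ofReal.comp_continuousOn hqc).mul
        ((hw.jointContinuous_timeMoll hk).space t)
    have i1 := hint _ _ hc1.continuous h2.deriv ((tsupport_deriv_subset ..).trans h3) hVc
    have i2 := hint _ _ h1.continuous h2 h3 hqU
    have i3 := hint _ _ h1.continuous h2 h3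
      ((hw.jointContinuous_timeMoll hk.derivative.derivative).space t)
    rw [pairCLM_apply]
    have e2 : ∫ x in Ioi (0 : ℝ), φ x * moll (deriv k) hw.continuous_wt.curve t x =
        ∫ x, φ x * timeMoll (deriv (deriv k)) w t x := by
      have e0 : ∫ x in Ioi (0 : ℝ), φ x * timeMoll (deriv (deriv k)) w t x =
          ∫ x, φ x * timeMoll (deriv (deriv k)) w t x :=
        setIntegral_eq_integral_of_forall_compl_eq_zero fun x hx => by rw [hz x hx, zero_mul]
      rw [← e0]
      refine integral_congr_ae ?_
      filter_upwards [hw.moll_wt_ae_eq hk.derivative t] with x hx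
      rw [hx]
    have e3 : ∫ x in Ioi (0 : ℝ), (spaceDeriv (timeMoll k w) t x * deriv φ x +
        (q x : ℂ) * timeMoll k w t x * φ x) = (∫ x, deriv φ x * spaceDeriv (timeMoll k w) t x) +
        ∫ x, φ x * ((q x : ℂ) * timeMoll k w t x) := by
      rw [setIntegral_eq_integral_of_forall_compl_eq_zero fun x hx => by
        rw [hz x hx, hz' x hx, mul_zero, mul_zero, add_zero], ← integral_add i1 i2]
      congr 1; funext x; ring
    rw [e2, e3, ibp]
    simp only [mul_add]
    rw [integral_add i3 i2]
    ring

/-- Since differentiation in time only replaces the kernel by its derivative, each statement about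
`u_t` is the one about `u` for the kernel `deriv k`. -/
theorem isRegularSolution_timeMoll :
    IsRegularSolution q (timeMoll k w) (spaceDeriv (timeMoll k w)) (timeMoll (deriv k) w)
      (timeMoll (deriv (deriv k)) w) (spaceDeriv (timeMoll (deriv k) w)) where
  sol := hw.isFiniteEnergySolution_timeMoll hqc hq0 hk
  hasDerivAt_t t x hx := hw.hasDerivAt_timeMoll hk t hx.le
  hasDerivAt_tt t x hx := hw.hasDerivAt_timeMoll hk.derivative t hx.le
  hasDerivAt_x t x hx := hw.hasDerivAt_timeMoll_space hqc hq0 hk t hx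
  hasDerivAt_xx t x hx := hw.hasDerivAt_spaceDeriv hqc hq0 hk t hx
  hasDerivAt_tx t x hx := hw.hasDerivAt_timeMoll_space hqc hq0 hk.derivative t hx
  hasDerivAt_xt t x hx := hw.hasDerivAt_spaceDeriv_time hqc hq0 hk t hx
  cont_u := hw.jointContinuous_timeMoll hk
  cont_ux := hw.jointContinuous_spaceDeriv hqc hq0 hk
  cont_ut := hw.jointContinuous_timeMoll hk.derivative
  cont_utt := hw.jointContinuous_timeMoll hk.derivative.derivative
  cont_uxt := hw.jointContinuous_spaceDeriv hqc hq0 hk.derivative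
  energyClass_t := hw.energyClass_timeMoll hqc hq0 hk.derivative
  continuous_uxt := hw.continuousInL2_spaceDeriv hqc hq0 hk.derivative
  continuous_potential_t := hw.continuousInL2_sqrtMul_timeMoll hqc hk.derivative
  continuous_utt := hw.continuousInL2_timeMoll_deriv hk.derivative
  bound T := by
    obtain ⟨K1, h1, h1'⟩ := hw.bound_timeMoll hk T
    obtain ⟨K2, h2, h2'⟩ := hw.bound_timeMoll hk.derivative T
    obtain ⟨K3, h3, h3'⟩ := hw.bound_timeMoll hk.derivative.derivative T
    refine ⟨K1 + K2 + K3, by positivity, fun t ht x hx => ⟨(h1' t ht x hx).trans ?_,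
      (h2' t ht x hx).trans ?_, (h3' t ht x hx).trans ?_⟩⟩ <;>
    · gcongr
      linarith

end Regularity

end IsFiniteEnergySolution

end

end HalfLineWave

/-! ### The potential, a maximum principle, and power bounds near zero. -/

namespace HalfLineWave

noncomputable section

/-- The standing assumptions on the potential. -/
structure IsAdmissible (lam : ℝ) (q₀ q : ℝ → ℝ) : Prop where
  hlam : lam = 0 ∨ 3 / 4 ≤ lam
  rep : IsRepulsive q₀
  growth : GrowthAtZero q₀
  eq : q = potential lam q₀

namespace IsAdmissible

variable {lam : ℝ} {q₀ q : ℝ → ℝ} (hA : IsAdmissible lam q₀ q)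
include hA

lemma lam_nonneg : 0 ≤ lam := by rcases hA.hlam with h | h <;> linarith

lemma apply (x : ℝ) : q x = lam / x ^ 2 + q₀ x := by rw [hA.eq]; rfl

lemma pos {x : ℝ} (hx : 0 < x) : 0 < q x := by
  rw [hA.apply]
  have := hA.rep.pos x hx
  have := hA.lam_nonneg
  positivity

lemma hasDerivAt_base {x : ℝ} (hx : 0 < x) : HasDerivAt q₀ (deriv q₀ x) x :=
  ((hA.rep.contDiffOn.differentiableOn (by norm_num)).differentiableAt
    (Ioi_mem_nhds hx)).hasDerivAt

lemma hasDerivAt' {x : ℝ} (hx : 0 < x) : HasDerivAt q (-2 * lam / x ^ 3 + deriv q₀ x) x := by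
  have h1 : HasDerivAt (fun x : ℝ => lam / x ^ 2) (-2 * lam / x ^ 3) x := by
    have := (hasDerivAt_const x lam).div (hasDerivAt_pow 2 x) (by positivity)
    refine this.congr_deriv ?_
    field_simp
    simp
    ring
  rw [hA.eq]
  exact h1.add (hA.hasDerivAt_base hx)

lemma deriv_eq {x : ℝ} (hx : 0 < x) : deriv q x = -2 * lam / x ^ 3 + deriv q₀ x :=
  (hA.hasDerivAt' hx).deriv

lemma hasDerivAt {x : ℝ} (hx : 0 < x) : HasDerivAt q (deriv q x) x := by
  rw [hA.deriv_eq hx]; exact hA.hasDerivAt' hx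

lemma deriv_neg {x : ℝ} (hx : 0 < x) : deriv q x < 0 := by
  rw [hA.deriv_eq hx]
  have h1 := hA.rep.deriv_neg x hx
  have h2 : 0 ≤ 2 * lam / x ^ 3 := by have := hA.lam_nonneg; positivity
  have : -2 * lam / x ^ 3 = -(2 * lam / x ^ 3) := by ring
  linarith

/-- The Morawetz weight `-q'/2` dominates the inverse-square part of `q` divided by `x`; this is how
that part of the potential energy is controlled near zero. -/
lemma lam_div_le {x : ℝ} (hx : 0 < x) : lam / x ^ 3 ≤ -(deriv q x) / 2 := by
  rw [hA.deriv_eq hx]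
  have h1 := hA.rep.deriv_neg x hx
  have : -(-2 * lam / x ^ 3 + deriv q₀ x) / 2 = lam / x ^ 3 + -deriv q₀ x / 2 := by ring
  linarith

lemma continuousOn : ContinuousOn q (Ioi 0) := fun _ hx =>
  (hA.hasDerivAt hx).continuousAt.continuousWithinAt

lemma continuousOn_deriv : ContinuousOn (deriv q) (Ioi 0) := by
  have h0 : ContinuousOn (deriv q₀) (Ioi 0) :=
    hA.rep.contDiffOn.continuousOn_deriv_of_isOpen isOpen_Ioi le_rfl
  have h1 : ContinuousOn (fun x : ℝ => -2 * lam / x ^ 3 + deriv q₀ x) (Ioi 0) := by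
    refine ContinuousOn.add (ContinuousOn.div (by fun_prop) (by fun_prop) fun x hx => ?_) h0
    have : (0 : ℝ) < x := hx
    positivity
  exact h1.congr fun x hx => hA.deriv_eq hx

lemma nonneg : ∀ x, 0 < x → 0 ≤ q x := fun _ hx => (hA.pos hx).le

lemma tendsto_zero : Tendsto q atTop (𝓝 0) := by
  have h1 : Tendsto (fun x : ℝ => lam / x ^ 2) atTop (𝓝 0) :=
    tendsto_const_nhds.div_atTop (tendsto_pow_atTop two_ne_zero)
  have := h1.add hA.rep.tendsto_zero
  rw [add_zero] at this
  refine this.congr fun x => (hA.apply x).symm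

lemma antitoneOn : AntitoneOn q (Ioi 0) :=
  antitoneOn_of_deriv_nonpos (convex_Ioi 0) hA.continuousOn
    (fun x hx => by
      rw [interior_Ioi] at hx
      exact (hA.hasDerivAt hx).differentiableAt.differentiableWithinAt)
    (fun x hx => by rw [interior_Ioi] at hx; exact (hA.deriv_neg hx).le)

/-- For `x ≤ 1` the exponent may be raised, so `κ ≥ 1` is no loss. Then `κ - 1` lies in `[0, 1)`,
and `x^(1 - κ)` is both integrable at zero and at least one there. -/
lemma exists_growth : ∃ κ C δ : ℝ, 1 ≤ κ ∧ κ < 2 ∧ 0 ≤ C ∧ 0 < δ ∧ δ ≤ 1 ∧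
    ∀ x, 0 < x → x ≤ δ → q₀ x ≤ C * x ^ (-κ) := by
  obtain ⟨κ, h0, h2, C, δ, hδ, h⟩ := hA.growth
  refine ⟨max κ 1, max C 0, min (δ / 2) 1, le_max_right _ _, max_lt h2 (by norm_num),
    le_max_right _ _, by positivity, min_le_right _ _, fun x hx hxd => ?_⟩
  have h3 := (le_abs_self _).trans (h x hx (by
    have := hxd.trans (min_le_left _ _); linarith)).1
  have hx1 : x ≤ 1 := hxd.trans (min_le_right _ _)
  calc q₀ x ≤ C * x ^ (-κ) := h3
    _ ≤ max C 0 * x ^ (-κ) := by gcongr; exact le_max_left _ _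
    _ ≤ max C 0 * x ^ (-(max κ 1)) := by
      refine mul_le_mul_of_nonneg_left ?_ (le_max_right _ _)
      exact Real.rpow_le_rpow_of_exponent_ge hx hx1 (neg_le_neg (le_max_left _ _))

end IsAdmissible

/-- A function with vanishing first and positive second derivative has no local maximum. -/
lemma not_isLocalMax_of_hasDerivAt {d d' : ℝ → ℝ} {x c : ℝ}
    (h1 : ∀ᶠ y in 𝓝 x, HasDerivAt d (d' y) y) (h2 : HasDerivAt d' c x) (hc : 0 < c) :
    ¬ IsLocalMax d x := by
  intro hmax
  have e1 : deriv d =ᶠ[𝓝 x] d' := h1.mono fun y hy => hy.deriv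
  have e2 : deriv (deriv d) x = c := e1.deriv_eq.trans h2.deriv
  have h0 : deriv d x = 0 := hmax.deriv_eq_zero
  have hmin := isLocalMin_of_deriv_deriv_pos (by rw [e2]; exact hc) h0
    h1.self_of_nhds.continuousAt
  -- The second derivative test makes the point a local minimum as well, so `d` is locally constant
  -- and `c` would be zero.
  have hconst : d =ᶠ[𝓝 x] fun _ => d x := by
    filter_upwards [hmax, hmin] with y h3 h4
    exact le_antisymm h3 h4
  have e3 : deriv d =ᶠ[𝓝 x] deriv fun _ => d x := hconst.deriv
  rw [e3.deriv_eq] at e2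
  simp at e2
  linarith

/-- Comparison with a supersolution on `[0, 1]`. -/
lemma le_of_supersolution {q v v' f s s' s'' : ℝ → ℝ} (hq : ∀ x, 0 < x → 0 ≤ q x)
    (hvc : ContinuousOn v (Icc 0 1)) (hsc : ContinuousOn s (Icc 0 1))
    (hv : ∀ x, 0 < x → HasDerivAt v (v' x) x)
    (hv' : ∀ x, 0 < x → HasDerivAt v' (f x + q x * v x) x)
    (hs : ∀ x, 0 < x → HasDerivAt s (s' x) x) (hs' : ∀ x, 0 < x → HasDerivAt s' (s'' x) x)
    (h0 : v 0 ≤ s 0) (h1 : v 1 ≤ s 1)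
    (hsuper : ∀ x, 0 < x → x < 1 → -f x < q x * s x - s'' x) :
    ∀ x ∈ Icc (0 : ℝ) 1, v x ≤ s x := by
  by_contra hcon
  push Not at hcon
  obtain ⟨y, hy, hys⟩ := hcon
  obtain ⟨x, hx, hmax⟩ := isCompact_Icc.exists_isMaxOn ⟨y, hy⟩ (hvc.sub hsc)
  have hpos : 0 < v x - s x := by
    have h2 : v y - s y ≤ v x - s x := hmax hy
    linarith
  have hx0 : 0 < x := by
    rcases hx.1.eq_or_lt with h | h
    · rw [← h] at hpos; linarith
    · exact h
  have hx1 : x < 1 := by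
    rcases hx.2.eq_or_lt with h | h
    · rw [h] at hpos; linarith
    · exact h
  refine not_isLocalMax_of_hasDerivAt (d := fun y => v y - s y) (d' := fun y => v' y - s' y)
    ?_ ((hv' x hx0).sub (hs' x hx0)) ?_ (hmax.isLocalMax (Icc_mem_nhds hx0 hx1))
  · filter_upwards [Ioi_mem_nhds hx0] with y hy
    exact (hv y hy).sub (hs y hy)
  -- At a positive interior maximum of `v - s` the second derivative is `f + q v - s''`, which
  -- exceeds `q (v - s) ≥ 0`.
  · have h3 := hsuper x hx0 hx1
    have h4 := mul_nonneg (hq x hx0) hpos.le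
    nlinarith

/-- The exponents of the power bounds for solutions near zero. -/
def IsBoundExponent (lam α : ℝ) : Prop := (lam = 0 ∧ α = 1) ∨ (3 / 4 ≤ lam ∧ 1 < α ∧ α < 3 / 2)

/-- For `λ = 0` the function `2x - x²` has `-s'' = 2`. For `λ ≥ 3/4` the power `x^α` satisfies `λ
s/x² - s'' = (λ - α(α - 1)) x^(α - 2)`, and `α(α - 1) < 3/4` exactly because `1 < α < 3/2`. The
positive `q₀` only helps. -/
lemma IsAdmissible.exists_supersolution {lam α : ℝ} {q₀ q : ℝ → ℝ} (hA : IsAdmissible lam q₀ q)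
    (hα : IsBoundExponent lam α) : ∃ (s s' s'' : ℝ → ℝ) (c : ℝ), 0 < c ∧
      ContinuousOn s (Icc 0 1) ∧
      (∀ x, 0 < x → HasDerivAt s (s' x) x) ∧ (∀ x, 0 < x → HasDerivAt s' (s'' x) x) ∧
      0 ≤ s 0 ∧ 1 ≤ s 1 ∧ (∀ x, 0 < x → x < 1 → c ≤ q x * s x - s'' x) ∧
      ∀ x, 0 < x → x ≤ 1 → s x ≤ 2 * x ^ α := by
  rcases hα with ⟨h0, rfl⟩ | ⟨hl, h1, h2⟩
  · refine ⟨fun x => 2 * x - x ^ 2, fun x => 2 - 2 * x, fun _ => -2, 2, by norm_num, by fun_prop,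
      fun x hx => ?_, fun x hx => ?_, by norm_num, by norm_num, fun x hx hx1 => ?_,
      fun x hx hx1 => ?_⟩
    · have := ((hasDerivAt_id x).const_mul 2).sub (hasDerivAt_pow 2 x)
      exact this.congr_deriv (by simp)
    · have := ((hasDerivAt_id x).const_mul 2).const_sub 2
      simpa using this
    · have := mul_nonneg (hA.pos hx).le (by nlinarith : 0 ≤ 2 * x - x ^ 2)
      linarith
    · rw [Real.rpow_one]; nlinarith [sq_nonneg x]
  · refine ⟨fun x => x ^ α, fun x => α * x ^ (α - 1), fun x => α * ((α - 1) * x ^ (α - 1 - 1)),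
      lam - α * (α - 1), by nlinarith, ?_, fun x hx => ?_, fun x hx => ?_, ?_, by simp,
      fun x hx hx1 => ?_, fun x hx hx1 => ?_⟩
    · exact (Real.continuous_rpow_const (by linarith)).continuousOn
    · exact Real.hasDerivAt_rpow_const (Or.inl hx.ne')
    · exact (Real.hasDerivAt_rpow_const (Or.inl hx.ne')).const_mul α
    · exact (Real.zero_rpow (by linarith)).ge
    · have hp : x ^ α = x ^ 2 * x ^ (α - 1 - 1) := by
        rw [← Real.rpow_natCast x 2, ← Real.rpow_add hx]; congr 1; push_cast; ring
      have hp0 : 1 ≤ x ^ (α - 1 - 1) := Real.one_le_rpow_of_pos_of_le_one_of_nonpos hx hx1.le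
        (by linarith)
      have hq0 := (hA.rep.pos x hx).le
      have e1 : q x * x ^ α - α * ((α - 1) * x ^ (α - 1 - 1)) =
          (lam - α * (α - 1)) * x ^ (α - 1 - 1) + q₀ x * x ^ α := by
        rw [hA.apply, add_mul, hp]; field_simp; ring
      rw [e1]
      have h3 : 0 ≤ q₀ x * x ^ α := mul_nonneg hq0 (Real.rpow_nonneg hx.le _)
      have h4 : 0 < lam - α * (α - 1) := by nlinarith
      nlinarith
    · have := Real.rpow_nonneg hx.le α
      linarith

lemma IsPrimitive.continuousOn_Ici {F : ℝ → L2} {f : ℝ → ℝ → ℂ} (h : IsPrimitive F f)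
    (hF : Continuous F) (t : ℝ) : ContinuousOn (f t) (Ici 0) := by
  have h1 := (h.continuous_max hF).comp (by fun_prop : Continuous fun x : ℝ => (t, x))
  refine h1.continuousOn.congr fun x hx => ?_
  simp [max_eq_left (show (0 : ℝ) ≤ x from hx)]

namespace IsRegularSolution

variable {lam : ℝ} {q₀ q : ℝ → ℝ} {u ux ut utt uxt : ℝ → ℝ → ℂ}

lemma apply_zero (hu : IsRegularSolution q u ux ut utt uxt) (t : ℝ) : u t 0 = 0 := by
  rw [hu.sol.isPrimitive t 0 le_rfl]; simp

/-- Power bounds near zero. -/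
lemma exists_norm_le_rpow (hu : IsRegularSolution q u ux ut utt uxt)
    (hA : IsAdmissible lam q₀ q) {α : ℝ} (hα : IsBoundExponent lam α) (T : ℝ) :
    ∃ C, 0 ≤ C ∧ ∀ t, |t| ≤ T → ∀ x, 0 < x → x ≤ 1 → ‖u t x‖ ≤ C * x ^ α := by
  obtain ⟨s, s', s'', c, hc, hsc, hs, hs', h0, h1, hsup, hle⟩ := hA.exists_supersolution hα
  obtain ⟨K, hK, hb⟩ := hu.bound T
  -- The first summand dominates the boundary value at `x = 1`; the second makes `m c` exceed the
  -- source bound `K`.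
  set m := K + (K + 1) / c with hm
  have hm0 : 0 < (K + 1) / c := by positivity
  refine ⟨4 * m, by positivity, fun t ht x hx hx1 => ?_⟩
  have hcont := hu.sol.isPrimitive.continuousOn_Ici hu.sol.continuous_wx.continuous_curve t
  have hcont' : ContinuousOn (u t) (Icc 0 1) := hcont.mono Icc_subset_Ici_self
  -- The comparison is real, so it is applied to plus and minus the real and imaginary parts. The
  -- factor 4 above is 2 for these two parts times 2 from `s x ≤ 2 x^α`.
  have key : ∀ L : ℂ →L[ℝ] ℝ, (∀ z, |L z| ≤ ‖z‖) → ∀ x ∈ Icc (0 : ℝ) 1, L (u t x) ≤ m * s x := by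
    intro L hL
    refine le_of_supersolution (v := fun x => L (u t x)) (v' := fun x => L (ux t x))
      (f := fun x => L (utt t x)) (s' := fun x => m * s' x) (s'' := fun x => m * s'' x) hA.nonneg
      (L.continuous.comp_continuousOn hcont') (hsc.const_smul m) (fun x hx => ?_) (fun x hx => ?_)
      (fun x hx => (hs x hx).const_mul m) (fun x hx => (hs' x hx).const_mul m) ?_ ?_ ?_
    · exact L.hasFDerivAt.comp_hasDerivAt x (hu.hasDerivAt_x t x hx)
    · have := L.hasFDerivAt.comp_hasDerivAt x (hu.hasDerivAt_xx t x hx)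
      refine this.congr_deriv ?_
      rw [map_add, ← Complex.real_smul, map_smul, smul_eq_mul]
    · simp only [hu.apply_zero, map_zero]; positivity
    · have h2 := (hb t ht 1 one_pos).1
      rw [Real.sqrt_one, mul_one] at h2
      calc L (u t 1) ≤ K := (le_abs_self _).trans ((hL _).trans h2)
        _ ≤ m * 1 := by linarith
        _ ≤ m * s 1 := by gcongr
    · intro x hx hx1
      have h2 := (hb t ht x hx).2.2
      have h3 : √x ≤ 1 := Real.sqrt_le_one.2 hx1.le
      have h4 : ‖utt t x‖ ≤ K := h2.trans (mul_le_of_le_one_right hK h3)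
      have h5 : -L (utt t x) ≤ K := (neg_le_abs _).trans ((hL _).trans h4)
      have h6 : K < m * c := by
        rw [hm, add_mul, div_mul_cancel₀ _ hc.ne']
        nlinarith
      have h7 := hsup x hx hx1
      have h8 : m * c ≤ m * (q x * s x - s'' x) := by gcongr
      linarith
  have hx' : x ∈ Icc (0 : ℝ) 1 := ⟨hx.le, hx1⟩
  have r1 := key Complex.reCLM Complex.abs_re_le_norm x hx'
  have r2 := key (-Complex.reCLM) (fun z => by simpa using Complex.abs_re_le_norm z) x hx'
  have r3 := key Complex.imCLM Complex.abs_im_le_norm x hx'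
  have r4 := key (-Complex.imCLM) (fun z => by simpa using Complex.abs_im_le_norm z) x hx'
  simp only [_root_.neg_apply, Complex.reCLM_apply, Complex.imCLM_apply] at r1 r2 r3 r4
  have h9 := Complex.norm_le_abs_re_add_abs_im (u t x)
  have h10 : |(u t x).re| ≤ m * s x := abs_le.2 ⟨by linarith, r1⟩
  have h11 : |(u t x).im| ≤ m * s x := abs_le.2 ⟨by linarith, r3⟩
  have h12 : m * s x ≤ m * (2 * x ^ α) := by
    gcongr
    exact hle x hx hx1
  linarith

end IsRegularSolution

end

end HalfLineWave

/-! ### The boundary trace of the space derivative. -/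

namespace HalfLineWave

noncomputable section

variable {lam : ℝ} {q₀ q : ℝ → ℝ}

lemma IsBoundExponent.one_le {lam α : ℝ} (h : IsBoundExponent lam α) : 1 ≤ α := by
  rcases h with ⟨_, rfl⟩ | ⟨_, h, _⟩ <;> linarith

lemma exists_isBoundExponent (h : lam = 0 ∨ 3 / 4 ≤ lam) : ∃ α, IsBoundExponent lam α := by
  rcases h with h | h
  · exact ⟨1, Or.inl ⟨h, rfl⟩⟩
  · exact ⟨5 / 4, Or.inr ⟨h, by norm_num, by norm_num⟩⟩

/-- Combined with `|u| ≤ C x^α`, this makes `q u` integrable at zero because `β < 1`: `β` is `κ - 1`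
when `λ = 0`, and `2 - α` otherwise. The second value is recorded because `α` close to `3/2` brings
it close to `1/2`, as needed for `u_xx ∈ L^p` with `p < 2`. -/
lemma IsAdmissible.exists_potential_bound (hA : IsAdmissible lam q₀ q) {α : ℝ}
    (hα : IsBoundExponent lam α) : ∃ β δ C, 0 ≤ β ∧ β < 1 ∧ 0 < δ ∧ δ ≤ 1 ∧ 0 ≤ C ∧
      (lam ≠ 0 → β = 2 - α) ∧ ∀ x, 0 < x → x ≤ δ → q x * x ^ α ≤ C * x ^ (-β) := by
  obtain ⟨κ, C, δ, h1, h2, hC, hδ, hδ1, hb⟩ := hA.exists_growth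
  rcases hα with ⟨h0, rfl⟩ | ⟨hl, ha1, ha2⟩
  · refine ⟨κ - 1, δ, C, by linarith, by linarith, hδ, hδ1, hC, fun h => absurd h0 h,
      fun x hx hxd => ?_⟩
    rw [hA.apply, h0, zero_div, zero_add]
    calc q₀ x * x ^ (1 : ℝ) ≤ C * x ^ (-κ) * x ^ (1 : ℝ) :=
          mul_le_mul_of_nonneg_right (hb x hx hxd) (Real.rpow_nonneg hx.le _)
      _ = _ := by rw [mul_assoc, ← Real.rpow_add hx]; congr 2; ring
  · refine ⟨2 - α, δ, lam + C, by linarith, by linarith, hδ, hδ1, by linarith, fun _ => rfl,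
      fun x hx hxd => ?_⟩
    have h3 : q x ≤ (lam + C) * x ^ (-2 : ℝ) := by
      rw [hA.apply, add_mul]
      have e : lam / x ^ 2 = lam * x ^ (-2 : ℝ) := by
        rw [Real.rpow_neg hx.le, div_eq_mul_inv]; norm_cast
      rw [e]
      have : x ^ (-κ) ≤ x ^ (-2 : ℝ) :=
        Real.rpow_le_rpow_of_exponent_ge hx (hxd.trans hδ1) (by linarith)
      have := mul_le_mul_of_nonneg_left this hC
      linarith [hb x hx hxd]
    calc q x * x ^ α ≤ (lam + C) * x ^ (-2 : ℝ) * x ^ α :=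
          mul_le_mul_of_nonneg_right h3 (Real.rpow_nonneg hx.le _)
      _ = _ := by rw [mul_assoc, ← Real.rpow_add hx]; congr 2; ring

lemma intervalIntegrable_rpow_neg {β C a b : ℝ} (hβ : β < 1) :
    IntervalIntegrable (fun x => C * x ^ (-β)) volume a b :=
  (intervalIntegral.intervalIntegrable_rpow' (by linarith)).const_mul C

lemma integral_rpow_neg_zero {β C x : ℝ} (hβ : β < 1) :
    ∫ y in (0 : ℝ)..x, C * y ^ (-β) = C / (1 - β) * x ^ (1 - β) := by
  rw [intervalIntegral.integral_const_mul, integral_rpow (Or.inl (by linarith)),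
    Real.zero_rpow (by linarith)]
  have : -β + 1 = 1 - β := by ring
  rw [this]; ring

namespace IsRegularSolution

variable {u ux ut utt uxt : ℝ → ℝ → ℂ}

lemma jointContinuous_source (hu : IsRegularSolution q u ux ut utt uxt)
    (hA : IsAdmissible lam q₀ q) : JointContinuous fun t x => utt t x + (q x : ℂ) * u t x := by
  refine ContinuousOn.add hu.cont_utt (ContinuousOn.mul ?_ hu.cont_u)
  exact Complex.continuous_ofReal.comp_continuousOn
    (hA.continuousOn.comp continuousOn_snd fun p hp => hp.2)

/-- In `u_xx = u_tt + q u` the first term is bounded near zero and the second is controlled by the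
power bound on `u`. For `β < 1` the derivative `u_x` then has a limit at the boundary. -/
lemma exists_source_bound (hu : IsRegularSolution q u ux ut utt uxt)
    (hA : IsAdmissible lam q₀ q) {α β δ C : ℝ} (hα : IsBoundExponent lam α) (hβ : 0 ≤ β)
    (hδ : δ ≤ 1) (hC : 0 ≤ C)
    (hb : ∀ x, 0 < x → x ≤ δ → q x * x ^ α ≤ C * x ^ (-β)) (T : ℝ) :
    ∃ K, 0 ≤ K ∧ ∀ t, |t| ≤ T → ∀ x, 0 < x → x ≤ δ → ‖utt t x + (q x : ℂ) * u t x‖ ≤ K * x ^ (-β) ∧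
      ‖u t x‖ ≤ K * x ∧ q x * ‖u t x‖ ≤ K * x ^ (-β) := by
  obtain ⟨C', hC', h1⟩ := hu.exists_norm_le_rpow hA hα T
  obtain ⟨K, hK, h2⟩ := hu.bound T
  refine ⟨K + C' + C * C', by positivity, fun t ht x hx hxd => ?_⟩
  have hx1 : x ≤ 1 := hxd.trans hδ
  have a1 := h1 t ht x hx hx1
  have a2 := (h2 t ht x hx).2.2
  have a3 : 1 ≤ x ^ (-β) := Real.one_le_rpow_of_pos_of_le_one_of_nonpos hx hx1 (by linarith)
  have a4 : ‖utt t x‖ ≤ K * x ^ (-β) := a2.trans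
    (mul_le_mul_of_nonneg_left ((Real.sqrt_le_one.2 hx1).trans a3) hK)
  have a5 : q x * ‖u t x‖ ≤ C * C' * x ^ (-β) := by
    calc q x * ‖u t x‖ ≤ q x * (C' * x ^ α) := mul_le_mul_of_nonneg_left a1 (hA.nonneg x hx)
      _ = C' * (q x * x ^ α) := by ring
      _ ≤ C' * (C * x ^ (-β)) := mul_le_mul_of_nonneg_left (hb x hx hxd) hC'
      _ = _ := by ring
  have hC'' : 0 ≤ C' * x ^ (-β) := by positivity
  have hK' : 0 ≤ K * x ^ (-β) := by positivity
  have hCC : 0 ≤ C * C' := by positivity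
  have hCC' : 0 ≤ C * C' * x ^ (-β) := by positivity
  refine ⟨?_, ?_, ?_⟩
  · have a6 : ‖(q x : ℂ) * u t x‖ = q x * ‖u t x‖ := by
      rw [norm_mul, Complex.norm_real, Real.norm_of_nonneg (hA.nonneg x hx)]
    have a7 := norm_add_le (utt t x) ((q x : ℂ) * u t x)
    rw [a6] at a7
    nlinarith
  · have a8 : x ^ α ≤ x := by
      simpa using Real.rpow_le_rpow_of_exponent_ge hx hx1 hα.one_le
    have : C' * x ^ α ≤ C' * x := by gcongr
    nlinarith
  · nlinarith

lemma ux_sub_eq (hu : IsRegularSolution q u ux ut utt uxt) (hA : IsAdmissible lam q₀ q) (t : ℝ)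
    {a b : ℝ} (ha : 0 < a) (hb : 0 < b) :
    ∫ y in a..b, (utt t y + (q y : ℂ) * u t y) = ux t b - ux t a := by
  have hpos : ∀ x ∈ uIcc a b, 0 < x := fun x hx => lt_of_lt_of_le (lt_min ha hb) hx.1
  exact intervalIntegral.integral_eq_sub_of_hasDerivAt
    (fun x hx => hu.hasDerivAt_xx t x (hpos x hx))
    (((hu.jointContinuous_source hA).space t).mono hpos).intervalIntegrable

/-- The boundary derivative of a regular solution. -/
theorem exists_trace (hu : IsRegularSolution q u ux ut utt uxt) (hA : IsAdmissible lam q₀ q) :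
    ∃ h : ℝ → ℂ, Continuous h ∧ (∀ t, HasDerivWithinAt (u t) (h t) (Ici 0) 0) ∧
      (∀ t, Tendsto (ux t) (𝓝[>] 0) (𝓝 (h t))) ∧
      ∀ T ε, 0 < ε → ∃ δ, 0 < δ ∧ ∀ t, |t| ≤ T → ∀ x, 0 < x → x ≤ δ →
        ‖ux t x - h t‖ ≤ ε ∧ q x * ‖u t x‖ ^ 2 ≤ ε ∧ ‖ut t x‖ ≤ ε := by
  obtain ⟨α, hα⟩ := exists_isBoundExponent hA.hlam
  obtain ⟨β, δ, C, hβ0, hβ, hδ, hδ1, hC, -, hb⟩ := hA.exists_potential_bound hα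
  have hsb := hu.exists_source_bound hA hα hβ0 hδ1 hC hb
  set r : ℝ → ℝ → ℂ := fun t x => utt t x + (q x : ℂ) * u t x with hr
  have hrc : JointContinuous r := hu.jointContinuous_source hA
  have hint : ∀ t, IntervalIntegrable (r t) volume 0 δ := by
    intro t
    obtain ⟨K, hK, h1⟩ := hsb |t|
    refine (intervalIntegrable_rpow_neg (C := K) (a := 0) (b := δ) hβ).mono_fun ?_ ?_
    · rw [uIoc_of_le hδ.le]
      exact ((hrc.space t).mono fun x hx => hx.1).aestronglyMeasurable measurableSet_Ioc
    · rw [uIoc_of_le hδ.le]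
      refine (ae_restrict_iff' measurableSet_Ioc).2 (Eventually.of_forall fun x hx => ?_)
      exact ((h1 t le_rfl x hx.1 hx.2).1).trans (le_abs_self _)
  -- The trace is obtained by integrating `u_xx` from `δ` down to zero, which is possible because it
  -- is integrable there.
  set h : ℝ → ℂ := fun t => ux t δ - ∫ y in (0 : ℝ)..δ, r t y with hh
  have hsub : ∀ t x, 0 < x → x ≤ δ → ux t x - h t = ∫ y in (0 : ℝ)..x, r t y := by
    intro t x hx hxd
    have h1 : IntervalIntegrable (r t) volume 0 x :=
      (hint t).mono_set (by rw [uIcc_of_le hx.le, uIcc_of_le hδ.le]; exact Icc_subset_Icc_right hxd)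
    have h2 : IntervalIntegrable (r t) volume x δ :=
      (hint t).mono_set (by rw [uIcc_of_le hxd, uIcc_of_le hδ.le]; exact Icc_subset_Icc_left hx.le)
    have h3 := intervalIntegral.integral_add_adjacent_intervals h1 h2
    rw [hu.ux_sub_eq hA t hx hδ] at h3
    simp only [hh, ← h3]; ring
  have hbound : ∀ T, ∃ K, 0 ≤ K ∧ ∀ t, |t| ≤ T → ∀ x, 0 < x → x ≤ δ →
      ‖ux t x - h t‖ ≤ K * x ^ (1 - β) ∧ q x * ‖u t x‖ ^ 2 ≤ K * x ^ (1 - β) ∧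
      ‖ut t x‖ ≤ K * x ^ (1 / 2 : ℝ) := by
    intro T
    obtain ⟨K, hK, h1⟩ := hsb T
    obtain ⟨K', hK', h2⟩ := hu.bound T
    have hb1 : 0 < 1 - β := by linarith
    refine ⟨K / (1 - β) + K * K + K', by positivity, fun t ht x hx hxd => ⟨?_, ?_, ?_⟩⟩
    · rw [hsub t x hx hxd]
      have h3 : ‖∫ y in (0 : ℝ)..x, r t y‖ ≤ ∫ y in (0 : ℝ)..x, K * y ^ (-β) := by
        refine intervalIntegral.norm_integral_le_of_norm_le hx.le
          (Eventually.of_forall fun y hy => ?_) (intervalIntegrable_rpow_neg hβ)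
        exact (h1 t ht y hy.1 (hy.2.trans hxd)).1
      rw [integral_rpow_neg_zero hβ] at h3
      refine h3.trans ?_
      have : 0 ≤ x ^ (1 - β) := by positivity
      have : 0 ≤ (K * K + K') * x ^ (1 - β) := by positivity
      nlinarith
    · obtain ⟨-, a1, a2⟩ := h1 t ht x hx hxd
      have e : x ^ (1 - β) = x ^ (-β) * x := by
        rw [show (1 - β) = -β + 1 by ring, Real.rpow_add_one hx.ne']
      calc q x * ‖u t x‖ ^ 2 = (q x * ‖u t x‖) * ‖u t x‖ := by ring
        _ ≤ (K * x ^ (-β)) * (K * x) := by gcongr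
        _ = K * K * x ^ (1 - β) := by rw [e]; ring
        _ ≤ _ := by
          gcongr
          have : 0 ≤ K / (1 - β) := by positivity
          linarith
    · rw [← Real.sqrt_eq_rpow]
      refine (h2 t ht x hx).2.1.trans ?_
      gcongr
      have : 0 ≤ K / (1 - β) := by positivity
      nlinarith
  have hunif : ∀ T ε, 0 < ε → ∃ d, 0 < d ∧ d ≤ δ ∧ ∀ t, |t| ≤ T → ∀ x, 0 < x → x ≤ d →
        ‖ux t x - h t‖ ≤ ε ∧ q x * ‖u t x‖ ^ 2 ≤ ε ∧ ‖ut t x‖ ≤ ε := by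
    intro T ε hε
    obtain ⟨K, hK, h1⟩ := hbound T
    have ht1 : Tendsto (fun x : ℝ => K * x ^ (1 - β)) (𝓝 0) (𝓝 0) := by
      have := ((Real.continuous_rpow_const (q := 1 - β) (by linarith)).tendsto 0).const_mul K
      rwa [Real.zero_rpow (by linarith), mul_zero] at this
    have ht2 : Tendsto (fun x : ℝ => K * x ^ (1 / 2 : ℝ)) (𝓝 0) (𝓝 0) := by
      have := ((Real.continuous_rpow_const (q := 1 / 2) (by norm_num)).tendsto 0).const_mul K
      rwa [Real.zero_rpow (by norm_num), mul_zero] at this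
    obtain ⟨d, hd, hd'⟩ := Metric.eventually_nhds_iff.1
      ((ht1.eventually (gt_mem_nhds hε)).and (ht2.eventually (gt_mem_nhds hε)))
    refine ⟨min (d / 2) δ, by positivity, min_le_right _ _, fun t ht x hx hxd => ?_⟩
    obtain ⟨a1, a2, a3⟩ := h1 t ht x hx (hxd.trans (min_le_right _ _))
    have hdist : dist x 0 < d := by
      rw [Real.dist_eq, sub_zero, abs_of_pos hx]
      linarith [hxd.trans (min_le_left _ _)]
    obtain ⟨b1, b2⟩ := hd' hdist
    exact ⟨a1.trans b1.le, a2.trans b1.le, a3.trans b2.le⟩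
  have htend : ∀ t, Tendsto (ux t) (𝓝[>] 0) (𝓝 (h t)) := by
    intro t
    rw [Metric.tendsto_nhdsWithin_nhds]
    intro ε hε
    obtain ⟨d, hd, -, h1⟩ := hunif |t| (ε / 2) (by positivity)
    refine ⟨d, hd, fun x hx hxd => ?_⟩
    have hx0 : 0 < x := hx
    rw [Real.dist_eq, sub_zero, abs_of_pos hx0] at hxd
    rw [dist_eq_norm]
    linarith [(h1 t le_rfl x hx hxd.le).1]
  refine ⟨h, ?_, fun t => ?_, htend, fun T ε hε => ?_⟩
  · refine continuous_iff_continuousAt.2 fun t => ?_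
    -- The trace is a locally uniform limit of the continuous functions `t ↦ ux t d` as `d → 0`.
    refine continuousAt_of_locally_uniform_approx_of_continuousAt fun V hV => ?_
    obtain ⟨ε, hε, hV'⟩ := Metric.mem_uniformity_dist.1 hV
    obtain ⟨d, hd, -, h1⟩ := hunif (|t| + 1) (ε / 2) (by positivity)
    refine ⟨Metric.ball t 1, Metric.ball_mem_nhds t one_pos, fun s => ux s d,
      (hu.cont_ux.time hd).continuousAt, fun s hs => hV' ?_⟩
    have hs' : |s| ≤ |t| + 1 := by
      have : |s - t| < 1 := by simpa [Real.dist_eq] using hs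
      have := abs_sub_abs_le_abs_sub s t
      linarith
    rw [dist_comm, dist_eq_norm]
    linarith [(h1 s hs' d hd le_rfl).1]
  · refine hasDerivWithinAt_Ici_of_tendsto_deriv (s := Ioi 0)
      (fun x hx => (hu.hasDerivAt_x t x hx).differentiableAt.differentiableWithinAt) ?_
      self_mem_nhdsWithin ?_
    · have := hu.sol.isPrimitive.continuousOn_Ici hu.sol.continuous_wx.continuous_curve t 0
        self_mem_Ici
      exact this.mono Ioi_subset_Ici_self
    · refine (htend t).congr' ?_
      filter_upwards [self_mem_nhdsWithin] with x hx
      exact (hu.hasDerivAt_x t x hx).deriv.symm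
  · obtain ⟨d, hd, -, h1⟩ := hunif T ε hε
    exact ⟨d, hd, h1⟩

end IsRegularSolution

end

end HalfLineWave

/-! ### Energy and momentum densities and their local conservation laws. -/

namespace HalfLineWave

noncomputable section

/-! ### Energies of finite-energy solutions -/

lemma norm_sqrtMul_sq {q : ℝ → ℝ} {x : ℝ} (h : 0 ≤ q x) (v : ℝ → ℂ) :
    ‖sqrtMul q v x‖ ^ 2 = q x * ‖v x‖ ^ 2 := by
  rw [sqrtMul, norm_mul, mul_pow, Complex.norm_real, Real.norm_of_nonneg (Real.sqrt_nonneg _),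
    Real.sq_sqrt h]

lemma MemLp.integrableOn_inner {f g : ℝ → ℂ} (hf : MemLp f 2 halfLine) (hg : MemLp g 2 halfLine) :
    IntegrableOn (fun x => inner ℝ (f x) (g x)) (Ioi 0) := by
  have h : IntegrableOn (fun x => (‖f x + g x‖ ^ 2 - ‖f x‖ ^ 2 - ‖g x‖ ^ 2) / 2) (Ioi 0) :=
    (((MemLp.integrableOn_sq (hf.add hg)).sub (MemLp.integrableOn_sq hf)).sub
      (MemLp.integrableOn_sq hg)).div_const 2
  refine h.congr_fun (fun x _ => ?_) measurableSet_Ioi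
  simp only []
  rw [norm_add_sq_real]; ring

/-- The momentum `∫ Re (w_t conj w_x)`. -/
def momentum (wx wt : ℝ → ℝ → ℂ) (t : ℝ) : ℝ := ∫ x in Ioi (0 : ℝ), inner ℝ (wt t x) (wx t x)

/-- The inward energy density. -/
def inwardDensity (q : ℝ → ℝ) (w wx wt : ℝ → ℝ → ℂ) (t x : ℝ) : ℝ :=
  1 / 2 * ‖wx t x + wt t x‖ ^ 2 + q x / 2 * ‖w t x‖ ^ 2

lemma inwardDensity_eq (q : ℝ → ℝ) (w wx wt : ℝ → ℝ → ℂ) (t x : ℝ) :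
    inwardDensity q w wx wt t x =
      energyDensity q w wx wt t x / 2 + inner ℝ (wt t x) (wx t x) := by
  rw [inwardDensity, energyDensity, norm_add_sq_real, real_inner_comm (wx t x)]; ring

lemma inwardDensity_nonneg {q : ℝ → ℝ} {x : ℝ} (hq : 0 ≤ q x) (w wx wt : ℝ → ℝ → ℂ) (t : ℝ) :
    0 ≤ inwardDensity q w wx wt t x := by
  rw [inwardDensity]; positivity

lemma energyDensity_nonneg {q : ℝ → ℝ} {x : ℝ} (hq : 0 ≤ q x) (w wx wt : ℝ → ℝ → ℂ) (t : ℝ) :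
    0 ≤ energyDensity q w wx wt t x := by
  rw [energyDensity]; positivity

lemma abs_inner_le_energyDensity {q : ℝ → ℝ} {x : ℝ} (hq : 0 ≤ q x) (w wx wt : ℝ → ℝ → ℂ) (t : ℝ) :
    |inner ℝ (wt t x) (wx t x)| ≤ energyDensity q w wx wt t x / 2 := by
  have h1 := abs_real_inner_le_norm (wt t x) (wx t x)
  have h2 : 0 ≤ q x * ‖w t x‖ ^ 2 := by positivity
  rw [energyDensity]
  nlinarith [sq_nonneg (‖wt t x‖ - ‖wx t x‖)]

lemma inwardDensity_le {q : ℝ → ℝ} {x : ℝ} (hq : 0 ≤ q x) (w wx wt : ℝ → ℝ → ℂ) (t : ℝ) :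
    inwardDensity q w wx wt t x ≤ energyDensity q w wx wt t x := by
  rw [inwardDensity_eq]
  linarith [le_abs_self (inner ℝ (wt t x) (wx t x)), abs_inner_le_energyDensity hq w wx wt t]

section Energy

variable {q : ℝ → ℝ} {w wx wt : ℝ → ℝ → ℂ}

namespace IsFiniteEnergySolution

variable (hw : IsFiniteEnergySolution q w wx wt) (hq : ∀ x, 0 < x → 0 ≤ q x)
include hw hq

lemma integrableOn_potential (t : ℝ) : IntegrableOn (fun x => q x * ‖w t x‖ ^ 2) (Ioi 0) :=
  (MemLp.integrableOn_sq (hw.energyClass t).memLp_potential).congr_fun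
    (fun x hx => norm_sqrtMul_sq (hq x hx) _) measurableSet_Ioi

lemma integral_potential (t : ℝ) : ∫ x in Ioi (0 : ℝ), q x * ‖w t x‖ ^ 2 =
    ‖hw.continuous_potential.curve t‖ ^ 2 := by
  rw [hw.continuous_potential.norm_curve_sq]
  exact (setIntegral_congr_fun measurableSet_Ioi fun x hx => norm_sqrtMul_sq (hq x hx) _).symm

lemma integrableOn_energyDensity (t : ℝ) :
    IntegrableOn (energyDensity q w wx wt t) (Ioi 0) :=
  ((MemLp.integrableOn_sq (hw.continuous_wx.1 t)).add
    (MemLp.integrableOn_sq (hw.continuous_wt.1 t))).add (hw.integrableOn_potential hq t)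

omit hq in
lemma integrableOn_inner (t : ℝ) :
    IntegrableOn (fun x => inner ℝ (wt t x) (wx t x)) (Ioi 0) :=
  MemLp.integrableOn_inner (hw.continuous_wt.1 t) (hw.continuous_wx.1 t)

lemma integrableOn_inwardDensity (t : ℝ) :
    IntegrableOn (inwardDensity q w wx wt t) (Ioi 0) := by
  have := ((hw.integrableOn_energyDensity hq t).div_const 2).add (hw.integrableOn_inner t)
  exact IntegrableOn.congr_fun this (fun x _ => (inwardDensity_eq q w wx wt t x).symm) measurableSet_Ioi

lemma energy_eq (t : ℝ) : energy q w wx wt t = ‖hw.continuous_wx.curve t‖ ^ 2 +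
    ‖hw.continuous_wt.curve t‖ ^ 2 + ‖hw.continuous_potential.curve t‖ ^ 2 := by
  rw [hw.continuous_wx.norm_curve_sq, hw.continuous_wt.norm_curve_sq, ← hw.integral_potential hq,
    energy]
  simp only [energyDensity]
  have i1 := MemLp.integrableOn_sq (hw.continuous_wx.1 t)
  have i2 := MemLp.integrableOn_sq (hw.continuous_wt.1 t)
  have i12 : IntegrableOn (fun x => ‖wx t x‖ ^ 2 + ‖wt t x‖ ^ 2) (Ioi 0) := i1.add i2
  rw [integral_add i12 (hw.integrableOn_potential hq t), integral_add i1 i2]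

lemma inwardEnergy_eq (t : ℝ) : inwardEnergy q w wx wt t =
    energy q w wx wt t / 2 + momentum wx wt t := by
  have : inwardEnergy q w wx wt t = ∫ x in Ioi (0 : ℝ), inwardDensity q w wx wt t x := rfl
  rw [this]
  simp only [inwardDensity_eq]
  rw [integral_add ((hw.integrableOn_energyDensity hq t).div_const 2) (hw.integrableOn_inner t),
    integral_div]
  rfl

lemma outwardEnergy_eq (t : ℝ) : outwardEnergy q w wx wt t =
    energy q w wx wt t / 2 - momentum wx wt t := by
  rw [outwardEnergy]
  have : ∀ x, 1 / 2 * ‖wx t x - wt t x‖ ^ 2 + q x / 2 * ‖w t x‖ ^ 2 =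
      energyDensity q w wx wt t x / 2 - inner ℝ (wt t x) (wx t x) := fun x => by
    rw [energyDensity, norm_sub_sq_real, real_inner_comm (wx t x)]; ring
  simp only [this]
  rw [integral_sub ((hw.integrableOn_energyDensity hq t).div_const 2) (hw.integrableOn_inner t),
    integral_div]
  rfl

omit hw in
lemma inwardEnergy_nonneg (t : ℝ) : 0 ≤ inwardEnergy q w wx wt t :=
  setIntegral_nonneg measurableSet_Ioi fun x hx => inwardDensity_nonneg (hq x hx) w wx wt t

lemma continuous_energy : Continuous (energy q w wx wt) := by
  rw [funext (hw.energy_eq hq)]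
  have h1 := hw.continuous_wx.continuous_curve
  have h2 := hw.continuous_wt.continuous_curve
  have h3 := hw.continuous_potential.continuous_curve
  fun_prop

lemma setIntegral_energyDensity_le (t : ℝ) {s : Set ℝ} (hs : s ⊆ Ioi 0) :
    ∫ x in s, energyDensity q w wx wt t x ≤ energy q w wx wt t :=
  setIntegral_mono_set (hw.integrableOn_energyDensity hq t)
    ((ae_restrict_iff' measurableSet_Ioi).2 (Eventually.of_forall fun x hx =>
      energyDensity_nonneg (hq x hx) w wx wt t)) (LE.le.eventuallyLE hs)

lemma intervalIntegral_energyDensity_le (t : ℝ) {a b : ℝ} (ha : 0 ≤ a) (hab : a ≤ b) :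
    ∫ x in a..b, energyDensity q w wx wt t x ≤ energy q w wx wt t := by
  rw [intervalIntegral.integral_of_le hab]
  exact hw.setIntegral_energyDensity_le hq t (Ioc_subset_Ioi_zero ha)

lemma intervalIntegrable_energyDensity (t : ℝ) {a b : ℝ} (ha : 0 ≤ a) (hb : 0 ≤ b) :
    IntervalIntegrable (energyDensity q w wx wt t) volume a b :=
  ⟨(hw.integrableOn_energyDensity hq t).mono_set (Ioc_subset_Ioi_zero ha),
    (hw.integrableOn_energyDensity hq t).mono_set (Ioc_subset_Ioi_zero hb)⟩

end IsFiniteEnergySolution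

end Energy

/-! ### Exhaustions of the half line -/

/-- Stated for sequences, since the right endpoints will be selected so that the flux through them
is small. -/
lemma tendsto_intervalIntegral_Ioi_zero {f : ℝ → ℝ} (hf : IntegrableOn f (Ioi 0)) {a b : ℕ → ℝ}
    (ha0 : ∀ n, 0 < a n) (hab : ∀ n, a n ≤ b n) (ha : Tendsto a atTop (𝓝 0))
    (hb : Tendsto b atTop atTop) :
    Tendsto (fun n => ∫ x in (a n)..(b n), f x) atTop (𝓝 (∫ x in Ioi (0 : ℝ), f x)) := by
  have hc : AECover (volume.restrict (Ioi (0 : ℝ))) atTop fun n => Ioc (a n) (b n) := by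
    refine ⟨(ae_restrict_iff' measurableSet_Ioi).2 (Eventually.of_forall fun x hx => ?_),
      fun n => measurableSet_Ioc⟩
    filter_upwards [ha.eventually (gt_mem_nhds hx), hb.eventually_ge_atTop x] with n h1 h2
    exact ⟨h1, h2⟩
  have := hc.integral_tendsto_of_countably_generated hf
  refine this.congr fun n => ?_
  rw [Measure.restrict_restrict measurableSet_Ioc,
    inter_eq_self_of_subset_left (Ioc_subset_Ioi_zero (ha0 n).le),
    intervalIntegral.integral_of_le (hab n)]

lemma tendsto_intervalIntegral_zero_left {f : ℝ → ℝ} (hf : IntegrableOn f (Ioi 0)) {y : ℝ}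
    (hy : 0 < y) : Tendsto (fun a => ∫ x in a..y, f x) (𝓝[>] 0) (𝓝 (∫ x in Ioc 0 y, f x)) := by
  have hc : AECover (volume.restrict (Ioc (0 : ℝ) y)) (𝓝[>] 0) fun a => Ioc a y := by
    refine ⟨(ae_restrict_iff' measurableSet_Ioc).2 (Eventually.of_forall fun x hx => ?_),
      fun n => measurableSet_Ioc⟩
    filter_upwards [Ioo_mem_nhdsGT hx.1] with a ha
    exact ⟨ha.2, hx.2⟩
  have := hc.integral_tendsto_of_countably_generated (hf.mono_set Ioc_subset_Ioi_self)
  refine this.congr' ?_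
  filter_upwards [Ioo_mem_nhdsGT hy] with a ha
  rw [Measure.restrict_restrict measurableSet_Ioc,
    inter_eq_self_of_subset_left (Ioc_subset_Ioc_left ha.1.le),
    intervalIntegral.integral_of_le ha.2.le]

/-! ### Differential identities -/

lemma JointContinuous.continuousOn_rect {f : ℝ → ℝ → ℝ} (hf : JointContinuous f) {s t a b : ℝ}
    (ha : 0 < a) (hb : 0 < b) :
    ContinuousOn (Function.uncurry f) (uIcc s t ×ˢ uIcc a b) :=
  hf.continuousOn_of_subset fun _ hx => lt_of_lt_of_le (lt_min ha hb) hx.1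

lemma JointContinuous.intervalIntegrable {f : ℝ → ℝ → ℝ} (hf : JointContinuous f) (t : ℝ) {a b : ℝ}
    (ha : 0 < a) (hb : 0 < b) : IntervalIntegrable (f t) volume a b :=
  ((hf.space t).mono fun _ hx => lt_of_lt_of_le (lt_min ha hb) hx.1).intervalIntegrable

lemma JointContinuous.continuous_intervalIntegral {f : ℝ → ℝ → ℝ} (hf : JointContinuous f)
    {a b : ℝ} (ha : 0 < a) (hb : 0 < b) : Continuous fun t => ∫ x in a..b, f t x := by
  have hm : 0 < min a b := lt_min ha hb
  have h1 : ∀ t, ∫ x in a..b, f t x = ∫ x in a..b, f t (max x (min a b)) := fun t =>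
    intervalIntegral.integral_congr fun x hx => by
      rw [max_eq_left hx.1]
  simp_rw [h1]
  exact intervalIntegral.continuous_parametric_intervalIntegral_of_continuous'
    (f := fun t x => f t (max x (min a b))) (hf.max_const hm) a b

lemma JointContinuous.swap {f : ℝ → ℝ → ℝ} (hf : JointContinuous f) {s t a b : ℝ}
    (ha : 0 < a) (hb : 0 < b) :
    ∫ τ in s..t, ∫ x in a..b, f τ x = ∫ x in a..b, ∫ τ in s..t, f τ x :=
  intervalIntegral_swap_of_continuousOn (hf.continuousOn_rect ha hb)

/-- Green's identity on a rectangle. -/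
lemma rectangle_identity {A A' B B' : ℝ → ℝ → ℝ}
    (hA : ∀ t x, 0 < x → HasDerivAt (fun t => A t x) (A' t x) t)
    (hB : ∀ t x, 0 < x → HasDerivAt (B t) (B' t x) x)
    (hAc : JointContinuous A) (hBc : JointContinuous B)
    (hA' : JointContinuous A') (hB' : JointContinuous B') (s t : ℝ) {a b : ℝ} (ha : 0 < a)
    (hb : 0 < b) :
    (∫ x in a..b, A t x) - ∫ x in a..b, A s x =
      (∫ τ in s..t, B τ b) - (∫ τ in s..t, B τ a) + ∫ τ in s..t, ∫ x in a..b, (A' τ x - B' τ x) := by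
  have hpos : ∀ x ∈ uIcc a b, 0 < x := fun x hx => lt_of_lt_of_le (lt_min ha hb) hx.1
  have e1 : (∫ x in a..b, A t x) - ∫ x in a..b, A s x = ∫ τ in s..t, ∫ x in a..b, A' τ x := by
    rw [hA'.swap ha hb, ← intervalIntegral.integral_sub (hAc.intervalIntegrable t ha hb)
      (hAc.intervalIntegrable s ha hb)]
    refine intervalIntegral.integral_congr fun x hx => ?_
    exact (intervalIntegral.integral_eq_sub_of_hasDerivAt (fun τ _ => hA τ x (hpos x hx))
      ((hA'.time (hpos x hx)).intervalIntegrable _ _)).symm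
  have e2 : (∫ τ in s..t, B τ b) - (∫ τ in s..t, B τ a) = ∫ τ in s..t, ∫ x in a..b, B' τ x := by
    rw [← intervalIntegral.integral_sub ((hBc.time hb).intervalIntegrable _ _)
      ((hBc.time ha).intervalIntegrable _ _)]
    refine intervalIntegral.integral_congr fun τ _ => ?_
    exact (intervalIntegral.integral_eq_sub_of_hasDerivAt (fun x hx => hB τ x (hpos x hx))
      (hB'.intervalIntegrable τ ha hb)).symm
  rw [e1, e2, ← intervalIntegral.integral_add]
  · refine intervalIntegral.integral_congr fun τ _ => ?_
    rw [intervalIntegral.integral_sub (hA'.intervalIntegrable τ ha hb)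
      (hB'.intervalIntegrable τ ha hb)]
    ring
  · exact (hB'.continuous_intervalIntegral ha hb).intervalIntegrable _ _
  · have : JointContinuous fun τ x => A' τ x - B' τ x := ContinuousOn.sub hA' hB'
    exact (this.continuous_intervalIntegral ha hb).intervalIntegrable _ _

namespace IsRegularSolution

variable {lam : ℝ} {q₀ q : ℝ → ℝ} {u ux ut utt uxt : ℝ → ℝ → ℂ}

/-- The momentum flux. -/
def flux (q : ℝ → ℝ) (u ux ut : ℝ → ℝ → ℂ) (t x : ℝ) : ℝ :=
  1 / 2 * (‖ux t x‖ ^ 2 + ‖ut t x‖ ^ 2 - q x * ‖u t x‖ ^ 2)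

section

variable (hu : IsRegularSolution q u ux ut utt uxt) (hA : IsAdmissible lam q₀ q)
include hu hA

omit hu in
lemma jointContinuous_q : JointContinuous fun _ x => q x :=
  hA.continuousOn.comp continuousOn_snd fun _ hp => hp.2

lemma jointContinuous_energyDensity : JointContinuous (energyDensity q u ux ut) :=
  ((hu.cont_ux.norm.pow 2).add (hu.cont_ut.norm.pow 2)).add
    (ContinuousOn.mul (jointContinuous_q hA) (hu.cont_u.norm.pow 2))

lemma jointContinuous_flux : JointContinuous (flux q u ux ut) :=
  continuousOn_const.mul (((hu.cont_ux.norm.pow 2).add (hu.cont_ut.norm.pow 2)).sub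
    (ContinuousOn.mul (jointContinuous_q hA) (hu.cont_u.norm.pow 2)))

omit hA in
lemma jointContinuous_inner : JointContinuous fun t x => inner ℝ (ut t x) (ux t x) :=
  ContinuousOn.inner (𝕜 := ℝ) hu.cont_ut hu.cont_ux

lemma jointContinuous_morawetz : JointContinuous (morawetzDensity q u) :=
  ContinuousOn.mul ((hA.continuousOn_deriv.comp continuousOn_snd fun _ hp => hp.2).neg.div_const 2)
    (hu.cont_u.norm.pow 2)

omit hA in
lemma hasDerivAt_energyDensity_time (t : ℝ) {x : ℝ} (hx : 0 < x) :
    HasDerivAt (fun t => energyDensity q u ux ut t x)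
      (2 * inner ℝ (ux t x) (uxt t x) + 2 * inner ℝ (ut t x) (utt t x) +
        q x * (2 * inner ℝ (u t x) (ut t x))) t :=
  ((hu.hasDerivAt_xt t x hx).norm_sq.add (hu.hasDerivAt_tt t x hx).norm_sq).add
    ((hu.hasDerivAt_t t x hx).norm_sq.const_mul (q x))

omit hA in
lemma hasDerivAt_inner_time (t : ℝ) {x : ℝ} (hx : 0 < x) :
    HasDerivAt (fun t => inner ℝ (ut t x) (ux t x))
      (inner ℝ (ut t x) (uxt t x) + inner ℝ (utt t x) (ux t x)) t :=
  (hu.hasDerivAt_tt t x hx).inner ℝ (hu.hasDerivAt_xt t x hx)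

omit hA in
lemma hasDerivAt_inner_space (t : ℝ) {x : ℝ} (hx : 0 < x) :
    HasDerivAt (fun x => inner ℝ (ut t x) (ux t x))
      (inner ℝ (ut t x) (utt t x) + q x * inner ℝ (ut t x) (u t x) +
        inner ℝ (uxt t x) (ux t x)) x := by
  refine ((hu.hasDerivAt_tx t x hx).inner ℝ (hu.hasDerivAt_xx t x hx)).congr_deriv ?_
  rw [inner_add_right, ← Complex.real_smul, real_inner_smul_right]

/-- Differentiating `-q|u|²/2` produces the Morawetz density from `q'`, while its other part cancels
the contribution of `q u` in `u_xx`. What remains is the time derivative of the momentum density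
plus `M`. -/
lemma hasDerivAt_flux (t : ℝ) {x : ℝ} (hx : 0 < x) :
    HasDerivAt (flux q u ux ut t) (inner ℝ (ux t x) (utt t x) + inner ℝ (ut t x) (uxt t x) +
      morawetzDensity q u t x) x := by
  have h1 := ((hu.hasDerivAt_xx t x hx).norm_sq.add (hu.hasDerivAt_tx t x hx).norm_sq).sub
    ((hA.hasDerivAt hx).mul (hu.hasDerivAt_x t x hx).norm_sq)
  refine (h1.const_mul (1 / 2)).congr_deriv ?_
  rw [inner_add_right, ← Complex.real_smul, real_inner_smul_right, morawetzDensity,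
    real_inner_comm (u t x) (ux t x)]
  ring

/-- The weighted energy identity on a rectangle. -/
lemma energy_identity {g g' : ℝ → ℝ} (hg : ∀ y, HasDerivAt g (g' y) y) (hg' : Continuous g')
    (s t : ℝ) {a b : ℝ} (ha : 0 < a) (hb : 0 < b) :
    (∫ x in a..b, g (x - t) * energyDensity q u ux ut t x) -
        ∫ x in a..b, g (x - s) * energyDensity q u ux ut s x =
      (∫ τ in s..t, g (b - τ) * (2 * inner ℝ (ut τ b) (ux τ b))) -
        (∫ τ in s..t, g (a - τ) * (2 * inner ℝ (ut τ a) (ux τ a))) +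
        ∫ τ in s..t, ∫ x in a..b, -(2 * (g' (x - τ) * inwardDensity q u ux ut τ x)) := by
  have hgc : Continuous g := continuous_iff_continuousAt.2 fun y => (hg y).continuousAt
  have jg : JointContinuous fun t x : ℝ => g (x - t) :=
    (hgc.comp (by fun_prop : Continuous fun p : ℝ × ℝ => p.2 - p.1)).continuousOn
  have jg' : JointContinuous fun t x : ℝ => g' (x - t) :=
    (hg'.comp (by fun_prop : Continuous fun p : ℝ × ℝ => p.2 - p.1)).continuousOn
  have hgt : ∀ t x : ℝ, HasDerivAt (fun t => g (x - t)) (-g' (x - t)) t := fun t x => by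
    simpa [Function.comp_def] using (hg (x - t)).comp t ((hasDerivAt_id t).const_sub x)
  have hgx : ∀ t x : ℝ, HasDerivAt (fun x => g (x - t)) (g' (x - t)) x := fun t x => by
    simpa [Function.comp_def] using (hg (x - t)).comp x ((hasDerivAt_id x).sub_const t)
  have je := hu.jointContinuous_energyDensity hA
  have ji := hu.jointContinuous_inner
  have j1 : JointContinuous fun t x => 2 * inner ℝ (ux t x) (uxt t x) +
      2 * inner ℝ (ut t x) (utt t x) + q x * (2 * inner ℝ (u t x) (ut t x)) :=
    ((continuousOn_const.mul (ContinuousOn.inner (𝕜 := ℝ) hu.cont_ux hu.cont_uxt)).add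
      (continuousOn_const.mul (ContinuousOn.inner (𝕜 := ℝ) hu.cont_ut hu.cont_utt))).add
      (ContinuousOn.mul (jointContinuous_q hA)
        (continuousOn_const.mul (ContinuousOn.inner (𝕜 := ℝ) hu.cont_u hu.cont_ut)))
  have j2 : JointContinuous fun t x => 2 * (inner ℝ (ut t x) (utt t x) +
      q x * inner ℝ (ut t x) (u t x) + inner ℝ (uxt t x) (ux t x)) :=
    continuousOn_const.mul (((ContinuousOn.inner (𝕜 := ℝ) hu.cont_ut hu.cont_utt).add
      (ContinuousOn.mul (jointContinuous_q hA) (ContinuousOn.inner (𝕜 := ℝ) hu.cont_ut hu.cont_u))).add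
      (ContinuousOn.inner (𝕜 := ℝ) hu.cont_uxt hu.cont_ux))
  rw [rectangle_identity (A := fun t x => g (x - t) * energyDensity q u ux ut t x)
    (B := fun t x => g (x - t) * (2 * inner ℝ (ut t x) (ux t x)))
    (fun t x hx => (hgt t x).mul (hu.hasDerivAt_energyDensity_time t hx))
    (fun t x hx => (hgx t x).mul ((hu.hasDerivAt_inner_space t hx).const_mul 2))
    (ContinuousOn.mul jg je) (ContinuousOn.mul jg (continuousOn_const.mul ji))
    (ContinuousOn.add (ContinuousOn.mul jg'.neg je) (ContinuousOn.mul jg j1))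
    (ContinuousOn.add (ContinuousOn.mul jg' (continuousOn_const.mul ji)) (ContinuousOn.mul jg j2))
    s t ha hb]
  -- The terms with `g` cancel by `e_t = (2p)_x`, and those with `g'` combine to `-g'(e + 2p) = -2
  -- g' e₋`.
  congr 1
  refine intervalIntegral.integral_congr fun τ _ => intervalIntegral.integral_congr fun x _ => ?_
  rw [inwardDensity_eq, real_inner_comm (ux τ x) (uxt τ x), real_inner_comm (ut τ x) (u τ x)]
  ring

/-- The momentum identity on a rectangle. -/
lemma momentum_identity (s t : ℝ) {a b : ℝ} (ha : 0 < a) (hb : 0 < b) :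
    (∫ x in a..b, inner ℝ (ut t x) (ux t x)) - ∫ x in a..b, inner ℝ (ut s x) (ux s x) =
      (∫ τ in s..t, flux q u ux ut τ b) - (∫ τ in s..t, flux q u ux ut τ a) -
        ∫ τ in s..t, ∫ x in a..b, morawetzDensity q u τ x := by
  have jm := hu.jointContinuous_morawetz hA
  rw [rectangle_identity (A := fun t x => inner ℝ (ut t x) (ux t x))
    (B := flux q u ux ut) (fun t x hx => hu.hasDerivAt_inner_time t hx)
    (fun t x hx => hu.hasDerivAt_flux hA t hx) hu.jointContinuous_inner
    (hu.jointContinuous_flux hA)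
    (ContinuousOn.add (ContinuousOn.inner (𝕜 := ℝ) hu.cont_ut hu.cont_uxt)
      (ContinuousOn.inner (𝕜 := ℝ) hu.cont_utt hu.cont_ux))
    (ContinuousOn.add (ContinuousOn.add (ContinuousOn.inner (𝕜 := ℝ) hu.cont_ux hu.cont_utt)
      (ContinuousOn.inner (𝕜 := ℝ) hu.cont_ut hu.cont_uxt)) jm) s t ha hb,
      sub_eq_add_neg (_ - _), ← intervalIntegral.integral_neg]
  congr 1
  refine intervalIntegral.integral_congr fun τ _ => ?_
  rw [← intervalIntegral.integral_neg]
  refine intervalIntegral.integral_congr fun x _ => ?_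
  rw [real_inner_comm (ux τ x) (utt τ x)]
  ring

end

end IsRegularSolution

end

end HalfLineWave

/-! ### Energy conservation and Morawetz inequalities for regular solutions. -/

namespace HalfLineWave

noncomputable section

namespace IsRegularSolution

variable {lam : ℝ} {q₀ q : ℝ → ℝ} {u ux ut utt uxt : ℝ → ℝ → ℂ}

/-- `h` is the boundary derivative of the regular solution `u`. -/
structure IsTrace (q : ℝ → ℝ) (u ux ut : ℝ → ℝ → ℂ) (h : ℝ → ℂ) : Prop where
  continuous : Continuous h
  slope : ∀ t, HasDerivWithinAt (u t) (h t) (Ici 0) 0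
  tendsto : ∀ t, Tendsto (ux t) (𝓝[>] 0) (𝓝 (h t))
  uniform : ∀ T ε, 0 < ε → ∃ δ, 0 < δ ∧ ∀ t, |t| ≤ T → ∀ x, 0 < x → x ≤ δ →
    ‖ux t x - h t‖ ≤ ε ∧ q x * ‖u t x‖ ^ 2 ≤ ε ∧ ‖ut t x‖ ≤ ε

lemma exists_isTrace (hu : IsRegularSolution q u ux ut utt uxt) (hA : IsAdmissible lam q₀ q) :
    ∃ h, IsTrace q u ux ut h := by
  obtain ⟨h, h1, h2, h3, h4⟩ := hu.exists_trace hA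
  exact ⟨h, h1, h2, h3, h4⟩

/-- Near `x = 0`, uniformly on compact time intervals, `u_x` is close to the trace while `u_t` and
`q|u|²` are small. So the energy flux vanishes at the boundary and the momentum flux becomes half
the squared trace. -/
lemma IsTrace.near_boundary {h : ℝ → ℂ} (hh : IsTrace q u ux ut h) (hq : ∀ x, 0 < x → 0 ≤ q x)
    (T : ℝ) {ε : ℝ} (hε : 0 < ε) : ∃ δ, 0 < δ ∧ ∀ t, |t| ≤ T → ∀ x, 0 < x → x ≤ δ →
      |inner ℝ (ut t x) (ux t x)| ≤ ε ∧ |flux q u ux ut t x - 1 / 2 * ‖h t‖ ^ 2| ≤ ε := by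
  obtain ⟨H, hH⟩ := (isCompact_Icc (a := -T) (b := T)).bddAbove_image hh.continuous.norm.continuousOn
  set H' := max H 0
  have hH0 : 0 ≤ H' := le_max_right _ _
  set η := min 1 (ε / (H' + 2)) with hη
  have hη0 : 0 < η := by positivity
  have hη1 : η ≤ 1 := min_le_left _ _
  have hη2 : η * (H' + 2) ≤ ε := by
    have := min_le_right 1 (ε / (H' + 2))
    rwa [le_div_iff₀ (by positivity)] at this
  obtain ⟨δ, hδ, h1⟩ := hh.uniform T η hη0
  refine ⟨δ, hδ, fun t ht x hx hxd => ?_⟩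
  obtain ⟨a1, a2, a3⟩ := h1 t ht x hx hxd
  have hht : ‖h t‖ ≤ H' := (hH (mem_image_of_mem _ (abs_le.1 ht))).trans (le_max_left _ _)
  have b1 : ‖ux t x‖ ≤ ‖h t‖ + η := by
    have := norm_add_le (ux t x - h t) (h t)
    rw [sub_add_cancel] at this; linarith
  have b2 : ‖h t‖ ≤ ‖ux t x‖ + η := by
    have := norm_sub_le (ux t x) (ux t x - h t)
    rw [sub_sub_cancel] at this; linarith
  have hn := norm_nonneg (h t)
  have hn' := norm_nonneg (ux t x)
  have hn'' := norm_nonneg (ut t x)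
  have hq0 : 0 ≤ q x * ‖u t x‖ ^ 2 := mul_nonneg (hq x hx) (sq_nonneg _)
  constructor
  · refine (abs_real_inner_le_norm _ _).trans ?_
    calc ‖ut t x‖ * ‖ux t x‖ ≤ η * (H' + 1) := by gcongr; linarith
      _ ≤ ε := by nlinarith
  · have c1 : ‖ux t x‖ ^ 2 - ‖h t‖ ^ 2 ≤ η * (2 * H' + 1) := by nlinarith
    have c2 : ‖h t‖ ^ 2 - ‖ux t x‖ ^ 2 ≤ η * (2 * H' + 1) := by nlinarith
    have c3 : ‖ut t x‖ ^ 2 ≤ η := by nlinarith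
    have c4 := sq_nonneg ‖ut t x‖
    rw [flux, abs_le]
    constructor <;> nlinarith

variable (hu : IsRegularSolution q u ux ut utt uxt) (hA : IsAdmissible lam q₀ q)
include hu hA

lemma tendsto_flux_zero {h : ℝ → ℂ} (hh : IsTrace q u ux ut h) (s t : ℝ) :
    Tendsto (fun a => ∫ τ in s..t, flux q u ux ut τ a) (𝓝[>] 0)
      (𝓝 (∫ τ in s..t, 1 / 2 * ‖h τ‖ ^ 2)) := by
  rw [Metric.tendsto_nhdsWithin_nhds]
  intro ε hε
  obtain ⟨δ, hδ, h1⟩ := hh.near_boundary hA.nonneg (max |s| |t|) (ε := ε / (2 * (|t - s| + 1)))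
    (by positivity)
  refine ⟨δ, hδ, fun x hx hxd => ?_⟩
  have hx0 : 0 < x := hx
  rw [Real.dist_eq, sub_zero, abs_of_pos hx0] at hxd
  rw [dist_eq_norm, ← intervalIntegral.integral_sub
    (((hu.jointContinuous_flux hA).time hx0).intervalIntegrable _ _)
    ((by have := hh.continuous; fun_prop : Continuous fun τ => 1 / 2 * ‖h τ‖ ^ 2).intervalIntegrable
      _ _)]
  have h2 : ‖∫ τ in s..t, (flux q u ux ut τ x - 1 / 2 * ‖h τ‖ ^ 2)‖ ≤
      ε / (2 * (|t - s| + 1)) * |t - s| := by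
    refine intervalIntegral.norm_integral_le_of_norm_le_const fun τ hτ => ?_
    refine (h1 τ ?_ x hx0 hxd.le).2
    rw [uIoc, mem_Ioc] at hτ
    rcases le_total s t with hst | hst
    · rw [min_eq_left hst, max_eq_right hst] at hτ
      exact abs_le_max_abs_abs hτ.1.le hτ.2
    · rw [min_eq_right hst, max_eq_left hst] at hτ
      rw [max_comm]
      exact abs_le_max_abs_abs hτ.1.le hτ.2
  refine h2.trans_lt ?_
  rw [div_mul_eq_mul_div, div_lt_iff₀ (by positivity)]
  nlinarith [abs_nonneg (t - s)]

lemma tendsto_inner_zero {g : ℝ → ℝ} (hg : ∀ y, |g y| ≤ 1) (s t : ℝ) :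
    Tendsto (fun a => ∫ τ in s..t, g (a - τ) * (2 * inner ℝ (ut τ a) (ux τ a))) (𝓝[>] 0)
      (𝓝 0) := by
  obtain ⟨h, hh⟩ := hu.exists_isTrace hA
  rw [Metric.tendsto_nhdsWithin_nhds]
  intro ε hε
  obtain ⟨δ, hδ, h1⟩ := hh.near_boundary hA.nonneg (max |s| |t|) (ε := ε / (4 * (|t - s| + 1)))
    (by positivity)
  refine ⟨δ, hδ, fun x hx hxd => ?_⟩
  have hx0 : 0 < x := hx
  rw [Real.dist_eq, sub_zero, abs_of_pos hx0] at hxd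
  rw [dist_zero_right]
  have h2 : ‖∫ τ in s..t, g (x - τ) * (2 * inner ℝ (ut τ x) (ux τ x))‖ ≤
      1 * (2 * (ε / (4 * (|t - s| + 1)))) * |t - s| := by
    refine intervalIntegral.norm_integral_le_of_norm_le_const fun τ hτ => ?_
    rw [Real.norm_eq_abs, abs_mul, abs_mul, abs_two]
    have h3 : |inner ℝ (ut τ x) (ux τ x)| ≤ ε / (4 * (|t - s| + 1)) := by
      refine (h1 τ ?_ x hx0 hxd.le).1
      rw [uIoc, mem_Ioc] at hτ
      rcases le_total s t with hst | hst
      · rw [min_eq_left hst, max_eq_right hst] at hτ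
        exact abs_le_max_abs_abs hτ.1.le hτ.2
      · rw [min_eq_right hst, max_eq_left hst] at hτ
        rw [max_comm]
        exact abs_le_max_abs_abs hτ.1.le hτ.2
    have := hg (x - τ)
    gcongr
  refine h2.trans_lt ?_
  have : 1 * (2 * (ε / (4 * (|t - s| + 1)))) * |t - s| = ε * |t - s| / (2 * (|t - s| + 1)) := by
    field_simp; norm_num
  rw [this, div_lt_iff₀ (by positivity)]
  nlinarith [abs_nonneg (t - s)]

omit hA in
lemma exists_energy_le (hq : ∀ x, 0 < x → 0 ≤ q x) (s t : ℝ) :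
    ∃ K, 0 ≤ K ∧ ∀ τ ∈ Icc s t, energy q u ux ut τ ≤ K := by
  obtain ⟨K, hK⟩ := (isCompact_Icc (a := s) (b := t)).bddAbove_image
    (hu.sol.continuous_energy hq).continuousOn
  exact ⟨max K 0, le_max_right _ _, fun τ hτ => (hK (mem_image_of_mem _ hτ)).trans (le_max_left _ _)⟩

/-- An averaging argument: if every far point carried at least `ε`, a window of length `R = ((t - s)
K + 1) / ε` would carry more than the energy bound `K` allows over the time interval. -/
lemma exists_far {s t : ℝ} (hst : s ≤ t) (N : ℝ) {ε : ℝ} (hε : 0 < ε) :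
    ∃ b, N ≤ b ∧ ∫ τ in s..t, energyDensity q u ux ut τ b < ε := by
  by_contra hcon
  push Not at hcon
  obtain ⟨K, hK, hE⟩ := hu.exists_energy_le hA.nonneg s t
  have je := hu.jointContinuous_energyDensity hA
  set c := max N 1
  have hc : 0 < c := lt_max_of_lt_right one_pos
  set R := ((t - s) * K + 1) / ε
  have hR : 0 ≤ R := by have := sub_nonneg.2 hst; positivity
  have h1 : ∫ τ in s..t, ∫ x in c..(c + R), energyDensity q u ux ut τ x ≤ ∫ _ in s..t, K := by
    refine intervalIntegral.integral_mono_on hst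
      ((je.continuous_intervalIntegral hc (by linarith)).intervalIntegrable _ _)
      (by simp) fun τ hτ => ?_
    exact (hu.sol.intervalIntegral_energyDensity_le hA.nonneg τ hc.le (by linarith)).trans (hE τ hτ)
  rw [je.swap hc (by linarith)] at h1
  have h2 : ∫ _ in c..(c + R), ε ≤ ∫ x in c..(c + R), ∫ τ in s..t, energyDensity q u ux ut τ x := by
    refine intervalIntegral.integral_mono_on (by linarith) (by simp) ?_ fun x hx => ?_
    · have hpos : ∀ x ∈ uIcc c (c + R), 0 < x := fun x hx =>
        lt_of_lt_of_le (lt_min hc (by linarith)) hx.1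
      have hm : ∀ x ∈ uIcc c (c + R), ∫ τ in s..t, energyDensity q u ux ut τ x =
          ∫ τ in s..t, energyDensity q u ux ut τ (max x c) := fun x hx => by
        rw [uIcc_of_le (by linarith)] at hx
        rw [max_eq_left hx.1]
      have hcont : Continuous fun x => ∫ τ in s..t, energyDensity q u ux ut τ (max x c) :=
        intervalIntegral.continuous_parametric_intervalIntegral_of_continuous'
          (f := fun x τ => energyDensity q u ux ut τ (max x c))
          ((je.max_const hc).comp continuous_swap) s t
      exact (hcont.continuousOn.congr hm).intervalIntegrable
    · exact hcon x ((le_max_left _ _).trans hx.1)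
  simp only [intervalIntegral.integral_const, smul_eq_mul, add_sub_cancel_left] at h1 h2
  have h3 : R * ε = (t - s) * K + 1 := by simp only [R]; field_simp
  linarith

/-- Pointwise decay at infinity is not available, so the right endpoints are chosen along a sequence
on which all fluxes, being bounded by the energy density, tend to zero. The sequence depends on `s`
and `t`. -/
lemma exists_exhaustion {s t : ℝ} (hst : s ≤ t) : ∃ a b : ℕ → ℝ, (∀ n, 0 < a n) ∧
    (∀ n, a n ≤ b n) ∧ Tendsto a atTop (𝓝[>] 0) ∧ Tendsto b atTop atTop ∧
    Tendsto (fun n => ∫ τ in s..t, energyDensity q u ux ut τ (b n)) atTop (𝓝 0) := by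
  have h1 : ∀ n : ℕ, ∃ b : ℝ, (n : ℝ) + 1 ≤ b ∧
      ∫ τ in s..t, energyDensity q u ux ut τ b < 1 / ((n : ℝ) + 1) := fun n =>
    hu.exists_far hA hst _ (by positivity)
  choose b hb1 hb2 using h1
  have hn : ∀ n : ℕ, (0 : ℝ) ≤ n := fun n => n.cast_nonneg
  have h0 : Tendsto (fun n : ℕ => 1 / ((n : ℝ) + 1)) atTop (𝓝 0) :=
    tendsto_one_div_add_atTop_nhds_zero_nat
  refine ⟨fun n => 1 / ((n : ℝ) + 1), b, fun n => by positivity, fun n => ?_, ?_, ?_, ?_⟩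
  · have : 1 / ((n : ℝ) + 1) ≤ 1 := by
      rw [div_le_one (by positivity)]; linarith [hn n]
    linarith [hb1 n, hn n]
  · exact tendsto_nhdsWithin_iff.2 ⟨h0, Eventually.of_forall fun n => by
      simp only [mem_Ioi]; positivity⟩
  · exact tendsto_atTop_mono (fun n => by linarith [hb1 n]) tendsto_natCast_atTop_atTop
  · refine squeeze_zero (fun n => ?_) (fun n => (hb2 n).le) h0
    exact intervalIntegral.integral_nonneg hst fun τ _ =>
      energyDensity_nonneg (hA.nonneg _ (by linarith [hb1 n, hn n])) _ _ _ _

omit hu hA in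
lemma abs_integral_le_of_le {f e : ℝ → ℝ} {s t : ℝ} (hst : s ≤ t) (he : Continuous e)
    (h : ∀ τ, |f τ| ≤ e τ) : |∫ τ in s..t, f τ| ≤ ∫ τ in s..t, e τ := by
  rw [← Real.norm_eq_abs]
  exact intervalIntegral.norm_integral_le_of_norm_le hst
    (Eventually.of_forall fun τ _ => (Real.norm_eq_abs (f τ)).le.trans (h τ))
    (he.intervalIntegrable _ _)

/-- Monotonicity of the energy weighted by an outgoing weight. -/
lemma weighted_energy {g g' : ℝ → ℝ} {L : ℝ} (hg : ∀ y, HasDerivAt g (g' y) y)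
    (hg' : Continuous g') (hg1 : ∀ y, |g y| ≤ 1) (hg0 : ∀ y, 0 ≤ g' y) (hgL : ∀ y, g' y ≤ L)
    {s t δ : ℝ} (hst : s ≤ t) (hδ : ∀ τ ∈ Icc s t, inwardEnergy q u ux ut τ ≤ δ) :
    (∫ x in Ioi (0 : ℝ), g (x - t) * energyDensity q u ux ut t x) ≤
      ∫ x in Ioi (0 : ℝ), g (x - s) * energyDensity q u ux ut s x ∧
    (∫ x in Ioi (0 : ℝ), g (x - s) * energyDensity q u ux ut s x) - 2 * L * δ * (t - s) ≤
      ∫ x in Ioi (0 : ℝ), g (x - t) * energyDensity q u ux ut t x := by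
  have hgc : Continuous g := continuous_iff_continuousAt.2 fun y => (hg y).continuousAt
  have hL : 0 ≤ L := (hg0 0).trans (hgL 0)
  obtain ⟨a, b, ha, hab, ha0, hb, hfar⟩ := hu.exists_exhaustion hA hst
  have ha0' := (tendsto_nhdsWithin_iff.1 ha0).1
  have je := hu.jointContinuous_energyDensity hA
  have hint : ∀ t, IntegrableOn (fun x => g (x - t) * energyDensity q u ux ut t x) (Ioi 0) :=
    fun t => Integrable.bdd_mul (c := 1) (hu.sol.integrableOn_energyDensity hA.nonneg t)
      (hgc.comp (by fun_prop : Continuous fun x : ℝ => x - t)).aestronglyMeasurable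
      (Eventually.of_forall fun x => hg1 _)
  have l1 := (tendsto_intervalIntegral_Ioi_zero (hint t) ha hab ha0' hb).sub
    (tendsto_intervalIntegral_Ioi_zero (hint s) ha hab ha0' hb)
  have hbpos : ∀ n, 0 < b n := fun n => (ha n).trans_le (hab n)
  have l2 : Tendsto (fun n => ∫ τ in s..t, g (b n - τ) * (2 * inner ℝ (ut τ (b n)) (ux τ (b n))))
      atTop (𝓝 0) := by
    refine squeeze_zero_norm (fun n => ?_) hfar
    refine abs_integral_le_of_le hst (je.time (hbpos n)) fun τ => ?_
    rw [abs_mul, abs_mul, abs_two]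
    have h1 := abs_inner_le_energyDensity (hA.nonneg _ (hbpos n)) u ux ut τ
    have h2 := hg1 (b n - τ)
    have h3 := abs_nonneg (inner ℝ (ut τ (b n)) (ux τ (b n)))
    nlinarith
  have l3 := (hu.tendsto_inner_zero hA hg1 s t).comp ha0
  have l4 := l1.sub (l2.sub l3)
  rw [sub_zero, sub_zero] at l4
  have ji : JointContinuous fun τ x => -(2 * (g' (x - τ) * inwardDensity q u ux ut τ x)) := by
    have jg' : JointContinuous fun t x : ℝ => g' (x - t) :=
      (hg'.comp (by fun_prop : Continuous fun p : ℝ × ℝ => p.2 - p.1)).continuousOn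
    have : JointContinuous (inwardDensity q u ux ut) := by
      have h1 : JointContinuous fun t x => energyDensity q u ux ut t x / 2 +
          inner ℝ (ut t x) (ux t x) := ContinuousOn.add (ContinuousOn.div_const je 2)
            hu.jointContinuous_inner
      exact ContinuousOn.congr h1 fun p _ => inwardDensity_eq _ _ _ _ _ _
    exact (continuousOn_const.mul (ContinuousOn.mul jg' this)).neg
  -- By `energy_identity` the quantity in the middle is minus twice the space-time integral of `g'
  -- e₋`, where `0 ≤ g' ≤ L` and `∫ e₋ ≤ δ`.
  have bnd : ∀ n, -(2 * L * δ * (t - s)) ≤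
      (∫ x in (a n)..(b n), g (x - t) * energyDensity q u ux ut t x) -
        (∫ x in (a n)..(b n), g (x - s) * energyDensity q u ux ut s x) -
      ((∫ τ in s..t, g (b n - τ) * (2 * inner ℝ (ut τ (b n)) (ux τ (b n)))) -
        ∫ τ in s..t, g (a n - τ) * (2 * inner ℝ (ut τ (a n)) (ux τ (a n)))) ∧
      (∫ x in (a n)..(b n), g (x - t) * energyDensity q u ux ut t x) -
        (∫ x in (a n)..(b n), g (x - s) * energyDensity q u ux ut s x) -
      ((∫ τ in s..t, g (b n - τ) * (2 * inner ℝ (ut τ (b n)) (ux τ (b n)))) -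
        ∫ τ in s..t, g (a n - τ) * (2 * inner ℝ (ut τ (a n)) (ux τ (a n)))) ≤ 0 := by
    intro n
    rw [hu.energy_identity hA hg hg' s t (ha n) (hbpos n), add_sub_cancel_left]
    have hdens : ∀ τ, ∀ x ∈ Icc (a n) (b n), 0 ≤ inwardDensity q u ux ut τ x := fun τ x hx =>
      inwardDensity_nonneg (hA.nonneg x ((ha n).trans_le hx.1)) _ _ _ _
    constructor
    · have h1 : ∫ _ in s..t, -(2 * L * δ) ≤ ∫ τ in s..t, ∫ x in (a n)..(b n),
          -(2 * (g' (x - τ) * inwardDensity q u ux ut τ x)) := by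
        refine intervalIntegral.integral_mono_on hst (by simp)
          ((ji.continuous_intervalIntegral (ha n) (hbpos n)).intervalIntegrable _ _) fun τ hτ => ?_
        have hii : IntervalIntegrable (inwardDensity q u ux ut τ) volume (a n) (b n) :=
          ⟨(hu.sol.integrableOn_inwardDensity hA.nonneg τ).mono_set (Ioc_subset_Ioi_zero (ha n).le),
          (hu.sol.integrableOn_inwardDensity hA.nonneg τ).mono_set
            (Ioc_subset_Ioi_zero (hbpos n).le)⟩
        have h2 : ∫ x in (a n)..(b n), -(2 * L * inwardDensity q u ux ut τ x) ≤
            ∫ x in (a n)..(b n), -(2 * (g' (x - τ) * inwardDensity q u ux ut τ x)) := by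
          refine intervalIntegral.integral_mono_on (hab n) (hii.const_mul (2 * L)).neg
            (ji.intervalIntegrable τ (ha n) (hbpos n)) fun x hx => ?_
          have h3 := mul_le_mul_of_nonneg_right (hgL (x - τ)) (hdens τ x hx)
          linarith
        refine le_trans ?_ h2
        rw [intervalIntegral.integral_neg, intervalIntegral.integral_const_mul, neg_le_neg_iff]
        have h4 : ∫ x in (a n)..(b n), inwardDensity q u ux ut τ x ≤ inwardEnergy q u ux ut τ := by
          rw [intervalIntegral.integral_of_le (hab n)]
          exact setIntegral_mono_set (hu.sol.integrableOn_inwardDensity hA.nonneg τ)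
            ((ae_restrict_iff' measurableSet_Ioi).2 (Eventually.of_forall fun x hx =>
              inwardDensity_nonneg (hA.nonneg x hx) _ _ _ _))
            (LE.le.eventuallyLE (Ioc_subset_Ioi_zero (ha n).le))
        have := h4.trans (hδ τ hτ)
        gcongr
      refine le_trans (le_of_eq ?_) h1
      rw [intervalIntegral.integral_const, smul_eq_mul]; ring
    · have h1 : 0 ≤ ∫ τ in s..t, -∫ x in (a n)..(b n),
          -(2 * (g' (x - τ) * inwardDensity q u ux ut τ x)) := by
        refine intervalIntegral.integral_nonneg hst fun τ _ => ?_
        rw [← intervalIntegral.integral_neg]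
        refine intervalIntegral.integral_nonneg (hab n) fun x hx => ?_
        have := mul_nonneg (hg0 (x - τ)) (hdens τ x hx)
        linarith
      rw [intervalIntegral.integral_neg] at h1
      linarith
  constructor
  · have := le_of_tendsto' l4 fun n => (bnd n).2
    linarith
  · have := ge_of_tendsto' l4 fun n => (bnd n).1
    linarith

/-- The constant weight has derivative zero, so `L = 0` is allowed and both inequalities of
`weighted_energy` become the same equality. -/
theorem energy_const (s t : ℝ) : energy q u ux ut s = energy q u ux ut t := by
  have key : ∀ s t, s ≤ t → energy q u ux ut s = energy q u ux ut t := by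
    intro s t hst
    obtain ⟨K, hK, hE⟩ := hu.exists_energy_le hA.nonneg s t
    have h1 := hu.weighted_energy hA (g := fun _ => 1) (g' := fun _ => 0) (L := 0) (δ := K)
      (fun y => hasDerivAt_const _ _) continuous_const (by simp) (by simp) (by simp) hst
      (fun τ hτ => by
        refine le_trans ?_ (hE τ hτ)
        exact setIntegral_mono_on (hu.sol.integrableOn_inwardDensity hA.nonneg τ)
          (hu.sol.integrableOn_energyDensity hA.nonneg τ) measurableSet_Ioi fun x hx =>
          inwardDensity_le (hA.nonneg x hx) _ _ _ _)
    simp only [one_mul] at h1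
    rw [energy, energy]
    linarith [h1.1, h1.2]
  rcases le_total s t with h | h
  · exact key s t h
  · exact (key t s h).symm

omit hA in
lemma abs_momentum_le (hq : ∀ x, 0 < x → 0 ≤ q x) (t : ℝ) :
    |momentum ux ut t| ≤ energy q u ux ut t / 2 := by
  rw [momentum, energy, ← integral_div]
  refine (abs_integral_le_integral_abs).trans ?_
  exact setIntegral_mono_on (hu.sol.integrableOn_inner t).abs
    ((hu.sol.integrableOn_energyDensity hq t).div_const 2) measurableSet_Ioi fun x hx =>
    abs_inner_le_energyDensity (hq x hx) _ _ _ _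

omit hu in
lemma morawetzDensity_nonneg (u : ℝ → ℝ → ℂ) (t : ℝ) {x : ℝ} (hx : 0 < x) :
    0 ≤ morawetzDensity q u t x := by
  have := hA.deriv_neg hx
  rw [morawetzDensity]
  exact mul_nonneg (by linarith) (sq_nonneg _)

/-- The Morawetz identity on a finite time interval, with the space integral exhausted. -/
lemma exists_morawetz {h : ℝ → ℂ} (hh : IsTrace q u ux ut h) {s t : ℝ} (hst : s ≤ t) :
    ∃ a b : ℕ → ℝ, (∀ n, 0 < a n) ∧
    (∀ n, a n ≤ b n) ∧ Tendsto a atTop (𝓝[>] 0) ∧ Tendsto b atTop atTop ∧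
    Tendsto (fun n => ∫ τ in s..t, ∫ x in (a n)..(b n), morawetzDensity q u τ x) atTop
      (𝓝 (momentum ux ut s - momentum ux ut t - ∫ τ in s..t, 1 / 2 * ‖h τ‖ ^ 2)) := by
  obtain ⟨a, b, ha, hab, ha0, hb, hfar⟩ := hu.exists_exhaustion hA hst
  refine ⟨a, b, ha, hab, ha0, hb, ?_⟩
  have ha0' := (tendsto_nhdsWithin_iff.1 ha0).1
  have hbpos : ∀ n, 0 < b n := fun n => (ha n).trans_le (hab n)
  have je := hu.jointContinuous_energyDensity hA
  have l1 := (tendsto_intervalIntegral_Ioi_zero (hu.sol.integrableOn_inner s) ha hab ha0' hb).sub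
    (tendsto_intervalIntegral_Ioi_zero (hu.sol.integrableOn_inner t) ha hab ha0' hb)
  have l2 : Tendsto (fun n => ∫ τ in s..t, flux q u ux ut τ (b n)) atTop (𝓝 0) := by
    refine squeeze_zero_norm (fun n => ?_) hfar
    refine abs_integral_le_of_le hst (je.time (hbpos n)) fun τ => ?_
    have h0 := mul_nonneg (hA.nonneg _ (hbpos n)) (sq_nonneg ‖u τ (b n)‖)
    rw [flux, energyDensity, abs_le]
    constructor <;> nlinarith [sq_nonneg ‖ux τ (b n)‖, sq_nonneg ‖ut τ (b n)‖]
  have l3 := (hu.tendsto_flux_zero hA hh s t).comp ha0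
  have l4 := (l1.add l2).sub l3
  rw [add_zero] at l4
  refine l4.congr fun n => ?_
  have := hu.momentum_identity hA s t (ha n) (hbpos n)
  simp only [Function.comp_apply]
  linarith

lemma integral_morawetz_mono {s t : ℝ} (hst : s ≤ t) {a b a' b' : ℝ} (ha : 0 < a') (haa : a' ≤ a)
    (hab : a ≤ b) (hbb : b ≤ b') :
    ∫ τ in s..t, ∫ x in a..b, morawetzDensity q u τ x ≤
      ∫ τ in s..t, ∫ x in a'..b', morawetzDensity q u τ x := by
  have jm := hu.jointContinuous_morawetz hA
  have ha0 : 0 < a := ha.trans_le haa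
  have hb0 : 0 < b := ha0.trans_le hab
  refine intervalIntegral.integral_mono_on hst
    ((jm.continuous_intervalIntegral ha0 hb0).intervalIntegrable _ _)
    ((jm.continuous_intervalIntegral ha (hb0.trans_le hbb)).intervalIntegrable _ _) fun τ _ => ?_
  refine intervalIntegral.integral_mono_interval haa hab hbb ?_
    (jm.intervalIntegrable τ ha (hb0.trans_le hbb))
  refine (ae_restrict_iff' measurableSet_Ioc).2 (Eventually.of_forall fun x hx => ?_)
  exact morawetzDensity_nonneg hA u τ (ha.trans hx.1)

/-- Because `M ≥ 0`, a fixed rectangle lies inside the exhausting ones eventually and contributes no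
more than their limit. -/
lemma morawetz_le {h : ℝ → ℂ} (hh : IsTrace q u ux ut h) {s t : ℝ} (hst : s ≤ t) {a b : ℝ}
    (ha : 0 < a) (hab : a ≤ b) :
    (∫ τ in s..t, 1 / 2 * ‖h τ‖ ^ 2) + ∫ τ in s..t, ∫ x in a..b, morawetzDensity q u τ x ≤
      momentum ux ut s - momentum ux ut t := by
  obtain ⟨a', b', ha', hab', ha0, hb, hl⟩ := hu.exists_morawetz hA hh hst
  have ha0' := (tendsto_nhdsWithin_iff.1 ha0).1
  have := ge_of_tendsto hl (b := ∫ τ in s..t, ∫ x in a..b, morawetzDensity q u τ x) (by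
    filter_upwards [ha0'.eventually (gt_mem_nhds ha), hb.eventually_ge_atTop b] with n h1 h2
    exact hu.integral_morawetz_mono hA hst (ha' n) h1.le hab h2)
  linarith

omit hu hA in
lemma integral_sq_trace_nonneg {h : ℝ → ℂ} {s t : ℝ} (hst : s ≤ t) :
    0 ≤ ∫ τ in s..t, 1 / 2 * ‖h τ‖ ^ 2 :=
  intervalIntegral.integral_nonneg hst fun _ _ => by positivity

/-- The momentum is at most `E/2` in absolute value at both end times, and the trace term can be
dropped. The bound depends neither on the time interval nor on the rectangle. -/
lemma morawetz_le_energy {s t : ℝ} (hst : s ≤ t) {a b : ℝ}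
    (ha : 0 < a) (hab : a ≤ b) :
    ∫ τ in s..t, ∫ x in a..b, morawetzDensity q u τ x ≤ energy q u ux ut 0 := by
  obtain ⟨h, hh⟩ := hu.exists_isTrace hA
  have h1 := hu.morawetz_le hA hh hst ha hab
  have h2 : 0 ≤ ∫ τ in s..t, 1 / 2 * ‖h τ‖ ^ 2 := integral_sq_trace_nonneg hst
  have h3 := abs_le.1 (hu.abs_momentum_le hA.nonneg s)
  have h4 := abs_le.1 (hu.abs_momentum_le hA.nonneg t)
  rw [hu.energy_const hA s 0] at h3
  rw [hu.energy_const hA t 0] at h4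
  linarith

lemma momentum_antitone : Antitone (momentum ux ut) := by
  intro s t hst
  obtain ⟨h, hh⟩ := hu.exists_isTrace hA
  have h1 := hu.morawetz_le hA hh hst one_pos le_rfl
  have h2 : 0 ≤ ∫ τ in s..t, 1 / 2 * ‖h τ‖ ^ 2 := integral_sq_trace_nonneg hst
  simp only [intervalIntegral.integral_same, intervalIntegral.integral_zero] at h1
  linarith

/-- The momentum flux through any point is bounded by the energy. -/
lemma integral_flux_le {s t : ℝ} (hst : s ≤ t) {y : ℝ} (hy : 0 < y) :
    ∫ τ in s..t, flux q u ux ut τ y ≤ 2 * energy q u ux ut 0 := by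
  obtain ⟨h, hh⟩ := hu.exists_isTrace hA
  have l1 := hu.tendsto_flux_zero hA hh s t
  have hE := fun τ => hu.energy_const hA τ 0
  have hp : ∀ τ, ∀ a, 0 < a → a ≤ y → |∫ x in a..y, inner ℝ (ut τ x) (ux τ x)| ≤
      energy q u ux ut 0 / 2 := by
    intro τ a ha hay
    rw [← hE τ]
    have h1 : |∫ x in a..y, inner ℝ (ut τ x) (ux τ x)| ≤
        ∫ x in a..y, energyDensity q u ux ut τ x / 2 := by
      rw [← Real.norm_eq_abs]
      refine intervalIntegral.norm_integral_le_of_norm_le hay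
        (Eventually.of_forall fun x hx => (Real.norm_eq_abs (inner ℝ (ut τ x) (ux τ x))).le.trans ?_)
        ((hu.sol.intervalIntegrable_energyDensity hA.nonneg τ ha.le hy.le).div_const 2)
      exact abs_inner_le_energyDensity (hA.nonneg x (ha.trans hx.1)) _ _ _ _
    rw [intervalIntegral.integral_div] at h1
    have := hu.sol.intervalIntegral_energyDensity_le hA.nonneg τ ha.le hay
    linarith
  -- The momentum in `(a, y)` accounts for `E` and the Morawetz integral for `E` minus the trace
  -- term. That trace term is the limit of the flux at `a`, so it cancels as `a → 0`, leaving `2E`.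
  have key : ∀ᶠ a in 𝓝[>] (0 : ℝ), (∫ τ in s..t, flux q u ux ut τ y) -
      (energy q u ux ut 0 + (energy q u ux ut 0 - ∫ τ in s..t, 1 / 2 * ‖h τ‖ ^ 2)) ≤
      ∫ τ in s..t, flux q u ux ut τ a := by
    filter_upwards [Ioo_mem_nhdsGT hy] with a ha
    have h1 := hu.momentum_identity hA s t ha.1 hy
    have h2 := abs_le.1 (hp s a ha.1 ha.2.le)
    have h3 := abs_le.1 (hp t a ha.1 ha.2.le)
    have h4 := hu.morawetz_le hA hh hst ha.1 ha.2.le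
    have h5 := abs_le.1 (hu.abs_momentum_le hA.nonneg s)
    have h6 := abs_le.1 (hu.abs_momentum_le hA.nonneg t)
    rw [hE s] at h5
    rw [hE t] at h6
    linarith
  have := ge_of_tendsto l1 key
  linarith

/-- The inward energy on `(0, y]` can only be lost through the boundary, the Morawetz density, or
the potential energy at `y`. -/
lemma inward_local_le {s t : ℝ} (hst : s ≤ t) {y : ℝ} (hy : 0 < y) :
    ∫ x in Ioc 0 y, inwardDensity q u ux ut s x ≤ (∫ x in Ioc 0 y, inwardDensity q u ux ut t x) +
      (∫ τ in s..t, q y * ‖u τ y‖ ^ 2) / 2 + (momentum ux ut s - momentum ux ut t) := by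
  obtain ⟨h, hh⟩ := hu.exists_isTrace hA
  have l1 := hu.tendsto_flux_zero hA hh s t
  have l2 := hu.tendsto_inner_zero hA (g := fun _ => 1) (by simp) s t
  have l3 := tendsto_intervalIntegral_zero_left (hu.sol.integrableOn_inwardDensity hA.nonneg s) hy
  have l4 := tendsto_intervalIntegral_zero_left (hu.sol.integrableOn_inwardDensity hA.nonneg t) hy
  have l5 := ((l3.sub l4).sub l1).sub (l2.div_const 2)
  have ji := hu.jointContinuous_inner
  have jf := hu.jointContinuous_flux hA
  have key : ∀ᶠ a in 𝓝[>] (0 : ℝ), (∫ x in a..y, inwardDensity q u ux ut s x) -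
      (∫ x in a..y, inwardDensity q u ux ut t x) - (∫ τ in s..t, flux q u ux ut τ a) -
      (∫ τ in s..t, 1 * (2 * inner ℝ (ut τ a) (ux τ a))) / 2 ≤
      (∫ τ in s..t, q y * ‖u τ y‖ ^ 2) / 2 +
      ((momentum ux ut s - momentum ux ut t) - ∫ τ in s..t, 1 / 2 * ‖h τ‖ ^ 2) := by
    filter_upwards [Ioo_mem_nhdsGT hy] with a ha
    have h1 := hu.momentum_identity hA s t ha.1 hy
    have h2 := hu.energy_identity hA (g := fun _ => 1) (g' := fun _ => 0)
      (fun y => hasDerivAt_const _ _) continuous_const s t ha.1 hy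
    simp only [zero_mul, mul_zero, neg_zero, intervalIntegral.integral_zero, add_zero,
      one_mul] at h2
    have h4 := hu.morawetz_le hA hh hst ha.1 ha.2.le
    have e : ∀ τ, ∫ x in a..y, inwardDensity q u ux ut τ x =
        (∫ x in a..y, energyDensity q u ux ut τ x) / 2 +
        ∫ x in a..y, inner ℝ (ut τ x) (ux τ x) := fun τ => by
      simp only [inwardDensity_eq]
      rw [intervalIntegral.integral_add
        ((hu.sol.intervalIntegrable_energyDensity hA.nonneg τ ha.1.le hy.le).div_const 2)
        (ji.intervalIntegrable τ ha.1 hy), intervalIntegral.integral_div]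
    -- At `y` the flux of `e₋` is `f + p = |u_x + u_t|²/2 - q|u|²/2`. Only its last term can carry
    -- inward energy out of `(0, y]`.
    have h5 : -(∫ τ in s..t, q y * ‖u τ y‖ ^ 2) / 2 ≤ (∫ τ in s..t, flux q u ux ut τ y) +
        (∫ τ in s..t, 2 * inner ℝ (ut τ y) (ux τ y)) / 2 := by
      have i1 : IntervalIntegrable (fun τ => q y * ‖u τ y‖ ^ 2) volume s t :=
        (continuous_const.mul ((hu.cont_u.time hy).norm.pow 2)).intervalIntegrable _ _
      have i2 : IntervalIntegrable (fun τ => 2 * inner ℝ (ut τ y) (ux τ y)) volume s t :=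
        (continuous_const.mul (ji.time hy)).intervalIntegrable _ _
      rw [neg_div, ← intervalIntegral.integral_div, ← intervalIntegral.integral_div,
        ← intervalIntegral.integral_neg,
        ← intervalIntegral.integral_add ((jf.time hy).intervalIntegrable _ _) (i2.div_const 2)]
      refine intervalIntegral.integral_mono_on hst (i1.div_const 2).neg
        (((jf.time hy).intervalIntegrable _ _).add (i2.div_const 2)) fun τ _ => ?_
      have h6 := norm_add_sq_real (ux τ y) (ut τ y)
      rw [real_inner_comm] at h6
      have h7 := sq_nonneg ‖ux τ y + ut τ y‖
      rw [flux]
      linarith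
    rw [e s, e t]
    simp only [one_mul]
    linarith
  have := le_of_tendsto l5 key
  linarith

end IsRegularSolution

end

end HalfLineWave

/-! ### Integrability in time of the energy in bounded regions. -/

namespace HalfLineWave

noncomputable section

/-- Truncation to `S` does not increase the `L²` norm, so the truncated curve is again continuous.
-/
lemma ContinuousInL2.continuous_setIntegral_sq {f : ℝ → ℝ → ℂ} (hf : ContinuousInL2 f) {S : Set ℝ}
    (hS : MeasurableSet S) (hS0 : S ⊆ Ioi 0) : Continuous fun t => ∫ x in S, ‖f t x‖ ^ 2 := by
  have hg : ContinuousInL2 fun t => S.indicator (f t) := by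
    refine ⟨fun t => (hf.1 t).indicator hS, fun t => ?_⟩
    refine tendsto_of_tendsto_of_tendsto_of_le_of_le tendsto_const_nhds (hf.2 t)
      (fun _ => zero_le) fun s => ?_
    refine eLpNorm_mono fun x => ?_
    by_cases hx : x ∈ S <;> simp [hx]
  have h := hg.continuous_curve.norm.pow 2
  refine h.congr fun t => ?_
  rw [Pi.pow_apply, hg.norm_curve_sq]
  have : (fun x => ‖S.indicator (f t) x‖ ^ 2) = S.indicator fun x => ‖f t x‖ ^ 2 := by
    funext x
    by_cases hx : x ∈ S <;> simp [hx]
  rw [this, setIntegral_indicator hS, inter_eq_self_of_subset_right hS0]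

lemma IsFiniteEnergySolution.continuous_setIntegral_energyDensity {q : ℝ → ℝ} {w wx wt : ℝ → ℝ → ℂ}
    (hw : IsFiniteEnergySolution q w wx wt) (hq : ∀ x, 0 < x → 0 ≤ q x) {S : Set ℝ}
    (hS : MeasurableSet S) (hS0 : S ⊆ Ioi 0) :
    Continuous fun t => ∫ x in S, energyDensity q w wx wt t x := by
  have h := ((hw.continuous_wx.continuous_setIntegral_sq hS hS0).add
    (hw.continuous_wt.continuous_setIntegral_sq hS hS0)).add
    (hw.continuous_potential.continuous_setIntegral_sq hS hS0)
  refine h.congr fun t => ?_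
  have i1 := (MemLp.integrableOn_sq (hw.continuous_wx.1 t)).mono_set hS0
  have i2 := (MemLp.integrableOn_sq (hw.continuous_wt.1 t)).mono_set hS0
  have i12 : IntegrableOn (fun x => ‖wx t x‖ ^ 2 + ‖wt t x‖ ^ 2) S := i1.add i2
  have i3 := (hw.integrableOn_potential hq t).mono_set hS0
  simp only [energyDensity]
  rw [integral_add i12 i3, integral_add i1 i2]
  simp only [Pi.add_apply, add_right_inj]
  exact setIntegral_congr_fun hS fun x hx => norm_sqrtMul_sq (hq x (hS0 hx)) _

lemma JointContinuous.continuousOn_integral_time {f : ℝ → ℝ → ℝ} (hf : JointContinuous f)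
    (s t : ℝ) : ContinuousOn (fun x => ∫ τ in s..t, f τ x) (Ioi 0) := by
  intro x hx
  have hx2 : (0 : ℝ) < x / 2 := half_pos hx
  have hcont : Continuous fun y => ∫ τ in s..t, f τ (max y (x / 2)) :=
    intervalIntegral.continuous_parametric_intervalIntegral_of_continuous'
      (f := fun y τ => f τ (max y (x / 2))) ((hf.max_const hx2).comp continuous_swap) s t
  refine (hcont.continuousAt.congr ?_).continuousWithinAt
  filter_upwards [Ioi_mem_nhds (half_lt_self (mem_Ioi.1 hx))] with y hy
  rw [max_eq_left (le_of_lt hy)]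

lemma JointContinuous.intervalIntegrable_integral_time {f : ℝ → ℝ → ℝ} (hf : JointContinuous f)
    (s t : ℝ) {a b : ℝ} (ha : 0 < a) (hb : 0 < b) :
    IntervalIntegrable (fun x => ∫ τ in s..t, f τ x) volume a b :=
  ((hf.continuousOn_integral_time s t).mono fun _ hx =>
    lt_of_lt_of_le (lt_min ha hb) hx.1).intervalIntegrable

/-- Monotone convergence in the left endpoint, for space-time integrals. -/
lemma JointContinuous.integral_Ioc_le {f : ℝ → ℝ → ℝ} (hf : JointContinuous f)
    (h0 : ∀ τ x, 0 < x → 0 ≤ f τ x) (hi : ∀ τ, IntegrableOn (f τ) (Ioi 0)) {x : ℝ} (hx : 0 < x)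
    (hc : Continuous fun τ => ∫ y in Ioc 0 x, f τ y) {s t C : ℝ}
    (h : ∀ a, 0 < a → a < x → ∫ τ in s..t, ∫ y in a..x, f τ y ≤ C) :
    ∫ τ in s..t, ∫ y in Ioc 0 x, f τ y ≤ C := by
  have hl : Tendsto (fun a => ∫ τ in s..t, ∫ y in a..x, f τ y) (𝓝[>] 0)
      (𝓝 (∫ τ in s..t, ∫ y in Ioc 0 x, f τ y)) := by
    refine intervalIntegral.tendsto_integral_filter_of_dominated_convergence
      (fun τ => ∫ y in Ioc 0 x, f τ y) ?_ ?_ (hc.intervalIntegrable _ _) ?_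
    · filter_upwards [self_mem_nhdsWithin] with a ha
      exact (hf.continuous_intervalIntegral ha hx).aestronglyMeasurable
    · filter_upwards [Ioo_mem_nhdsGT hx] with a ha
      refine Eventually.of_forall fun τ _ => ?_
      rw [intervalIntegral.integral_of_le ha.2.le, Real.norm_of_nonneg]
      · exact setIntegral_mono_set ((hi τ).mono_set Ioc_subset_Ioi_self)
          ((ae_restrict_iff' measurableSet_Ioc).2 (Eventually.of_forall fun y hy => h0 τ y hy.1))
          (LE.le.eventuallyLE (Ioc_subset_Ioc_left ha.1.le))
      · exact setIntegral_nonneg measurableSet_Ioc fun y hy => h0 τ y (ha.1.trans hy.1)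
    · exact Eventually.of_forall fun τ _ => tendsto_intervalIntegral_zero_left (hi τ) hx
  refine le_of_tendsto hl ?_
  filter_upwards [Ioo_mem_nhdsGT hx] with a ha
  exact h a ha.1 ha.2

lemma IsEnergyClass.norm_sq_le {q : ℝ → ℝ} {v v' : ℝ → ℂ} (hv : IsEnergyClass q v v') {x : ℝ}
    (hx : 0 ≤ x) : ‖v x‖ ^ 2 ≤ x * ∫ y in Ioc 0 x, ‖v' y‖ ^ 2 := by
  rw [hv.eq_integral x hx]
  simpa using norm_integral_sq_le hv.memLp_deriv le_rfl hx

namespace IsRegularSolution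

variable {lam : ℝ} {q₀ q : ℝ → ℝ} {u ux ut utt uxt : ℝ → ℝ → ℂ}

section

variable (hu : IsRegularSolution q u ux ut utt uxt) (hA : IsAdmissible lam q₀ q)
include hu hA

lemma jointContinuous_potential : JointContinuous fun τ x => q x * ‖u τ x‖ ^ 2 :=
  ContinuousOn.mul (jointContinuous_q hA) (hu.cont_u.norm.pow 2)

/-- The space-time integral of the energy density is controlled by that of the potential energy. -/
lemma integral_flux_rect_le {s t : ℝ} (hst : s ≤ t) {a b : ℝ} (ha : 0 < a) (hab : a ≤ b) :
    ∫ τ in s..t, ∫ y in a..b, flux q u ux ut τ y ≤ 2 * energy q u ux ut 0 * (b - a) := by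
  have jf := hu.jointContinuous_flux hA
  have hb := ha.trans_le hab
  rw [jf.swap ha hb]
  have : ∫ y in a..b, ∫ τ in s..t, flux q u ux ut τ y ≤ ∫ _ in a..b, 2 * energy q u ux ut 0 :=
    intervalIntegral.integral_mono_on hab (jf.intervalIntegrable_integral_time s t ha hb) (by simp)
      fun y hy => hu.integral_flux_le hA hst (ha.trans_le hy.1)
  refine this.trans (le_of_eq ?_)
  simp; ring

omit hu in
lemma energy_nonneg (u ux ut : ℝ → ℝ → ℂ) : 0 ≤ energy q u ux ut 0 :=
  setIntegral_nonneg measurableSet_Ioi fun x hx => energyDensity_nonneg (hA.nonneg x hx) u ux ut 0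

end

/-- Near the boundary, potential and kinetic energy have small space-time integrals. -/
lemma exists_near_zero (hA : IsAdmissible lam q₀ q) : ∃ δ, 0 < δ ∧
    ∀ {u ux ut utt uxt : ℝ → ℝ → ℂ}, IsRegularSolution q u ux ut utt uxt →
    ∀ s t, s ≤ t → ∀ x, 0 < x → x ≤ δ →
      ∫ τ in s..t, ∫ y in Ioc 0 x, ‖ux τ y‖ ^ 2 ≤ 10 * x * energy q u ux ut 0 ∧
      ∀ a, 0 < a → a ≤ x →
        ∫ τ in s..t, ∫ y in a..x, q y * ‖u τ y‖ ^ 2 ≤ 6 * x * energy q u ux ut 0 := by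
  obtain ⟨κ, C, δ₀, hκ1, hκ2, hC, hδ₀, -, hgr⟩ := hA.exists_growth
  have hβ : κ - 1 < 1 := by linarith
  -- This is the integral of `C y^(1 - κ)` over `(0, x)`. Making it less than 1/2 allows the kinetic
  -- term to be absorbed at the end.
  have hlim : Tendsto (fun x : ℝ => C / (1 - (κ - 1)) * x ^ (1 - (κ - 1))) (𝓝[>] 0) (𝓝 0) := by
    have : ContinuousAt (fun x : ℝ => C / (1 - (κ - 1)) * x ^ (1 - (κ - 1))) 0 :=
      continuousAt_const.mul (Real.continuousAt_rpow_const _ _ (Or.inr (by linarith)))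
    have h := this.tendsto
    rw [Real.zero_rpow (by linarith), mul_zero] at h
    exact h.mono_left nhdsWithin_le_nhds
  obtain ⟨δ, hδ, hδh⟩ := mem_nhdsGT_iff_exists_Ioc_subset.1
    ((hlim.eventually (gt_mem_nhds (by norm_num : (0 : ℝ) < 1 / 2))).and (Ioc_mem_nhdsGT hδ₀))
  refine ⟨δ, hδ, fun {u ux ut utt uxt} hu s t hst x hx hxd => ?_⟩
  obtain ⟨hx1, hx2⟩ := hδh ⟨hx, hxd⟩
  set E := energy q u ux ut 0
  have hE : 0 ≤ E := energy_nonneg hA u ux ut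
  set G : ℝ → ℝ := fun τ => ∫ y in Ioc 0 x, ‖ux τ y‖ ^ 2 with hG
  have hGc : Continuous G :=
    hu.sol.continuous_wx.continuous_setIntegral_sq measurableSet_Ioc Ioc_subset_Ioi_self
  have hG0 : ∀ τ, 0 ≤ G τ := fun τ => setIntegral_nonneg measurableSet_Ioc fun _ _ => sq_nonneg _
  have jp := hu.jointContinuous_potential hA
  have jm := hu.jointContinuous_morawetz hA
  -- The inverse-square part is bounded by `y M ≤ x M`; for the `q₀` part, `|u(y)|² ≤ y ∫ |u_x|²`
  -- gains the power of `y` that makes the growth bound integrable.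
  have hpot : ∀ τ y, 0 < y → y ≤ x → q y * ‖u τ y‖ ^ 2 ≤
      x * morawetzDensity q u τ y + C * y ^ (-(κ - 1)) * G τ := by
    intro τ y hy hyx
    have h1 : ‖u τ y‖ ^ 2 ≤ y * G τ := by
      refine ((hu.sol.energyClass τ).norm_sq_le hy.le).trans ?_
      refine mul_le_mul_of_nonneg_left ?_ hy.le
      exact setIntegral_mono_set ((MemLp.integrableOn_sq (hu.sol.continuous_wx.1 τ)).mono_set
        Ioc_subset_Ioi_self) (Eventually.of_forall fun _ => sq_nonneg _)
        (LE.le.eventuallyLE (Ioc_subset_Ioc_right hyx))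
    have h2 : lam / y ^ 2 * ‖u τ y‖ ^ 2 ≤ x * morawetzDensity q u τ y := by
      have e : lam / y ^ 2 = y * (lam / y ^ 3) := by field_simp
      have h3 := morawetzDensity_nonneg hA u τ hy
      have h4 := mul_le_mul_of_nonneg_right (hA.lam_div_le hy) (sq_nonneg ‖u τ y‖)
      calc lam / y ^ 2 * ‖u τ y‖ ^ 2 = y * (lam / y ^ 3 * ‖u τ y‖ ^ 2) := by rw [e]; ring
        _ ≤ y * morawetzDensity q u τ y := by rw [morawetzDensity]; gcongr
        _ ≤ _ := by gcongr
    have h3 : q₀ y * ‖u τ y‖ ^ 2 ≤ C * y ^ (-(κ - 1)) * G τ := by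
      calc q₀ y * ‖u τ y‖ ^ 2 ≤ (C * y ^ (-κ)) * (y * G τ) := by
            have := hgr y hy (hyx.trans hx2.2)
            have := (hA.rep.pos y hy).le
            gcongr
        _ = C * (y ^ (-κ) * y) * G τ := by ring
        _ = _ := by
          rw [← Real.rpow_add_one hy.ne']
          congr 3; ring
    rw [hA.apply, add_mul]
    linarith
  have hpot2 : ∀ a, 0 < a → a ≤ x → ∫ τ in s..t, ∫ y in a..x, q y * ‖u τ y‖ ^ 2 ≤
      x * E + 1 / 2 * ∫ τ in s..t, G τ := by
    intro a ha hax
    have h1 : ∫ τ in s..t, ∫ y in a..x, q y * ‖u τ y‖ ^ 2 ≤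
        ∫ τ in s..t, (x * (∫ y in a..x, morawetzDensity q u τ y) + 1 / 2 * G τ) := by
      refine intervalIntegral.integral_mono_on hst
        ((jp.continuous_intervalIntegral ha hx).intervalIntegrable _ _)
        (((continuous_const.mul (jm.continuous_intervalIntegral ha hx)).add
          (continuous_const.mul hGc)).intervalIntegrable _ _) fun τ _ => ?_
      have i1 := (jm.intervalIntegrable τ ha hx).const_mul x
      have i2 : IntervalIntegrable (fun y => C * y ^ (-(κ - 1)) * G τ) volume a x :=
        (intervalIntegrable_rpow_neg hβ).mul_const _
      have h2 : ∫ y in a..x, q y * ‖u τ y‖ ^ 2 ≤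
          ∫ y in a..x, (x * morawetzDensity q u τ y + C * y ^ (-(κ - 1)) * G τ) :=
        intervalIntegral.integral_mono_on hax (jp.intervalIntegrable τ ha hx) (i1.add i2)
          fun y hy => hpot τ y (ha.trans_le hy.1) hy.2
      rw [intervalIntegral.integral_add i1 i2, intervalIntegral.integral_const_mul,
        intervalIntegral.integral_mul_const] at h2
      refine h2.trans ?_
      have h3 : ∫ y in a..x, C * y ^ (-(κ - 1)) ≤ ∫ y in (0 : ℝ)..x, C * y ^ (-(κ - 1)) := by
        refine intervalIntegral.integral_mono_interval ha.le hax le_rfl ?_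
          (intervalIntegrable_rpow_neg hβ)
        refine (ae_restrict_iff' measurableSet_Ioc).2 (Eventually.of_forall fun y hy => ?_)
        have := hy.1
        simp only [Pi.zero_apply]
        positivity
      rw [integral_rpow_neg_zero hβ] at h3
      have h4 := mul_le_mul_of_nonneg_right (h3.trans hx1.le) (hG0 τ)
      linarith
    refine h1.trans ?_
    rw [intervalIntegral.integral_add
      (((jm.continuous_intervalIntegral ha hx).intervalIntegrable _ _).const_mul x)
      ((hGc.intervalIntegrable _ _).const_mul (1 / 2)), intervalIntegral.integral_const_mul,
      intervalIntegral.integral_const_mul]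
    have := mul_le_mul_of_nonneg_left (hu.morawetz_le_energy hA hst ha hax) hx.le
    linarith
  -- From `|u_x|² ≤ 2f + q|u|²`: the flux contributes `4 x E`, the potential `x E` plus half of the
  -- left side. Absorption gives the constant 10 for the kinetic part and `1 + 10/2 = 6` for the
  -- potential part.
  have hkin : ∫ τ in s..t, G τ ≤ 5 * x * E + 1 / 2 * ∫ τ in s..t, G τ := by
    have jx : JointContinuous fun τ y => ‖ux τ y‖ ^ 2 := hu.cont_ux.norm.pow 2
    have jf := hu.jointContinuous_flux hA
    refine jx.integral_Ioc_le (fun _ _ _ => sq_nonneg _)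
      (fun τ => MemLp.integrableOn_sq (hu.sol.continuous_wx.1 τ)) hx hGc fun a ha hax => ?_
    have h1 : ∫ τ in s..t, ∫ y in a..x, ‖ux τ y‖ ^ 2 ≤
        ∫ τ in s..t, (2 * (∫ y in a..x, flux q u ux ut τ y) +
          ∫ y in a..x, q y * ‖u τ y‖ ^ 2) := by
      refine intervalIntegral.integral_mono_on hst
        ((jx.continuous_intervalIntegral ha hx).intervalIntegrable _ _)
        (((continuous_const.mul (jf.continuous_intervalIntegral ha hx)).add
          (jp.continuous_intervalIntegral ha hx)).intervalIntegrable _ _) fun τ _ => ?_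
      rw [← intervalIntegral.integral_const_mul,
        ← intervalIntegral.integral_add ((jf.intervalIntegrable τ ha hx).const_mul 2)
          (jp.intervalIntegrable τ ha hx)]
      refine intervalIntegral.integral_mono_on hax.le (jx.intervalIntegrable τ ha hx)
        (((jf.intervalIntegrable τ ha hx).const_mul 2).add (jp.intervalIntegrable τ ha hx))
        fun y _ => ?_
      rw [flux]
      linarith [sq_nonneg ‖ut τ y‖]
    rw [intervalIntegral.integral_add
      (((jf.continuous_intervalIntegral ha hx).intervalIntegrable _ _).const_mul 2)
      ((jp.continuous_intervalIntegral ha hx).intervalIntegrable _ _),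
      intervalIntegral.integral_const_mul] at h1
    have h2 := hu.integral_flux_rect_le hA hst ha hax.le
    have h3 := hpot2 a ha hax.le
    have h4 : 0 ≤ E * a := by positivity
    have h5 : 2 * E * (x - a) = 2 * (x * E) - 2 * (E * a) := by ring
    linarith
  have hGE : ∫ τ in s..t, G τ ≤ 10 * x * E := by linarith
  exact ⟨hGE, fun a ha hax => (hpot2 a ha hax).trans (by linarith)⟩

variable (hu : IsRegularSolution q u ux ut utt uxt) (hA : IsAdmissible lam q₀ q)
include hu hA

/-- The energy in a bounded region is integrable in time. -/
lemma exists_integral_energy_le (R : ℝ) : ∃ K, ∀ s t, s ≤ t →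
    ∫ τ in s..t, ∫ y in Ioc 0 R, energyDensity q u ux ut τ y ≤ K := by
  obtain ⟨δ, hδ, hnear⟩ := exists_near_zero hA
  set E := energy q u ux ut 0
  have hE : 0 ≤ E := energy_nonneg hA u ux ut
  set R' := max R δ
  have hR' : 0 < R' := hδ.trans_le (le_max_right _ _)
  have je := hu.jointContinuous_energyDensity hA
  have jp := hu.jointContinuous_potential hA
  have jm := hu.jointContinuous_morawetz hA
  have jf := hu.jointContinuous_flux hA
  -- Away from zero and infinity `-q'` is bounded below, so there the potential energy is controlled
  -- by the Morawetz density.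
  obtain ⟨m, hm⟩ := (isCompact_Icc (a := δ) (b := R')).bddAbove_image
    (f := fun x => q x / (-(deriv q x) / 2))
    (by
      have hs : Icc δ R' ⊆ Ioi 0 := fun x hx => hδ.trans_le hx.1
      refine (hA.continuousOn.mono hs).div ((hA.continuousOn_deriv.mono hs).neg.div_const 2)
        fun x hx => ?_
      have := hA.deriv_neg (hs hx)
      exact (by linarith : (0 : ℝ) < -deriv q x / 2).ne')
  set m' := max m 0
  have hpot : ∀ τ y, δ ≤ y → y ≤ R' → q y * ‖u τ y‖ ^ 2 ≤ m' * morawetzDensity q u τ y := by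
    intro τ y h1 h2
    have h3 : q y / (-(deriv q y) / 2) ≤ m' := (hm (mem_image_of_mem _ ⟨h1, h2⟩)).trans
      (le_max_left _ _)
    have := hA.deriv_neg (hδ.trans_le h1)
    rw [div_le_iff₀ (by linarith)] at h3
    rw [morawetzDensity]
    nlinarith [mul_le_mul_of_nonneg_right h3 (sq_nonneg ‖u τ y‖)]
  refine ⟨4 * R' * E + 2 * (6 * δ * E + m' * E), fun s t hst => ?_⟩
  have hR0 : ∫ τ in s..t, ∫ y in Ioc 0 R, energyDensity q u ux ut τ y ≤
      ∫ τ in s..t, ∫ y in Ioc 0 R', energyDensity q u ux ut τ y := by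
    refine intervalIntegral.integral_mono_on hst
      ((hu.sol.continuous_setIntegral_energyDensity hA.nonneg measurableSet_Ioc
        Ioc_subset_Ioi_self).intervalIntegrable _ _)
      ((hu.sol.continuous_setIntegral_energyDensity hA.nonneg measurableSet_Ioc
        Ioc_subset_Ioi_self).intervalIntegrable _ _) fun τ _ => ?_
    exact setIntegral_mono_set ((hu.sol.integrableOn_energyDensity hA.nonneg τ).mono_set
      Ioc_subset_Ioi_self) ((ae_restrict_iff' measurableSet_Ioc).2 (Eventually.of_forall fun y hy =>
        energyDensity_nonneg (hA.nonneg y hy.1) _ _ _ _))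
      (LE.le.eventuallyLE (Ioc_subset_Ioc_right (le_max_left _ _)))
  refine hR0.trans (je.integral_Ioc_le
    (fun τ x hx => energyDensity_nonneg (hA.nonneg x hx) _ _ _ _)
    (hu.sol.integrableOn_energyDensity hA.nonneg) hR'
    (hu.sol.continuous_setIntegral_energyDensity hA.nonneg measurableSet_Ioc Ioc_subset_Ioi_self)
    fun a ha haR => ?_)
  set c := min a δ
  have hc : 0 < c := lt_min ha hδ
  have hcR : c ≤ R' := (min_le_left _ _).trans haR.le
  have h0 : ∫ τ in s..t, ∫ y in a..R', energyDensity q u ux ut τ y ≤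
      ∫ τ in s..t, ∫ y in c..R', energyDensity q u ux ut τ y := by
    refine intervalIntegral.integral_mono_on hst
      ((je.continuous_intervalIntegral ha hR').intervalIntegrable _ _)
      ((je.continuous_intervalIntegral hc hR').intervalIntegrable _ _) fun τ _ => ?_
    refine intervalIntegral.integral_mono_interval (min_le_left _ _) haR.le le_rfl ?_
      (je.intervalIntegrable τ hc hR')
    exact (ae_restrict_iff' measurableSet_Ioc).2 (Eventually.of_forall fun y hy =>
      energyDensity_nonneg (hA.nonneg y (hc.trans hy.1)) _ _ _ _)
  refine h0.trans ?_
  -- Since `e = 2f + 2q|u|²`, it suffices to bound the flux at each point and the potential energy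
  -- near zero and away from it separately.
  have e1 : ∫ τ in s..t, ∫ y in c..R', energyDensity q u ux ut τ y =
      2 * (∫ τ in s..t, ∫ y in c..R', flux q u ux ut τ y) +
      2 * ((∫ τ in s..t, ∫ y in c..δ, q y * ‖u τ y‖ ^ 2) +
        ∫ τ in s..t, ∫ y in δ..R', q y * ‖u τ y‖ ^ 2) := by
    have c1 := (jf.continuous_intervalIntegral hc hR').intervalIntegrable (μ := volume) s t
    have c2 := (jp.continuous_intervalIntegral hc hδ).intervalIntegrable (μ := volume) s t
    have c3 := (jp.continuous_intervalIntegral hδ hR').intervalIntegrable (μ := volume) s t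
    rw [← intervalIntegral.integral_add c2 c3, ← intervalIntegral.integral_const_mul,
      ← intervalIntegral.integral_const_mul, ← intervalIntegral.integral_add (c1.const_mul 2)
      ((c2.add c3).const_mul 2)]
    refine intervalIntegral.integral_congr fun τ _ => ?_
    rw [intervalIntegral.integral_add_adjacent_intervals (jp.intervalIntegrable τ hc hδ)
      (jp.intervalIntegrable τ hδ hR'), ← intervalIntegral.integral_const_mul,
      ← intervalIntegral.integral_const_mul, ← intervalIntegral.integral_add
        ((jf.intervalIntegrable τ hc hR').const_mul 2)
        ((jp.intervalIntegrable τ hc hR').const_mul 2)]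
    refine intervalIntegral.integral_congr fun y _ => ?_
    simp only [flux, energyDensity]
    ring
  have h1 := hu.integral_flux_rect_le hA hst hc hcR
  have h2 := (hnear hu s t hst δ hδ le_rfl).2 c hc (min_le_right _ _)
  have h3 : ∫ τ in s..t, ∫ y in δ..R', q y * ‖u τ y‖ ^ 2 ≤
      m' * ∫ τ in s..t, ∫ y in δ..R', morawetzDensity q u τ y := by
    rw [← intervalIntegral.integral_const_mul]
    refine intervalIntegral.integral_mono_on hst
      ((jp.continuous_intervalIntegral hδ hR').intervalIntegrable _ _)
      ((continuous_const.mul (jm.continuous_intervalIntegral hδ hR')).intervalIntegrable _ _)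
      fun τ _ => ?_
    rw [← intervalIntegral.integral_const_mul]
    exact intervalIntegral.integral_mono_on (le_max_right _ _) (jp.intervalIntegrable τ hδ hR')
      ((jm.intervalIntegrable τ hδ hR').const_mul _) fun y hy => hpot τ y hy.1 hy.2
  have h4 := mul_le_mul_of_nonneg_left (hu.morawetz_le_energy hA hst hδ (le_max_right R δ))
    (le_max_right m 0)
  have h5 : 0 ≤ E * c := by positivity
  have h6 : 2 * E * (R' - c) = 2 * R' * E - 2 * (E * c) := by ring
  rw [e1]
  linarith

/-- The energy leaves every bounded region, along a sequence of times. -/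
lemma exists_local_energy_lt (R s : ℝ) {η : ℝ} (hη : 0 < η) :
    ∃ t, s ≤ t ∧ ∫ y in Ioc 0 R, energyDensity q u ux ut t y < η := by
  by_contra hcon
  push Not at hcon
  obtain ⟨K, hK⟩ := hu.exists_integral_energy_le hA R
  -- Over a time interval of this length a local energy of at least `η` would accumulate to `|K| + 1
  -- > K`.
  set t := s + (|K| + 1) / η
  have hst : s ≤ t := by
    have : 0 ≤ (|K| + 1) / η := by positivity
    linarith
  have h1 : ∫ _ in s..t, η ≤ ∫ τ in s..t, ∫ y in Ioc 0 R, energyDensity q u ux ut τ y :=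
    intervalIntegral.integral_mono_on hst (by simp)
      ((hu.sol.continuous_setIntegral_energyDensity hA.nonneg measurableSet_Ioc
        Ioc_subset_Ioi_self).intervalIntegrable _ _) fun τ hτ => hcon τ hτ.1
  have h2 := h1.trans (hK s t hst)
  have h3 : (|K| + 1) / η * η = |K| + 1 := by field_simp
  rw [intervalIntegral.integral_const, smul_eq_mul, add_sub_cancel_left, h3] at h2
  linarith [le_abs_self K]

end IsRegularSolution

end

end HalfLineWave

/-! ### Decay of the inward energy, finite speed, and emptying of cones. -/

namespace HalfLineWave

noncomputable section

lemma exists_tail_lt {f : ℝ → ℝ} (hf : IntegrableOn f (Ioi 0)) {ε : ℝ} (hε : 0 < ε) :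
    ∃ R, 0 < R ∧ (∫ x in Ioi R, f x) < ε ∧ (∫ x in Ioi (0 : ℝ), f x) < (∫ x in Ioc 0 R, f x) + ε := by
  have h := intervalIntegral_tendsto_integral_Ioi 0 hf tendsto_id
  obtain ⟨R, h1, h2⟩ := ((h.eventually (lt_mem_nhds (sub_lt_self _ hε))).and
    (eventually_gt_atTop 0)).exists
  simp only [id] at h1
  rw [intervalIntegral.integral_of_le h2.le] at h1
  refine ⟨R, h2, ?_, by linarith⟩
  have h3 : ∫ x in Ioi (0 : ℝ), f x = (∫ x in Ioc 0 R, f x) + ∫ x in Ioi R, f x := by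
    rw [← Ioc_union_Ioi_eq_Ioi h2.le, setIntegral_union (Ioc_disjoint_Ioi le_rfl) measurableSet_Ioi
      (hf.mono_set Ioc_subset_Ioi_self) (hf.mono_set (Ioi_subset_Ioi h2.le))]
  linarith

lemma exists_deriv_smoothTransition_le : ∃ K, 0 ≤ K ∧ ∀ y, deriv Real.smoothTransition y ≤ K := by
  have hc : Continuous (deriv Real.smoothTransition) :=
    (Real.smoothTransition.contDiff (n := 1)).continuous_deriv le_rfl
  obtain ⟨K, hK⟩ := (isCompact_Icc (a := (0 : ℝ)) (b := 1)).bddAbove_image hc.continuousOn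
  refine ⟨max K 0, le_max_right _ _, fun y => ?_⟩
  by_cases hy : y ∈ Icc (0 : ℝ) 1
  · exact (hK (mem_image_of_mem _ hy)).trans (le_max_left _ _)
  · rw [mem_Icc, not_and_or, not_le, not_le] at hy
    have : deriv Real.smoothTransition y = 0 := by
      rcases hy with hy | hy
      · have : Real.smoothTransition =ᶠ[𝓝 y] fun _ => 0 := by
          filter_upwards [Iio_mem_nhds hy] with z hz
          exact Real.smoothTransition.zero_of_nonpos (le_of_lt hz)
        rw [this.deriv_eq, deriv_const]
      · have : Real.smoothTransition =ᶠ[𝓝 y] fun _ => 1 := by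
          filter_upwards [Ioi_mem_nhds hy] with z hz
          exact Real.smoothTransition.one_of_one_le (le_of_lt hz)
        rw [this.deriv_eq, deriv_const]
    rw [this]
    exact le_max_right _ _

lemma hasDerivAt_smoothTransition_comp (c ℓ y : ℝ) :
    HasDerivAt (fun y => Real.smoothTransition ((y - c) / ℓ))
      (deriv Real.smoothTransition ((y - c) / ℓ) * (1 / ℓ)) y := by
  have h1 : HasDerivAt Real.smoothTransition (deriv Real.smoothTransition ((y - c) / ℓ))
      ((y - c) / ℓ) :=
    ((Real.smoothTransition.contDiff (n := 1)).differentiable (by norm_num) _).hasDerivAt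
  exact h1.comp y (((hasDerivAt_id y).sub_const c).div_const ℓ)

lemma continuous_deriv_smoothTransition_comp (c ℓ : ℝ) :
    Continuous fun y => deriv Real.smoothTransition ((y - c) / ℓ) * (1 / ℓ) := by
  have hc : Continuous (deriv Real.smoothTransition) :=
    (Real.smoothTransition.contDiff (n := 1)).continuous_deriv le_rfl
  fun_prop

lemma abs_smoothTransition_le (y : ℝ) : |Real.smoothTransition y| ≤ 1 := by
  rw [abs_of_nonneg (Real.smoothTransition.nonneg y)]
  exact Real.smoothTransition.le_one y

namespace IsRegularSolution

variable {lam : ℝ} {q₀ q : ℝ → ℝ} {u ux ut utt uxt : ℝ → ℝ → ℂ}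
variable (hu : IsRegularSolution q u ux ut utt uxt) (hA : IsAdmissible lam q₀ q)
include hu hA

/-- The momentum is monotone and bounded below by `-E/2`, so it converges and its losses after a
late time are small. -/
lemma exists_momentum_sub_le {η : ℝ} (hη : 0 < η) :
    ∃ s, 0 ≤ s ∧ ∀ t, s ≤ t → momentum ux ut s - momentum ux ut t ≤ η := by
  have hb : BddBelow (range (momentum ux ut)) := ⟨-(energy q u ux ut 0 / 2), by
    rintro _ ⟨t, rfl⟩
    have := (abs_le.1 (hu.abs_momentum_le hA.nonneg t)).1
    rwa [hu.energy_const hA t 0] at this⟩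
  have hl := tendsto_atTop_ciInf (hu.momentum_antitone hA) hb
  obtain ⟨s, h1, h2⟩ := ((hl.eventually (gt_mem_nhds (lt_add_of_pos_right _ hη))).and
    (eventually_ge_atTop 0)).exists
  exact ⟨s, h2, fun t _ => by linarith [ciInf_le hb t]⟩

lemma inwardEnergy_antitone : Antitone (inwardEnergy q u ux ut) := by
  intro s t hst
  rw [hu.sol.inwardEnergy_eq hA.nonneg, hu.sol.inwardEnergy_eq hA.nonneg, hu.energy_const hA t s]
  have := hu.momentum_antitone hA hst
  linarith

/-- The inward energy decays. -/
theorem exists_inwardEnergy_le {ε : ℝ} (hε : 0 < ε) :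
    ∃ s, 0 ≤ s ∧ ∀ t, s ≤ t → inwardEnergy q u ux ut t ≤ ε := by
  set η := ε / 4 with hηd
  have hη : 0 < η := by positivity
  obtain ⟨s, hs0, hs⟩ := hu.exists_momentum_sub_le hA hη
  refine ⟨s, hs0, fun t hst => (hu.inwardEnergy_antitone hA hst).trans ?_⟩
  by_contra! hcon
  have hid := hu.sol.integrableOn_inwardDensity hA.nonneg
  obtain ⟨Y, hY, -, hY2⟩ := exists_tail_lt (hid s) hη
  set E := energy q u ux ut 0
  have hY3 : 3 * η < ∫ x in Ioc 0 Y, inwardDensity q u ux ut s x := by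
    have : inwardEnergy q u ux ut s = ∫ x in Ioi (0 : ℝ), inwardDensity q u ux ut s x := rfl
    linarith
  have hqY := hA.pos hY
  -- As `q → 0`, some `R` beyond `Y` has `log (q Y) - log (q R) > (E + 1) / η`, just enough for the
  -- contradiction below.
  have hsmall : 0 < q Y * Real.exp (-((E + 1) / η)) := by positivity
  obtain ⟨R, hR1, hR2⟩ := ((hA.tendsto_zero.eventually (gt_mem_nhds hsmall)).and
    (eventually_ge_atTop Y)).exists
  have hR0 : 0 < R := hY.trans_le hR2
  obtain ⟨T, hsT, hT⟩ := hu.exists_local_energy_lt hA R s hη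
  have jm := hu.jointContinuous_morawetz hA
  have jp := hu.jointContinuous_potential hA
  -- More than `3η` of inward energy lies in `(0, y]` at time `s`. At time `T` less than `η` is
  -- left, the momentum accounts for at most `η`, and half the integral on the right must cover the
  -- rest.
  have hJ : ∀ y ∈ Icc Y R, 2 * η ≤ ∫ τ in s..T, q y * ‖u τ y‖ ^ 2 := by
    intro y hy
    have hy0 : 0 < y := hY.trans_le hy.1
    have h1 := hu.inward_local_le hA hsT hy0
    have h2 := hs T hsT
    have h3 : ∫ x in Ioc 0 Y, inwardDensity q u ux ut s x ≤
        ∫ x in Ioc 0 y, inwardDensity q u ux ut s x :=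
      setIntegral_mono_set ((hid s).mono_set Ioc_subset_Ioi_self)
        ((ae_restrict_iff' measurableSet_Ioc).2 (Eventually.of_forall fun x hx =>
          inwardDensity_nonneg (hA.nonneg x hx.1) _ _ _ _))
        (LE.le.eventuallyLE (Ioc_subset_Ioc_right hy.1))
    have h4 : ∫ x in Ioc 0 y, inwardDensity q u ux ut T x ≤
        ∫ x in Ioc 0 R, energyDensity q u ux ut T x := by
      refine (setIntegral_mono_on ((hid T).mono_set Ioc_subset_Ioi_self)
        ((hu.sol.integrableOn_energyDensity hA.nonneg T).mono_set Ioc_subset_Ioi_self)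
        measurableSet_Ioc fun x hx => inwardDensity_le (hA.nonneg x hx.1) _ _ _ _).trans ?_
      exact setIntegral_mono_set ((hu.sol.integrableOn_energyDensity hA.nonneg T).mono_set
        Ioc_subset_Ioi_self)
        ((ae_restrict_iff' measurableSet_Ioc).2 (Eventually.of_forall fun x hx =>
          energyDensity_nonneg (hA.nonneg x hx.1) _ _ _ _))
        (LE.le.eventuallyLE (Ioc_subset_Ioc_right hy.2))
    linarith
  have hlog : ∫ y in Y..R, -(deriv q y) / q y = Real.log (q Y) - Real.log (q R) := by
    have hpos : ∀ y ∈ uIcc Y R, 0 < y := fun y hy => by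
      rw [uIcc_of_le hR2] at hy; exact hY.trans_le hy.1
    have h1 : ∫ y in Y..R, -(deriv q y) / q y = -Real.log (q R) - -Real.log (q Y) := by
      refine intervalIntegral.integral_eq_sub_of_hasDerivAt (f := fun y => -Real.log (q y))
        (fun y hy => ?_) ?_
      · rw [neg_div]
        exact ((hA.hasDerivAt (hpos y hy)).log (hA.pos (hpos y hy)).ne').neg
      · exact ((hA.continuousOn_deriv.mono hpos).neg.div (hA.continuousOn.mono hpos)
          fun y hy => (hA.pos (hpos y hy)).ne').intervalIntegrable
    linarith
  have hlog2 : (E + 1) / η < Real.log (q Y) - Real.log (q R) := by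
    have h1 := Real.log_lt_log (hA.pos hR0) hR1
    rw [Real.log_mul hqY.ne' (Real.exp_pos _).ne', Real.log_exp] at h1
    linarith
  have h1 := hu.morawetz_le_energy hA hsT hY hR2
  rw [jm.swap hY hR0] at h1
  have h2 : ∫ y in Y..R, -(deriv q y) / q y * η ≤
      ∫ y in Y..R, ∫ τ in s..T, morawetzDensity q u τ y := by
    have hpos : ∀ y ∈ uIcc Y R, 0 < y := fun y hy => by
      rw [uIcc_of_le hR2] at hy; exact hY.trans_le hy.1
    refine intervalIntegral.integral_mono_on hR2 ?_
      (jm.intervalIntegrable_integral_time s T hY hR0) fun y hy => ?_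
    · exact (((hA.continuousOn_deriv.mono hpos).neg.div (hA.continuousOn.mono hpos)
          fun y hy => (hA.pos (hpos y hy)).ne').mul continuousOn_const).intervalIntegrable
    · have hy0 : 0 < y := hY.trans_le hy.1
      have hq := hA.pos hy0
      have hq' := hA.deriv_neg hy0
      -- The relation `M = (-q'/q)(q|u|²)/2` turns the lower bound into a logarithmic derivative of
      -- `q`, and so `∬ M ≥ η log(q(Y)/q(R)) > E + 1`.
      have e : ∫ τ in s..T, morawetzDensity q u τ y =
          -(deriv q y) / q y / 2 * ∫ τ in s..T, q y * ‖u τ y‖ ^ 2 := by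
        rw [← intervalIntegral.integral_const_mul]
        refine intervalIntegral.integral_congr fun τ _ => ?_
        simp only [morawetzDensity]
        field_simp
      rw [e]
      have h3 : 0 ≤ -(deriv q y) / q y / 2 := by
        have : 0 ≤ -(deriv q y) := by linarith
        positivity
      have := mul_le_mul_of_nonneg_left (hJ y hy) h3
      linarith
  rw [intervalIntegral.integral_mul_const, hlog] at h2
  have h3 := mul_lt_mul_of_pos_right hlog2 hη
  rw [div_mul_cancel₀ _ hη.ne'] at h3
  linarith

/-- Finite speed of propagation. -/
theorem exists_tail_energy_le {ε : ℝ} (hε : 0 < ε) :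
    ∃ R, 0 < R ∧ ∀ t, 0 ≤ t → ∫ x in Ioi (R + t), energyDensity q u ux ut t x ≤ ε := by
  have hie := hu.sol.integrableOn_energyDensity hA.nonneg
  obtain ⟨R, hR, hR1, -⟩ := exists_tail_lt (hie 0) hε
  obtain ⟨K, -, hK⟩ := exists_deriv_smoothTransition_le
  refine ⟨R + 1, by linarith, fun t ht => ?_⟩
  -- In the frame `x - t` this weight rises from 0 at `R` to 1 at `R + 1`, and the energy it
  -- measures does not increase in time.
  set g : ℝ → ℝ := fun y => Real.smoothTransition ((y - R) / 1) with hg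
  have h1 := (hu.weighted_energy hA (g := g) (L := K) (δ := inwardEnergy q u ux ut 0)
    (hasDerivAt_smoothTransition_comp R 1)
    (continuous_deriv_smoothTransition_comp R 1) (fun y => abs_smoothTransition_le _)
    (fun y => by
      have := Real.smoothTransition.monotone.deriv_nonneg (x := (y - R) / 1)
      linarith)
    (fun y => by have := hK ((y - R) / 1); linarith) ht
    (fun τ hτ => hu.inwardEnergy_antitone hA hτ.1)).1
  have hgc : Continuous g := by
    have := Real.smoothTransition.continuous
    fun_prop
  have hint : ∀ t, IntegrableOn (fun x => g (x - t) * energyDensity q u ux ut t x) (Ioi 0) :=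
    fun t => Integrable.bdd_mul (c := 1) (hie t)
      (hgc.comp (by fun_prop : Continuous fun x : ℝ => x - t)).aestronglyMeasurable
      (Eventually.of_forall fun x => abs_smoothTransition_le _)
  have h2 : ∫ x in Ioi (R + 1 + t), energyDensity q u ux ut t x ≤
      ∫ x in Ioi (0 : ℝ), g (x - t) * energyDensity q u ux ut t x := by
    have hs : Ioi (R + 1 + t) ⊆ Ioi 0 := Ioi_subset_Ioi (by linarith)
    have e : ∫ x in Ioi (R + 1 + t), energyDensity q u ux ut t x =
        ∫ x in Ioi (R + 1 + t), g (x - t) * energyDensity q u ux ut t x := by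
      refine setIntegral_congr_fun measurableSet_Ioi fun x hx => ?_
      have hx' : R + 1 + t < x := hx
      simp only [hg]
      rw [Real.smoothTransition.one_of_one_le (by rw [div_one]; linarith), one_mul]
    rw [e]
    refine setIntegral_mono_set (hint t) ((ae_restrict_iff' measurableSet_Ioi).2
      (Eventually.of_forall fun x hx => ?_)) (LE.le.eventuallyLE hs)
    exact mul_nonneg (Real.smoothTransition.nonneg _)
      (energyDensity_nonneg (hA.nonneg x hx) _ _ _ _)
  have h3 : ∫ x in Ioi (0 : ℝ), g (x - 0) * energyDensity q u ux ut 0 x ≤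
      ∫ x in Ioi R, energyDensity q u ux ut 0 x := by
    have hs : Ioi R ⊆ Ioi 0 := Ioi_subset_Ioi hR.le
    rw [← inter_eq_self_of_subset_right hs, ← setIntegral_indicator measurableSet_Ioi]
    refine setIntegral_mono_on (hint 0) ?_ measurableSet_Ioi fun x hx => ?_
    · exact (hie 0).indicator measurableSet_Ioi
    · have he := energyDensity_nonneg (hA.nonneg x hx) u ux ut 0
      by_cases hx' : x ∈ Ioi R
      · rw [indicator_of_mem hx']
        have := Real.smoothTransition.le_one ((x - 0 - R) / 1)
        exact mul_le_of_le_one_left he this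
      · rw [indicator_of_notMem hx']
        have hx2 : x ≤ R := not_lt.1 hx'
        simp only [hg]
        rw [Real.smoothTransition.zero_of_nonpos (by rw [div_one]; linarith), zero_mul]
  linarith

/-- The energy leaves the region `x ≤ c t` for `c < 1`. -/
theorem exists_cone_energy_le {c : ℝ} (hc0 : 0 < c) (hc1 : c < 1) {ε : ℝ} (hε : 0 < ε) :
    ∃ T, 0 < T ∧ ∀ t, T ≤ t → ∫ x in Ioc 0 (c * t), energyDensity q u ux ut t x ≤ ε := by
  have hie := hu.sol.integrableOn_energyDensity hA.nonneg
  obtain ⟨K, hK0, hK⟩ := exists_deriv_smoothTransition_le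
  have hd : 0 < 1 - c := by linarith
  -- Chosen so that the loss `2 (K/ℓ) δ (t - s)` is at most `ε`, given `ℓ ≥ (1 - c) t / 2`.
  set δ := ε * (1 - c) / (4 * (K + 1)) with hδ
  obtain ⟨s, hs0, hs⟩ := hu.exists_inwardEnergy_le hA (ε := δ) (by positivity)
  refine ⟨2 * s / (1 - c) + 1, by positivity, fun t ht => ?_⟩
  have hst2 : 2 * s ≤ (1 - c) * (t - 1) := by
    have : 2 * s / (1 - c) ≤ t - 1 := by linarith
    rw [div_le_iff₀ hd] at this; linarith
  have ht1 : 1 ≤ t := by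
    have : 0 ≤ 2 * s / (1 - c) := by positivity
    linarith
  have hst : s ≤ t := by nlinarith
  -- The transition of `g` runs from `-(1 - c)t` to `-s`. At time `s` the weight equals 1 on the
  -- whole half line, at time `t` it vanishes on `x ≤ c t`, and its slope is of order `1/t`.
  set ℓ := (1 - c) * t - s with hℓ
  have hℓ1 : (1 - c) * t / 2 ≤ ℓ := by nlinarith
  have hℓ0 : 0 < ℓ := lt_of_lt_of_le (by positivity) hℓ1
  set g : ℝ → ℝ := fun y => Real.smoothTransition ((y - (-((1 - c) * t))) / ℓ) with hg
  have h1 := (hu.weighted_energy hA (g := g) (L := K / ℓ) (δ := δ)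
    (hasDerivAt_smoothTransition_comp _ ℓ)
    (continuous_deriv_smoothTransition_comp _ ℓ) (fun y => abs_smoothTransition_le _)
    (fun y => by
      have := Real.smoothTransition.monotone.deriv_nonneg (x := (y - (-((1 - c) * t))) / ℓ)
      positivity)
    (fun y => by
      have := hK ((y - (-((1 - c) * t))) / ℓ)
      rw [mul_one_div]; gcongr) hst
    (fun τ hτ => hs τ hτ.1)).2
  have hgc : Continuous g := by
    have := Real.smoothTransition.continuous
    fun_prop
  have hint : ∀ t, IntegrableOn (fun x => g (x - t) * energyDensity q u ux ut t x) (Ioi 0) :=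
    fun t => Integrable.bdd_mul (c := 1) (hie t)
      (hgc.comp (by fun_prop : Continuous fun x : ℝ => x - t)).aestronglyMeasurable
      (Eventually.of_forall fun x => abs_smoothTransition_le _)
  have h2 : ∫ x in Ioi (0 : ℝ), g (x - s) * energyDensity q u ux ut s x = energy q u ux ut t := by
    rw [hu.energy_const hA t s]
    refine setIntegral_congr_fun measurableSet_Ioi fun x hx => ?_
    have hx' : 0 < x := hx
    simp only [hg]
    rw [Real.smoothTransition.one_of_one_le (by rw [le_div_iff₀ hℓ0]; linarith), one_mul]
  have h3 : ∫ x in Ioc 0 (c * t), energyDensity q u ux ut t x ≤ energy q u ux ut t -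
      ∫ x in Ioi (0 : ℝ), g (x - t) * energyDensity q u ux ut t x := by
    rw [energy, ← integral_sub (hie t) (hint t)]
    have e : ∫ x in Ioc 0 (c * t), energyDensity q u ux ut t x =
        ∫ x in Ioc 0 (c * t), (energyDensity q u ux ut t x -
          g (x - t) * energyDensity q u ux ut t x) := by
      refine setIntegral_congr_fun measurableSet_Ioc fun x hx => ?_
      have hx' := hx.2
      simp only [hg]
      rw [Real.smoothTransition.zero_of_nonpos
        (div_nonpos_of_nonpos_of_nonneg (by linarith) hℓ0.le), zero_mul, sub_zero]
    rw [e]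
    refine setIntegral_mono_set ((hie t).sub (hint t)) ((ae_restrict_iff' measurableSet_Ioi).2
      (Eventually.of_forall fun x hx => ?_)) (LE.le.eventuallyLE Ioc_subset_Ioi_self)
    have he := energyDensity_nonneg (hA.nonneg x hx) u ux ut t
    have hg1 : g (x - t) ≤ 1 := Real.smoothTransition.le_one _
    simp only [Pi.zero_apply]
    nlinarith
  have h4 : 2 * (K / ℓ) * δ * (t - s) ≤ ε := by
    have h5 : K / ℓ ≤ (K + 1) / ((1 - c) * t / 2) := by gcongr; linarith
    calc 2 * (K / ℓ) * δ * (t - s) ≤ 2 * ((K + 1) / ((1 - c) * t / 2)) * δ * t := by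
          have hδ0 : 0 ≤ δ := by positivity
          have : t - s ≤ t := by linarith
          have : 0 ≤ t - s := by linarith
          gcongr
      _ = ε := by
          rw [hδ]
          have : (0 : ℝ) < t := by linarith
          field_simp
          norm_num
  linarith

end IsRegularSolution

end

end HalfLineWave

/-! ### Operations on solutions, and passage from regular to finite-energy solutions. -/

namespace HalfLineWave

noncomputable section

/-! ### Operations on solutions -/

lemma ContinuousInL2.add {f g : ℝ → ℝ → ℂ} (hf : ContinuousInL2 f) (hg : ContinuousInL2 g) :
    ContinuousInL2 fun t x => f t x + g t x :=
  continuousInL2_of_ae_eq (F := fun t => hf.curve t + hg.curve t)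
    (hf.continuous_curve.add hg.continuous_curve) fun t => by
    filter_upwards [Lp.coeFn_add (hf.curve t) (hg.curve t), hf.coeFn_curve t, hg.coeFn_curve t]
      with x h1 h2 h3
    rw [h1, Pi.add_apply, h2, h3]

lemma ContinuousInL2.const_mul {f : ℝ → ℝ → ℂ} (hf : ContinuousInL2 f) (c : ℂ) :
    ContinuousInL2 fun t x => c * f t x :=
  continuousInL2_of_ae_eq (F := fun t => c • hf.curve t) (hf.continuous_curve.const_smul c) fun t => by
    filter_upwards [Lp.coeFn_smul c (hf.curve t), hf.coeFn_curve t] with x h1 h2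
    rw [h1, Pi.smul_apply, h2, smul_eq_mul]

lemma ContinuousInL2.comp {f : ℝ → ℝ → ℂ} (hf : ContinuousInL2 f) {σ : ℝ → ℝ} (hσ : Continuous σ) :
    ContinuousInL2 fun t => f (σ t) :=
  ⟨fun t => hf.1 (σ t), fun t => (hf.2 (σ t)).comp (hσ.tendsto t)⟩

section Operations

variable {q : ℝ → ℝ} {w wx wt v vx vt : ℝ → ℝ → ℂ}

lemma IsEnergyClass.add {f f' g g' : ℝ → ℂ} (hf : IsEnergyClass q f f') (hg : IsEnergyClass q g g') :
    IsEnergyClass q (fun x => f x + g x) (fun x => f' x + g' x) where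
  memLp_deriv := hf.memLp_deriv.add hg.memLp_deriv
  eq_integral x hx := by
    rw [hf.eq_integral x hx, hg.eq_integral x hx, intervalIntegral.integral_add
      (MemLp.intervalIntegrable' hf.memLp_deriv le_rfl hx)
      (MemLp.intervalIntegrable' hg.memLp_deriv le_rfl hx)]
  memLp_potential := by
    convert hf.memLp_potential.add hg.memLp_potential using 1
    funext x
    simp only [sqrtMul, Pi.add_apply]; ring

lemma IsEnergyClass.const_mul {f f' : ℝ → ℂ} (hf : IsEnergyClass q f f') (c : ℂ) :
    IsEnergyClass q (fun x => c * f x) (fun x => c * f' x) where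
  memLp_deriv := hf.memLp_deriv.const_mul c
  eq_integral x hx := by
    rw [hf.eq_integral x hx, intervalIntegral.integral_const_mul]
  memLp_potential := by
    convert hf.memLp_potential.const_mul c using 1
    funext x
    simp only [sqrtMul]; ring

namespace IsFiniteEnergySolution

variable (hw : IsFiniteEnergySolution q w wx wt)
include hw

lemma integrableOn_weak (hqc : ContinuousOn q (Ioi 0)) {φ : ℝ → ℂ} (h1 : ContDiff ℝ ∞ φ)
    (h2 : HasCompactSupport φ) (h3 : tsupport φ ⊆ Ioi 0) (t : ℝ) :
    IntegrableOn (fun x => wt t x * φ x) (Ioi 0) ∧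
    IntegrableOn (fun x => wx t x * deriv φ x + (q x : ℂ) * w t x * φ x) (Ioi 0) := by
  have hc1 : ContDiff ℝ ∞ (deriv φ) := ((contDiff_infty_iff_deriv (𝕜 := ℝ)).1 h1).2
  have hm : MemLp φ 2 halfLine := (h1.continuous.memLp_of_hasCompactSupport h2).restrict _
  have hm' : MemLp (deriv φ) 2 halfLine :=
    (hc1.continuous.memLp_of_hasCompactSupport h2.deriv).restrict _
  refine ⟨(hw.continuous_wt.1 t).integrable_mul hm,
    ((hw.continuous_wx.1 t).integrable_mul hm').add ?_⟩
  have hqU : ContinuousOn (fun x => (q x : ℂ) * w t x) (Ioi 0) :=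
    (Complex.continuous_ofReal.comp_continuousOn hqc).mul (hw.jointContinuous.space t)
  have : Integrable fun x => (q x : ℂ) * w t x * φ x :=
    (ContinuousOn.continuous_of_tsupport_subset (hqU.mul h1.continuous.continuousOn) isOpen_Ioi
      ((tsupport_mul_subset_right (f := fun x => (q x : ℂ) * w t x) (g := φ)).trans
        h3)).integrable_of_hasCompactSupport h2.mul_left
  exact this.integrableOn

lemma add (hv : IsFiniteEnergySolution q v vx vt) (hqc : ContinuousOn q (Ioi 0)) :
    IsFiniteEnergySolution q (fun t x => w t x + v t x) (fun t x => wx t x + vx t x)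
      (fun t x => wt t x + vt t x) where
  energyClass t := (hw.energyClass t).add (hv.energyClass t)
  continuous_wx := hw.continuous_wx.add hv.continuous_wx
  continuous_potential := by
    convert hw.continuous_potential.add hv.continuous_potential using 1
    funext t x
    simp only [sqrtMul]; ring
  continuous_wt := hw.continuous_wt.add hv.continuous_wt
  time_deriv t := by
    have h := (hw.time_deriv t).add (hv.time_deriv t)
    rw [add_zero] at h
    refine tendsto_of_tendsto_of_tendsto_of_le_of_le tendsto_const_nhds h (fun _ => zero_le)
      fun s => ?_
    have h1 : AEStronglyMeasurable
        (fun x => ((s - t : ℝ) : ℂ)⁻¹ * (w s x - w t x) - wt t x) halfLine :=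
      (((hw.aestronglyMeasurable s).sub (hw.aestronglyMeasurable t)).const_mul _).sub
        (hw.continuous_wt.1 t).1
    have h2 : AEStronglyMeasurable
        (fun x => ((s - t : ℝ) : ℂ)⁻¹ * (v s x - v t x) - vt t x) halfLine :=
      (((hv.aestronglyMeasurable s).sub (hv.aestronglyMeasurable t)).const_mul _).sub
        (hv.continuous_wt.1 t).1
    refine le_trans (le_of_eq ?_) (eLpNorm_add_le h1 h2 (by norm_num))
    congr 1
    funext x
    simp only [Pi.add_apply]; ring
  weak_eq φ h1 h2 h3 t := by
    have h := (hw.weak_eq φ h1 h2 h3 t).add (hv.weak_eq φ h1 h2 h3 t)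
    have e1 : ((fun s => ∫ x in Ioi (0 : ℝ), wt s x * φ x) +
        fun s => ∫ x in Ioi (0 : ℝ), vt s x * φ x) =
        fun s => ∫ x in Ioi (0 : ℝ), (wt s x + vt s x) * φ x := by
      funext s
      rw [Pi.add_apply, ← integral_add (hw.integrableOn_weak hqc h1 h2 h3 s).1
        (hv.integrableOn_weak hqc h1 h2 h3 s).1]
      congr 1; funext x; ring
    rw [e1] at h
    refine h.congr_deriv ?_
    rw [← neg_add, ← integral_add (hw.integrableOn_weak hqc h1 h2 h3 t).2
        (hv.integrableOn_weak hqc h1 h2 h3 t).2]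
    congr 2; funext x; ring

lemma const_mul (c : ℂ) :
    IsFiniteEnergySolution q (fun t x => c * w t x) (fun t x => c * wx t x)
      (fun t x => c * wt t x) where
  energyClass t := (hw.energyClass t).const_mul c
  continuous_wx := hw.continuous_wx.const_mul c
  continuous_potential := by
    convert hw.continuous_potential.const_mul c using 1
    funext t x
    simp only [sqrtMul]; ring
  continuous_wt := hw.continuous_wt.const_mul c
  time_deriv t := by
    have h := ENNReal.Tendsto.const_mul (a := ‖c‖ₑ) (hw.time_deriv t) (Or.inr enorm_ne_top)
    rw [mul_zero] at h
    refine h.congr fun s => ?_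
    rw [← eLpNorm_const_smul]
    congr 1
    funext x
    simp only [Pi.smul_apply, smul_eq_mul]; ring
  weak_eq φ h1 h2 h3 t := by
    have h := (hw.weak_eq φ h1 h2 h3 t).const_mul c
    simp only [← integral_const_mul] at h
    simp only [mul_assoc c]
    refine h.congr_deriv ?_
    rw [mul_neg, ← integral_const_mul]
    congr 2; funext x; ring

lemma sub (hv : IsFiniteEnergySolution q v vx vt) (hqc : ContinuousOn q (Ioi 0)) :
    IsFiniteEnergySolution q (fun t x => w t x - v t x) (fun t x => wx t x - vx t x)
      (fun t x => wt t x - vt t x) := by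
  have := hw.add (hv.const_mul (-1)) hqc
  simpa [sub_eq_add_neg] using this

lemma shift (T : ℝ) :
    IsFiniteEnergySolution q (fun t => w (t + T)) (fun t => wx (t + T)) (fun t => wt (t + T)) where
  energyClass t := hw.energyClass _
  continuous_wx := hw.continuous_wx.comp (continuous_add_const T)
  continuous_potential := hw.continuous_potential.comp (continuous_add_const T)
  continuous_wt := hw.continuous_wt.comp (continuous_add_const T)
  time_deriv t := by
    have h : Tendsto (fun s => s + T) (𝓝[≠] t) (𝓝[≠] (t + T)) :=
      (continuous_add_const T).continuousWithinAt.tendsto_nhdsWithin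
        fun s hs => fun h => hs (add_right_cancel h)
    refine ((hw.time_deriv (t + T)).comp h).congr fun s => ?_
    simp only [Function.comp_apply, add_sub_add_right_eq_sub]
  weak_eq φ h1 h2 h3 t := (hw.weak_eq φ h1 h2 h3 (t + T)).comp_add_const t T

/-- Time reversal. -/
lemma reverse :
    IsFiniteEnergySolution q (fun t => w (-t)) (fun t => wx (-t)) (fun t x => -wt (-t) x) where
  energyClass t := hw.energyClass _
  continuous_wx := hw.continuous_wx.comp continuous_neg
  continuous_potential := hw.continuous_potential.comp continuous_neg
  continuous_wt := by
    have := (hw.continuous_wt.comp continuous_neg).const_mul (-1)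
    simpa using this
  time_deriv t := by
    have h : Tendsto (fun s : ℝ => -s) (𝓝[≠] t) (𝓝[≠] (-t)) :=
      continuous_neg.continuousWithinAt.tendsto_nhdsWithin
        fun s hs => fun h => hs (neg_injective h)
    refine ((hw.time_deriv (-t)).comp h).congr fun s => ?_
    simp only [Function.comp_apply]
    rw [← eLpNorm_neg]
    congr 1
    funext x
    have : ((-s - -t : ℝ) : ℂ)⁻¹ = -((s - t : ℝ) : ℂ)⁻¹ := by
      rw [← inv_neg]; congr 1; push_cast; ring
    simp only [Pi.neg_apply, this]
    ring
  weak_eq φ h1 h2 h3 t := by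
    have h := ((hw.weak_eq φ h1 h2 h3 (-t)).scomp t (hasDerivAt_neg t)).neg
    simp only [neg_smul, one_smul, neg_neg] at h
    refine h.congr_of_eventuallyEq (Eventually.of_forall fun s => ?_)
    simp only [Pi.neg_apply, Function.comp_apply, ← integral_neg, neg_mul]

end IsFiniteEnergySolution

end Operations

/-! ### Approximation by mollification -/

/-- A shrinking sequence of bump functions. -/
def bump (n : ℕ) : ContDiffBump (0 : ℝ) where
  rIn := 1 / (2 * (n + 1))
  rOut := 1 / (n + 1)
  rIn_pos := by positivity
  rIn_lt_rOut := by
    have : (0 : ℝ) < n + 1 := by positivity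
    rw [div_lt_div_iff₀ (by positivity) this]
    linarith

/-- A sequence of smooth kernels converging to the Dirac mass. -/
def kernelSeq (n : ℕ) : ℝ → ℝ := (bump n).normed volume

lemma isKernel_kernelSeq (n : ℕ) : IsKernel (kernelSeq n) :=
  ⟨(bump n).contDiff_normed, (bump n).hasCompactSupport_normed⟩

lemma tendsto_moll {F : Type*} [NormedAddCommGroup F] [NormedSpace ℝ F] [CompleteSpace F]
    {f : ℝ → F} (hf : Continuous f) (t : ℝ) :
    Tendsto (fun n => moll (kernelSeq n) f t) atTop (𝓝 (f t)) :=
  ContDiffBump.convolution_tendsto_right_of_continuous (φ := bump) (μ := volume)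
    (tendsto_one_div_add_atTop_nhds_zero_nat (𝕜 := ℝ)) hf t

namespace IsFiniteEnergySolution

variable {lam : ℝ} {q₀ q : ℝ → ℝ} {w wx wt v vx vt : ℝ → ℝ → ℂ}

lemma energyDensity_le_add {x : ℝ} (hq : 0 ≤ q x) (t : ℝ) : energyDensity q w wx wt t x ≤
    2 * energyDensity q v vx vt t x + 2 * energyDensity q (fun t x => w t x - v t x)
      (fun t x => wx t x - vx t x) (fun t x => wt t x - vt t x) t x := by
  have key : ∀ a b : ℂ, ‖a‖ ^ 2 ≤ 2 * ‖b‖ ^ 2 + 2 * ‖a - b‖ ^ 2 := fun a b => by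
    have h := norm_add_le b (a - b)
    rw [add_sub_cancel] at h
    nlinarith [sq_nonneg (‖b‖ - ‖a - b‖), norm_nonneg a, norm_nonneg b, norm_nonneg (a - b)]
  have h1 := key (wx t x) (vx t x)
  have h2 := key (wt t x) (vt t x)
  have h3 := mul_le_mul_of_nonneg_left (key (w t x) (v t x)) hq
  simp only [energyDensity]
  linarith

lemma inwardDensity_le_add {x : ℝ} (hq : 0 ≤ q x) (t : ℝ) : inwardDensity q w wx wt t x ≤
    2 * inwardDensity q v vx vt t x + 2 * inwardDensity q (fun t x => w t x - v t x)
      (fun t x => wx t x - vx t x) (fun t x => wt t x - vt t x) t x := by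
  have key : ∀ a b : ℂ, ‖a‖ ^ 2 ≤ 2 * ‖b‖ ^ 2 + 2 * ‖a - b‖ ^ 2 := fun a b => by
    have h := norm_add_le b (a - b)
    rw [add_sub_cancel] at h
    nlinarith [sq_nonneg (‖b‖ - ‖a - b‖), norm_nonneg a, norm_nonneg b, norm_nonneg (a - b)]
  have h1 := key (wx t x + wt t x) (vx t x + vt t x)
  have h3 := mul_le_mul_of_nonneg_left (key (w t x) (v t x)) hq
  have e : wx t x + wt t x - (vx t x + vt t x) = wx t x - vx t x + (wt t x - vt t x) := by ring
  rw [e] at h1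
  simp only [inwardDensity]
  linarith

variable (hw : IsFiniteEnergySolution q w wx wt)
include hw

lemma setIntegral_energyDensity_le_add (hv : IsFiniteEnergySolution q v vx vt)
    (hqc : ContinuousOn q (Ioi 0)) (hq : ∀ x, 0 < x → 0 ≤ q x) {S : Set ℝ} (hS : MeasurableSet S)
    (hS0 : S ⊆ Ioi 0) (t : ℝ) : ∫ x in S, energyDensity q w wx wt t x ≤
      2 * (∫ x in S, energyDensity q v vx vt t x) + 2 * energy q (fun t x => w t x - v t x)
        (fun t x => wx t x - vx t x) (fun t x => wt t x - vt t x) t := by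
  have hs := hw.sub hv hqc
  have i1 := (hv.integrableOn_energyDensity hq t).mono_set hS0
  have i2 := (hs.integrableOn_energyDensity hq t).mono_set hS0
  have h1 := setIntegral_mono_on ((hw.integrableOn_energyDensity hq t).mono_set hS0)
    ((i1.const_mul 2).add (i2.const_mul 2)) hS
    fun x hx => energyDensity_le_add (hq x (hS0 hx)) t
  simp only [Pi.add_apply] at h1
  rw [integral_add (i1.const_mul 2) (i2.const_mul 2), integral_const_mul, integral_const_mul] at h1
  have h2 := hs.setIntegral_energyDensity_le hq t hS0
  linarith

lemma inwardEnergy_le_energy (hq : ∀ x, 0 < x → 0 ≤ q x) (t : ℝ) :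
    inwardEnergy q w wx wt t ≤ energy q w wx wt t :=
  setIntegral_mono_on (hw.integrableOn_inwardDensity hq t)
    (hw.integrableOn_energyDensity hq t) measurableSet_Ioi fun x hx =>
    inwardDensity_le (hq x hx) _ _ _ _

lemma inwardEnergy_le_add (hv : IsFiniteEnergySolution q v vx vt)
    (hqc : ContinuousOn q (Ioi 0)) (hq : ∀ x, 0 < x → 0 ≤ q x) (t : ℝ) :
    inwardEnergy q w wx wt t ≤
      2 * inwardEnergy q v vx vt t + 2 * energy q (fun t x => w t x - v t x)
        (fun t x => wx t x - vx t x) (fun t x => wt t x - vt t x) t := by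
  have hs := hw.sub hv hqc
  have i1 := hv.integrableOn_inwardDensity hq t
  have i2 := hs.integrableOn_inwardDensity hq t
  have h1 := setIntegral_mono_on (hw.integrableOn_inwardDensity hq t)
    ((i1.const_mul 2).add (i2.const_mul 2)) measurableSet_Ioi
    fun x hx => inwardDensity_le_add (hq x hx) t
  simp only [Pi.add_apply] at h1
  rw [integral_add (i1.const_mul 2) (i2.const_mul 2), integral_const_mul, integral_const_mul] at h1
  have h2 := hs.inwardEnergy_le_energy hq t
  exact h1.trans (by
    have : ∫ x in Ioi (0 : ℝ), inwardDensity q (fun t x => w t x - v t x)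
        (fun t x => wx t x - vx t x) (fun t x => wt t x - vt t x) t x ≤ _ := h2
    have e : ∫ x in Ioi (0 : ℝ), inwardDensity q v vx vt t x = inwardEnergy q v vx vt t := rfl
    rw [e]
    linarith)

/-- Polarization exhibits the momentum as a continuous function of the curves in `L2`, so it passes
to the limit under mollification. -/
lemma momentum_eq (t : ℝ) : momentum wx wt t =
    (‖hw.continuous_wx.curve t + hw.continuous_wt.curve t‖ ^ 2 - ‖hw.continuous_wx.curve t‖ ^ 2 -
      ‖hw.continuous_wt.curve t‖ ^ 2) / 2 := by
  have e : ‖hw.continuous_wx.curve t + hw.continuous_wt.curve t‖ ^ 2 =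
      ∫ x in Ioi (0 : ℝ), ‖wx t x + wt t x‖ ^ 2 := by
    rw [← (hw.continuous_wx.add hw.continuous_wt).norm_curve_sq t]
    congr 2
  have i1 := MemLp.integrableOn_sq (hw.continuous_wx.1 t)
  have i2 := MemLp.integrableOn_sq (hw.continuous_wt.1 t)
  have i3 := MemLp.integrableOn_sq ((hw.continuous_wx.add hw.continuous_wt).1 t)
  have i31 : IntegrableOn (fun x => ‖wx t x + wt t x‖ ^ 2 - ‖wx t x‖ ^ 2) (Ioi 0) := i3.sub i1
  rw [e, hw.continuous_wx.norm_curve_sq, hw.continuous_wt.norm_curve_sq, momentum,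
    ← integral_sub i3 i1, ← integral_sub i31 i2, ← integral_div]
  congr 1; funext x
  rw [norm_add_sq_real, real_inner_comm (wx t x)]; ring

variable (hA : IsAdmissible lam q₀ q)
include hA

lemma regular_timeMoll {k : ℝ → ℝ} (hk : IsKernel k) :
    IsRegularSolution q (timeMoll k w) (spaceDeriv (timeMoll k w)) (timeMoll (deriv k) w)
      (timeMoll (deriv (deriv k)) w) (spaceDeriv (timeMoll (deriv k) w)) :=
  hw.isRegularSolution_timeMoll hA.continuousOn hA.nonneg hk

lemma curves_timeMoll {k : ℝ → ℝ} (hk : IsKernel k) :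
    (hw.regular_timeMoll hA hk).sol.continuous_wx.curve = moll k hw.continuous_wx.curve ∧
    (hw.regular_timeMoll hA hk).sol.continuous_wt.curve = moll k hw.continuous_wt.curve ∧
    (hw.regular_timeMoll hA hk).sol.continuous_potential.curve =
      moll k hw.continuous_potential.curve :=
  ⟨ContinuousInL2.curve_eq_of_ae_eq _ (hw.moll_wx_ae_eq hA.continuousOn hA.nonneg hk),
    ContinuousInL2.curve_eq_of_ae_eq _ (hw.moll_wt_ae_eq hk),
    ContinuousInL2.curve_eq_of_ae_eq _ (hw.moll_potential_ae_eq hA.continuousOn hk)⟩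

lemma tendsto_energy_timeMoll (t : ℝ) : Tendsto (fun n => energy q (timeMoll (kernelSeq n) w)
    (spaceDeriv (timeMoll (kernelSeq n) w)) (timeMoll (deriv (kernelSeq n)) w) t) atTop
    (𝓝 (energy q w wx wt t)) := by
  have h1 := tendsto_moll hw.continuous_wx.continuous_curve t
  have h2 := tendsto_moll hw.continuous_wt.continuous_curve t
  have h3 := tendsto_moll hw.continuous_potential.continuous_curve t
  rw [hw.energy_eq hA.nonneg]
  refine (((h1.norm.pow 2).add (h2.norm.pow 2)).add (h3.norm.pow 2)).congr fun n => ?_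
  rw [(hw.regular_timeMoll hA (isKernel_kernelSeq n)).sol.energy_eq hA.nonneg]
  obtain ⟨e1, e2, e3⟩ := hw.curves_timeMoll hA (isKernel_kernelSeq n)
  rw [e1, e2, e3]

lemma tendsto_momentum_timeMoll (t : ℝ) : Tendsto (fun n => momentum
    (spaceDeriv (timeMoll (kernelSeq n) w)) (timeMoll (deriv (kernelSeq n)) w) t) atTop
    (𝓝 (momentum wx wt t)) := by
  have h1 := tendsto_moll hw.continuous_wx.continuous_curve t
  have h2 := tendsto_moll hw.continuous_wt.continuous_curve t
  rw [hw.momentum_eq]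
  refine (((((h1.add h2).norm.pow 2).sub (h1.norm.pow 2)).sub (h2.norm.pow 2)).div_const 2).congr
    fun n => ?_
  rw [(hw.regular_timeMoll hA (isKernel_kernelSeq n)).sol.momentum_eq]
  obtain ⟨e1, e2, e3⟩ := hw.curves_timeMoll hA (isKernel_kernelSeq n)
  rw [e1, e2]

/-- Conservation of energy. -/
theorem energy_const (s t : ℝ) : energy q w wx wt s = energy q w wx wt t :=
  tendsto_nhds_unique ((hw.tendsto_energy_timeMoll hA s).congr fun n =>
    (hw.regular_timeMoll hA (isKernel_kernelSeq n)).energy_const hA s t)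
    (hw.tendsto_energy_timeMoll hA t)

lemma tendsto_energy_sub_timeMoll (t : ℝ) : Tendsto (fun n => energy q
    (fun t x => w t x - timeMoll (kernelSeq n) w t x)
    (fun t x => wx t x - spaceDeriv (timeMoll (kernelSeq n) w) t x)
    (fun t x => wt t x - timeMoll (deriv (kernelSeq n)) w t x) t) atTop (𝓝 0) := by
  have h1 := ((tendsto_moll hw.continuous_wx.continuous_curve t).const_sub
    (hw.continuous_wx.curve t)).norm.pow 2
  have h2 := ((tendsto_moll hw.continuous_wt.continuous_curve t).const_sub
    (hw.continuous_wt.curve t)).norm.pow 2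
  have h3 := ((tendsto_moll hw.continuous_potential.continuous_curve t).const_sub
    (hw.continuous_potential.curve t)).norm.pow 2
  have h := (h1.add h2).add h3
  simp only [sub_self, norm_zero, ne_eq, OfNat.ofNat_ne_zero, not_false_eq_true, zero_pow,
    add_zero] at h
  refine h.congr fun n => ?_
  have hr := hw.regular_timeMoll hA (isKernel_kernelSeq n)
  obtain ⟨e1, e2, e3⟩ := hw.curves_timeMoll hA (isKernel_kernelSeq n)
  have hs := hw.sub hr.sol hA.continuousOn
  have c1 : hs.continuous_wx.curve t = hw.continuous_wx.curve t - hr.sol.continuous_wx.curve t := by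
    rw [ContinuousInL2.curve, ContinuousInL2.curve, ContinuousInL2.curve, ← MemLp.toLp_sub]
    rfl
  have c2 : hs.continuous_wt.curve t = hw.continuous_wt.curve t - hr.sol.continuous_wt.curve t := by
    rw [ContinuousInL2.curve, ContinuousInL2.curve, ContinuousInL2.curve, ← MemLp.toLp_sub]
    rfl
  have c3 : hs.continuous_potential.curve t =
      hw.continuous_potential.curve t - hr.sol.continuous_potential.curve t := by
    rw [ContinuousInL2.curve, ContinuousInL2.curve, ContinuousInL2.curve, ← MemLp.toLp_sub]
    refine MemLp.toLp_congr _ _ (Eventually.of_forall fun x => ?_)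
    simp only [sqrtMul, Pi.sub_apply]; ring
  rw [hs.energy_eq hA.nonneg, c1, c2, c3, e1, e2, e3]

/-- The error is itself a solution, so its energy is conserved. Closeness at time zero is therefore
uniform in time, and asymptotic statements pass to the limit. -/
lemma exists_regular_approximation {ε : ℝ} (hε : 0 < ε) : ∃ u ux ut utt uxt : ℝ → ℝ → ℂ,
    IsRegularSolution q u ux ut utt uxt ∧ ∀ t, energy q (fun t x => w t x - u t x)
      (fun t x => wx t x - ux t x) (fun t x => wt t x - ut t x) t < ε := by
  obtain ⟨n, hn⟩ := ((hw.tendsto_energy_sub_timeMoll hA 0).eventually (gt_mem_nhds hε)).exists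
  have hr := hw.regular_timeMoll hA (isKernel_kernelSeq n)
  refine ⟨_, _, _, _, _, hr, fun t => ?_⟩
  rw [(hw.sub hr.sol hA.continuousOn).energy_const hA t 0]
  exact hn

lemma momentum_antitone : Antitone (momentum wx wt) := fun s t hst =>
  le_of_tendsto_of_tendsto' (hw.tendsto_momentum_timeMoll hA t) (hw.tendsto_momentum_timeMoll hA s)
    fun n => (hw.regular_timeMoll hA (isKernel_kernelSeq n)).momentum_antitone hA hst

theorem exists_inwardEnergy_le {ε : ℝ} (hε : 0 < ε) :
    ∃ s, 0 ≤ s ∧ ∀ t, s ≤ t → inwardEnergy q w wx wt t ≤ ε := by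
  obtain ⟨u, ux, ut, utt, uxt, hr, hu⟩ := hw.exists_regular_approximation hA
    (ε := ε / 4) (by positivity)
  obtain ⟨s, hs0, hs⟩ := hr.exists_inwardEnergy_le hA (ε := ε / 4) (by positivity)
  refine ⟨s, hs0, fun t ht => ?_⟩
  have := hw.inwardEnergy_le_add hr.sol hA.continuousOn hA.nonneg t
  linarith [hs t ht, hu t]

theorem exists_tail_energy_le {ε : ℝ} (hε : 0 < ε) :
    ∃ R, 0 < R ∧ ∀ t, 0 ≤ t → ∫ x in Ioi (R + t), energyDensity q w wx wt t x ≤ ε := by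
  obtain ⟨u, ux, ut, utt, uxt, hr, hu⟩ := hw.exists_regular_approximation hA
    (ε := ε / 4) (by positivity)
  obtain ⟨R, hR0, hR⟩ := hr.exists_tail_energy_le hA (ε := ε / 4) (by positivity)
  refine ⟨R, hR0, fun t ht => ?_⟩
  have := hw.setIntegral_energyDensity_le_add hr.sol hA.continuousOn hA.nonneg
    (measurableSet_Ioi (a := R + t)) (Ioi_subset_Ioi (by linarith)) t
  linarith [hR t ht, hu t]

theorem exists_cone_energy_le {c : ℝ} (hc0 : 0 < c) (hc1 : c < 1) {ε : ℝ} (hε : 0 < ε) :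
    ∃ T, 0 < T ∧ ∀ t, T ≤ t → ∫ x in Ioc 0 (c * t), energyDensity q w wx wt t x ≤ ε := by
  obtain ⟨u, ux, ut, utt, uxt, hr, hu⟩ := hw.exists_regular_approximation hA
    (ε := ε / 4) (by positivity)
  obtain ⟨T, hT0, hT⟩ := hr.exists_cone_energy_le hA hc0 hc1 (ε := ε / 4) (by positivity)
  refine ⟨T, hT0, fun t ht => ?_⟩
  have := hw.setIntegral_energyDensity_le_add hr.sol hA.continuousOn hA.nonneg
    (measurableSet_Ioc (a := 0) (b := c * t)) Ioc_subset_Ioi_self t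
  linarith [hT t ht, hu t]

end IsFiniteEnergySolution

end

end HalfLineWave

/-! ### Hardy's inequality and weighted bounds for concentrated derivatives. -/

namespace HalfLineWave

noncomputable section

/-! ### Hardy's inequality -/

/-- Cauchy–Schwarz for the splitting `‖f‖ = y^(-1/4) · y^(1/4) ‖f‖`, with `∫_0^x y^(-1/2) dy = 2√x`.
It is obtained from the discriminant of the nonnegative quadratic `c ↦ ∫ (c √y ‖f‖ - 1)² / √y`. -/
lemma sq_integral_le_weighted {f : ℝ → ℂ} (hf : MemLp f 2 halfLine) {x : ℝ} (hx : 0 < x) :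
    IntegrableOn (fun y => √y * ‖f y‖ ^ 2) (Ioc 0 x) ∧
    ‖∫ y in (0 : ℝ)..x, f y‖ ^ 2 ≤ 2 * √x * ∫ y in Ioc 0 x, √y * ‖f y‖ ^ 2 := by
  have i0 := (MemLp.integrableOn_sq hf).mono_set (Ioc_subset_Ioi_self : Ioc 0 x ⊆ Ioi 0)
  have i1 : IntegrableOn (fun y => √y * ‖f y‖ ^ 2) (Ioc 0 x) := by
    refine Integrable.bdd_mul (c := √x) i0 Real.continuous_sqrt.aestronglyMeasurable ?_
    refine (ae_restrict_iff' measurableSet_Ioc).2 (Eventually.of_forall fun y hy => ?_)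
    rw [Real.norm_of_nonneg (Real.sqrt_nonneg _)]
    exact Real.sqrt_le_sqrt hy.2
  refine ⟨i1, ?_⟩
  have i2 : IntegrableOn (fun y => ‖f y‖) (Ioc 0 x) := (MemLp.integrableOn_Ioc hf le_rfl).norm
  have i3 : IntegrableOn (fun y : ℝ => 1 * y ^ (-(1 / 2 : ℝ))) (Ioc 0 x) :=
    (intervalIntegrable_iff_integrableOn_Ioc_of_le hx.le).1
      (intervalIntegrable_rpow_neg (by norm_num))
  have e3 : ∫ y in Ioc 0 x, 1 * y ^ (-(1 / 2 : ℝ)) = 2 * √x := by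
    rw [← intervalIntegral.integral_of_le hx.le, integral_rpow_neg_zero (by norm_num),
      Real.sqrt_eq_rpow]
    norm_num
  have hN : ‖∫ y in (0 : ℝ)..x, f y‖ ≤ ∫ y in Ioc 0 x, ‖f y‖ := by
    rw [intervalIntegral.integral_of_le hx.le]
    exact norm_integral_le_integral_norm _
  have hd : discrim (∫ y in Ioc 0 x, √y * ‖f y‖ ^ 2) (-2 * ∫ y in Ioc 0 x, ‖f y‖) (2 * √x) ≤ 0 := by
    refine discrim_le_zero fun c => ?_
    have e : (∫ y in Ioc 0 x, √y * ‖f y‖ ^ 2) * (c * c) + (-2 * ∫ y in Ioc 0 x, ‖f y‖) * c +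
        2 * √x = ∫ y in Ioc 0 x, ((c * c) * (√y * ‖f y‖ ^ 2) + (-2 * c) * ‖f y‖ +
          1 * y ^ (-(1 / 2 : ℝ))) := by
      have j1 : IntegrableOn (fun y => (c * c) * (√y * ‖f y‖ ^ 2)) (Ioc 0 x) := i1.const_mul _
      have j2 : IntegrableOn (fun y => (-2 * c) * ‖f y‖) (Ioc 0 x) := i2.const_mul _
      have j12 : IntegrableOn (fun y => (c * c) * (√y * ‖f y‖ ^ 2) + (-2 * c) * ‖f y‖) (Ioc 0 x) :=
        j1.add j2
      rw [integral_add j12 i3, integral_add j1 j2, integral_const_mul, integral_const_mul, e3]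
      ring
    rw [e]
    refine setIntegral_nonneg measurableSet_Ioc fun y hy => ?_
    have hy0 : 0 < √y := Real.sqrt_pos.2 hy.1
    have e4 : y ^ (-(1 / 2 : ℝ)) = (√y)⁻¹ := by
      rw [Real.rpow_neg hy.1.le, Real.sqrt_eq_rpow]
    rw [e4]
    have : (c * c) * (√y * ‖f y‖ ^ 2) + (-2 * c) * ‖f y‖ + 1 * (√y)⁻¹ =
        (c * √y * ‖f y‖ - 1) ^ 2 / √y := by
      field_simp; ring
    rw [this]
    positivity
  rw [discrim] at hd
  have h1 : ‖∫ y in (0 : ℝ)..x, f y‖ ^ 2 ≤ (∫ y in Ioc 0 x, ‖f y‖) ^ 2 := by gcongr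
  nlinarith

/-- Tonelli over `y < x`, with `∫_y^∞ 2 x^(-3/2) dx = 4 y^(-1/2)`. Working in `[0, ∞]` avoids
integrability questions, and the integrability part of Hardy's inequality comes out of the estimate.
-/
lemma lintegral_hardy {g : ℝ → ℝ≥0∞} (hg : Measurable g) :
    ∫⁻ x in Ioi (0 : ℝ), ENNReal.ofReal (2 * x ^ (-(3 / 2) : ℝ)) * ∫⁻ y in Ioo 0 x, g y =
      ∫⁻ y in Ioi (0 : ℝ), ENNReal.ofReal (4 * y ^ (-(1 / 2) : ℝ)) * g y := by
  set A : ℝ → ℝ≥0∞ := fun x => ENNReal.ofReal (2 * x ^ (-(3 / 2) : ℝ)) with hA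
  have hAm : Measurable A := by fun_prop
  have hS : MeasurableSet {p : ℝ × ℝ | p.2 < p.1} := measurableSet_lt measurable_snd measurable_fst
  set k : ℝ × ℝ → ℝ≥0∞ := {p : ℝ × ℝ | p.2 < p.1}.indicator fun p => A p.1 * g p.2
  have hk : Measurable k :=
    ((hAm.comp measurable_fst).mul (hg.comp measurable_snd)).indicator hS
  have e1 : ∀ x, A x * ∫⁻ y in Ioo 0 x, g y = ∫⁻ y in Ioi (0 : ℝ), k (x, y) := by
    intro x
    rw [← lintegral_const_mul _ hg]
    have : (fun y => k (x, y)) = (Iio x).indicator fun y => A x * g y := by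
      funext y
      simp only [k, indicator, mem_ofPred_eq, mem_Iio]
    rw [this, setLIntegral_indicator measurableSet_Iio, inter_comm]
    rfl
  have e2 : ∀ y ∈ Ioi (0 : ℝ), ∫⁻ x in Ioi (0 : ℝ), k (x, y) =
      ENNReal.ofReal (4 * y ^ (-(1 / 2) : ℝ)) * g y := by
    intro y hy
    have hy' : 0 < y := hy
    have h1 : (fun x => k (x, y)) = (Ioi y).indicator fun x => A x * g y := by
      funext x
      simp only [k, indicator, mem_ofPred_eq, mem_Ioi]
    rw [h1, setLIntegral_indicator measurableSet_Ioi,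
      inter_eq_self_of_subset_left (Ioi_subset_Ioi hy'.le), lintegral_mul_const _ hAm]
    congr 1
    have h2 : IntegrableOn (fun x : ℝ => 2 * x ^ (-(3 / 2) : ℝ)) (Ioi y) :=
      (integrableOn_Ioi_rpow_of_lt (by norm_num) hy').const_mul 2
    rw [hA, ← ofReal_integral_eq_lintegral_ofReal h2
      ((ae_restrict_iff' measurableSet_Ioi).2 (Eventually.of_forall fun x hx => by
        have : 0 < x := hy'.trans hx
        simp only [Pi.zero_apply]; positivity)), integral_const_mul,
      integral_Ioi_rpow_of_lt (by norm_num) hy']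
    congr 1
    norm_num
    ring
  calc _ = ∫⁻ x in Ioi (0 : ℝ), ∫⁻ y in Ioi (0 : ℝ), k (x, y) :=
        setLIntegral_congr_fun measurableSet_Ioi fun x _ => e1 x
    _ = ∫⁻ y in Ioi (0 : ℝ), ∫⁻ x in Ioi (0 : ℝ), k (x, y) :=
        lintegral_lintegral_swap (f := fun x y => k (x, y)) hk.aemeasurable
    _ = _ := setLIntegral_congr_fun measurableSet_Ioi e2

theorem hardy {f : ℝ → ℂ} (hf : MemLp f 2 halfLine) :
    IntegrableOn (fun x => ‖∫ y in (0 : ℝ)..x, f y‖ ^ 2 / x ^ 2) (Ioi 0) ∧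
    ∫ x in Ioi (0 : ℝ), ‖∫ y in (0 : ℝ)..x, f y‖ ^ 2 / x ^ 2 ≤ 4 * ∫ x in Ioi (0 : ℝ), ‖f x‖ ^ 2 := by
  -- A strongly measurable representative, required by Tonelli.
  obtain ⟨F, hFm, hfF⟩ := hf.1
  have hF : MemLp F 2 halfLine := (memLp_congr_ae hfF).1 hf
  have hV : ∀ x ∈ Ioi (0 : ℝ), ‖∫ y in (0 : ℝ)..x, f y‖ ^ 2 / x ^ 2 =
      ‖∫ y in (0 : ℝ)..x, F y‖ ^ 2 / x ^ 2 := fun x hx => by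
    rw [intervalIntegral_congr_ae_halfLine hfF le_rfl (le_of_lt hx)]
  have hfF2 : ∫ x in Ioi (0 : ℝ), ‖f x‖ ^ 2 = ∫ x in Ioi (0 : ℝ), ‖F x‖ ^ 2 :=
    integral_congr_ae (by
      have : ∀ᵐ x ∂volume.restrict (Ioi (0 : ℝ)), f x = F x := hfF
      filter_upwards [this] with x hx
      rw [hx])
  rw [setIntegral_congr_fun measurableSet_Ioi hV, integrableOn_congr_fun hV measurableSet_Ioi, hfF2]
  set V : ℝ → ℝ := fun x => ‖∫ y in (0 : ℝ)..x, F y‖ ^ 2 / x ^ 2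
  have hFi := MemLp.integrableOn_sq hF
  have hV0 : ∀ x, 0 ≤ V x := fun x => by positivity
  have hle : ∫⁻ x in Ioi (0 : ℝ), ENNReal.ofReal (V x) ≤
      ENNReal.ofReal (4 * ∫ x in Ioi (0 : ℝ), ‖F x‖ ^ 2) := by
    have hg : Measurable fun y : ℝ => ENNReal.ofReal (√y * ‖F y‖ ^ 2) :=
      (Real.continuous_sqrt.measurable.mul (hFm.norm.measurable.pow_const 2)).ennreal_ofReal
    calc ∫⁻ x in Ioi (0 : ℝ), ENNReal.ofReal (V x)
        ≤ ∫⁻ x in Ioi (0 : ℝ), ENNReal.ofReal (2 * x ^ (-(3 / 2) : ℝ)) *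
          ∫⁻ y in Ioo 0 x, ENNReal.ofReal (√y * ‖F y‖ ^ 2) := by
          refine setLIntegral_mono' measurableSet_Ioi fun x hx => ?_
          have hx' : 0 < x := hx
          obtain ⟨h1, h2⟩ := sq_integral_le_weighted hF hx'
          rw [setLIntegral_congr Ioo_ae_eq_Ioc, ← ofReal_integral_eq_lintegral_ofReal h1
            (Eventually.of_forall fun y => by simp only [Pi.zero_apply]; positivity),
            ← ENNReal.ofReal_mul (by positivity)]
          refine ENNReal.ofReal_le_ofReal ?_
          simp only [V]
          rw [div_le_iff₀ (by positivity)]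
          refine h2.trans (le_of_eq ?_)
          have : √x = x ^ (-(3 / 2) : ℝ) * x ^ 2 := by
            rw [← Real.rpow_natCast, ← Real.rpow_add hx', Real.sqrt_eq_rpow]
            norm_num
          rw [this]; ring
      _ = ∫⁻ y in Ioi (0 : ℝ), ENNReal.ofReal (4 * y ^ (-(1 / 2) : ℝ)) *
          ENNReal.ofReal (√y * ‖F y‖ ^ 2) := lintegral_hardy hg
      _ = ∫⁻ y in Ioi (0 : ℝ), ENNReal.ofReal (4 * ‖F y‖ ^ 2) := by
          refine setLIntegral_congr_fun measurableSet_Ioi fun y hy => ?_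
          have hy' : 0 < y := hy
          rw [← ENNReal.ofReal_mul (by positivity), Real.rpow_neg hy'.le, ← Real.sqrt_eq_rpow]
          have := Real.sqrt_pos.2 hy'
          congr 1
          field_simp
      _ = _ := by
          rw [← ofReal_integral_eq_lintegral_ofReal (hFi.const_mul 4)
            (Eventually.of_forall fun y => by simp only [Pi.zero_apply]; positivity),
            integral_const_mul]
  have hcont : ContinuousOn V (Ioi 0) := by
    have h1 : ContinuousOn (fun x => ∫ y in (0 : ℝ)..x, F y) (Ioi 0) := by
      intro x hx
      have hx' : (0 : ℝ) < x := hx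
      have h0 : IntegrableOn F (Icc 0 (x + 1)) :=
        (integrableOn_Icc_iff_integrableOn_Ioc (by simp)).2 (MemLp.integrableOn_Ioc hF le_rfl)
      have h2 : ContinuousOn (fun z => ∫ y in (0 : ℝ)..z, F y) (Icc 0 (x + 1)) := by
        have h3 : (0 : ℝ) ≤ x + 1 := by linarith
        rw [← uIcc_of_le h3] at h0 ⊢
        exact intervalIntegral.continuousOn_primitive_interval h0
      exact (h2.continuousAt (Icc_mem_nhds hx' (by linarith))).continuousWithinAt
    refine (h1.norm.pow 2).div (by fun_prop) fun x hx => ?_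
    have hx' : (0 : ℝ) < x := hx
    positivity
  have hint : IntegrableOn V (Ioi 0) := by
    refine ⟨hcont.aestronglyMeasurable measurableSet_Ioi, ?_⟩
    rw [hasFiniteIntegral_iff_ofReal (Eventually.of_forall hV0)]
    exact hle.trans_lt ENNReal.ofReal_lt_top
  refine ⟨hint, ?_⟩
  rw [← ofReal_integral_eq_lintegral_ofReal hint (Eventually.of_forall hV0)] at hle
  refine (ENNReal.ofReal_le_ofReal_iff ?_).1 hle
  have : 0 ≤ ∫ x in Ioi (0 : ℝ), ‖F x‖ ^ 2 := integral_nonneg fun _ => by positivity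
  positivity

/-! ### Weighted decay when the derivative concentrates far away -/

lemma integral_indicator_sq {f : ℝ → ℂ} {S : Set ℝ} (hS : MeasurableSet S) (hS0 : S ⊆ Ioi 0) :
    ∫ x in Ioi (0 : ℝ), ‖S.indicator f x‖ ^ 2 = ∫ x in S, ‖f x‖ ^ 2 := by
  have : (fun x => ‖S.indicator f x‖ ^ 2) = S.indicator fun x => ‖f x‖ ^ 2 := by
    funext x
    by_cases hx : x ∈ S <;> simp [hx]
  rw [this, setIntegral_indicator hS, inter_eq_self_of_subset_right hS0]

/-- Weighted bounds for a primitive whose derivative concentrates on `(a, b]`. -/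
lemma weighted_bounds {f : ℝ → ℂ} (hf : MemLp f 2 halfLine) {a b : ℝ} (ha : 0 < a) (hab : a ≤ b) :
    (∫ x in Ioi (0 : ℝ), ‖∫ y in (0 : ℝ)..x, f y‖ ^ 2 / x ^ 2 ≤
      8 * ((∫ x in Ioc 0 a, ‖f x‖ ^ 2) + ∫ x in Ioi b, ‖f x‖ ^ 2) +
        2 * ((b - a) / a * ∫ x in Ioi (0 : ℝ), ‖f x‖ ^ 2)) ∧
    ∀ x, 0 < x → ‖∫ y in (0 : ℝ)..x, f y‖ ^ 2 / x ≤
      2 * ((∫ x in Ioc 0 a, ‖f x‖ ^ 2) + ∫ x in Ioi b, ‖f x‖ ^ 2) +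
        2 * ((b - a) / a * ∫ x in Ioi (0 : ℝ), ‖f x‖ ^ 2) := by
  have hb : 0 < b := ha.trans_le hab
  set S : Set ℝ := Ioc 0 a ∪ Ioi b with hS
  have hSm : MeasurableSet S := measurableSet_Ioc.union measurableSet_Ioi
  have hS0 : S ⊆ Ioi 0 := union_subset Ioc_subset_Ioi_self (Ioi_subset_Ioi hb.le)
  have i0 := MemLp.integrableOn_sq hf
  set D := (∫ x in Ioc 0 a, ‖f x‖ ^ 2) + ∫ x in Ioi b, ‖f x‖ ^ 2
  set N := ∫ x in Ioi (0 : ℝ), ‖f x‖ ^ 2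
  have hN : 0 ≤ N := integral_nonneg fun _ => by positivity
  have eD : ∫ x in S, ‖f x‖ ^ 2 = D :=
    setIntegral_union (Ioc_disjoint_Ioi hab) measurableSet_Ioi
      (i0.mono_set Ioc_subset_Ioi_self) (i0.mono_set (Ioi_subset_Ioi hb.le))
  -- The small part of `f`, off `(a, b]`, is treated by Hardy's inequality with constant 4; the part
  -- on `(a, b]` by the shortness of that interval.
  set f₁ := S.indicator f with hf₁
  set f₂ := (Ioc a b).indicator f with hf₂
  have m1 : MemLp f₁ 2 halfLine := hf.indicator hSm
  have m2 : MemLp f₂ 2 halfLine := hf.indicator measurableSet_Ioc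
  have e1 : ∫ x in Ioi (0 : ℝ), ‖f₁ x‖ ^ 2 = D := by rw [integral_indicator_sq hSm hS0, eD]
  have hdec : ∀ x, 0 < x → f x = f₁ x + f₂ x := by
    intro x hx
    by_cases h1 : x ≤ a
    · have h2 : x ∈ S := Or.inl ⟨hx, h1⟩
      have h3 : x ∉ Ioc a b := fun h => absurd h.1 (not_lt.2 h1)
      rw [hf₁, hf₂, indicator_of_mem h2, indicator_of_notMem h3, add_zero]
    · by_cases h4 : x ≤ b
      · have h2 : x ∉ S := by
          rintro (h | h)
          · exact h1 h.2
          · exact absurd h (not_lt.2 h4)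
        have h3 : x ∈ Ioc a b := ⟨not_le.1 h1, h4⟩
        rw [hf₁, hf₂, indicator_of_notMem h2, indicator_of_mem h3, zero_add]
      · have h2 : x ∈ S := Or.inr (not_le.1 h4)
        have h3 : x ∉ Ioc a b := fun h => h4 h.2
        rw [hf₁, hf₂, indicator_of_mem h2, indicator_of_notMem h3, add_zero]
  have hV : ∀ x, 0 < x → ∫ y in (0 : ℝ)..x, f y = (∫ y in (0 : ℝ)..x, f₁ y) +
      ∫ y in (0 : ℝ)..x, f₂ y := by
    intro x hx
    rw [← intervalIntegral.integral_add (MemLp.intervalIntegrable' m1 le_rfl hx.le)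
      (MemLp.intervalIntegrable' m2 le_rfl hx.le)]
    refine intervalIntegral.integral_congr_ae (Eventually.of_forall fun y hy => ?_)
    rw [uIoc_of_le hx.le] at hy
    exact hdec y hy.1
  have hsq : ∀ x, 0 < x → ‖∫ y in (0 : ℝ)..x, f y‖ ^ 2 ≤ 2 * ‖∫ y in (0 : ℝ)..x, f₁ y‖ ^ 2 +
      2 * ‖∫ y in (0 : ℝ)..x, f₂ y‖ ^ 2 := by
    intro x hx
    rw [hV x hx]
    have := norm_add_le (∫ y in (0 : ℝ)..x, f₁ y) (∫ y in (0 : ℝ)..x, f₂ y)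
    nlinarith [sq_nonneg (‖∫ y in (0 : ℝ)..x, f₁ y‖ - ‖∫ y in (0 : ℝ)..x, f₂ y‖),
      norm_nonneg ((∫ y in (0 : ℝ)..x, f₁ y) + ∫ y in (0 : ℝ)..x, f₂ y)]
  have hz : ∀ x, 0 < x → x ≤ a → ∫ y in (0 : ℝ)..x, f₂ y = 0 := by
    intro x hx hxa
    refine intervalIntegral.integral_zero_ae (Eventually.of_forall fun y hy => ?_)
    rw [uIoc_of_le hx.le] at hy
    exact indicator_of_notMem (fun h => absurd (hy.2.trans hxa) (not_le.2 h.1)) _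
  -- The primitive of `f₂` vanishes up to `a` and is bounded after it. The weights `x⁻²`, integrated
  -- from `a`, and `x⁻¹` then each yield the factor `1/a`.
  have h2 : ∀ x, a < x → ‖∫ y in (0 : ℝ)..x, f₂ y‖ ^ 2 ≤ (b - a) * N := by
    intro x hx
    have hx0 : 0 < x := ha.trans hx
    have e : ∫ y in (0 : ℝ)..x, f₂ y = ∫ y in a..(min x b), f y := by
      rw [intervalIntegral.integral_of_le hx0.le, intervalIntegral.integral_of_le (le_min hx.le hab),
        setIntegral_indicator measurableSet_Ioc, Ioc_inter_Ioc, max_eq_right ha.le]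
    rw [e]
    refine (norm_integral_sq_le hf ha.le (le_min hx.le hab)).trans ?_
    have h3 : ∫ y in Ioc a (min x b), ‖f y‖ ^ 2 ≤ N :=
      setIntegral_mono_set i0 (Eventually.of_forall fun _ => by
        simp only [Pi.zero_apply]; positivity) (LE.le.eventuallyLE (Ioc_subset_Ioi_zero ha.le))
    have h4 : 0 ≤ ∫ y in Ioc a (min x b), ‖f y‖ ^ 2 := integral_nonneg fun _ => by positivity
    have h5 := min_le_right x b
    have h6 : 0 ≤ b - a := by linarith
    gcongr
  constructor
  · obtain ⟨j1, j1'⟩ := hardy m1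
    obtain ⟨j2, -⟩ := hardy m2
    have h3 : ∫ x in Ioi (0 : ℝ), ‖∫ y in (0 : ℝ)..x, f₂ y‖ ^ 2 / x ^ 2 ≤ (b - a) / a * N := by
      have k1 : IntegrableOn (fun x : ℝ => (b - a) * N * x ^ (-2 : ℝ)) (Ioi a) :=
        (integrableOn_Ioi_rpow_of_lt (by norm_num) ha).const_mul _
      have k2 : ∫ x in Ioi (0 : ℝ), ‖∫ y in (0 : ℝ)..x, f₂ y‖ ^ 2 / x ^ 2 =
          ∫ x in Ioi a, ‖∫ y in (0 : ℝ)..x, f₂ y‖ ^ 2 / x ^ 2 := by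
        rw [← Ioc_union_Ioi_eq_Ioi ha.le, setIntegral_union (Ioc_disjoint_Ioi le_rfl)
          measurableSet_Ioi (j2.mono_set Ioc_subset_Ioi_self)
          (j2.mono_set (Ioi_subset_Ioi ha.le)), add_eq_right]
        refine setIntegral_eq_zero_of_forall_eq_zero fun x hx => ?_
        rw [hz x hx.1 hx.2]; simp
      rw [k2]
      refine (setIntegral_mono_on (j2.mono_set (Ioi_subset_Ioi ha.le)) k1 measurableSet_Ioi
        fun x hx => ?_).trans (le_of_eq ?_)
      · have hx0 : 0 < x := ha.trans hx
        rw [div_le_iff₀ (by positivity)]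
        refine (h2 x hx).trans (le_of_eq ?_)
        rw [mul_assoc, ← Real.rpow_natCast, ← Real.rpow_add hx0]
        norm_num
      · rw [integral_const_mul, integral_Ioi_rpow_of_lt (by norm_num) ha]
        norm_num
        rw [Real.rpow_neg_one]
        field_simp
    have h4 : ∫ x in Ioi (0 : ℝ), ‖∫ y in (0 : ℝ)..x, f y‖ ^ 2 / x ^ 2 ≤
        ∫ x in Ioi (0 : ℝ), (2 * (‖∫ y in (0 : ℝ)..x, f₁ y‖ ^ 2 / x ^ 2) +
          2 * (‖∫ y in (0 : ℝ)..x, f₂ y‖ ^ 2 / x ^ 2)) := by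
      refine setIntegral_mono_on (hardy hf).1 ((j1.const_mul 2).add (j2.const_mul 2))
        measurableSet_Ioi fun x hx => ?_
      have hx0 : 0 < x := hx
      have := hsq x hx0
      rw [← mul_div_assoc, ← mul_div_assoc, ← add_div]
      gcongr
    rw [integral_add (j1.const_mul 2) (j2.const_mul 2), integral_const_mul,
      integral_const_mul] at h4
    rw [e1] at j1'
    linarith
  · intro x hx
    have h3 := hsq x hx
    have h4 : ‖∫ y in (0 : ℝ)..x, f₁ y‖ ^ 2 ≤ x * D := by
      have := norm_integral_sq_le m1 le_rfl hx.le
      rw [sub_zero] at this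
      refine this.trans (mul_le_mul_of_nonneg_left ?_ hx.le)
      rw [← e1]
      exact setIntegral_mono_set (MemLp.integrableOn_sq m1) (Eventually.of_forall fun _ => by
        simp only [Pi.zero_apply]; positivity) (LE.le.eventuallyLE Ioc_subset_Ioi_self)
    have h5 : ‖∫ y in (0 : ℝ)..x, f₂ y‖ ^ 2 ≤ x * ((b - a) / a * N) := by
      have h6 : 0 ≤ (b - a) / a * N := by
        have : 0 ≤ b - a := by linarith
        positivity
      rcases le_or_gt x a with hxa | hxa
      · rw [hz x hx hxa, norm_zero, zero_pow two_ne_zero]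
        positivity
      · refine (h2 x hxa).trans ?_
        have : (b - a) * N = a * ((b - a) / a * N) := by field_simp
        rw [this]
        gcongr
    rw [div_le_iff₀ hx]
    linarith

end

end HalfLineWave

/-! ### Asymptotics of finite-energy solutions as time tends to infinity. -/

namespace HalfLineWave

noncomputable section

namespace IsFiniteEnergySolution

variable {lam : ℝ} {q₀ q : ℝ → ℝ} {w wx wt : ℝ → ℝ → ℂ}
variable (hw : IsFiniteEnergySolution q w wx wt)
include hw

lemma integrableOn_hardy (t : ℝ) : IntegrableOn (fun x => ‖w t x‖ ^ 2 / x ^ 2) (Ioi 0) :=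
  (hardy (hw.continuous_wx.1 t)).1.congr_fun (fun x hx => by
    simp only [(hw.energyClass t).eq_integral x (le_of_lt hx)]) measurableSet_Ioi

lemma bddAbove_weighted (t : ℝ) : BddAbove (range fun x : Ioi (0 : ℝ) => ‖w t x‖ ^ 2 / (x : ℝ)) := by
  refine ⟨∫ y in Ioi (0 : ℝ), ‖wx t y‖ ^ 2, ?_⟩
  rintro _ ⟨⟨x, hx⟩, rfl⟩
  have hx' : 0 < x := hx
  simp only
  rw [div_le_iff₀ hx', mul_comm]
  refine ((hw.energyClass t).norm_sq_le hx'.le).trans (mul_le_mul_of_nonneg_left ?_ hx'.le)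
  exact setIntegral_mono_set (MemLp.integrableOn_sq (hw.continuous_wx.1 t))
    (Eventually.of_forall fun _ => by simp only [Pi.zero_apply]; positivity)
    (LE.le.eventuallyLE Ioc_subset_Ioi_self)

lemma outwardEnergy_add_inwardEnergy (hq : ∀ x, 0 < x → 0 ≤ q x) (t : ℝ) :
    outwardEnergy q w wx wt t + inwardEnergy q w wx wt t = energy q w wx wt t := by
  rw [hw.outwardEnergy_eq hq, hw.inwardEnergy_eq hq]; ring

lemma integral_potential_le (hq : ∀ x, 0 < x → 0 ≤ q x) (t : ℝ) :
    ∫ x in Ioi (0 : ℝ), q x * ‖w t x‖ ^ 2 ≤ 2 * inwardEnergy q w wx wt t := by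
  have : inwardEnergy q w wx wt t = ∫ x in Ioi (0 : ℝ), inwardDensity q w wx wt t x := rfl
  rw [this, ← integral_const_mul]
  refine setIntegral_mono_on (hw.integrableOn_potential hq t)
    ((hw.integrableOn_inwardDensity hq t).const_mul 2) measurableSet_Ioi fun x _ => ?_
  rw [inwardDensity]
  nlinarith [sq_nonneg ‖wx t x + wt t x‖]

lemma setIntegral_wx_le (hq : ∀ x, 0 < x → 0 ≤ q x) {S : Set ℝ} (hS : MeasurableSet S)
    (hS0 : S ⊆ Ioi 0) (t : ℝ) :
    ∫ x in S, ‖wx t x‖ ^ 2 ≤ ∫ x in S, energyDensity q w wx wt t x := by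
  refine setIntegral_mono_on ((MemLp.integrableOn_sq (hw.continuous_wx.1 t)).mono_set hS0)
    ((hw.integrableOn_energyDensity hq t).mono_set hS0) hS fun x hx => ?_
  have := hq x (hS0 hx)
  have : 0 ≤ q x * ‖w t x‖ ^ 2 := by positivity
  rw [energyDensity]
  nlinarith [sq_nonneg ‖wt t x‖]

omit hw in
lemma energy_nonneg (hq : ∀ x, 0 < x → 0 ≤ q x) (t : ℝ) : 0 ≤ energy q w wx wt t :=
  setIntegral_nonneg measurableSet_Ioi fun x hx => energyDensity_nonneg (hq x hx) w wx wt t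

variable (hA : IsAdmissible lam q₀ q)
include hA

theorem inwardEnergy_antitone : Antitone (inwardEnergy q w wx wt) := fun s t hst => by
  rw [hw.inwardEnergy_eq hA.nonneg, hw.inwardEnergy_eq hA.nonneg, hw.energy_const hA t s]
  linarith [hw.momentum_antitone hA hst]

theorem outwardEnergy_monotone : Monotone (outwardEnergy q w wx wt) := fun s t hst => by
  rw [hw.outwardEnergy_eq hA.nonneg, hw.outwardEnergy_eq hA.nonneg, hw.energy_const hA t s]
  linarith [hw.momentum_antitone hA hst]

theorem tendsto_inwardEnergy : Tendsto (inwardEnergy q w wx wt) atTop (𝓝 0) := by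
  rw [Metric.tendsto_atTop]
  intro ε hε
  obtain ⟨s, -, hs⟩ := hw.exists_inwardEnergy_le hA (half_pos hε)
  refine ⟨s, fun t ht => ?_⟩
  rw [Real.dist_eq, sub_zero, abs_of_nonneg (inwardEnergy_nonneg hA.nonneg t)]
  linarith [hs t ht]

theorem tendsto_outwardEnergy (s : ℝ) :
    Tendsto (outwardEnergy q w wx wt) atTop (𝓝 (energy q w wx wt s)) := by
  have h := (hw.tendsto_inwardEnergy hA).const_sub (energy q w wx wt s)
  rw [sub_zero] at h
  refine h.congr fun t => ?_
  rw [hw.energy_const hA s t, ← hw.outwardEnergy_add_inwardEnergy hA.nonneg t]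
  ring

theorem tendsto_potential :
    Tendsto (fun t => ∫ x in Ioi (0 : ℝ), q x * ‖w t x‖ ^ 2) atTop (𝓝 0) := by
  have h := (hw.tendsto_inwardEnergy hA).const_mul 2
  rw [mul_zero] at h
  refine squeeze_zero (fun t => setIntegral_nonneg measurableSet_Ioi fun x hx => ?_)
    (fun t => hw.integral_potential_le hA.nonneg t) h
  exact mul_nonneg (hA.nonneg x hx) (sq_nonneg _)

theorem tendsto_cone_energy {c : ℝ} (hc0 : 0 < c) (hc1 : c < 1) :
    Tendsto (fun t => ∫ x in Ioc 0 (c * |t|), energyDensity q w wx wt t x) atTop (𝓝 0) := by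
  rw [Metric.tendsto_atTop]
  intro ε hε
  obtain ⟨T, hT0, hT⟩ := hw.exists_cone_energy_le hA hc0 hc1 (half_pos hε)
  refine ⟨T, fun t ht => ?_⟩
  rw [Real.dist_eq, sub_zero, abs_of_nonneg (setIntegral_nonneg measurableSet_Ioc fun x hx =>
    energyDensity_nonneg (hA.nonneg x hx.1) w wx wt t), abs_of_pos (hT0.trans_le ht)]
  linarith [hT t ht]

/-- At large times, the weighted norms of part four are small. -/
lemma exists_weighted_le {ε : ℝ} (hε : 0 < ε) : ∃ T, ∀ t, T ≤ t →
    ∫ x in Ioi (0 : ℝ), ‖w t x‖ ^ 2 / x ^ 2 ≤ ε ∧ ∀ x, 0 < x → ‖w t x‖ ^ 2 / x ≤ ε := by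
  set E := energy q w wx wt 0
  have hE : 0 ≤ E := energy_nonneg hA.nonneg 0
  -- The bounds of `weighted_bounds` are at most `8 · 2η + 2 · 4ηE = η (16 + 8E)`.
  set η := min (1 / 4) (ε / (16 + 8 * E)) with hηd
  have hη : 0 < η := by positivity
  have hη1 : η ≤ 1 / 4 := min_le_left _ _
  have hη2 : η * (16 + 8 * E) ≤ ε := by
    have := min_le_right (1 / 4) (ε / (16 + 8 * E))
    rwa [← hηd, le_div_iff₀ (by positivity)] at this
  obtain ⟨T, hT0, hT⟩ := hw.exists_cone_energy_le hA (c := 1 - η) (by linarith) (by linarith) hη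
  obtain ⟨R, hR0, hR⟩ := hw.exists_tail_energy_le hA hη
  refine ⟨max T (R / η), fun t ht => ?_⟩
  have ht1 : T ≤ t := (le_max_left _ _).trans ht
  have ht0 : 0 < t := hT0.trans_le ht1
  have ht2 : R ≤ t * η := by
    have := (le_max_right T (R / η)).trans ht
    rwa [div_le_iff₀ hη] at this
  set a := (1 - η) * t with ha
  have ha0 : 0 < a := mul_pos (by linarith) ht0
  have hab : a ≤ R + t := by nlinarith
  obtain ⟨h1, h2⟩ := weighted_bounds (hw.continuous_wx.1 t) ha0 hab
  have h3 : (∫ x in Ioc 0 a, ‖wx t x‖ ^ 2) ≤ η :=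
    (hw.setIntegral_wx_le hA.nonneg measurableSet_Ioc Ioc_subset_Ioi_self t).trans (hT t ht1)
  have h4 : (∫ x in Ioi (R + t), ‖wx t x‖ ^ 2) ≤ η :=
    (hw.setIntegral_wx_le hA.nonneg measurableSet_Ioi (Ioi_subset_Ioi (by linarith)) t).trans
      (hR t ht0.le)
  have h5 : ∫ x in Ioi (0 : ℝ), ‖wx t x‖ ^ 2 ≤ E :=
    (hw.setIntegral_wx_le hA.nonneg measurableSet_Ioi subset_rfl t).trans
      (hw.energy_const hA t 0).le
  -- For `t ≥ R/η` the derivative concentrates on an interval from `(1 - η)t` of length at most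
  -- `2ηt`, and `2η/(1 - η) ≤ 4η` since `η ≤ 1/4`.
  have h6 : (R + t - a) / a ≤ 4 * η := by
    rw [div_le_iff₀ ha0, ha]
    nlinarith [mul_pos hη ht0]
  have h7 : 0 ≤ ∫ x in Ioi (0 : ℝ), ‖wx t x‖ ^ 2 := integral_nonneg fun _ => by positivity
  have h8 : (R + t - a) / a * ∫ x in Ioi (0 : ℝ), ‖wx t x‖ ^ 2 ≤ 4 * η * E :=
    mul_le_mul h6 h5 h7 (by positivity)
  constructor
  · have e : ∫ x in Ioi (0 : ℝ), ‖w t x‖ ^ 2 / x ^ 2 =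
        ∫ x in Ioi (0 : ℝ), ‖∫ y in (0 : ℝ)..x, wx t y‖ ^ 2 / x ^ 2 :=
      setIntegral_congr_fun measurableSet_Ioi fun x hx => by
        simp only [(hw.energyClass t).eq_integral x (le_of_lt hx)]
    rw [e]
    linarith
  · intro x hx
    have := h2 x hx
    rw [← (hw.energyClass t).eq_integral x hx.le] at this
    linarith

theorem tendsto_hardy :
    Tendsto (fun t => ∫ x in Ioi (0 : ℝ), ‖w t x‖ ^ 2 / x ^ 2) atTop (𝓝 0) := by
  rw [Metric.tendsto_atTop]
  intro ε hε
  obtain ⟨T, hT⟩ := hw.exists_weighted_le hA (half_pos hε)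
  refine ⟨T, fun t ht => ?_⟩
  rw [Real.dist_eq, sub_zero, abs_of_nonneg (integral_nonneg fun x => by positivity)]
  linarith [(hT t ht).1]

theorem tendsto_weighted_iSup :
    Tendsto (fun t => ⨆ x : Ioi (0 : ℝ), ‖w t x‖ ^ 2 / (x : ℝ)) atTop (𝓝 0) := by
  rw [Metric.tendsto_atTop]
  intro ε hε
  obtain ⟨T, hT⟩ := hw.exists_weighted_le hA (half_pos hε)
  refine ⟨T, fun t ht => ?_⟩
  rw [Real.dist_eq, sub_zero, abs_of_nonneg (Real.iSup_nonneg fun x => by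
    have : (0 : ℝ) < x := x.2
    positivity)]
  have : ⨆ x : Ioi (0 : ℝ), ‖w t x‖ ^ 2 / (x : ℝ) ≤ ε / 2 :=
    Real.iSup_le (fun x => (hT t ht).2 x x.2) (by positivity)
  linarith

end IsFiniteEnergySolution

/-! ### Time reversal -/

section Reversal

variable (q : ℝ → ℝ) (w wx wt : ℝ → ℝ → ℂ) (t : ℝ)

lemma energyDensity_reverse (x : ℝ) :
    energyDensity q (fun t => w (-t)) (fun t => wx (-t)) (fun t x => -wt (-t) x) t x =
      energyDensity q w wx wt (-t) x := by
  simp [energyDensity]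

lemma inwardEnergy_reverse :
    inwardEnergy q (fun t => w (-t)) (fun t => wx (-t)) (fun t x => -wt (-t) x) t =
      outwardEnergy q w wx wt (-t) := by
  simp [inwardEnergy, outwardEnergy, sub_eq_add_neg]

lemma outwardEnergy_reverse :
    outwardEnergy q (fun t => w (-t)) (fun t => wx (-t)) (fun t x => -wt (-t) x) t =
      inwardEnergy q w wx wt (-t) := by
  simp [inwardEnergy, outwardEnergy]

lemma energy_reverse :
    energy q (fun t => w (-t)) (fun t => wx (-t)) (fun t x => -wt (-t) x) t =
      energy q w wx wt (-t) := by
  simp [energy, energyDensity]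

end Reversal

lemma tendsto_atBot_of_reverse {α : Type*} [TopologicalSpace α] {f g : ℝ → α} {l : α}
    (h : Tendsto g atTop (𝓝 l)) (hfg : ∀ t, g t = f (-t)) : Tendsto f atBot (𝓝 l) :=
  (h.comp tendsto_neg_atBot_atTop).congr fun t => by rw [Function.comp_apply, hfg, neg_neg]

end

end HalfLineWave

/-! ### Density of square integrable and strong solutions in the energy norm. -/

namespace HalfLineWave

noncomputable section

namespace IsFiniteEnergySolution

variable {lam : ℝ} {q₀ q : ℝ → ℝ} {w wx wt v vx vt : ℝ → ℝ → ℂ}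

lemma energyDensity_add_le {x θ : ℝ} (hq : 0 ≤ q x) (hθ : 0 < θ) (t : ℝ) :
    energyDensity q (fun t x => v t x + w t x) (fun t x => vx t x + wx t x)
      (fun t x => vt t x + wt t x) t x ≤
    (1 + θ) * energyDensity q v vx vt t x + (1 + 1 / θ) * energyDensity q w wx wt t x := by
  have key : ∀ a b : ℂ, ‖a + b‖ ^ 2 ≤ (1 + θ) * ‖a‖ ^ 2 + (1 + 1 / θ) * ‖b‖ ^ 2 := fun a b => by
    have h := norm_add_le a b
    have h1 : 0 ≤ (θ * ‖a‖ - ‖b‖) ^ 2 / θ := by positivity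
    have h2 : (θ * ‖a‖ - ‖b‖) ^ 2 / θ = θ * ‖a‖ ^ 2 - 2 * ‖a‖ * ‖b‖ + 1 / θ * ‖b‖ ^ 2 := by
      field_simp; ring
    nlinarith [norm_nonneg (a + b)]
  have h1 := key (vx t x) (wx t x)
  have h2 := key (vt t x) (wt t x)
  have h3 := mul_le_mul_of_nonneg_left (key (v t x) (w t x)) hq
  simp only [energyDensity]
  nlinarith

variable (hw : IsFiniteEnergySolution q w wx wt)
include hw

/-- Near-orthogonality: when `v` lives mostly on `(0, R]` and `w` mostly beyond `R`, the energy of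
the sum is nearly the sum of the energies. On each of the two regions the favourable weight `1 + θ`
goes to the dominant summand. -/
lemma energy_add_le (hv : IsFiniteEnergySolution q v vx vt) (hqc : ContinuousOn q (Ioi 0))
    (hq : ∀ x, 0 < x → 0 ≤ q x) {R θ : ℝ} (hR : 0 < R) (hθ : 0 < θ) (t : ℝ) :
    energy q (fun t x => v t x + w t x) (fun t x => vx t x + wx t x)
      (fun t x => vt t x + wt t x) t ≤ (1 + θ) * (energy q v vx vt t + energy q w wx wt t) +
      (1 + 1 / θ) * ((∫ x in Ioi R, energyDensity q v vx vt t x) +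
        ∫ x in Ioc 0 R, energyDensity q w wx wt t x) := by
  have hs := hv.add hw hqc
  have iv := hv.integrableOn_energyDensity hq t
  have iw := hw.integrableOn_energyDensity hq t
  have is := hs.integrableOn_energyDensity hq t
  have h1 := setIntegral_mono_on (is.mono_set (Ioc_subset_Ioi_self : Ioc 0 R ⊆ Ioi 0))
    (((iv.mono_set Ioc_subset_Ioi_self).const_mul (1 + θ)).add
      ((iw.mono_set Ioc_subset_Ioi_self).const_mul (1 + 1 / θ))) measurableSet_Ioc
    fun x hx => energyDensity_add_le (hq x hx.1) hθ t
  have hRs : Ioi R ⊆ Ioi 0 := Ioi_subset_Ioi hR.le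
  have h2 := setIntegral_mono_on (is.mono_set hRs)
    (((iw.mono_set hRs).const_mul (1 + θ)).add
      ((iv.mono_set hRs).const_mul (1 + 1 / θ))) measurableSet_Ioi
    fun x hx => by
      have := energyDensity_add_le (v := w) (vx := wx) (vt := wt) (w := v) (wx := vx) (wt := vt)
        (hq x (hRs hx)) hθ t
      simp only [add_comm (w _ _), add_comm (wx _ _), add_comm (wt _ _)] at this
      exact this
  simp only [Pi.add_apply] at h1 h2
  rw [integral_add ((iv.mono_set Ioc_subset_Ioi_self).const_mul (1 + θ))
    ((iw.mono_set Ioc_subset_Ioi_self).const_mul (1 + 1 / θ)), integral_const_mul,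
    integral_const_mul] at h1
  rw [integral_add ((iw.mono_set hRs).const_mul (1 + θ))
    ((iv.mono_set hRs).const_mul (1 + 1 / θ)), integral_const_mul, integral_const_mul] at h2
  have e : energy q (fun t x => v t x + w t x) (fun t x => vx t x + wx t x)
      (fun t x => vt t x + wt t x) t = (∫ x in Ioc 0 R, energyDensity q (fun t x => v t x + w t x)
        (fun t x => vx t x + wx t x) (fun t x => vt t x + wt t x) t x) +
      ∫ x in Ioi R, energyDensity q (fun t x => v t x + w t x)
        (fun t x => vx t x + wx t x) (fun t x => vt t x + wt t x) t x := by
    rw [energy, ← Ioc_union_Ioi_eq_Ioi hR.le, setIntegral_union (Ioc_disjoint_Ioi le_rfl)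
      measurableSet_Ioi (is.mono_set Ioc_subset_Ioi_self) (is.mono_set hRs)]
  have a1 := hv.setIntegral_energyDensity_le hq t (Ioc_subset_Ioi_self : Ioc 0 R ⊆ Ioi 0)
  have a2 := hw.setIntegral_energyDensity_le hq t hRs
  have b1 := mul_le_mul_of_nonneg_left a1 (by positivity : 0 ≤ 1 + θ)
  have b2 := mul_le_mul_of_nonneg_left a2 (by positivity : 0 ≤ 1 + θ)
  rw [e]
  linarith

lemma continuousInL2_of_memLp (h : MemLp (w 0) 2 halfLine) : ContinuousInL2 w :=
  continuousInL2_of_ae_eq (F := fun t => h.toLp (w 0) + hw.incr t)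
    (continuous_const.add hw.continuous_incr) fun t => by
    filter_upwards [Lp.coeFn_add (h.toLp (w 0)) (hw.incr t), h.coeFn_toLp, hw.coeFn_incr t]
      with x h1 h2 h3
    rw [h1, Pi.add_apply, h2, h3]; ring

lemma continuousInL2_timeMoll {k : ℝ → ℝ} (hk : IsKernel k) (h : MemLp (w 0) 2 halfLine) :
    ContinuousInL2 (timeMoll k w) :=
  continuousInL2_of_ae_eq (continuous_moll hk (hw.continuousInL2_of_memLp h).continuous_curve)
    (moll_ae_eq hk (hw.continuousInL2_of_memLp h).continuous_curve hw.jointContinuous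
      (hw.continuousInL2_of_memLp h).coeFn_curve)

variable (hA : IsAdmissible lam q₀ q)
include hA

/-- Sums of time translates with almost orthogonal terms. -/
lemma exists_translate_sum (N : ℕ) : ∃ v vx vt : ℝ → ℝ → ℂ, IsFiniteEnergySolution q v vx vt ∧
    energy q v vx vt 0 ≤ N * (energy q w wx wt 0 + 1) ∧
    MemLp (fun x => (N : ℂ) * w 0 x - v 0 x) 2 halfLine := by
  set E := energy q w wx wt 0
  have hE : 0 ≤ E := energy_nonneg hA.nonneg 0
  induction N with
  | zero =>
    refine ⟨_, _, _, hw.const_mul 0, ?_, ?_⟩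
    · simp [energy, energyDensity]
    · simp
  | succ N ih =>
    obtain ⟨v, vx, vt, hv, h1, h2⟩ := ih
    set A := energy q v vx vt 0 + E
    have hv0 : 0 ≤ energy q v vx vt 0 := energy_nonneg hA.nonneg 0
    have hA0 : 0 ≤ A := by positivity
    -- Chosen so that `θ A` and the term with `η` below are each at most 1/2; each new translate
    -- then costs at most `E + 1`.
    set θ := 1 / (2 * (A + 1)) with hθd
    have hθ : 0 < θ := by positivity
    have hθA : θ * A ≤ 1 / 2 := by
      rw [hθd, div_mul_eq_mul_div, div_le_iff₀ (by positivity)]; linarith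
    set η := 1 / (4 * (1 + 1 / θ)) with hηd
    have hη : 0 < η := by positivity
    -- Almost all the energy of the sum built so far lies in `(0, R]`. The translation time is so
    -- late that `w` has left that interval: `R ≤ t/2`, and the cone with `c = 1/2` is empty up to
    -- `η`.
    obtain ⟨R, hR, hR1, -⟩ := exists_tail_lt (hv.integrableOn_energyDensity hA.nonneg 0) hη
    obtain ⟨T, hT0, hT⟩ := hw.exists_cone_energy_le hA (c := 1 / 2) (by norm_num) (by norm_num) hη
    set t := max T (2 * R)
    have hz := hw.shift t
    refine ⟨_, _, _, hv.add hz hA.continuousOn, ?_, ?_⟩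
    · have h3 := hz.energy_add_le hv hA.continuousOn hA.nonneg hR hθ 0
      have h4 : energy q (fun s => w (s + t)) (fun s => wx (s + t)) (fun s => wt (s + t)) 0 = E := by
        have : energy q (fun s => w (s + t)) (fun s => wx (s + t)) (fun s => wt (s + t)) 0 =
            energy q w wx wt (0 + t) := rfl
        rw [this, hw.energy_const hA (0 + t) 0]
      have h5 : ∫ x in Ioc 0 R, energyDensity q (fun s => w (s + t)) (fun s => wx (s + t))
          (fun s => wt (s + t)) 0 x ≤ η := by
        have e : ∀ x, energyDensity q (fun s => w (s + t)) (fun s => wx (s + t))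
          (fun s => wt (s + t)) 0 x = energyDensity q w wx wt t x := fun x => by
          simp only [energyDensity, zero_add]
        simp only [e]
        refine le_trans ?_ (hT t (le_max_left _ _))
        refine setIntegral_mono_set ((hw.integrableOn_energyDensity hA.nonneg t).mono_set
          Ioc_subset_Ioi_self) ((ae_restrict_iff' measurableSet_Ioc).2
          (Eventually.of_forall fun x hx => energyDensity_nonneg (hA.nonneg x hx.1) _ _ _ _))
          (LE.le.eventuallyLE (Ioc_subset_Ioc_right ?_))
        have := le_max_right T (2 * R)
        linarith
      rw [h4] at h3
      have h6 : (1 + 1 / θ) * (η + η) = 1 / 2 := by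
        rw [hηd]; field_simp; norm_num
      have h7 : (1 + 1 / θ) * ((∫ x in Ioi R, energyDensity q v vx vt 0 x) +
          ∫ x in Ioc 0 R, energyDensity q (fun s => w (s + t)) (fun s => wx (s + t))
          (fun s => wt (s + t)) 0 x) ≤ (1 + 1 / θ) * (η + η) := by
        gcongr
      push_cast
      have h8 : (1 + θ) * A = A + θ * A := by ring
      refine h3.trans ?_
      have h9 : A = energy q v vx vt 0 + E := rfl
      rw [← h9, h8]
      linarith
    · convert h2.add (hw.memLp_sub 0 (0 + t)) using 1
      funext x
      simp only [Pi.add_apply]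
      push_cast
      ring

/-- Finite-energy solutions are limits of square integrable ones. -/
lemma exists_memLp_approximation {ε : ℝ} (hε : 0 < ε) : ∃ v vx vt : ℝ → ℝ → ℂ,
    IsFiniteEnergySolution q v vx vt ∧ MemLp (v 0) 2 halfLine ∧
    energy q (fun t x => w t x - v t x) (fun t x => wx t x - vx t x)
      (fun t x => wt t x - vt t x) 0 < ε := by
  set E := energy q w wx wt 0
  have hE : 0 ≤ E := energy_nonneg hA.nonneg 0
  -- The mean `v/N` of `N` translates has energy at most `(E + 1)/N`, while `w - v/N` at time zero
  -- is a mean of increments of `w` in time and so is square integrable.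
  obtain ⟨N, hN⟩ := exists_nat_gt ((E + 1) / ε)
  have hN0 : (0 : ℝ) < N := lt_of_le_of_lt (by positivity) hN
  have hN0' : (N : ℂ) ≠ 0 := by exact_mod_cast hN0.ne'
  obtain ⟨v, vx, vt, hv, h1, h2⟩ := hw.exists_translate_sum hA N
  have hc := hv.const_mul ((N : ℂ)⁻¹)
  refine ⟨_, _, _, hw.sub hc hA.continuousOn, ?_, ?_⟩
  · convert h2.const_mul ((N : ℂ)⁻¹) using 1
    funext x
    field_simp
  · simp only [sub_sub_cancel]
    have e : energy q (fun t x => (N : ℂ)⁻¹ * v t x) (fun t x => (N : ℂ)⁻¹ * vx t x)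
        (fun t x => (N : ℂ)⁻¹ * vt t x) 0 = ((N : ℝ)⁻¹) ^ 2 * energy q v vx vt 0 := by
      rw [energy, energy, ← integral_const_mul]
      congr 1; funext x
      simp only [energyDensity, norm_mul, norm_inv, Complex.norm_natCast]
      ring
    rw [e]
    rw [div_lt_iff₀ hε] at hN
    calc ((N : ℝ)⁻¹) ^ 2 * energy q v vx vt 0 ≤ ((N : ℝ)⁻¹) ^ 2 * (N * (E + 1)) := by gcongr
      _ = (E + 1) / N := by field_simp
      _ < ε := by rw [div_lt_iff₀ hN0]; linarith

end IsFiniteEnergySolution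

namespace IsRegularSolution

variable {lam : ℝ} {q₀ q : ℝ → ℝ} {u ux ut utt uxt : ℝ → ℝ → ℂ}
variable (hu : IsRegularSolution q u ux ut utt uxt) (hA : IsAdmissible lam q₀ q)
include hu hA

/-- Power bounds for the source term on `(0, 1)`. -/
lemma exists_source_le {α : ℝ} (hα : IsBoundExponent lam α) (t : ℝ) : ∃ β K, 0 ≤ β ∧ β < 1 ∧
    0 ≤ K ∧ (lam ≠ 0 → β = 2 - α) ∧
    ∀ x ∈ Ioo (0 : ℝ) 1, ‖utt t x + (q x : ℂ) * u t x‖ ≤ K * x ^ (-β) := by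
  obtain ⟨β, δ, C, h1, h2, h3, h4, h5, h6, h7⟩ := hA.exists_potential_bound hα
  obtain ⟨K, hK, hb⟩ := hu.exists_source_bound hA hα h1 h4 h5 h7 |t|
  have hc := ((hu.jointContinuous_source hA).space t).norm.mono
    (fun x hx => h3.trans_le hx.1 : Icc δ 1 ⊆ Ioi 0)
  obtain ⟨M, hM⟩ := isCompact_Icc.bddAbove_image hc
  refine ⟨β, max K M, h1, h2, le_max_of_le_left hK, h6, fun x hx => ?_⟩
  have hx0 := hx.1
  rcases le_or_gt x δ with h | h
  · refine ((hb t le_rfl x hx0 h).1).trans ?_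
    gcongr
    exact le_max_left _ _
  · have a1 : ‖utt t x + (q x : ℂ) * u t x‖ ≤ M := hM (mem_image_of_mem _ ⟨h.le, hx.2.le⟩)
    have a3 : 1 ≤ x ^ (-β) := Real.one_le_rpow_of_pos_of_le_one_of_nonpos hx0 hx.2.le (by linarith)
    calc _ ≤ M := a1
      _ ≤ max K M := le_max_right _ _
      _ ≤ max K M * x ^ (-β) := le_mul_of_one_le_right (le_max_of_le_left hK) a3

/-- The operator applied to `u` is `-u_tt`, which is in `L²`. The conditions on `u_xx` near zero
come from the power bounds, those near infinity from `q` being bounded there. -/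
lemma isInDomain (hL : ContinuousInL2 u) (t : ℝ) : IsInDomain lam q₀ (u t) (ux t)
    (fun x => utt t x + (q x : ℂ) * u t x) where
  locallyIntegrable := ((hu.jointContinuous_source hA).space t).locallyIntegrableOn
    measurableSet_Ioi
  sub_eq a b ha hab := by
    have hpos : ∀ x ∈ uIcc a b, 0 < x := fun x hx => by
      rw [uIcc_of_le hab] at hx; exact ha.trans_le hx.1
    exact (intervalIntegral.integral_eq_sub_of_hasDerivAt
      (fun x hx => hu.hasDerivAt_x t x (hpos x hx))
      ((hu.cont_ux.space t).mono hpos).intervalIntegrable).symm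
  deriv_sub_eq a b ha hab := (hu.ux_sub_eq hA t ha (ha.trans_le hab)).symm
  near_zero _ := by
    obtain ⟨α, hα⟩ := exists_isBoundExponent hA.hlam
    obtain ⟨β, K, -, hβ, -, -, hb⟩ := hu.exists_source_le hA hα t
    have h1 : IntegrableOn (fun x : ℝ => K * x ^ (-β)) (Ioo 0 1) :=
      ((intervalIntegrable_iff_integrableOn_Ioc_of_le zero_le_one).1
        (intervalIntegrable_rpow_neg hβ)).mono_set Ioo_subset_Ioc_self
    refine Integrable.mono' h1 ?_ ((ae_restrict_iff' measurableSet_Ioo).2 (Eventually.of_forall hb))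
    exact (((hu.jointContinuous_source hA).space t).mono
      Ioo_subset_Ioi_self).aestronglyMeasurable measurableSet_Ioo
  near_zero' hl p hp1 hp2 := by
    have hp0 : p ≠ 0 := (zero_lt_one.trans_le hp1).ne'
    have hpt : p ≠ ⊤ := (hp2.trans (by norm_num)).ne
    have hpr : 1 ≤ p.toReal := by
      rw [← ENNReal.toReal_one]; exact ENNReal.toReal_mono hpt hp1
    have hpr2 : p.toReal < 2 := by
      rw [← ENNReal.toReal_ofNat]; exact ENNReal.toReal_strict_mono (by norm_num) hp2
    set r := p.toReal
    -- As `r < 2`, `2 - 1/r < 3/2`, and `α` is taken between them. Then `β = 2 - α < 1/r`, so the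
    -- `r`-th power of `x^(-β)` is integrable; the maximum with `5/4` keeps `α > 1`.
    set α := max (5 / 4) ((3 / 2 + (2 - 1 / r)) / 2) with hαd
    have hr2 : 1 / 2 < 1 / r := by
      rw [div_lt_div_iff₀ (by norm_num) (by linarith)]; linarith
    have hα1 : 2 - 1 / r < α := lt_of_lt_of_le (by linarith) (le_max_right _ _)
    have hα : IsBoundExponent lam α :=
      Or.inr ⟨hA.hlam.resolve_left hl, lt_of_lt_of_le (by norm_num) (le_max_left _ _),
        max_lt (by norm_num) (by linarith)⟩
    obtain ⟨β, K, hβ0, hβ, hK, hβα, hb⟩ := hu.exists_source_le hA hα t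
    have hβr : β * r < 1 := by
      have : β < 1 / r := by rw [hβα hl]; linarith
      rwa [lt_div_iff₀ (by linarith)] at this
    have hm : AEStronglyMeasurable (fun x => utt t x + (q x : ℂ) * u t x)
        (volume.restrict (Ioo 0 1)) := (((hu.jointContinuous_source hA).space t).mono
      Ioo_subset_Ioi_self).aestronglyMeasurable measurableSet_Ioo
    rw [← integrable_norm_rpow_iff hm hp0 hpt]
    have h1 : IntegrableOn (fun x : ℝ => K ^ r * x ^ (-(β * r))) (Ioo 0 1) :=
      ((intervalIntegrable_iff_integrableOn_Ioc_of_le zero_le_one).1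
        (intervalIntegrable_rpow_neg hβr)).mono_set Ioo_subset_Ioc_self
    refine Integrable.mono' h1 (hm.norm.aemeasurable.pow_const r).aestronglyMeasurable
      ((ae_restrict_iff' measurableSet_Ioo).2 (Eventually.of_forall fun x hx => ?_))
    have hx0 := hx.1
    rw [Real.norm_of_nonneg (by positivity)]
    calc ‖utt t x + (q x : ℂ) * u t x‖ ^ r ≤ (K * x ^ (-β)) ^ r :=
          Real.rpow_le_rpow (norm_nonneg _) (hb x hx) (by linarith)
      _ = _ := by
        rw [Real.mul_rpow hK (by positivity), ← Real.rpow_mul hx0.le, neg_mul]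
  near_infinity := by
    have hs : Ioi (1 : ℝ) ⊆ Ioi 0 := Ioi_subset_Ioi zero_le_one
    have hr : halfLine.restrict (Ioi 1) = volume.restrict (Ioi 1) :=
      halfLine_restrict measurableSet_Ioi hs
    have h1 : MemLp (utt t) 2 (volume.restrict (Ioi 1)) := by
      rw [← hr]; exact (hu.continuous_utt.1 t).restrict _
    have h2 : MemLp (sqrtMul q (u t)) 2 (volume.restrict (Ioi 1)) := by
      rw [← hr]; exact (hu.sol.continuous_potential.1 t).restrict _
    refine h1.add ?_
    have hm : AEStronglyMeasurable (fun x => (q x : ℂ) * u t x) (volume.restrict (Ioi 1)) :=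
      (((Complex.continuous_ofReal.comp_continuousOn hA.continuousOn).mul
        (hu.cont_u.space t)).mono hs).aestronglyMeasurable measurableSet_Ioi
    -- For `x > 1`, `q ≤ √(q 1) √q` because `q` decreases, so `q u` is controlled by the finite
    -- potential energy.
    refine MemLp.of_le_mul (c := √(q 1)) h2 hm ((ae_restrict_iff' measurableSet_Ioi).2
      (Eventually.of_forall fun x hx => ?_))
    have hx0 : (0 : ℝ) < x := hs hx
    have hq1 : q x ≤ q 1 := hA.antitoneOn (mem_Ioi.2 one_pos) hx0 (le_of_lt hx)
    rw [sqrtMul, norm_mul, norm_mul, Complex.norm_real, Complex.norm_real,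
      Real.norm_of_nonneg (hA.nonneg x hx0), Real.norm_of_nonneg (Real.sqrt_nonneg _), ← mul_assoc]
    refine mul_le_mul_of_nonneg_right ?_ (norm_nonneg _)
    calc q x = √(q x) * √(q x) := (Real.mul_self_sqrt (hA.nonneg x hx0)).symm
      _ ≤ √(q 1) * √(q x) := by
        have := Real.sqrt_le_sqrt hq1
        gcongr
  memLp := hL.1 t
  boundary := by
    refine ⟨hu.apply_zero t, ?_⟩
    obtain ⟨K, hK, hb⟩ := hu.bound |t|
    refine squeeze_zero_norm' (a := fun x => K * √x) ?_ ?_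
    · filter_upwards [self_mem_nhdsWithin] with x hx
      exact (hb t le_rfl x hx).1
    · have : Continuous fun x => K * √x := by fun_prop
      have h := this.tendsto 0
      simp only [Real.sqrt_zero, mul_zero] at h
      exact h.mono_left nhdsWithin_le_nhds
  boundary' hl := by
    obtain ⟨h, hh⟩ := hu.exists_isTrace hA
    -- Any admissible exponent above 1 forces the slope of `u` at zero, and with it the limit of
    -- `u_x`, to vanish.
    have hα : IsBoundExponent lam (5 / 4) :=
      Or.inr ⟨hA.hlam.resolve_left hl, by norm_num, by norm_num⟩
    obtain ⟨C, hC, hb⟩ := hu.exists_norm_le_rpow hA hα |t|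
    have h1 := hasDerivWithinAt_iff_tendsto_slope.1 (hh.slope t)
    have h2 : Tendsto (slope (u t) 0) (𝓝[>] 0) (𝓝 (h t)) := by
      refine h1.mono_left (nhdsWithin_mono _ fun x hx => ?_)
      exact ⟨le_of_lt (mem_Ioi.1 hx), ne_of_gt (mem_Ioi.1 hx)⟩
    have h3 : Tendsto (slope (u t) 0) (𝓝[>] 0) (𝓝 0) := by
      refine squeeze_zero_norm' (a := fun x => C * x ^ (1 / 4 : ℝ)) ?_ ?_
      · filter_upwards [Ioo_mem_nhdsGT (zero_lt_one' ℝ)] with x hx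
        have hx0 := hx.1
        rw [slope_def_module, hu.apply_zero, sub_zero, sub_zero, norm_smul, norm_inv,
          Real.norm_of_nonneg hx0.le, inv_mul_le_iff₀ hx0]
        refine (hb t le_rfl x hx0 hx.2.le).trans (le_of_eq ?_)
        rw [show (5 / 4 : ℝ) = 1 + 1 / 4 by norm_num, Real.rpow_add hx0, Real.rpow_one]
        ring
      · have hc : ContinuousAt (fun x : ℝ => C * x ^ (1 / 4 : ℝ)) 0 :=
          continuousAt_const.mul (Real.continuousAt_rpow_const _ _ (Or.inr (by norm_num)))
        have h := hc.tendsto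
        rw [Real.zero_rpow (by norm_num), mul_zero] at h
        exact h.mono_left nhdsWithin_le_nhds
    rw [← tendsto_nhds_unique h2 h3]
    exact hh.tendsto t
  memLp_op := by
    have e : (fun x => -(utt t x + (q x : ℂ) * u t x) + (potential lam q₀ x : ℂ) * u t x) =
        fun x => -utt t x := by
      funext x
      rw [← hA.eq]; ring
    rw [e]
    exact (hu.continuous_utt.1 t).neg

theorem isStrongSolution (hL : ContinuousInL2 u) : IsStrongSolution lam q₀ u ux ut := by
  refine ⟨hA.eq ▸ hu.sol, ⟨ux, _, fun t => hu.isInDomain hA hL t, hL, ?_⟩,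
    ⟨ut, uxt, fun t => EventuallyEq.rfl, fun t => hA.eq ▸ hu.energyClass_t t, hu.continuous_uxt,
      hA.eq ▸ hu.continuous_potential_t⟩⟩
  have e : (fun t x => -(utt t x + (q x : ℂ) * u t x) + (potential lam q₀ x : ℂ) * u t x) =
      fun t x => -1 * utt t x := by
    funext t x
    rw [← hA.eq]; ring
  rw [e]
  exact hu.continuous_utt.const_mul (-1)

end IsRegularSolution

end

end HalfLineWave

/-! ### The boundary derivative as an extension by continuity. -/

namespace HalfLineWave

noncomputable section

/-! ### Square integrable functions -/

section SquareIntegrable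

variable {α : Type*} [MeasurableSpace α] {μ : Measure α} {f : α → ℂ}

lemma eLpNorm_two_eq (hf : MemLp f 2 μ) :
    eLpNorm f 2 μ = ENNReal.ofReal √(∫ x, ‖f x‖ ^ 2 ∂μ) := by
  rw [hf.eLpNorm_eq_integral_rpow_norm (by norm_num) (by norm_num), Real.sqrt_eq_rpow]
  simp

lemma eLpNorm_two_le (hf : MemLp f 2 μ) {E : ℝ} (h : ∫ x, ‖f x‖ ^ 2 ∂μ ≤ E) :
    eLpNorm f 2 μ ≤ ENNReal.ofReal √E := by
  rw [eLpNorm_two_eq hf]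
  exact ENNReal.ofReal_le_ofReal (Real.sqrt_le_sqrt h)

lemma integral_sq_eq_eLpNorm (hf : MemLp f 2 μ) :
    ∫ x, ‖f x‖ ^ 2 ∂μ = (eLpNorm f 2 μ).toReal ^ 2 := by
  rw [eLpNorm_two_eq hf, ENNReal.toReal_ofReal (Real.sqrt_nonneg _),
    Real.sq_sqrt (integral_nonneg fun _ => by positivity)]

lemma tendsto_integral_sq {f : ℕ → α → ℂ} {g : α → ℂ} (hf : ∀ n, MemLp (f n) 2 μ)
    (hg : MemLp g 2 μ) (h : Tendsto (fun n => eLpNorm (f n - g) 2 μ) atTop (𝓝 0)) :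
    Tendsto (fun n => ∫ x, ‖f n x‖ ^ 2 ∂μ) atTop (𝓝 (∫ x, ‖g x‖ ^ 2 ∂μ)) := by
  have h1 := ((Lp.tendsto_Lp_iff_tendsto_eLpNorm'' f hf g hg).2 h).norm.pow 2
  simp only [Lp.norm_toLp, ← integral_sq_eq_eLpNorm (hf _), ← integral_sq_eq_eLpNorm hg] at h1
  exact h1

/-- Fatou's lemma with bounds that may vary with `n`; it transfers quantitative estimates to limits
known only pointwise. -/
lemma eLpNorm_le_of_tendsto {f : ℕ → α → ℂ} {g : α → ℂ} (hf : ∀ n, AEStronglyMeasurable (f n) μ)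
    (h : ∀ᵐ x ∂μ, Tendsto (fun n => f n x) atTop (𝓝 (g x))) {c : ℕ → ℝ≥0∞} {C : ℝ≥0∞}
    (hle : ∀ᶠ n in atTop, eLpNorm (f n) 2 μ ≤ c n) (hc : Tendsto c atTop (𝓝 C)) :
    eLpNorm g 2 μ ≤ C := by
  refine (Lp.eLpNorm_lim_le_liminf_eLpNorm hf g h).trans ?_
  rw [← hc.liminf_eq]
  exact liminf_le_liminf hle

end SquareIntegrable

lemma memLp_two_of_intervalIntegral_le {f : ℝ → ℂ} (hf : Continuous f) {C : ℝ}
    (h : ∀ s t, s ≤ t → ∫ τ in s..t, ‖f τ‖ ^ 2 ≤ C) :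
    MemLp f 2 volume ∧ ∫ τ, ‖f τ‖ ^ 2 ≤ C := by
  have ha : Tendsto (fun n : ℕ => -(n : ℝ)) atTop atBot :=
    tendsto_neg_atTop_atBot.comp tendsto_natCast_atTop_atTop
  have hc : Continuous fun τ => ‖f τ‖ ^ 2 := by fun_prop
  have hle : ∀ n : ℕ, ∫ τ in (-(n : ℝ))..n, ‖f τ‖ ^ 2 ≤ C := fun n => h _ _ (by
    have : (0 : ℝ) ≤ n := n.cast_nonneg
    linarith)
  have hi : Integrable fun τ => ‖f τ‖ ^ 2 := by
    refine integrable_of_intervalIntegral_norm_bounded C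
      (fun n : ℕ => (hc.integrableOn_Icc).mono_set Ioc_subset_Icc_self) ha
      tendsto_natCast_atTop_atTop (Eventually.of_forall fun n => ?_)
    refine le_trans (le_of_eq ?_) (hle n)
    congr 1; funext τ
    rw [Real.norm_of_nonneg (by positivity)]
  refine ⟨(memLp_two_iff_integrable_sq_norm hf.aestronglyMeasurable).2 hi, ?_⟩
  exact le_of_tendsto' (intervalIntegral_tendsto_integral hi ha tendsto_natCast_atTop_atTop) hle

/-- The energy of the difference of two solutions. -/
def energyDist (q : ℝ → ℝ) (w wx wt v vx vt : ℝ → ℝ → ℂ) : ℝ :=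
  energy q (fun t x => w t x - v t x) (fun t x => wx t x - vx t x) (fun t x => wt t x - vt t x) 0

lemma energyDist_comm (q : ℝ → ℝ) (w wx wt v vx vt : ℝ → ℝ → ℂ) :
    energyDist q w wx wt v vx vt = energyDist q v vx vt w wx wt := by
  simp only [energyDist, energy, energyDensity]
  simp_rw [norm_sub_rev (w _ _), norm_sub_rev (wx _ _), norm_sub_rev (wt _ _)]

namespace IsFiniteEnergySolution

variable {lam : ℝ} {q₀ q : ℝ → ℝ} {w wx wt v vx vt z zx zt : ℝ → ℝ → ℂ}
variable (hw : IsFiniteEnergySolution q w wx wt) (hv : IsFiniteEnergySolution q v vx vt)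
  (hA : IsAdmissible lam q₀ q)
include hw hv hA

lemma energyDist_nonneg : 0 ≤ energyDist q w wx wt v vx vt := by
  have := hw.sub hv hA.continuousOn
  exact energy_nonneg hA.nonneg 0

lemma energyDist_triangle (hz : IsFiniteEnergySolution q z zx zt) :
    energyDist q w wx wt z zx zt ≤
      2 * energyDist q w wx wt v vx vt + 2 * energyDist q v vx vt z zx zt := by
  have h := (hw.sub hz hA.continuousOn).setIntegral_energyDensity_le_add
    (hv.sub hz hA.continuousOn) hA.continuousOn hA.nonneg measurableSet_Ioi subset_rfl 0
  simp only [sub_sub_sub_cancel_right] at h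
  have : energyDist q w wx wt z zx zt ≤
      2 * energyDist q v vx vt z zx zt + 2 * energyDist q w wx wt v vx vt := h
  linarith

lemma energyDist_eq : energyDist q w wx wt v vx vt =
    (eLpNorm (fun x => wx 0 x - vx 0 x) 2 halfLine).toReal ^ 2 +
    (eLpNorm (fun x => wt 0 x - vt 0 x) 2 halfLine).toReal ^ 2 +
    (eLpNorm (sqrtMul q (fun x => w 0 x - v 0 x)) 2 halfLine).toReal ^ 2 := by
  have hs := hw.sub hv hA.continuousOn
  rw [energyDist, hs.energy_eq hA.nonneg, hs.continuous_wx.norm_curve_sq,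
    hs.continuous_wt.norm_curve_sq, hs.continuous_potential.norm_curve_sq,
    ← integral_sq_eq_eLpNorm (hs.continuous_wx.1 0), ← integral_sq_eq_eLpNorm (hs.continuous_wt.1 0),
    ← integral_sq_eq_eLpNorm (hs.continuous_potential.1 0)]
  rfl

lemma eLpNorm_sub_le :
    eLpNorm (fun x => wx 0 x - vx 0 x) 2 halfLine ≤
      ENNReal.ofReal √(energyDist q w wx wt v vx vt) ∧
    eLpNorm (fun x => wt 0 x - vt 0 x) 2 halfLine ≤
      ENNReal.ofReal √(energyDist q w wx wt v vx vt) ∧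
    eLpNorm (sqrtMul q (fun x => w 0 x - v 0 x)) 2 halfLine ≤
      ENNReal.ofReal √(energyDist q w wx wt v vx vt) := by
  have hs := hw.sub hv hA.continuousOn
  have h := hw.energyDist_eq hv hA
  have h1 := hs.continuous_wx.1 0
  have h2 := hs.continuous_wt.1 0
  have h3 := hs.continuous_potential.1 0
  have e1 := integral_sq_eq_eLpNorm h1
  have e2 := integral_sq_eq_eLpNorm h2
  have e3 := integral_sq_eq_eLpNorm h3
  refine ⟨eLpNorm_two_le h1 ?_, eLpNorm_two_le h2 ?_, eLpNorm_two_le h3 ?_⟩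
  · rw [e1, h]; nlinarith [sq_nonneg (eLpNorm (fun x => wt 0 x - vt 0 x) 2 halfLine).toReal,
      sq_nonneg (eLpNorm (sqrtMul q (fun x => w 0 x - v 0 x)) 2 halfLine).toReal]
  · rw [e2, h]; nlinarith [sq_nonneg (eLpNorm (fun x => wx 0 x - vx 0 x) 2 halfLine).toReal,
      sq_nonneg (eLpNorm (sqrtMul q (fun x => w 0 x - v 0 x)) 2 halfLine).toReal]
  · rw [e3, h]; nlinarith [sq_nonneg (eLpNorm (fun x => wt 0 x - vt 0 x) 2 halfLine).toReal,
      sq_nonneg (eLpNorm (fun x => wx 0 x - vx 0 x) 2 halfLine).toReal]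

omit hw hA in
lemma norm_sq_le_energy (hq : ∀ x, 0 < x → 0 ≤ q x) (t : ℝ) {x : ℝ} (hx : 0 < x) :
    ‖v t x‖ ^ 2 ≤ x * energy q v vx vt t := by
  refine ((hv.energyClass t).norm_sq_le hx.le).trans (mul_le_mul_of_nonneg_left ?_ hx.le)
  exact (hv.setIntegral_wx_le hq measurableSet_Ioc Ioc_subset_Ioi_self t).trans
    (hv.setIntegral_energyDensity_le hq t Ioc_subset_Ioi_self)

omit hw hv in
/-- Square integrability in time near the boundary. -/
lemma exists_integral_sq_le : ∃ δ, 0 < δ ∧ ∀ {v vx vt : ℝ → ℝ → ℂ},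
    IsFiniteEnergySolution q v vx vt → ∀ s t, s ≤ t → ∀ x, 0 < x → x ≤ δ →
      ∫ τ in s..t, ‖v τ x‖ ^ 2 ≤ 20 * x ^ 2 * energy q v vx vt 0 := by
  obtain ⟨δ, hδ, hnear⟩ := IsRegularSolution.exists_near_zero hA
  refine ⟨δ, hδ, fun {v vx vt} hv s t hst x hx hxd => ?_⟩
  have l1 := (hv.tendsto_energy_timeMoll hA 0).const_mul (20 * x ^ 2)
  have l2 := (hv.tendsto_energy_sub_timeMoll hA 0).const_mul (2 * x * (t - s))
  -- Replacing `v` by its mollification costs the factor 2, hence `20 = 2 · 10`, and an error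
  -- proportional to `t - s` that vanishes in the limit with the time interval fixed.
  have l3 := l1.add l2
  rw [mul_zero, add_zero] at l3
  refine ge_of_tendsto' l3 fun n => ?_
  have hr := hv.regular_timeMoll hA (isKernel_kernelSeq n)
  have hs := hv.sub hr.sol hA.continuousOn
  set u := timeMoll (kernelSeq n) v
  have c1 : Continuous fun τ => ‖u τ x‖ ^ 2 := (hr.cont_u.time hx).norm.pow 2
  have c2 : Continuous fun τ => ‖v τ x‖ ^ 2 := (hv.jointContinuous.time hx).norm.pow 2
  set D := energy q (fun t x => v t x - timeMoll (kernelSeq n) v t x)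
    (fun t x => vx t x - spaceDeriv (timeMoll (kernelSeq n) v) t x)
    (fun t x => vt t x - timeMoll (deriv (kernelSeq n)) v t x) 0 with hD
  have h1 : ∀ τ, ‖v τ x‖ ^ 2 ≤ 2 * ‖u τ x‖ ^ 2 + 2 * (x * D) := by
    intro τ
    have h2 := hs.norm_sq_le_energy hA.nonneg τ hx
    rw [hs.energy_const hA τ 0, ← hD] at h2
    have h3 := norm_add_le (u τ x) (v τ x - u τ x)
    rw [add_sub_cancel] at h3
    nlinarith [sq_nonneg (‖u τ x‖ - ‖v τ x - u τ x‖), norm_nonneg (v τ x), norm_nonneg (u τ x),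
      norm_nonneg (v τ x - u τ x)]
  have h4 : ∫ τ in s..t, ‖v τ x‖ ^ 2 ≤ ∫ τ in s..t, (2 * ‖u τ x‖ ^ 2 + 2 * (x * D)) :=
    intervalIntegral.integral_mono_on hst (c2.intervalIntegrable _ _)
      ((c1.const_mul 2).add continuous_const |>.intervalIntegrable _ _) fun τ _ => h1 τ
  rw [intervalIntegral.integral_add ((c1.const_mul 2).intervalIntegrable _ _) (by simp),
    intervalIntegral.integral_const_mul, intervalIntegral.integral_const, smul_eq_mul] at h4
  have h5 : ∫ τ in s..t, ‖u τ x‖ ^ 2 ≤ x * (10 * x * energy q u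
      (spaceDeriv (timeMoll (kernelSeq n) v)) (timeMoll (deriv (kernelSeq n)) v) 0) := by
    have h6 := (hnear hr s t hst x hx hxd).1
    have h7 : ∫ τ in s..t, ‖u τ x‖ ^ 2 ≤ ∫ τ in s..t, x * ∫ y in Ioc 0 x,
        ‖spaceDeriv (timeMoll (kernelSeq n) v) τ y‖ ^ 2 :=
      intervalIntegral.integral_mono_on hst (c1.intervalIntegrable _ _)
        ((continuous_const.mul (hr.sol.continuous_wx.continuous_setIntegral_sq measurableSet_Ioc
          Ioc_subset_Ioi_self)).intervalIntegrable _ _)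
        fun τ _ => (hr.sol.energyClass τ).norm_sq_le hx.le
    rw [intervalIntegral.integral_const_mul] at h7
    exact h7.trans (mul_le_mul_of_nonneg_left h6 hx.le)
  linarith

omit hw in
/-- The boundary slopes of a finite-energy solution are controlled by the energy. -/
lemma slope_bound {h : ℝ → ℂ} (hh : ∀ t, HasDerivWithinAt (v t) (h t) (Ici 0) 0) :
    MemLp h 2 volume ∧ eLpNorm h 2 volume ≤ ENNReal.ofReal √(20 * energy q v vx vt 0) := by
  obtain ⟨δ, hδ, hb⟩ := exists_integral_sq_le hA
  -- Difference quotients at the boundary. They converge pointwise to the slope, and the factor `x²`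
  -- in `exists_integral_sq_le` makes their `L²` norms bounded uniformly.
  set f : ℕ → ℝ → ℂ := fun n t => ((n : ℝ) + 1) • v t (1 / ((n : ℝ) + 1)) with hf
  have hpos : ∀ n : ℕ, (0 : ℝ) < 1 / ((n : ℝ) + 1) := fun n => by positivity
  have hx0 : Tendsto (fun n : ℕ => 1 / ((n : ℝ) + 1)) atTop (𝓝 0) :=
    tendsto_one_div_add_atTop_nhds_zero_nat
  have hcont : ∀ n, Continuous (f n) := fun n =>
    (hv.jointContinuous.time (hpos n)).const_smul ((n : ℝ) + 1)
  have hlim : ∀ t, Tendsto (fun n => f n t) atTop (𝓝 (h t)) := by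
    intro t
    have h1 := hasDerivWithinAt_iff_tendsto_slope.1 (hh t)
    have h2 : Tendsto (fun n : ℕ => 1 / ((n : ℝ) + 1)) atTop (𝓝[Ici 0 \ {0}] 0) :=
      tendsto_nhdsWithin_iff.2 ⟨hx0, Eventually.of_forall fun n => ⟨(hpos n).le, (hpos n).ne'⟩⟩
    refine (h1.comp h2).congr fun n => ?_
    have hv0 : v t 0 = 0 := by rw [(hv.energyClass t).eq_integral 0 le_rfl]; simp
    rw [Function.comp_apply, slope_def_module, hv0, sub_zero, sub_zero]
    simp only [hf, one_div, inv_inv]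
  have hle : ∀ᶠ n in atTop, eLpNorm (f n) 2 volume ≤
      ENNReal.ofReal √(20 * energy q v vx vt 0) := by
    filter_upwards [hx0.eventually (ge_mem_nhds hδ)] with n hn
    obtain ⟨m1, m2⟩ := memLp_two_of_intervalIntegral_le (hcont n)
      (C := 20 * energy q v vx vt 0) fun s t hst => by
        have h1 := hb hv s t hst _ (hpos n) hn
        have e : ∀ τ, ‖f n τ‖ ^ 2 = ((n : ℝ) + 1) ^ 2 * ‖v τ (1 / ((n : ℝ) + 1))‖ ^ 2 := fun τ => by
          rw [hf, norm_smul, mul_pow, Real.norm_of_nonneg (by positivity)]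
        simp only [e]
        rw [intervalIntegral.integral_const_mul]
        calc _ ≤ ((n : ℝ) + 1) ^ 2 * (20 * (1 / ((n : ℝ) + 1)) ^ 2 * energy q v vx vt 0) := by
              gcongr
          _ = _ := by field_simp
    exact eLpNorm_two_le m1 m2
  have hm : ∀ n, AEStronglyMeasurable (f n) volume := fun n => (hcont n).aestronglyMeasurable
  have hfin := eLpNorm_le_of_tendsto hm (Eventually.of_forall hlim) hle tendsto_const_nhds
  exact ⟨⟨aestronglyMeasurable_of_tendsto_ae atTop hm (Eventually.of_forall hlim),
    hfin.trans_lt ENNReal.ofReal_lt_top⟩, hfin⟩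

lemma slope_sub_le {h g : ℝ → ℂ} (hh : ∀ t, HasDerivWithinAt (w t) (h t) (Ici 0) 0)
    (hg : ∀ t, HasDerivWithinAt (v t) (g t) (Ici 0) 0) :
    eLpNorm (h - g) 2 volume ≤ ENNReal.ofReal √(20 * energyDist q w wx wt v vx vt) :=
  ((hw.sub hv hA.continuousOn).slope_bound hA fun t => (hh t).sub (hg t)).2

omit hv in
lemma tendsto_energyDist_timeMoll : Tendsto (fun n => energyDist q w wx wt
    (timeMoll (kernelSeq n) w) (spaceDeriv (timeMoll (kernelSeq n) w))
    (timeMoll (deriv (kernelSeq n)) w)) atTop (𝓝 0) :=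
  hw.tendsto_energy_sub_timeMoll hA 0

omit hv in
/-- The boundary derivative, with its continuity in the energy norm. -/
theorem exists_boundary_limit : ∃ g : ℝ → ℂ, MemLp g 2 volume ∧
    ∀ {v vx vt : ℝ → ℝ → ℂ} {h : ℝ → ℂ}, IsFiniteEnergySolution q v vx vt →
      (∀ t, HasDerivWithinAt (v t) (h t) (Ici 0) 0) →
      eLpNorm (h - g) 2 volume ≤ ENNReal.ofReal √(40 * energyDist q v vx vt w wx wt) := by
  have hr := fun n => hw.regular_timeMoll hA (isKernel_kernelSeq n)
  choose h hh using fun n => (hr n).exists_isTrace hA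
  have hL : ∀ n, MemLp (h n) 2 volume := fun n => ((hr n).sol.slope_bound hA (hh n).slope).1
  set d : ℕ → ℝ := fun n => energyDist q w wx wt
    (timeMoll (kernelSeq n) w) (spaceDeriv (timeMoll (kernelSeq n) w))
    (timeMoll (deriv (kernelSeq n)) w) with hd
  have hdl : Tendsto d atTop (𝓝 0) := hw.tendsto_energyDist_timeMoll hA
  have hd0 : ∀ n, 0 ≤ d n := fun n => hw.energyDist_nonneg (hr n).sol hA
  -- Slopes depend linearly on the solution, so `slope_bound` applied to differences gives `20 (2 d
  -- m + 2 d n)`; this explains the threshold `ε²/80`.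
  have hC : CauchySeq fun n => (hL n).toLp (h n) := by
    rw [Metric.cauchySeq_iff]
    intro ε hε
    obtain ⟨N, hN⟩ := eventually_atTop.1 (hdl.eventually (gt_mem_nhds
      (by positivity : 0 < ε ^ 2 / 80)))
    refine ⟨N, fun m hm n hn => ?_⟩
    rw [dist_eq_norm, ← MemLp.toLp_sub, Lp.norm_toLp]
    have h1 := (hr m).sol.slope_sub_le (hr n).sol hA (hh m).slope (hh n).slope
    have h2 := (hr m).sol.energyDist_triangle hw hA (hr n).sol
    rw [energyDist_comm q (timeMoll (kernelSeq m) w) (spaceDeriv (timeMoll (kernelSeq m) w))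
      (timeMoll (deriv (kernelSeq m)) w) w wx wt] at h2
    have h3 := hN m hm
    have h4 := hN n hn
    have h5 : (eLpNorm (h m - h n) 2 volume).toReal ≤ √(20 * (2 * d m + 2 * d n)) := by
      refine ENNReal.toReal_le_of_le_ofReal (Real.sqrt_nonneg _) (h1.trans ?_)
      refine ENNReal.ofReal_le_ofReal (Real.sqrt_le_sqrt ?_)
      linarith
    refine h5.trans_lt ((Real.sqrt_lt' hε).2 ?_)
    linarith
  obtain ⟨G, hG⟩ := cauchySeq_tendsto_of_complete hC
  have hGm : MemLp (G : ℝ → ℂ) 2 volume := Lp.memLp G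
  have hlim : Tendsto (fun n => eLpNorm (h n - (G : ℝ → ℂ)) 2 volume) atTop (𝓝 0) := by
    refine (Lp.tendsto_Lp_iff_tendsto_eLpNorm'' h hL _ hGm).1 ?_
    rwa [Lp.toLp_coeFn]
  refine ⟨G, hGm, fun {v vx vt k} hv hk => ?_⟩
  have hkm := (hv.slope_bound hA hk).1
  have l1 : Tendsto (fun n => ENNReal.ofReal √(20 * (2 * energyDist q v vx vt w wx wt + 2 * d n)) +
      eLpNorm (h n - (G : ℝ → ℂ)) 2 volume) atTop
      (𝓝 (ENNReal.ofReal √(20 * (2 * energyDist q v vx vt w wx wt + 2 * 0)) + 0)) := by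
    refine Tendsto.add ?_ hlim
    exact (ENNReal.continuous_ofReal.tendsto _).comp
      (((hdl.const_mul 2).const_add _).const_mul 20).sqrt
  have e : 20 * (2 * energyDist q v vx vt w wx wt + 2 * 0) =
      40 * energyDist q v vx vt w wx wt := by ring
  rw [add_zero, e] at l1
  refine ge_of_tendsto' l1 fun n => ?_
  have h1 : k - (G : ℝ → ℂ) = (k - h n) + (h n - (G : ℝ → ℂ)) := by
    funext t; simp
  rw [h1]
  refine (eLpNorm_add_le (hkm.1.sub (hL n).1) ((hL n).1.sub hGm.1) (by norm_num)).trans ?_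
  gcongr
  refine (hv.slope_sub_le (hr n).sol hA hk (hh n).slope).trans ?_
  refine ENNReal.ofReal_le_ofReal (Real.sqrt_le_sqrt ?_)
  have := hv.energyDist_triangle hw hA (hr n).sol
  linarith

omit hv in
/-- Approximation by strong solutions. -/
theorem exists_strongApproximation : ∃ u ux ut h, StrongApproximation lam q₀ w wx wt u ux ut h := by
  -- Two successive approximations: by a solution that is square integrable in space, then by its
  -- time mollification. Each costs `1/(n + 1)`, doubled by the quadratic triangle inequality.
  have key : ∀ n : ℕ, ∃ (u ux ut : ℝ → ℝ → ℂ) (h : ℝ → ℂ), IsFiniteEnergySolution q u ux ut ∧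
      IsStrongSolution lam q₀ u ux ut ∧ (∀ t, HasDerivWithinAt (u t) (h t) (Ici 0) 0) ∧
      energyDist q u ux ut w wx wt ≤ 4 * (1 / ((n : ℝ) + 1)) := by
    intro n
    have hn : 0 < 1 / ((n : ℝ) + 1) := by positivity
    obtain ⟨v, vx, vt, hv, hv2, hv3⟩ := hw.exists_memLp_approximation hA hn
    obtain ⟨m, hm⟩ := ((hv.tendsto_energyDist_timeMoll hA).eventually (gt_mem_nhds hn)).exists
    have hr := hv.regular_timeMoll hA (isKernel_kernelSeq m)
    obtain ⟨h, hh⟩ := hr.exists_isTrace hA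
    refine ⟨_, _, _, h, hr.sol,
      hr.isStrongSolution hA (hv.continuousInL2_timeMoll (isKernel_kernelSeq m) hv2), hh.slope, ?_⟩
    have h1 := hr.sol.energyDist_triangle hv hA hw
    rw [energyDist_comm q _ _ _ v, energyDist_comm q v vx vt w] at h1
    have h2 : energyDist q w wx wt v vx vt < 1 / ((n : ℝ) + 1) := hv3
    linarith
  choose u ux ut h h1 h2 h3 h4 using key
  refine ⟨u, ux, ut, h, h2, h3, ?_, ?_, ?_⟩
  all_goals
    have hl : Tendsto (fun n : ℕ => ENNReal.ofReal √(4 * (1 / ((n : ℝ) + 1)))) atTop (𝓝 0) := by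
      have h5 : Tendsto (fun n : ℕ => √(4 * (1 / ((n : ℝ) + 1)))) atTop (𝓝 0) := by
        have := ((tendsto_one_div_add_atTop_nhds_zero_nat (𝕜 := ℝ)).const_mul 4).sqrt
        rwa [mul_zero, Real.sqrt_zero] at this
      have h6 := (ENNReal.continuous_ofReal.tendsto 0).comp h5
      rwa [ENNReal.ofReal_zero] at h6
    refine tendsto_of_tendsto_of_tendsto_of_le_of_le tendsto_const_nhds hl (fun _ => zero_le)
      fun n => ?_
    have h7 := (h1 n).eLpNorm_sub_le hw hA
    have h8 := ENNReal.ofReal_le_ofReal (Real.sqrt_le_sqrt (h4 n))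
  · exact h7.1.trans h8
  · exact h7.2.1.trans h8
  · rw [← hA.eq]
    exact h7.2.2.trans h8

omit hv in
lemma tendsto_energyDist_of_strongApproximation {u ux ut : ℕ → ℝ → ℝ → ℂ} {h : ℕ → ℝ → ℂ}
    (hu : StrongApproximation lam q₀ w wx wt u ux ut h) :
    Tendsto (fun k => energyDist q (u k) (ux k) (ut k) w wx wt) atTop (𝓝 0) := by
  have hs : ∀ k, IsFiniteEnergySolution q (u k) (ux k) (ut k) := fun k => hA.eq ▸ (hu.strong k).1
  simp_rw [fun k => (hs k).energyDist_eq hw hA]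
  have h1 := ((ENNReal.tendsto_toReal ENNReal.zero_ne_top).comp hu.tendsto_x).pow 2
  have h2 := ((ENNReal.tendsto_toReal ENNReal.zero_ne_top).comp hu.tendsto_t).pow 2
  have h3 := ((ENNReal.tendsto_toReal ENNReal.zero_ne_top).comp hu.tendsto_potential).pow 2
  rw [← hA.eq] at h3
  simpa using (h1.add h2).add h3

end IsFiniteEnergySolution

end

end HalfLineWave

/-! ### Integration over the half plane and the Morawetz identity. -/

namespace HalfLineWave

noncomputable section

/-! ### Integration over the half plane -/

lemma ae_prod_halfLine {p : ℝ × ℝ → Prop} (h : ∀ t x, 0 < x → p (t, x)) :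
    ∀ᵐ z ∂(volume : Measure ℝ).prod halfLine, p z := by
  have e : (volume : Measure ℝ).prod halfLine =
      ((volume : Measure ℝ).prod volume).restrict (univ ×ˢ Ioi 0) := by
    rw [← Measure.prod_restrict, Measure.restrict_univ]; rfl
  rw [e]
  refine (ae_restrict_iff' (MeasurableSet.univ.prod measurableSet_Ioi)).2
    (Eventually.of_forall fun z hz => ?_)
  exact h z.1 z.2 hz.2

lemma JointContinuous.aestronglyMeasurable {E : Type*} [NormedAddCommGroup E] {f : ℝ → ℝ → E}
    (hf : JointContinuous f) :
    AEStronglyMeasurable (fun z : ℝ × ℝ => f z.1 z.2) ((volume : Measure ℝ).prod halfLine) := by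
  have e : (volume : Measure ℝ).prod halfLine =
      (volume : Measure (ℝ × ℝ)).restrict (univ ×ˢ Ioi 0) := by
    rw [Measure.volume_eq_prod, ← Measure.prod_restrict, Measure.restrict_univ]; rfl
  rw [e]
  exact ContinuousOn.aestronglyMeasurable_of_isSeparable hf
    (MeasurableSet.univ.prod measurableSet_Ioi) (TopologicalSpace.IsSeparable.of_separableSpace _)

lemma halfLine_restrict_Ioc {a : ℝ} (ha : 0 ≤ a) (b : ℝ) :
    halfLine.restrict (Ioc a b) = volume.restrict (Ioc a b) := by
  rw [halfLine, Measure.restrict_restrict_of_subset]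
  exact fun x hx => ha.trans_lt hx.1

lemma JointContinuous.integrableOn_rect {f : ℝ → ℝ → ℝ} (hf : JointContinuous f) (s t : ℝ) {a : ℝ}
    (ha : 0 < a) (b : ℝ) : IntegrableOn (fun z : ℝ × ℝ => f z.1 z.2) (Ioc s t ×ˢ Ioc a b)
      ((volume : Measure ℝ).prod halfLine) := by
  rw [IntegrableOn, ← Measure.prod_restrict, halfLine_restrict_Ioc ha.le, Measure.prod_restrict,
    ← Measure.volume_eq_prod]
  have hc : ContinuousOn (fun z : ℝ × ℝ => f z.1 z.2) (Icc s t ×ˢ Icc a b) :=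
    hf.continuousOn_of_subset fun x hx => ha.trans_le hx.1
  exact (hc.integrableOn_compact (isCompact_Icc.prod isCompact_Icc)).mono_set
    (prod_mono Ioc_subset_Icc_self Ioc_subset_Icc_self)

lemma JointContinuous.integral_rect {f : ℝ → ℝ → ℝ} (hf : JointContinuous f) {s t : ℝ} (hst : s ≤ t)
    {a b : ℝ} (ha : 0 < a) (hab : a ≤ b) :
    ∫ z in Ioc s t ×ˢ Ioc a b, f z.1 z.2 ∂((volume : Measure ℝ).prod halfLine) =
      ∫ τ in s..t, ∫ x in a..b, f τ x := by
  rw [setIntegral_prod _ (hf.integrableOn_rect s t ha b), intervalIntegral.integral_of_le hst]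
  simp only [halfLine_restrict_Ioc ha.le, intervalIntegral.integral_of_le hab]

lemma aecover_rect {T a b : ℕ → ℝ} (hT : Tendsto T atTop atTop) (ha : Tendsto a atTop (𝓝 0))
    (hb : Tendsto b atTop atTop) : AECover ((volume : Measure ℝ).prod halfLine) atTop
      fun n => Ioc (-T n) (T n) ×ˢ Ioc (a n) (b n) := by
  refine ⟨ae_prod_halfLine fun t x hx => ?_, fun n => measurableSet_Ioc.prod measurableSet_Ioc⟩
  filter_upwards [hT.eventually_gt_atTop |t|, ha.eventually (gt_mem_nhds hx),
    hb.eventually_ge_atTop x] with n h1 h2 h3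
  have h4 := abs_lt.1 h1
  exact ⟨⟨h4.1, h4.2.le⟩, h2, h3⟩

/-! ### The Morawetz identity -/

namespace IsFiniteEnergySolution

variable {lam : ℝ} {q₀ q : ℝ → ℝ} {w wx wt : ℝ → ℝ → ℂ}
variable (hw : IsFiniteEnergySolution q w wx wt) (hA : IsAdmissible lam q₀ q)
include hw hA

lemma tendsto_momentum_atTop :
    Tendsto (momentum wx wt) atTop (𝓝 (-(energy q w wx wt 0 / 2))) := by
  have h := (hw.tendsto_inwardEnergy hA).sub_const (energy q w wx wt 0 / 2)
  rw [zero_sub] at h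
  refine h.congr fun t => ?_
  rw [hw.inwardEnergy_eq hA.nonneg, hw.energy_const hA t 0]
  ring

/-- Time reversal changes the sign of `w_t`, hence of the momentum, and exchanges the two ends of
the time axis. -/
lemma tendsto_momentum_atBot :
    Tendsto (momentum wx wt) atBot (𝓝 (energy q w wx wt 0 / 2)) := by
  have h := (hw.reverse.tendsto_momentum_atTop hA).neg
  rw [energy_reverse, neg_neg, neg_zero] at h
  refine tendsto_atBot_of_reverse h fun t => ?_
  simp only [momentum, inner_neg_left, integral_neg, neg_neg]

end IsFiniteEnergySolution

namespace IsRegularSolution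

variable {lam : ℝ} {q₀ q : ℝ → ℝ} {u ux ut utt uxt : ℝ → ℝ → ℂ}
variable (hu : IsRegularSolution q u ux ut utt uxt) (hA : IsAdmissible lam q₀ q)
include hu hA

lemma integrable_morawetzDensity : Integrable (fun z : ℝ × ℝ => morawetzDensity q u z.1 z.2)
    ((volume : Measure ℝ).prod halfLine) := by
  have jm := hu.jointContinuous_morawetz hA
  have hpos : ∀ n : ℕ, (0 : ℝ) < 1 / ((n : ℝ) + 1) := fun n => by positivity
  refine (aecover_rect tendsto_natCast_atTop_atTop tendsto_one_div_add_atTop_nhds_zero_nat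
    (tendsto_atTop_add_const_right _ 1
      tendsto_natCast_atTop_atTop)).integrable_of_integral_bounded_of_nonneg_ae
    (energy q u ux ut 0) (fun n => jm.integrableOn_rect _ _ (hpos n) _)
    (ae_prod_halfLine fun t x hx => morawetzDensity_nonneg hA u t hx)
    (Eventually.of_forall fun n => ?_)
  have h0 : (0 : ℝ) ≤ n := n.cast_nonneg
  have h1 : 1 / ((n : ℝ) + 1) ≤ n + 1 := by
    rw [div_le_iff₀ (by positivity)]; nlinarith
  rw [jm.integral_rect (by linarith) (hpos n) h1]
  exact hu.morawetz_le_energy hA (by linarith) (hpos n) h1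

/-- The Morawetz identity for regular solutions. -/
theorem morawetz_identity {h : ℝ → ℂ} (hh : IsTrace q u ux ut h) :
    1 / 2 * (∫ t, ‖h t‖ ^ 2) + ∫ z, morawetzDensity q u z.1 z.2
      ∂((volume : Measure ℝ).prod halfLine) = energy q u ux ut 0 := by
  have jm := hu.jointContinuous_morawetz hA
  have hi := hu.integrable_morawetzDensity hA
  have hh2 := MemLp.integrable_norm_pow (hu.sol.slope_bound hA hh.slope).1 (by norm_num)
  have hneg : Tendsto (fun n : ℕ => -(n : ℝ)) atTop atBot :=
    tendsto_neg_atTop_atBot.comp tendsto_natCast_atTop_atTop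
  set S : ℕ → ℝ := fun n => momentum ux ut (-(n : ℝ)) - momentum ux ut n -
    ∫ τ in (-(n : ℝ))..n, 1 / 2 * ‖h τ‖ ^ 2 with hS
  have hSl : Tendsto S atTop (𝓝 (energy q u ux ut 0 - 1 / 2 * ∫ t, ‖h t‖ ^ 2)) := by
    have l1 := (hu.sol.tendsto_momentum_atBot hA).comp hneg
    have l2 := (hu.sol.tendsto_momentum_atTop hA).comp tendsto_natCast_atTop_atTop (α := ℕ)
    have l3 := (intervalIntegral_tendsto_integral hh2 hneg
      tendsto_natCast_atTop_atTop).const_mul (1 / 2)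
    have l4 := (l1.sub l2).sub l3
    rw [sub_neg_eq_add, add_halves] at l4
    refine l4.congr fun n => ?_
    rw [hS]
    simp only [Function.comp_apply, intervalIntegral.integral_const_mul]
  -- A diagonal choice: the good endpoints of `exists_morawetz` depend on the time interval, so for
  -- each `[-n, n]` one pair is fixed whose error is below `1/(n + 1)`. The resulting rectangles
  -- exhaust the half plane.
  have key : ∀ n : ℕ, ∃ a b : ℝ, 0 < a ∧ a ≤ b ∧ a < 1 / ((n : ℝ) + 1) ∧ (n : ℝ) ≤ b ∧
      |(∫ τ in (-(n : ℝ))..n, ∫ x in a..b, morawetzDensity q u τ x) - S n| <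
        1 / ((n : ℝ) + 1) := by
    intro n
    have hn : (0 : ℝ) < 1 / ((n : ℝ) + 1) := by positivity
    have h0 : (0 : ℝ) ≤ n := n.cast_nonneg
    obtain ⟨a, b, ha, hab, ha0, hb, hl⟩ := hu.exists_morawetz hA hh
      (show -(n : ℝ) ≤ n by linarith)
    obtain ⟨k, h1, h2, h3⟩ := (((tendsto_nhdsWithin_iff.1 ha0).1.eventually (gt_mem_nhds hn)).and
      ((hb.eventually_ge_atTop (n : ℝ)).and
        (hl.eventually (Metric.ball_mem_nhds _ hn)))).exists
    exact ⟨a k, b k, ha k, hab k, h1, h2, by rwa [Real.dist_eq] at h3⟩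
  choose a b ha hab ha1 hb1 hd using key
  have ha0 : Tendsto a atTop (𝓝 0) := squeeze_zero (fun n => (ha n).le) (fun n => (ha1 n).le)
    tendsto_one_div_add_atTop_nhds_zero_nat
  have hb0 : Tendsto b atTop atTop := tendsto_atTop_mono hb1 tendsto_natCast_atTop_atTop
  have l1 := (aecover_rect tendsto_natCast_atTop_atTop ha0
    hb0).integral_tendsto_of_countably_generated hi
  have l2 : Tendsto (fun n : ℕ => (∫ τ in (-(n : ℝ))..n, ∫ x in (a n)..(b n),
      morawetzDensity q u τ x) - S n) atTop (𝓝 0) :=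
    squeeze_zero_norm (fun n => (hd n).le) tendsto_one_div_add_atTop_nhds_zero_nat
  have l3 := l2.add hSl
  have h1 := tendsto_nhds_unique l1 (l3.congr fun n => by
    have h0 : (0 : ℝ) ≤ n := n.cast_nonneg
    rw [jm.integral_rect (by linarith) (ha n) (hab n)]
    ring)
  rw [h1]
  ring

end IsRegularSolution

/-- The square root of the Morawetz density. -/
def morawetzAmplitude (q : ℝ → ℝ) (w : ℝ → ℝ → ℂ) (z : ℝ × ℝ) : ℂ :=
  (√(-(deriv q z.2) / 2) : ℂ) * w z.1 z.2

namespace IsFiniteEnergySolution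

variable {lam : ℝ} {q₀ q : ℝ → ℝ} {w wx wt v vx vt : ℝ → ℝ → ℂ}
variable (hw : IsFiniteEnergySolution q w wx wt) (hv : IsFiniteEnergySolution q v vx vt)
  (hA : IsAdmissible lam q₀ q)

include hA in
lemma norm_morawetzAmplitude_sq (w : ℝ → ℝ → ℂ) (t : ℝ) {x : ℝ} (hx : 0 < x) :
    ‖morawetzAmplitude q w (t, x)‖ ^ 2 = morawetzDensity q w t x := by
  have := hA.deriv_neg hx
  rw [morawetzAmplitude, norm_mul, mul_pow, Complex.norm_real, Real.norm_eq_abs, sq_abs,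
    Real.sq_sqrt (by linarith), morawetzDensity]

include hA in
lemma ae_norm_morawetzAmplitude_sq (w : ℝ → ℝ → ℂ) :
    (fun z => ‖morawetzAmplitude q w z‖ ^ 2) =ᵐ[(volume : Measure ℝ).prod halfLine]
      fun z => morawetzDensity q w z.1 z.2 :=
  ae_prod_halfLine fun t _ hx => norm_morawetzAmplitude_sq hA w t hx

include hw hA in
lemma aestronglyMeasurable_morawetzAmplitude :
    AEStronglyMeasurable (morawetzAmplitude q w) ((volume : Measure ℝ).prod halfLine) := by
  refine JointContinuous.aestronglyMeasurable (f := fun t x => morawetzAmplitude q w (t, x)) ?_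
  refine ContinuousOn.mul ?_ hw.jointContinuous
  refine Complex.continuous_ofReal.comp_continuousOn (Real.continuous_sqrt.comp_continuousOn ?_)
  exact (hA.continuousOn_deriv.comp continuousOn_snd fun z hz => hz.2).neg.div_const 2

-- The amplitude is linear in the solution, so the bound of its `L²` norm by the energy, proved for
-- mollifications and passed to the limit by Fatou, also estimates differences. This gives
-- convergence of the Morawetz integrals, and not just semicontinuity.
include hw hA in
lemma memLp_morawetzAmplitude :
    MemLp (morawetzAmplitude q w) 2 ((volume : Measure ℝ).prod halfLine) ∧
    eLpNorm (morawetzAmplitude q w) 2 ((volume : Measure ℝ).prod halfLine) ≤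
      ENNReal.ofReal √(energy q w wx wt 0) := by
  have hr := fun n => hw.regular_timeMoll hA (isKernel_kernelSeq n)
  have hm := fun n => (hr n).sol.aestronglyMeasurable_morawetzAmplitude hA
  have hle : ∀ n, eLpNorm (morawetzAmplitude q (timeMoll (kernelSeq n) w)) 2
      ((volume : Measure ℝ).prod halfLine) ≤ ENNReal.ofReal √(energy q (timeMoll (kernelSeq n) w)
        (spaceDeriv (timeMoll (kernelSeq n) w)) (timeMoll (deriv (kernelSeq n)) w) 0) := fun n => by
    have hi := (hr n).integrable_morawetzDensity hA
    have hae := ae_norm_morawetzAmplitude_sq hA (timeMoll (kernelSeq n) w)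
    refine eLpNorm_two_le ((memLp_two_iff_integrable_sq_norm (hm n)).2 (hi.congr hae.symm)) ?_
    rw [integral_congr_ae hae]
    obtain ⟨h, hh⟩ := (hr n).exists_isTrace hA
    have h1 := (hr n).morawetz_identity hA hh
    have h2 : 0 ≤ ∫ t, ‖h t‖ ^ 2 := integral_nonneg fun _ => sq_nonneg _
    linarith
  have hlim : ∀ᵐ z ∂(volume : Measure ℝ).prod halfLine, Tendsto
      (fun n => morawetzAmplitude q (timeMoll (kernelSeq n) w) z) atTop
      (𝓝 (morawetzAmplitude q w z)) :=
    ae_prod_halfLine fun t x hx => (tendsto_moll (hw.jointContinuous.time hx) t).const_mul _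
  have hfin := eLpNorm_le_of_tendsto hm hlim (Eventually.of_forall hle)
    ((ENNReal.continuous_ofReal.tendsto _).comp (hw.tendsto_energy_timeMoll hA 0).sqrt)
  exact ⟨⟨hw.aestronglyMeasurable_morawetzAmplitude hA, hfin.trans_lt ENNReal.ofReal_lt_top⟩, hfin⟩

include hw hA in
lemma integrable_morawetzDensity : Integrable (fun z : ℝ × ℝ => morawetzDensity q w z.1 z.2)
    ((volume : Measure ℝ).prod halfLine) :=
  ((hw.memLp_morawetzAmplitude hA).1.integrable_norm_pow (by norm_num)).congr
    (ae_norm_morawetzAmplitude_sq hA w)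

include hw hv hA in
lemma morawetzAmplitude_sub_le :
    eLpNorm (morawetzAmplitude q w - morawetzAmplitude q v) 2 ((volume : Measure ℝ).prod halfLine) ≤
      ENNReal.ofReal √(energyDist q w wx wt v vx vt) := by
  have e : morawetzAmplitude q w - morawetzAmplitude q v =
      morawetzAmplitude q fun t x => w t x - v t x := by
    funext z
    simp only [morawetzAmplitude, Pi.sub_apply, mul_sub]
  rw [e]
  exact ((hw.sub hv hA.continuousOn).memLp_morawetzAmplitude hA).2

include hw hA in
/-- The Morawetz identity, with the boundary derivative. -/
theorem exists_boundaryDerivative : ∃ g : ℝ → ℂ, IsBoundaryDerivative lam q₀ w wx wt g ∧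
    1 / 2 * (∫ t, ‖g t‖ ^ 2) + ∫ t, ∫ x in Ioi (0 : ℝ), morawetzDensity q w t x =
      energy q w wx wt 0 := by
  obtain ⟨g, hg, hgl⟩ := hw.exists_boundary_limit hA
  have hsqrt : ∀ {d : ℕ → ℝ} (c : ℝ), Tendsto d atTop (𝓝 0) →
      Tendsto (fun n => ENNReal.ofReal √(c * d n)) atTop (𝓝 0) := fun c hd => by
    have h := (hd.const_mul c).sqrt
    rw [mul_zero, Real.sqrt_zero] at h
    have h' := (ENNReal.continuous_ofReal.tendsto 0).comp h
    rwa [ENNReal.ofReal_zero] at h'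
  refine ⟨g, ⟨hg, hw.exists_strongApproximation hA, fun u ux ut h hu => ?_⟩, ?_⟩
  · refine tendsto_of_tendsto_of_tendsto_of_le_of_le tendsto_const_nhds
      (hsqrt 40 (hw.tendsto_energyDist_of_strongApproximation hA hu)) (fun _ => zero_le) fun k => ?_
    exact hgl (hA.eq ▸ (hu.strong k).1) (hu.slope k)
  · have hr := fun n => hw.regular_timeMoll hA (isKernel_kernelSeq n)
    choose h hh using fun n => (hr n).exists_isTrace hA
    have hd := hw.tendsto_energyDist_timeMoll hA
    simp only [energyDist_comm q w] at hd
    -- The traces and the Morawetz amplitudes of the mollified solutions converge in `L²`, and their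
    -- energies converge too, so the identity for regular solutions passes to the limit.
    have l1 : Tendsto (fun n => ∫ t, ‖h n t‖ ^ 2) atTop (𝓝 (∫ t, ‖g t‖ ^ 2)) :=
      tendsto_integral_sq (fun n => ((hr n).sol.slope_bound hA (hh n).slope).1) hg
        (tendsto_of_tendsto_of_tendsto_of_le_of_le tendsto_const_nhds (hsqrt 40 hd)
          (fun _ => zero_le) fun n => hgl (hr n).sol (hh n).slope)
    have l2 := tendsto_integral_sq (fun n => ((hr n).sol.memLp_morawetzAmplitude hA).1)
      (hw.memLp_morawetzAmplitude hA).1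
      (tendsto_of_tendsto_of_tendsto_of_le_of_le tendsto_const_nhds (hsqrt 1 hd)
        (fun _ => zero_le) fun n => by
          rw [one_mul]; exact (hr n).sol.morawetzAmplitude_sub_le hw hA)
    have l3 := (l1.const_mul (1 / 2)).add l2
    have e : ∀ w : ℝ → ℝ → ℂ, ∫ z, ‖morawetzAmplitude q w z‖ ^ 2
        ∂((volume : Measure ℝ).prod halfLine) =
        ∫ z, morawetzDensity q w z.1 z.2 ∂((volume : Measure ℝ).prod halfLine) :=
      fun w => integral_congr_ae (ae_norm_morawetzAmplitude_sq hA w)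
    simp only [e, fun n => (hr n).morawetz_identity hA (hh n)] at l3
    have h1 := tendsto_nhds_unique (hw.tendsto_energy_timeMoll hA 0) l3
    rw [h1, integral_prod _ (hw.integrable_morawetzDensity hA)]
    rfl

end IsFiniteEnergySolution

end

end HalfLineWave

/-! ### Assembly of the theorem. -/

theorem mainTheorem7 (lam : ℝ) (hlam : lam = 0 ∨ 3 / 4 ≤ lam) (q₀ q : ℝ → ℝ)
    (hrep : HalfLineWave.IsRepulsive q₀) (hgrowth : HalfLineWave.GrowthAtZero q₀)
    (hq : q = HalfLineWave.potential lam q₀) (w wx wt : ℝ → ℝ → ℂ)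
    (hw : HalfLineWave.IsFiniteEnergySolution q w wx wt) (E : ℝ)
    (hE : E = HalfLineWave.energy q w wx wt 0) :
    -- conservation of energy
    (∀ t, HalfLineWave.energy q w wx wt t = E) ∧
    -- monotonicity and limits of the inward and outward energies
    Antitone (HalfLineWave.inwardEnergy q w wx wt) ∧
    Monotone (HalfLineWave.outwardEnergy q w wx wt) ∧
    Tendsto (HalfLineWave.outwardEnergy q w wx wt) atTop (𝓝 E) ∧
    Tendsto (HalfLineWave.inwardEnergy q w wx wt) atBot (𝓝 E) ∧
    Tendsto (HalfLineWave.outwardEnergy q w wx wt) atBot (𝓝 0) ∧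
    Tendsto (HalfLineWave.inwardEnergy q w wx wt) atTop (𝓝 0) ∧
    -- decay of the potential energy
    Tendsto (fun t => ∫ x in Ioi (0 : ℝ), q x * ‖w t x‖ ^ 2) atTop (𝓝 0) ∧
    Tendsto (fun t => ∫ x in Ioi (0 : ℝ), q x * ‖w t x‖ ^ 2) atBot (𝓝 0) ∧
    -- the Morawetz identity
    (∃ g : ℝ → ℂ, HalfLineWave.IsBoundaryDerivative lam q₀ w wx wt g ∧
      Integrable (fun p : ℝ × ℝ => HalfLineWave.morawetzDensity q w p.1 p.2)
        (volume.prod HalfLineWave.halfLine) ∧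
      1 / 2 * (∫ t, ‖g t‖ ^ 2) +
        ∫ t, ∫ x in Ioi (0 : ℝ), HalfLineWave.morawetzDensity q w t x = E) ∧
    -- energy leaves every region `x ≤ c |t|` with `c < 1`
    (∀ c : ℝ, 0 < c → c < 1 →
      Tendsto (fun t => ∫ x in Ioc (0 : ℝ) (c * |t|),
        HalfLineWave.energyDensity q w wx wt t x) atTop (𝓝 0) ∧
      Tendsto (fun t => ∫ x in Ioc (0 : ℝ) (c * |t|),
        HalfLineWave.energyDensity q w wx wt t x) atBot (𝓝 0)) ∧
    -- decay of the Hardy integral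
    (∀ t, IntegrableOn (fun x => ‖w t x‖ ^ 2 / x ^ 2) (Ioi 0)) ∧
    Tendsto (fun t => ∫ x in Ioi (0 : ℝ), ‖w t x‖ ^ 2 / x ^ 2) atTop (𝓝 0) ∧
    Tendsto (fun t => ∫ x in Ioi (0 : ℝ), ‖w t x‖ ^ 2 / x ^ 2) atBot (𝓝 0) ∧
    -- decay of the weighted supremum
    (∀ t, BddAbove (range fun x : Ioi (0 : ℝ) => ‖w t x‖ ^ 2 / (x : ℝ))) ∧
    Tendsto (fun t => ⨆ x : Ioi (0 : ℝ), ‖w t x‖ ^ 2 / (x : ℝ)) atTop (𝓝 0) ∧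
    Tendsto (fun t => ⨆ x : Ioi (0 : ℝ), ‖w t x‖ ^ 2 / (x : ℝ)) atBot (𝓝 0) := by
  have hA : HalfLineWave.IsAdmissible lam q₀ q := ⟨hlam, hrep, hgrowth, hq⟩
  -- Each limit at `-∞` is the corresponding limit at `+∞` for the reversed solution, for which
  -- inward and outward energies are exchanged.
  have hr := hw.reverse
  subst hE
  obtain ⟨g, hg, hgE⟩ := hw.exists_boundaryDerivative hA
  have hEr : HalfLineWave.energy q (fun t => w (-t)) (fun t => wx (-t)) (fun t x => -wt (-t) x) 0 =
      HalfLineWave.energy q w wx wt 0 := by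
    rw [HalfLineWave.energy_reverse, neg_zero]
  have hout := hr.tendsto_outwardEnergy hA 0
  rw [hEr] at hout
  refine ⟨fun t => hw.energy_const hA t 0, hw.inwardEnergy_antitone hA,
    hw.outwardEnergy_monotone hA, hw.tendsto_outwardEnergy hA 0,
    HalfLineWave.tendsto_atBot_of_reverse hout
      (HalfLineWave.outwardEnergy_reverse q w wx wt),
    HalfLineWave.tendsto_atBot_of_reverse (hr.tendsto_inwardEnergy hA)
      (HalfLineWave.inwardEnergy_reverse q w wx wt),
    hw.tendsto_inwardEnergy hA, hw.tendsto_potential hA,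
    HalfLineWave.tendsto_atBot_of_reverse (hr.tendsto_potential hA) fun _ => rfl,
    ⟨g, hg, hw.integrable_morawetzDensity hA, hgE⟩,
    fun c hc0 hc1 => ⟨hw.tendsto_cone_energy hA hc0 hc1,
      HalfLineWave.tendsto_atBot_of_reverse (hr.tendsto_cone_energy hA hc0 hc1) fun t => ?_⟩,
    hw.integrableOn_hardy, hw.tendsto_hardy hA,
    HalfLineWave.tendsto_atBot_of_reverse (hr.tendsto_hardy hA) fun _ => rfl,
    hw.bddAbove_weighted, hw.tendsto_weighted_iSup hA,
    HalfLineWave.tendsto_atBot_of_reverse (hr.tendsto_weighted_iSup hA) fun _ => rfl⟩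
  simp only [HalfLineWave.energyDensity_reverse, abs_neg]
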